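/- **Setting.** Let $d\ge1$, $\beta\in(0,\infty)$, $\mathbb T^d=(\mathbb R/\mathbb Z)^d$, $\mathbb D=\mathbb T^d\times\mathbb R^d$ with points $z=(x,v)$, and let $V:\mathbb T^d\to\mathbb R$ be even, positive definite ($\widehat V\ge0$) and in $W^{2,\infty}(\mathbb T^d)$. Set $M_\beta(v)=(\beta/2\pi)^{d/2}e^{-\beta|v|^2/2}$. Let $L^2_\beta(\mathbb D^n)$ be the $L^2$ space with weight $M_\beta^{\otimes n}$, let $H^1_\beta(\mathbb R^d)$ be the space of functions $h$ with $\|h\|_{H^1_\beta}^2=\int_{\mathbb R^d}(|h|^2+|\nabla h|^2)M_\beta<\infty$, and let $H^{-1}_\beta(\mathbb R^d)$ be its dual with respect to the $L^2_\beta(\mathbb R^d)$ pairing. In this pairing $(\nabla_v-\beta v)\cdot$ is minus the adjoint of $\nabla_v$. Let $f^\circ:\mathbb R^d\to\mathbb R$ be such that $g^\circ:=f^\circ/M_\beta$ has a weak gradient and $g^\circ,(\nabla_v-\beta v)g^\circ\in L^2_\beta(\mathbb R^d)$ (that is, $g^\circ\in H^1_\beta(\mathbb R^d)$). For $N\ge1$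 let $$F_N^\circ(z_0,\dots,z_N)=f^\circ(v_0)\,Z_{N,\beta}^{-1}\,e^{-\frac\beta2\sum_{j=1}^N|v_j|^2-\frac\beta{2N}\sum_{1\le j\ne l\le N}V(x_j-x_l)},$$ where $Z_{N,\beta}$ is the integral of the exponential factor over $\mathbb D^N$. Let $F_N^{j+1;\circ}(z_0,\dots,z_j)=\int_{\mathbb D^{N-j}}F_N^\circ\,dz_{j+1}\dots dz_N$ be its marginals and $$G_N^{3;\circ}(z_0,z_1,z_2)=\sum_{\sigma\subset\{1,2\}}(-1)^{2-\#\sigma}\frac{F_N^{\#\sigma+1;\circ}}{M_\beta^{\otimes(\#\sigma+1)}}(z_0,z_\sigma)$$ the third initial cumulant (with $G_1^{3;\circ}:=0$). For $m\ge0$ define $$iL_{m+1}G=\sum_{j=0}^mv_j\cdot\nabla_{x_j}G+\sum_{j=1}^m\tfrac{N+1-m}N\,\beta v_j\cdot\int_{\mathbb D}\nabla V(x_j-x_*)\,G(\dots,z_{j-1},z_*,z_{j+1},\dots)\,M_\beta(v_*)\,dz_*,$$ with the maximal domain in $L^2_\beta(\mathbb D^{m+1})$, and, in the sense of distributions, $$M_{m+2}^{m+1}G=\tfrac{N-m}N\sum_{j=0}^m\int_{\mathbb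 D}\nabla V(x_j-x_*)\cdot(\nabla_{v_j}-\beta v_j)G(z_0,\dots,z_m,z_*)\,M_\beta(v_*)\,dz_*.$$ **Proposition.** For all $N\ge1$ and $\omega\in\mathbb C$ with $\Im\omega>0$, there exist unique $H_3=(iL_3-i\omega)^{-1}(NG_N^{3;\circ})\in L^2_\beta(\mathbb D^3)$, $K_2=M_3^2H_3\in L^2_\beta(\mathbb D^2)$ and $H_2=(iL_2-i\omega)^{-1}K_2\in L^2_\beta(\mathbb D^2)$. The distribution on $\mathbb R^d$ $$T_N^\omega:=i\omega\int_{\mathbb T^d}\big(M_2^1(iL_2-i\omega)^{-1}M_3^2(iL_3-i\omega)^{-1}(NG_N^{3;\circ})\big)(x,\cdot)\,dx$$ satisfies: 1. $T_N^\omega\to0$ in $H^{-1}_\beta(\mathbb R^d)$ as $\omega\to0$ with $\Im\omega>0$, uniformly in $N\ge1$; 2. for all $N\ge1$ and $\Im\omega>0$ one can write $T_N^\omega=(\nabla_v-\beta v)\cdot G_{N,\beta}^\omega$ for some measurable $G_{N,\beta}^\omega:\mathbb R^d\to\mathbb C^d$ with $$|G_{N,\beta}^\omega(v)|\le C\,|(\nabla_v-\beta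 v)g^\circ(v)|\qquad\text{for almost every }v\in\mathbb R^d,$$ where the constant $C$ depends only on $d$, $\beta$ and a bound on $\|V\|_{W^{2,\infty}(\mathbb T^d)}$ (and not on $N$, $\omega$ or $f^\circ$). -/

import Mathlib

open MeasureTheory
open scoped ENNReal

noncomputable section

namespace TaggedParticle

/-! ### Phase space, Maxwellian weight, smooth functions -/

/-- The torus `𝕋ᵈ = (ℝ/ℤ)ᵈ`, with its Lebesgue measure of total mass one. -/
abbrev Torus (d : ℕ) : Type := UnitAddTorus (Fin d)

/-- Velocity space `ℝᵈ`. -/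
abbrev Vel (d : ℕ) : Type := EuclideanSpace ℝ (Fin d)

/-- One-particle phase space `𝔻 = 𝕋ᵈ × ℝᵈ`. -/
abbrev Phase (d : ℕ) : Type := Torus d × Vel d

/-- The Maxwellian density `M_β(v) = (β / 2π)^(d/2) exp(-β|v|²/2)`. -/
def maxwellian (d : ℕ) (β : ℝ) (v : Vel d) : ℝ :=
  (β / (2 * Real.pi)) ^ ((d : ℝ) / 2) * Real.exp (-(β / 2) * ‖v‖ ^ 2)

/-- The measure `M_β(v) dv` on `ℝᵈ`. -/
def velMeasure (d : ℕ) (β : ℝ) : Measure (Vel d) :=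
  (volume : Measure (Vel d)).withDensity fun v => ENNReal.ofReal (maxwellian d β v)

/-- The measure `M_β(v) dx dv` on `𝔻`. -/
def oneMeasure (d : ℕ) (β : ℝ) : Measure (Phase d) :=
  (volume : Measure (Torus d)).prod (velMeasure d β)

/-- The measure `M_β^{⊗n} dz` on `𝔻ⁿ`; its `L²` space is `L²_β(𝔻ⁿ)`. -/
def phaseMeasure (d : ℕ) (β : ℝ) (n : ℕ) : Measure (Fin n → Phase d) :=
  Measure.pi fun _ => oneMeasure d β

/-- A function on the torus is smooth when its periodic lift to `ℝᵈ` is smooth. -/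
def SmoothOnTorus {d : ℕ} (φ : Torus d → ℝ) : Prop :=
  ContDiff ℝ (⊤ : ℕ∞) fun y : Fin d → ℝ => φ fun a => (y a : UnitAddCircle)

/-- The partial derivative `∂_{x_a} φ` on the torus. -/
def torusDeriv {d : ℕ} (a : Fin d) (φ : Torus d → ℝ) (x : Torus d) : ℝ :=
  deriv (fun t : ℝ => φ (x + Pi.single a (t : UnitAddCircle))) 0

/-- Test functions on `𝔻ⁿ`: smooth (after lifting the positions to `ℝᵈ`) and compactly supported. -/
structure IsTest {d n : ℕ} (ψ : (Fin n → Phase d) → ℂ) : Prop where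
  smooth : ContDiff ℝ (⊤ : ℕ∞) fun y : Fin n → (Fin d → ℝ) × Vel d =>
    ψ fun i => ((fun a => ((y i).1 a : UnitAddCircle)), (y i).2)
  compactSupport : HasCompactSupport ψ

/-- Test functions on `ℝᵈ`, with values in `𝕜 = ℝ` or `ℂ`. -/
structure IsVelTest {d : ℕ} {𝕜 : Type} [RCLike 𝕜] (ψ : Vel d → 𝕜) : Prop where
  smooth : ContDiff ℝ (⊤ : ℕ∞) ψ
  compactSupport : HasCompactSupport ψ

/-- The partial derivative `∂_{v_a} ψ` on `ℝᵈ`. -/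
def velDeriv {d : ℕ} {𝕜 : Type} [RCLike 𝕜] (a : Fin d) (ψ : Vel d → 𝕜) (v : Vel d) : 𝕜 :=
  fderiv ℝ ψ v (EuclideanSpace.single a 1)

/-- The partial derivative `∂_{x_{j,a}} ψ` on `𝔻ⁿ`. -/
def dx {d n : ℕ} (j : Fin n) (a : Fin d) (ψ : (Fin n → Phase d) → ℂ) (z : Fin n → Phase d) : ℂ :=
  deriv (fun t : ℝ =>
    ψ (Function.update z j ((z j).1 + Pi.single a (t : UnitAddCircle), (z j).2))) 0

/-- The partial derivative `∂_{v_{j,a}} ψ` on `𝔻ⁿ`. -/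
def dv {d n : ℕ} (j : Fin n) (a : Fin d) (ψ : (Fin n → Phase d) → ℂ) (z : Fin n → Phase d) : ℂ :=
  velDeriv a (fun w => ψ (Function.update z j ((z j).1, w))) (z j).2

/-! ### Weak gradients and Sobolev spaces -/

/-- `F` is the weak gradient of `V` on the torus. -/
def HasTorusWeakGrad {d : ℕ} (V : Torus d → ℝ) (F : Torus d → Vel d) : Prop :=
  ∀ φ : Torus d → ℝ, SmoothOnTorus φ → ∀ a : Fin d,
    ∫ x, V x * torusDeriv a φ x = -∫ x, F x a * φ x

/-- `V ∈ W^{2,∞}(𝕋ᵈ)` with weak gradient `F = ∇V`, where `V` and its weak derivatives of order one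
and two are bounded by `K`. -/
structure MemW2Infty {d : ℕ} (V : Torus d → ℝ) (F : Torus d → Vel d) (K : ℝ) : Prop where
  measurable : Measurable V
  bound : ∀ᵐ x, |V x| ≤ K
  measurable_grad : Measurable F
  weakGrad : HasTorusWeakGrad V F
  bound_grad : ∀ᵐ x, ‖F x‖ ≤ K
  hessian : ∀ a : Fin d, ∃ D : Torus d → Vel d, Measurable D ∧
    HasTorusWeakGrad (fun x => F x a) D ∧ ∀ᵐ x, ‖D x‖ ≤ K

/-- `V` is positive definite: all its Fourier coefficients are nonnegative
(for a real even `V` they are real). -/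
def PosDefPotential {d : ℕ} (V : Torus d → ℝ) : Prop :=
  ∀ n : Fin d → ℤ, 0 ≤ (UnitAddTorus.mFourierCoeff (fun x => (V x : ℂ)) n).re

/-- `D` is the weak gradient of `g` on `ℝᵈ`. -/
def HasVelWeakGrad {d : ℕ} (g : Vel d → ℝ) (D : Vel d → Vel d) : Prop :=
  ∀ ψ : Vel d → ℝ, IsVelTest ψ → ∀ a : Fin d,
    ∫ v, g v * velDeriv a ψ v = -∫ v, D v a * ψ v

/-- The squared norm of `H¹_β(ℝᵈ)`, for test functions. -/
def h1NormSq {d : ℕ} (β : ℝ) (ψ : Vel d → ℂ) : ℝ :=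
  ∫ v, (‖ψ v‖ ^ 2 + ∑ a : Fin d, ‖velDeriv a ψ v‖ ^ 2) ∂velMeasure d β

/-- The norm of `H⁻¹_β(ℝᵈ)`, the dual of `H¹_β(ℝᵈ)` for the pairing of `L²_β(ℝᵈ)`. A distribution is
given by its values `T ψ` (the extension of `∫ T ψ M_β dv`) on test functions. -/
def hNegOneNorm {d : ℕ} (β : ℝ) (T : (Vel d → ℂ) → ℂ) : ℝ≥0∞ :=
  ⨆ (ψ : Vel d → ℂ) (_ : IsVelTest ψ) (_ : h1NormSq β ψ ≤ 1), ‖T ψ‖ₑ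

/-! ### Initial data, marginals and cumulants -/

/-- The unnormalised Gibbs weight of `N` background particles. -/
def gibbsWeight {d : ℕ} (β : ℝ) (V : Torus d → ℝ) (N : ℕ) (z : Fin N → Phase d) : ℝ :=
  Real.exp (-(β / 2) * ∑ j, ‖(z j).2‖ ^ 2
    - β / (2 * N) * ∑ j, ∑ l, if j = l then 0 else V ((z j).1 - (z l).1))

/-- The Gibbs density `M_{N,β}`. -/
def gibbsDensity {d : ℕ} (β : ℝ) (V : Torus d → ℝ) (N : ℕ) (z : Fin N → Phase d) : ℝ :=
  (∫ y, gibbsWeight β V N y)⁻¹ * gibbsWeight β V N z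

/-- The initial density `F_N°(z_0, …, z_N) = f°(v_0) M_{N,β}(z_1, …, z_N)`; label `0` is the tagged
particle. -/
def initialDensity {d : ℕ} (β : ℝ) (V : Torus d → ℝ) (f : Vel d → ℝ) (N : ℕ)
    (z : Fin (N + 1) → Phase d) : ℝ :=
  f (z 0).2 * gibbsDensity β V N fun i => z i.succ

/-- The marginal `F_N^{m+1}(z_0, …, z_m) = ∫ F_N(z_0, …, z_N) dz_{m+1} … dz_N` (for `m ≤ N`). -/
def marginal {d : ℕ} (N m : ℕ) (F : (Fin (N + 1) → Phase d) → ℝ) (z : Fin (m + 1) → Phase d) : ℝ :=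
  ∫ y : Fin (N - m) → Phase d, F fun i =>
    if h : i.val < m + 1 then z ⟨i.val, h⟩ else y ⟨i.val - (m + 1), by omega⟩

/-- The point `(z_0, z_σ)`, for `σ` a set of background labels; the label `i : Fin m` stands for the
background particle number `i + 1`. -/
def selectParticles {d m : ℕ} (z : Fin (m + 1) → Phase d) (σ : Finset (Fin m)) :
    Fin (σ.card + 1) → Phase d :=
  Fin.cons (z 0) fun i => z (σ.orderEmbOfFin rfl i).succ

/-- The cumulant
`G_N^{m+1}(z_0, …, z_m) = ∑_σ (-1)^{m - #σ} (F_N^{#σ+1} / M_β^{⊗(#σ+1)})(z_0, z_σ)`,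
with the convention that it vanishes for `m > N`. -/
def cumulant {d : ℕ} (β : ℝ) (N m : ℕ) (F : (Fin (N + 1) → Phase d) → ℝ)
    (z : Fin (m + 1) → Phase d) : ℝ :=
  if m ≤ N then
    ∑ σ : Finset (Fin m), (-1) ^ (m - σ.card) *
      (marginal N σ.card F (selectParticles z σ) /
        ∏ i, maxwellian d β (selectParticles z σ i).2)
  else 0

/-! ### The operators of the hierarchy

Below `F = ∇V`. All operators act on (classes of) functions of `L²_β`; they commute with permutations
of the background labels, so the subspace of functions symmetric in these labels is preserved. -/

/-- `∑_j v_j · ∇_{x_j} ψ`. -/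
def transport {d n : ℕ} (ψ : (Fin n → Phase d) → ℂ) (z : Fin n → Phase d) : ℂ :=
  ∑ j, ∑ a, ((z j).2 a : ℂ) * dx j a ψ z

/-- The mean-field part of `iL_{m+1}`:
`∑_{j ≠ 0} (N+1-m)/N β v_j · ∫ ∇V(x_j - x_*) H(z with z_j replaced by z_*) M_β(v_*) dz_*`. -/
def meanFieldTerm {d : ℕ} (β : ℝ) (F : Torus d → Vel d) (N m : ℕ)
    (H : (Fin (m + 1) → Phase d) → ℂ) (z : Fin (m + 1) → Phase d) : ℂ :=
  ∑ j, if j = 0 then 0 else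
    (((N : ℝ) + 1 - m) / N * β : ℝ) * ∑ a, ((z j).2 a : ℂ) *
      ∫ y, (F ((z j).1 - y.1) a : ℂ) * H (Function.update z j y) ∂oneMeasure d β

/-- The graph of the linearized Vlasov operator `iL_{m+1}` on `L²_β(𝔻^{m+1})`, with its maximal domain:
`iL_{m+1} H = G`, where the transport term is taken in the sense of distributions. -/
structure IsVlasov {d : ℕ} (β : ℝ) (F : Torus d → Vel d) (N m : ℕ)
    (H G : (Fin (m + 1) → Phase d) → ℂ) : Prop where
  memLp_left : MemLp H 2 (phaseMeasure d β (m + 1))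
  memLp_right : MemLp G 2 (phaseMeasure d β (m + 1))
  weak : ∀ ψ, IsTest ψ →
    ∫ z, (-(H z * transport ψ z) + meanFieldTerm β F N m H z * ψ z) ∂phaseMeasure d β (m + 1)
      = ∫ z, G z * ψ z ∂phaseMeasure d β (m + 1)

/-- `H = (iL_{m+1} - iω)⁻¹ G`, that is, `iL_{m+1} H = G + iω H`. -/
def IsResolvent {d : ℕ} (β : ℝ) (F : Torus d → Vel d) (N m : ℕ) (ω : ℂ)
    (G H : (Fin (m + 1) → Phase d) → ℂ) : Prop :=
  IsVlasov β F N m H fun z => G z + Complex.I * ω * H z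

/-- The component `a` of
`(N-m)/N ∫ ∇V(x_j - x_*) H(z_0, …, z_m, z_*) M_β(v_*) dz_*`. -/
def forceMoment {d : ℕ} (β : ℝ) (F : Torus d → Vel d) (N m : ℕ)
    (H : (Fin (m + 2) → Phase d) → ℂ) (j : Fin (m + 1)) (a : Fin d)
    (z : Fin (m + 1) → Phase d) : ℂ :=
  (((N : ℝ) - m) / N : ℝ) *
    ∫ y, (F ((z j).1 - y.1) a : ℂ) * H (Fin.snoc (α := fun _ => Phase d) z y) ∂oneMeasure d β

/-- The distribution
`M_{m+2}^{m+1} H = ∑_j (∇_{v_j} - β v_j) · (N-m)/N ∫ ∇V(x_j - x_*) H(…, z_*) M_β(v_*) dz_*`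
paired with `ψ` in `L²_β(𝔻^{m+1})`. In this pairing the operator `(∇_v - βv)·` is minus the transpose
of `∇_v`. -/
def mPairing {d : ℕ} (β : ℝ) (F : Torus d → Vel d) (N m : ℕ)
    (H : (Fin (m + 2) → Phase d) → ℂ) (ψ : (Fin (m + 1) → Phase d) → ℂ) : ℂ :=
  -∑ j, ∑ a, ∫ z, forceMoment β F N m H j a z * dv j a ψ z ∂phaseMeasure d β (m + 1)

/-- `M_{m+2}^{m+1} H` is the function `K ∈ L²_β(𝔻^{m+1})`. -/
structure IsMApplied {d : ℕ} (β : ℝ) (F : Torus d → Vel d) (N m : ℕ)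
    (H : (Fin (m + 2) → Phase d) → ℂ) (K : (Fin (m + 1) → Phase d) → ℂ) : Prop where
  memLp : MemLp K 2 (phaseMeasure d β (m + 1))
  weak : ∀ ψ, IsTest ψ → ∫ z, K z * ψ z ∂phaseMeasure d β (m + 1) = mPairing β F N m H ψ

/-- `H₃ = (iL_3 - iω)⁻¹ (N G_N^{3;∘})`, `K₂ = M_3^2 H₃` and `H₂ = (iL_2 - iω)⁻¹ K₂`. -/
structure IsInitCorrelation {d : ℕ} (β : ℝ) (V : Torus d → ℝ) (F : Torus d → Vel d)
    (f : Vel d → ℝ) (N : ℕ) (ω : ℂ) (H₃ : (Fin 3 → Phase d) → ℂ)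
    (K₂ H₂ : (Fin 2 → Phase d) → ℂ) : Prop where
  resolvent_three : IsResolvent β F N 2 ω
    (fun z => ((N * cumulant β N 2 (initialDensity β V f N) z : ℝ) : ℂ)) H₃
  apply_M : IsMApplied β F N 1 H₃ K₂
  resolvent_two : IsResolvent β F N 1 ω K₂ H₂

/-- The distribution `iω ∫ (M_2^1 H₂)(x, ·) dx` on `ℝᵈ`, paired with `ψ` in `L²_β(ℝᵈ)`. -/
def spaceAverage {d : ℕ} (β : ℝ) (F : Torus d → Vel d) (N : ℕ) (ω : ℂ)
    (H₂ : (Fin 2 → Phase d) → ℂ) (ψ : Vel d → ℂ) : ℂ :=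
  Complex.I * ω * mPairing β F N 0 H₂ fun z => ψ (z 0).2

/-- The distribution `(∇_v - βv) · G` on `ℝᵈ`, paired with `ψ` in `L²_β(ℝᵈ)`. -/
def divPairing {d : ℕ} (β : ℝ) (G : Vel d → EuclideanSpace ℂ (Fin d)) (ψ : Vel d → ℂ) : ℂ :=
  -∫ v, ∑ a, G v a * velDeriv a ψ v ∂velMeasure d β

end TaggedParticle

end

noncomputable section

namespace TaggedParticle

open Set Filter Topology ProbabilityTheory Complex UnitAddTorus
open Finset (sum_congr mul_sum sum_mul mem_univ sum_neg_distrib mul_prod_erase prod_mul_distrib sum_const sum_add_distrib sum_sub_distrib card_univ prod_congr sum_le_sum)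
open Function (update update_comm update_idem update_of_ne update_self update_eq_self)
open Real (norm_of_nonneg norm_eq_abs)
open scoped ComplexConjugate Real

section

open FourierTransform

/-! Everything decouples into Fourier modes in the positions, and each mode reduces to a scalar
Gaussian problem.

Source. The Gibbs weight factorizes into velocities and positions, and translation invariance makes
its one-point marginals trivial. Hence the scaled cumulant is `g(v₀) R(x₁ - x₂)`, where `R` is `N`
times the two-point correlation (`cumulant_eq`). It has mean zero, and its Fourier coefficients are
bounded uniformly in `N` (`GradField.norm_integral_gibbsCorr_le`). Indeed, positive definiteness
bounds the Gibbs weight from above and Jensen's inequality bounds the partition function from below.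
The quotient of the two bounds is `exp (βK/2)`, which controls the variance of `∑ e_k(x_j)`.

One mode. For `k ≠ 0` put `n = √β k/|k|` and `σ = 2π|k|/√β`. Under the Maxwellian `ξ = n·v` is a
standard Gaussian, and after division by `σ` a background particle is governed by multiplication by
`iξ` plus `L iξ E[·]`. Here `L` is `(N-1)/N β V̂(k)` in `iL_3` and `β V̂(k)` in `iL_2`. Let `U_t` be
the Vlasov flow of the constant `1` and `a(t) = E U_t` its density. With `w = ω/σ`, the resolvent of
the two-particle problem applied to `1` is `h(ξ, η) = ∫₀^∞ e^{iwt} U_t(ξ) U_t(-η) dt`, and its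
marginal is `p(ξ) = ∫₀^∞ e^{iwt} a(t) U_t(ξ) dt`. The dispersion function `1 + L ∫₀^∞ e^{-zt} t
e^{-t²/2} dt` is bounded below on `Re z ≥ 0`, uniformly in the coupling (`exists_le_norm_disp`).
Therefore `a` and `a'` are integrable on positive times with uniform bounds, and `p` stays bounded
as `Im w → 0`.

Collisions. In `M_3^2 H₃` the particle that is integrated out passes its wave number to its partner.
If the partner is the tagged particle, the result is the mode `(-k, k)` with profile `n·(∇ -
βv)g(v₀) p(n·v₁)`. If it is the other background particle, the result is spatially homogeneous. The
next resolvent multiplies the homogeneous part by the singular factor `i/ω`, but `M_2^1` annihilates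
it because `∇V` has mean zero. On the mode `(-k, k)` the tagged velocity is a parameter `ζ`, and the
density `Y(ζ)` of the solution solves a scalar equation. The decisive estimates are `|Y| ≤ C` and
`|w| |Y| ≤ C`, uniformly in `Im w > 0` (`exists_modeSolution`). The first comes from writing
resolvents as time integrals, the second from an integration by parts in time.

Summation. The flux is `-∑ ω c_k V̂(k) (n·(∇ - βv)g(v)) Y_k(n·v) n` with `|c_k| ≤ |R̂_k| V̂(k)`. The
coefficients `σ V̂(k)` are bounded, since they come from the bounded field `∇V`, and `∑ V̂(k) ≤ K`.
The flux is thus at most `C min(1, |ω|) |(∇ - βv)g|` (`exists_correlation`): the `1` gives the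
uniform bound and the `|ω|` gives the convergence.

Uniqueness. A difference of two solutions solves a homogeneous equation on each mode. Testing it
against `(1 + l_i A_i)(1 + l_j A_j) h`, with `A` the averages over one velocity, makes every term
real except the one containing `ω`, so that `h = 0` (`IsNullMode.ae_eq_zero`). -/

lemma hasDerivAt_congr_both {𝕜 E : Type*} [NontriviallyNormedField 𝕜] [NormedAddCommGroup E]
    [NormedSpace 𝕜 E] {f g : 𝕜 → E} {f' g' : E} {x : 𝕜} (h : HasDerivAt f f' x) (hf : g = f)
    (hd : g' = f') : HasDerivAt g g' x := by
  subst hf; subst hd; exact h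

lemma ae_Ioi : ∀ᵐ t ∂volume.restrict (Ioi (0 : ℝ)), t ∈ Ioi (0 : ℝ) :=
  ae_restrict_mem measurableSet_Ioi

/-! ### One-sided Laplace transforms of Gaussian moments -/

/-- The function `tⁿ exp(-t²/2)`. -/
def gMoment (n : ℕ) (t : ℝ) : ℝ := t ^ n * rexp (-(t ^ 2 / 2))

/-- The one-sided Laplace transform of `tⁿ exp(-t²/2)`. -/
def lap (n : ℕ) (z : ℂ) : ℂ := ∫ t in Ioi (0 : ℝ), cexp (-(z * t)) * (gMoment n t : ℂ)

/-- The `L¹(0, ∞)` norm of `tⁿ exp(-t²/2)`. -/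
def lapBound (n : ℕ) : ℝ := ∫ t in Ioi (0 : ℝ), |gMoment n t|

lemma continuous_gMoment (n : ℕ) : Continuous (gMoment n) := by
  unfold gMoment; fun_prop

lemma integrable_pow_mul_exp_quarter (n : ℕ) :
    Integrable fun t : ℝ => t ^ n * rexp (-(t ^ 2 / 4)) := by
  have := integrable_rpow_mul_exp_neg_mul_sq (b := 1 / 4) (by norm_num) (s := n)
    (by have : (0 : ℝ) ≤ n := n.cast_nonneg
        linarith)
  refine this.congr (ae_of_all _ fun t => ?_)
  simp only [Real.rpow_natCast]
  congr 2; ring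

lemma integrable_gMoment (n : ℕ) : Integrable (gMoment n) := by
  have := integrable_rpow_mul_exp_neg_mul_sq (b := 1 / 2) (by norm_num) (s := n)
    (by have : (0 : ℝ) ≤ n := n.cast_nonneg
        linarith)
  refine this.congr (ae_of_all _ fun t => ?_)
  simp only [Real.rpow_natCast, gMoment]
  congr 2; ring

lemma lapBound_nonneg (n : ℕ) : 0 ≤ lapBound n := integral_nonneg fun _ => abs_nonneg _

lemma norm_exp_neg_mul_le {z : ℂ} {R : ℝ} (hz : -R ≤ z.re) {t : ℝ} (ht : 0 ≤ t) :
    ‖cexp (-(z * t))‖ ≤ rexp (R * t) := by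
  rw [norm_exp]
  apply Real.exp_le_exp.2
  simp only [neg_re, mul_re, ofReal_re, ofReal_im, mul_zero, sub_zero]
  nlinarith

lemma norm_exp_neg_mul_le_one {z : ℂ} (hz : 0 ≤ z.re) {t : ℝ} (ht : 0 ≤ t) :
    ‖cexp (-(z * t))‖ ≤ 1 := by
  simpa using norm_exp_neg_mul_le (R := 0) (by simpa using hz) ht

/-- Half of the Gaussian is spent on the exponential, through `Rt ≤ R² + t²/4`. No sign of `Re z` is
required, so the bound also dominates the integrand in a full neighbourhood of a point of the
imaginary axis. -/
lemma norm_lap_integrand_le {z : ℂ} {R : ℝ} (hz : -R ≤ z.re) (n : ℕ) {t : ℝ} (ht : 0 ≤ t) :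
    ‖cexp (-(z * t)) * (gMoment n t : ℂ)‖ ≤ rexp (R ^ 2) * (t ^ n * rexp (-(t ^ 2 / 4))) := by
  rw [norm_mul, norm_real, gMoment, norm_mul, norm_of_nonneg (pow_nonneg ht n),
    norm_of_nonneg (Real.exp_pos _).le]
  have h1 := norm_exp_neg_mul_le hz ht
  have h2 : rexp (R * t) * rexp (-(t ^ 2 / 2)) ≤ rexp (R ^ 2) * rexp (-(t ^ 2 / 4)) := by
    rw [← Real.exp_add, ← Real.exp_add]
    apply Real.exp_le_exp.2
    nlinarith [sq_nonneg (R - t / 2)]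
  have h3 := mul_le_mul_of_nonneg_right h1 (Real.exp_pos (-(t ^ 2 / 2))).le
  have h4 := mul_le_mul_of_nonneg_left (h3.trans h2) (pow_nonneg ht n)
  nlinarith

lemma integrableOn_lap (n : ℕ) (z : ℂ) :
    IntegrableOn (fun t : ℝ => cexp (-(z * t)) * (gMoment n t : ℂ)) (Ioi 0) := by
  refine Integrable.mono' (g := fun t => rexp (|z.re| ^ 2) * (t ^ n * rexp (-(t ^ 2 / 4))))
    ((integrable_pow_mul_exp_quarter n).const_mul _).integrableOn ?_ ?_
  · have := continuous_gMoment n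
    fun_prop
  · filter_upwards [ae_Ioi] with t ht
    exact norm_lap_integrand_le (neg_abs_le _) n (le_of_lt ht)

lemma norm_lap_le (n : ℕ) {z : ℂ} (hz : 0 ≤ z.re) : ‖lap n z‖ ≤ lapBound n := by
  refine norm_integral_le_of_norm_le (integrable_gMoment n).abs.integrableOn ?_
  filter_upwards [ae_Ioi] with t ht
  rw [norm_mul, norm_real]
  exact mul_le_of_le_one_left (norm_nonneg _) (norm_exp_neg_mul_le_one hz (le_of_lt ht))

lemma hasDerivAt_lap (n : ℕ) (z : ℂ) : HasDerivAt (lap n) (-lap (n + 1) z) z := by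
  have key := hasDerivAt_integral_of_dominated_loc_of_deriv_le
    (μ := volume.restrict (Ioi (0 : ℝ))) (𝕜 := ℂ)
    (F := fun z t => cexp (-(z * t)) * (gMoment n t : ℂ))
    (F' := fun z t => -(cexp (-(z * t)) * (gMoment (n + 1) t : ℂ)))
    (x₀ := z) (s := Metric.ball z 1)
    (bound := fun t => rexp ((|z.re| + 1) ^ 2) * (t ^ (n + 1) * rexp (-(t ^ 2 / 4))))
    (Metric.ball_mem_nhds z one_pos)
    (Eventually.of_forall fun w => (integrableOn_lap n w).aestronglyMeasurable)
    (integrableOn_lap n z) (integrableOn_lap (n + 1) z).neg.aestronglyMeasurable ?_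
    ((integrable_pow_mul_exp_quarter (n + 1)).const_mul _).integrableOn ?_
  · exact key.2.congr_deriv (integral_neg _)
  · filter_upwards [ae_Ioi] with t ht w hw
    rw [norm_neg]
    refine norm_lap_integrand_le ?_ (n + 1) (le_of_lt ht)
    have h1 : |(w - z).re| ≤ ‖w - z‖ := abs_re_le_norm _
    rw [mem_ball_iff_norm] at hw
    have := abs_le.1 (h1.trans hw.le)
    have h3 := neg_abs_le z.re
    simp only [sub_re] at this
    linarith [this.1]
  · refine ae_of_all _ fun t w _ => ?_
    have h1 : HasDerivAt (fun w : ℂ => -(w * t)) (-(1 * (t : ℂ))) w :=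
      ((hasDerivAt_id w).mul_const (t : ℂ)).neg
    have := (h1.cexp).mul_const (gMoment n t : ℂ)
    refine this.congr_deriv ?_
    simp only [gMoment]; push_cast; ring

lemma continuous_lap (n : ℕ) : Continuous (lap n) :=
  continuous_iff_continuousAt.2 fun z => (hasDerivAt_lap n z).continuousAt

lemma hasDerivAt_gMoment_zero (t : ℝ) : HasDerivAt (gMoment 0) (-gMoment 1 t) t := by
  unfold gMoment
  have h : HasDerivAt (fun t : ℝ => -(t ^ 2 / 2)) (-t) t := by
    exact ((hasDerivAt_pow 2 t).div_const 2).neg.congr_deriv (by simp)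
  refine hasDerivAt_congr_both h.exp ?_ ?_
  · funext t; simp
  · simp; ring

lemma hasDerivAt_gMoment_succ (n : ℕ) (t : ℝ) :
    HasDerivAt (gMoment (n + 1)) ((n + 1) * gMoment n t - gMoment (n + 2) t) t := by
  have h := (hasDerivAt_pow (n + 1) t).mul (hasDerivAt_gMoment_zero t)
  refine hasDerivAt_congr_both h ?_ ?_
  · funext t; simp [gMoment]
  · simp [gMoment]; ring

/-- Integration by parts on the half line. The boundary term at infinity vanishes because the
function and its derivative are both integrable. The resulting recurrences between the transforms
are later the source of their decay in `z`. -/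
lemma mul_lap_aux (z : ℂ) {φ φ' : ℝ → ℝ} (hφ : ∀ t, HasDerivAt φ (φ' t) t)
    (h0 : IntegrableOn (fun t : ℝ => cexp (-(z * t)) * (φ t : ℂ)) (Ioi 0))
    (h1 : IntegrableOn (fun t : ℝ => cexp (-(z * t)) * (φ' t : ℂ)) (Ioi 0)) :
    z * ∫ t in Ioi (0 : ℝ), cexp (-(z * t)) * (φ t : ℂ)
      = φ 0 + ∫ t in Ioi (0 : ℝ), cexp (-(z * t)) * (φ' t : ℂ) := by
  have hd : ∀ t : ℝ, HasDerivAt (fun t : ℝ => cexp (-(z * t)) * (φ t : ℂ))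
      (-(z * (cexp (-(z * t)) * (φ t : ℂ))) + cexp (-(z * t)) * (φ' t : ℂ)) t := by
    intro t
    have h1 : HasDerivAt (fun w : ℝ => -(z * w)) (-(z * 1)) t :=
      ((hasDerivAt_id (t : ℂ)).comp_ofReal.const_mul z).neg
    have := h1.cexp.mul (hφ t).ofReal_comp
    exact this.congr_deriv (by ring)
  have hint := (h0.const_mul z).neg.add h1
  have hlim := tendsto_zero_of_hasDerivAt_of_integrableOn_Ioi (a := 0)
    (fun t _ => hd t) hint h0
  have := integral_Ioi_of_hasDerivAt_of_tendsto (a := 0) (hd 0).continuousAt.continuousWithinAt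
    (fun t _ => hd t) hint hlim
  have e := integral_add (h0.const_mul z).neg h1
  simp only [Pi.neg_apply] at e
  rw [e] at this
  simp only [integral_neg, integral_const_mul, ofReal_zero, mul_zero, neg_zero,
    exp_zero, one_mul, zero_sub] at this
  linear_combination -this

lemma mul_lap_zero (z : ℂ) : z * lap 0 z = 1 - lap 1 z := by
  have h := mul_lap_aux z (φ := gMoment 0) hasDerivAt_gMoment_zero
    (integrableOn_lap 0 z) (by simpa using (integrableOn_lap 1 z).neg)
  rw [lap, h]
  simp only [gMoment, lap]
  simp [integral_neg, sub_eq_add_neg]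

lemma mul_lap_succ (n : ℕ) (z : ℂ) : z * lap (n + 1) z = (n + 1) * lap n z - lap (n + 2) z := by
  have hi : IntegrableOn (fun t : ℝ => cexp (-(z * t)) *
      (((n + 1) * gMoment n t - gMoment (n + 2) t : ℝ) : ℂ)) (Ioi 0) := by
    refine (((integrableOn_lap n z).const_mul ((n : ℂ) + 1)).sub
      (integrableOn_lap (n + 2) z)).congr (ae_of_all _ fun t => ?_)
    simp; ring
  have h := mul_lap_aux z (φ := gMoment (n + 1)) (hasDerivAt_gMoment_succ n)
    (integrableOn_lap (n + 1) z) hi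
  rw [lap, h]
  have h2 : ∫ t in Ioi (0 : ℝ), cexp (-(z * t)) *
      (((n + 1) * gMoment n t - gMoment (n + 2) t : ℝ) : ℂ)
      = (n + 1) * lap n z - lap (n + 2) z := by
    rw [lap, lap, ← integral_const_mul, ← integral_sub
      ((integrableOn_lap n z).const_mul ((n : ℂ) + 1)) (integrableOn_lap (n + 2) z)]
    congr 1; funext t; push_cast; ring
  rw [h2]; simp [gMoment]

/-! ### Gaussian expectations -/

/-- The standard Gaussian law. -/
abbrev gauss : Measure ℝ := gaussianReal 0 1

/-- `E[(iξ)ⁿ exp(-itξ)]` for a standard Gaussian `ξ`. -/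
def gaussExp (n : ℕ) (t : ℝ) : ℂ := ∫ ξ : ℝ, (I * ξ) ^ n * cexp (-(I * (t * ξ))) ∂gauss

lemma integrable_pow_gauss (n : ℕ) : Integrable (fun ξ : ℝ => |ξ| ^ n) gauss := by
  rcases Nat.eq_zero_or_pos n with rfl | hn
  · simp
  · have := (memLp_id_gaussianReal (μ := 0) (v := 1) n).integrable_norm_pow (by omega)
    simpa using this

lemma integrable_one_add_pow_gauss (n : ℕ) : Integrable (fun ξ : ℝ => (1 + |ξ|) ^ n) gauss := by
  simp_rw [add_comm (1 : ℝ), add_pow, one_pow, mul_one]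
  exact integrable_finsetSum _ fun i _ => (integrable_pow_gauss i).mul_const _

lemma norm_exp_neg_I_mul (x : ℝ) : ‖cexp (-(I * x))‖ = 1 := by
  rw [norm_exp]; simp

lemma norm_exp_neg_I_mul_mul (x y : ℝ) : ‖cexp (-(I * (x * y)))‖ = 1 := by
  rw [← ofReal_mul]; exact norm_exp_neg_I_mul _

lemma integrable_gaussExp (n : ℕ) (t : ℝ) :
    Integrable (fun ξ : ℝ => (I * ξ) ^ n * cexp (-(I * (t * ξ)))) gauss := by
  refine (integrable_pow_gauss n).mono' (by fun_prop)
    (ae_of_all _ fun ξ => ?_)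
  rw [norm_mul, norm_exp_neg_I_mul_mul]; simp

lemma hasDerivAt_gaussExp (n : ℕ) (t : ℝ) : HasDerivAt (gaussExp n) (-gaussExp (n + 1) t) t := by
  have key := hasDerivAt_integral_of_dominated_loc_of_deriv_le
    (μ := gauss) (𝕜 := ℝ)
    (F := fun t ξ => (I * ξ) ^ n * cexp (-(I * (t * ξ))))
    (F' := fun t ξ => -((I * ξ) ^ (n + 1) * cexp (-(I * (t * ξ)))))
    (x₀ := t) (s := univ) (bound := fun ξ => |ξ| ^ (n + 1)) univ_mem
    (Eventually.of_forall fun w => (integrable_gaussExp n w).aestronglyMeasurable)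
    (integrable_gaussExp n t) (integrable_gaussExp (n + 1) t).neg.aestronglyMeasurable ?_
    (integrable_pow_gauss (n + 1)) ?_
  · exact key.2.congr_deriv (integral_neg _)
  · refine ae_of_all _ fun ξ w _ => ?_
    rw [norm_neg, norm_mul, norm_exp_neg_I_mul_mul]; simp
  · refine ae_of_all _ fun ξ w _ => ?_
    have h1 : HasDerivAt (fun w : ℝ => -(I * (w * ξ))) (-(I * (1 * (ξ : ℂ)))) w :=
      (((hasDerivAt_id (w : ℂ)).comp_ofReal.mul_const (ξ : ℂ)).const_mul I).neg
    have := (h1.cexp).const_mul ((I * ξ) ^ n)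
    exact this.congr_deriv (by ring)

lemma gaussExp_zero (t : ℝ) : gaussExp 0 t = gMoment 0 t := by
  have h := charFun_gaussianReal (μ := 0) (v := 1) (-t)
  rw [charFun_apply_real] at h
  simp only [gaussExp, gMoment, pow_zero, one_mul]
  convert h using 1
  · congr 1; funext x; congr 1; push_cast; ring
  · push_cast; congr 1; simp

/-- The moments are successive derivatives of the characteristic function. Orders up to two are all
that is needed, and their explicit form shows that they are integrable in time. -/
lemma gaussExp_one (t : ℝ) : gaussExp 1 t = gMoment 1 t := by
  have h1 := hasDerivAt_gaussExp 0 t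
  have h2 : HasDerivAt (gaussExp 0) ((-gMoment 1 t : ℝ) : ℂ) t := by
    have := (hasDerivAt_gMoment_zero t).ofReal_comp
    exact hasDerivAt_congr_both this (funext gaussExp_zero) rfl
  have := h1.unique h2
  push_cast at this
  simpa using this

lemma gaussExp_two (t : ℝ) : gaussExp 2 t = gMoment 2 t - gMoment 0 t := by
  have h1 := hasDerivAt_gaussExp 1 t
  have h2 : HasDerivAt (gaussExp 1) ((gMoment 0 t - gMoment 2 t : ℝ) : ℂ) t := by
    have := (hasDerivAt_gMoment_succ 0 t).ofReal_comp
    exact hasDerivAt_congr_both this (funext gaussExp_one) (by simp)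
  have := h1.unique h2
  push_cast at this
  linear_combination -this

/-- `∫ |E[(iξ)ⁿ exp(-itξ)]| dt`. -/
def gaussBound (n : ℕ) : ℝ := ∫ t, ‖gaussExp n t‖

lemma gaussBound_nonneg (n : ℕ) : 0 ≤ gaussBound n := integral_nonneg fun _ => norm_nonneg _

lemma integrable_gaussExp_time {n : ℕ} (hn : n ≤ 2) : Integrable (gaussExp n) := by
  interval_cases n
  · rw [show gaussExp 0 = fun t => (gMoment 0 t : ℂ) from funext gaussExp_zero]
    exact (integrable_gMoment 0).ofReal
  · rw [show gaussExp 1 = fun t => (gMoment 1 t : ℂ) from funext gaussExp_one]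
    exact (integrable_gMoment 1).ofReal
  · rw [show gaussExp 2 = fun t => (gMoment 2 t : ℂ) - gMoment 0 t from funext gaussExp_two]
    exact (integrable_gMoment 2).ofReal.sub (integrable_gMoment 0).ofReal

lemma I_mul_add_ne_zero {z : ℂ} (hz : 0 < z.re) (ξ : ℝ) : I * ξ + z ≠ 0 := by
  intro h
  have := congrArg Complex.re h
  simp at this; linarith

/-- Denominators are traded for time integrals, so that the average over `ξ` can be taken first. -/
lemma inv_I_mul_add_eq_integral {z : ℂ} (hz : 0 < z.re) (ξ : ℝ) :
    (I * ξ + z)⁻¹ = ∫ s in Ioi (0 : ℝ), cexp (-(z * s)) * cexp (-(I * (s * ξ))) := by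
  have h := integral_exp_mul_complex_Ioi (a := -(I * ξ + z)) (by simpa using hz) 0
  have e : ∀ s : ℝ, cexp (-(z * s)) * cexp (-(I * (s * ξ))) = cexp (-(I * ξ + z) * s) := by
    intro s; rw [← exp_add]; congr 1; ring
  simp_rw [e, h]
  rw [ofReal_zero, mul_zero, exp_zero, neg_div_neg_eq, one_div]

/-- `E[(iξ)ⁿ exp(-iτξ) / (iξ + z)]`. -/
def gaussRes (n : ℕ) (z : ℂ) (τ : ℝ) : ℂ :=
  ∫ ξ : ℝ, (I * ξ) ^ n * cexp (-(I * (τ * ξ))) * (I * ξ + z)⁻¹ ∂gauss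

lemma integrableOn_exp_neg_mul {z : ℂ} (hz : 0 < z.re) :
    IntegrableOn (fun s : ℝ => cexp (-(z * s))) (Ioi 0) := by
  have := integrableOn_exp_mul_complex_Ioi (a := -z) (by simpa using hz) 0
  simpa using this

lemma gaussRes_eq_integral (n : ℕ) {z : ℂ} (hz : 0 < z.re) (τ : ℝ) :
    gaussRes n z τ = ∫ s in Ioi (0 : ℝ), cexp (-(z * s)) * gaussExp n (τ + s) := by
  unfold gaussRes gaussExp
  simp_rw [inv_I_mul_add_eq_integral hz, ← integral_const_mul]
  rw [integral_integral_swap]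
  · congr 1; funext s; congr 1; funext ξ
    rw [show -(I * (((τ + s : ℝ) : ℂ) * ξ)) = -(I * (τ * ξ)) + -(I * (s * ξ)) by push_cast; ring,
      exp_add]
    ring
  · have h := (integrable_gaussExp n τ).mul_prod (integrableOn_exp_neg_mul hz)
    have h2 := h.mul_bdd (c := 1) (g := fun x : ℝ × ℝ => cexp (-(I * (x.2 * x.1))))
      (by fun_prop)
      (ae_of_all _ fun x => (norm_exp_neg_I_mul_mul _ _).le)
    refine h2.congr (ae_of_all _ fun x => ?_)
    simp only [Function.uncurry]; ring

/-- Taking absolute values inside the Gaussian expectation would cost a factor `1/Re z`. In the time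
representation the expectation is already an integrable function of time, so the bound is uniform up
to the imaginary axis. -/
lemma norm_gaussRes_le {n : ℕ} (hn : n ≤ 2) {z : ℂ} (hz : 0 < z.re) (τ : ℝ) :
    ‖gaussRes n z τ‖ ≤ gaussBound n := by
  rw [gaussRes_eq_integral n hz]
  have hi : Integrable fun s : ℝ => gaussExp n (τ + s) :=
    (integrable_gaussExp_time hn).comp_add_left τ
  calc _ ≤ ∫ s in Ioi (0 : ℝ), ‖gaussExp n (τ + s)‖ := by
        refine norm_integral_le_of_norm_le hi.norm.integrableOn ?_
        filter_upwards [ae_Ioi] with s hs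
        rw [norm_mul]
        exact mul_le_of_le_one_left (norm_nonneg _) (norm_exp_neg_mul_le_one hz.le (le_of_lt hs))
    _ ≤ ∫ s : ℝ, ‖gaussExp n (τ + s)‖ :=
        setIntegral_le_integral hi.norm (ae_of_all _ fun _ => norm_nonneg _)
    _ = gaussBound n := integral_add_left_eq_self (fun s => ‖gaussExp n s‖) τ

lemma gaussRes_one_zero {z : ℂ} (hz : 0 < z.re) : gaussRes 1 z 0 = lap 1 z := by
  rw [gaussRes_eq_integral 1 hz, lap]
  congr 1; funext s; rw [zero_add, gaussExp_one]

lemma norm_inv_I_mul_add_le {z : ℂ} (hz : 0 < z.re) (ξ : ℝ) : ‖(I * ξ + z)⁻¹‖ ≤ z.re⁻¹ := by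
  rw [norm_inv]
  apply inv_anti₀ hz
  have := re_le_norm (I * ξ + z)
  simpa using this

lemma integrable_gaussRes (n : ℕ) {z : ℂ} (hz : 0 < z.re) (τ : ℝ) :
    Integrable (fun ξ : ℝ => (I * ξ) ^ n * cexp (-(I * (τ * ξ))) * (I * ξ + z)⁻¹) gauss :=
  (integrable_gaussExp n τ).mul_bdd (c := z.re⁻¹) (by fun_prop)
    (ae_of_all _ fun ξ => norm_inv_I_mul_add_le hz ξ)

/-! ### The dispersion function -/

/-- The dispersion function `1 + L ∫₀^∞ exp(-zt) t exp(-t²/2) dt`. -/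
def disp (L : ℝ) (z : ℂ) : ℂ := 1 + L * lap 1 z

/-- Since `lap 1 z = E[iξ/(iξ + z)]` and `Re (z iξ/(iξ + z)) = Re z ξ²/|iξ + z|²`, the interaction
term contributes a nonnegative real part. This rules out growing modes. -/
lemma re_mul_disp_ge {L : ℝ} (hL : 0 ≤ L) {z : ℂ} (hz : 0 < z.re) : z.re ≤ (z * disp L z).re := by
  have h : (z * lap 1 z).re = ∫ ξ : ℝ, (z * ((I * ξ) * (I * ξ + z)⁻¹)).re ∂gauss := by
    rw [← gaussRes_one_zero hz, gaussRes, ← integral_const_mul]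
    have hi := (integrable_gaussRes 1 hz 0).const_mul z
    have := (reCLM.integral_comp_comm hi).symm
    simp only [reCLM_apply] at this
    rw [this]
    congr 1; funext ξ; simp
  have h2 : 0 ≤ (z * lap 1 z).re := by
    rw [h]
    refine integral_nonneg fun ξ => ?_
    have e : z * ((I * ξ) * (I * ξ + z)⁻¹) = z * (I * ξ) / (I * ξ + z) := by
      rw [div_eq_mul_inv]; ring
    simp only [e, Pi.zero_apply]
    rw [div_re, ← add_div]
    apply div_nonneg _ (normSq_nonneg _)
    simp
    nlinarith [mul_nonneg hz.le (sq_nonneg ξ)]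
  have : (z * disp L z).re = z.re + L * (z * lap 1 z).re := by
    rw [disp, show z * (1 + L * lap 1 z) = z + L * (z * lap 1 z) by ring, add_re,
      re_ofReal_mul]
  rw [this]
  nlinarith [mul_nonneg hL h2]

/-- Landau damping. The imaginary part is a sine transform with an even integrand, hence half of an
integral over the whole line, which is a Gaussian moment. -/
lemma im_lap_one_I (y : ℝ) : (lap 1 (I * y)).im = -(Real.sqrt (2 * π) / 2 * gMoment 1 y) := by
  have hsin : (lap 1 (I * y)).im = -∫ t in Ioi (0 : ℝ), Real.sin (y * t) * gMoment 1 t := by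
    have := (imCLM.integral_comp_comm (integrableOn_lap 1 (I * y))).symm
    simp only [imCLM_apply] at this
    rw [lap, this, ← integral_neg]
    congr 1; funext t
    rw [im_mul_ofReal, show -(I * (y : ℂ) * t) = ((-(y * t) : ℝ) : ℂ) * I by push_cast; ring,
      exp_ofReal_mul_I_im, Real.sin_neg]
    ring
  have heven : ∫ t : ℝ, Real.sin (y * t) * gMoment 1 t
      = 2 * ∫ t in Ioi (0 : ℝ), Real.sin (y * t) * gMoment 1 t := by
    rw [← integral_comp_abs (f := fun t => Real.sin (y * t) * gMoment 1 t)]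
    congr 1; funext t
    rcases abs_cases t with ⟨h, _⟩ | ⟨h, _⟩ <;> simp [h, gMoment]
  have hE : (gaussExp 1 y).re = ∫ ξ : ℝ, ξ * Real.sin (y * ξ) ∂gauss := by
    have := (reCLM.integral_comp_comm (integrable_gaussExp 1 y)).symm
    simp only [reCLM_apply] at this
    rw [gaussExp, this]
    congr 1; funext t
    rw [show -(I * ((y : ℂ) * t)) = ((-(y * t) : ℝ) : ℂ) * I by push_cast; ring, mul_re,
      exp_ofReal_mul_I_im]
    simp
  rw [gaussExp_one, ofReal_re, integral_gaussianReal_eq_integral_smul one_ne_zero] at hE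
  have hpdf : ∀ x : ℝ, gaussianPDFReal 0 1 x • (x * Real.sin (y * x))
      = (Real.sqrt (2 * π))⁻¹ * (Real.sin (y * x) * gMoment 1 x) := by
    intro x
    simp [gaussianPDFReal, gMoment]
    rw [neg_div]
    ring
  simp_rw [hpdf] at hE
  rw [integral_const_mul, heven] at hE
  have hpos : 0 < Real.sqrt (2 * π) := Real.sqrt_pos.2 (by positivity)
  rw [hsin, hE]
  field_simp

/-- Three regimes: positivity of `Re (z disp)` in the open half plane, a nonzero imaginary part on
the imaginary axis away from the origin, and the value `1 + L` at the origin. -/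
lemma disp_ne_zero {L : ℝ} (hL : 0 ≤ L) {z : ℂ} (hz : 0 ≤ z.re) : disp L z ≠ 0 := by
  rcases hz.lt_or_eq with h | h
  · intro h0
    have := re_mul_disp_ge hL h
    rw [h0] at this
    simp at this; linarith
  · have hzy : z = I * (z.im : ℂ) := by
      apply Complex.ext <;> simp [← h]
    rcases hL.lt_or_eq with hL | hL
    · by_cases hy : z.im = 0
      · have hz0 : z = 0 := by rw [hzy, hy]; simp
        subst hz0
        have h1 : lap 1 0 = 1 := by
          have := mul_lap_zero 0
          rw [zero_mul] at this
          linear_combination this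
        rw [disp, h1]
        intro h0
        have := congrArg Complex.re h0
        simp at this; linarith
      · intro h0
        have h1 := congrArg Complex.im h0
        rw [disp, add_im, im_ofReal_mul, hzy, im_lap_one_I] at h1
        have hpos : 0 < Real.sqrt (2 * π) := Real.sqrt_pos.2 (by positivity)
        have he := Real.exp_pos (-(z.im ^ 2 / 2))
        simp [gMoment, hL.ne', hy] at h1
        exact absurd h1 (by positivity)
    · simp [disp, ← hL]

/-- Using the recurrence twice shows that `z² lap n z` is bounded for `n = 1, 2, 3`, which gives
decay like `1/(1 + |z|²)`. For `n = 0` only boundedness is used. -/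
lemma sq_mul_lap_one (z : ℂ) : z ^ 2 * lap 1 z = 1 - 3 * lap 1 z + lap 3 z := by
  have h1 := mul_lap_succ 0 z
  have h2 := mul_lap_succ 1 z
  have h0 := mul_lap_zero z
  norm_num at h1 h2
  linear_combination z * h1 + h0 - h2

lemma sq_mul_lap_two (z : ℂ) : z ^ 2 * lap 2 z = 2 * lap 0 z - 5 * lap 2 z + lap 4 z := by
  have h1 := mul_lap_succ 0 z
  have h2 := mul_lap_succ 1 z
  have h3 := mul_lap_succ 2 z
  norm_num at h1 h2 h3
  linear_combination z * h2 + 2 * h1 - h3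

lemma sq_mul_lap_three (z : ℂ) : z ^ 2 * lap 3 z = 6 * lap 1 z - 7 * lap 3 z + lap 5 z := by
  have h2 := mul_lap_succ 1 z
  have h3 := mul_lap_succ 2 z
  have h4 := mul_lap_succ 3 z
  norm_num at h2 h3 h4
  linear_combination z * h3 + 3 * h2 - h4

/-- A constant dominating `(1 + |z|²) |lap n z|` for `n = 1, 2, 3` and `|lap 0 z|`. -/
def lapConst : ℝ := 2 + 8 * (lapBound 0 + lapBound 1 + lapBound 2 + lapBound 3 + lapBound 4 + lapBound 5)

lemma lapConst_pos : 0 < lapConst := by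
  have := lapBound_nonneg
  unfold lapConst
  linarith [this 0, this 1, this 2, this 3, this 4, this 5]

lemma norm_lap_zero_le {z : ℂ} (hz : 0 ≤ z.re) : ‖lap 0 z‖ ≤ lapConst := by
  have := lapBound_nonneg
  unfold lapConst
  linarith [this 0, this 1, this 2, this 3, this 4, this 5, norm_lap_le 0 hz]

lemma one_add_sq_mul_norm_lap_le {z : ℂ} (hz : 0 ≤ z.re) {n : ℕ} (h1 : 1 ≤ n) (h3 : n ≤ 3) :
    (1 + ‖z‖ ^ 2) * ‖lap n z‖ ≤ lapConst := by
  have h := lapBound_nonneg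
  have l0 := norm_lap_le 0 hz
  have l1 := norm_lap_le 1 hz
  have l2 := norm_lap_le 2 hz
  have l3 := norm_lap_le 3 hz
  have l4 := norm_lap_le 4 hz
  have l5 := norm_lap_le 5 hz
  have key : ∀ a b c : ℂ, ‖a - b + c‖ ≤ ‖a‖ + ‖b‖ + ‖c‖ := fun a b c =>
    (norm_add_le _ _).trans (add_le_add_left (norm_sub_le _ _) _)
  have e : (1 + ‖z‖ ^ 2) * ‖lap n z‖ = ‖lap n z‖ + ‖z ^ 2 * lap n z‖ := by
    rw [norm_mul, norm_pow]; ring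
  rw [e]
  unfold lapConst
  interval_cases n
  · have := key 1 (3 * lap 1 z) (lap 3 z)
    rw [← sq_mul_lap_one] at this
    simp only [norm_mul, norm_one, norm_ofNat] at this ⊢
    linarith [h 0, h 1, h 2, h 3, h 4, h 5]
  · have := key (2 * lap 0 z) (5 * lap 2 z) (lap 4 z)
    rw [← sq_mul_lap_two] at this
    simp only [norm_mul, norm_ofNat] at this ⊢
    linarith [h 0, h 1, h 2, h 3, h 4, h 5]
  -- This case dictates the factor `8` in `lapConst`: `lap 3` occurs once on its own and seven times
  -- in the expansion.
  · have := key (6 * lap 1 z) (7 * lap 3 z) (lap 5 z)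
    rw [← sq_mul_lap_three] at this
    simp only [norm_mul, norm_ofNat] at this ⊢
    linarith [h 0, h 1, h 2, h 3, h 4, h 5]

lemma norm_lap_le_div {z : ℂ} (hz : 0 ≤ z.re) {n : ℕ} (h1 : 1 ≤ n) (h3 : n ≤ 3) :
    ‖lap n z‖ ≤ lapConst / (1 + ‖z‖ ^ 2) := by
  rw [le_div_iff₀ (by positivity), mul_comm]
  exact one_add_sq_mul_norm_lap_le hz h1 h3

/-- Uniform stability of the Maxwellian: the dispersion function is bounded below. -/
theorem exists_le_norm_disp (K : ℝ) :
    ∃ c : ℝ, 0 < c ∧ ∀ L ∈ Icc 0 K, ∀ z : ℂ, 0 ≤ z.re → c ≤ ‖disp L z‖ := by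
  -- With this radius, `R ≤ 1 + |z|²` as soon as `|z| ≥ R`, and the decay of `lap 1` makes the
  -- interaction term at most `1/2`. The remaining couplings and frequencies form a compact set on
  -- which `disp` does not vanish.
  set R : ℝ := 2 * |K| * lapConst + 1 with hR
  set S : Set (ℝ × ℂ) := Icc 0 K ×ˢ (Metric.closedBall 0 R ∩ {z : ℂ | 0 ≤ z.re}) with hS
  have hSc : IsCompact S := isCompact_Icc.prod
    ((isCompact_closedBall _ _).inter_right (isClosed_le continuous_const continuous_re))
  have hcont : Continuous fun p : ℝ × ℂ => ‖disp p.1 p.2‖ := by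
    have := (continuous_lap 1)
    unfold disp; fun_prop
  have hR1 : 1 ≤ R := by
    have := lapConst_pos
    have := abs_nonneg K
    rw [hR]; nlinarith [mul_nonneg this lapConst_pos.le]
  have far : ∀ L ∈ Icc 0 K, ∀ z : ℂ, 0 ≤ z.re → R ≤ ‖z‖ → 1 / 2 ≤ ‖disp L z‖ := by
    intro L hL z hz hzR
    have h1 := one_add_sq_mul_norm_lap_le hz (n := 1) le_rfl (by norm_num)
    have h2 : |K| * ‖lap 1 z‖ ≤ 1 / 2 := by
      have h4 : R ≤ 1 + ‖z‖ ^ 2 := by nlinarith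
      have h5 : R * ‖lap 1 z‖ ≤ lapConst := (mul_le_mul_of_nonneg_right h4 (norm_nonneg _)).trans h1
      have h6 : R * (|K| * ‖lap 1 z‖) ≤ R * (1 / 2) := by
        calc R * (|K| * ‖lap 1 z‖) = |K| * (R * ‖lap 1 z‖) := by ring
          _ ≤ |K| * lapConst := mul_le_mul_of_nonneg_left h5 (abs_nonneg _)
          _ ≤ R * (1 / 2) := by rw [hR]; linarith
      exact le_of_mul_le_mul_left h6 (by linarith)
    have h3 : ‖(L : ℂ) * lap 1 z‖ ≤ 1 / 2 := by
      rw [norm_mul, norm_real, norm_of_nonneg hL.1]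
      exact (mul_le_mul_of_nonneg_right (hL.2.trans (le_abs_self _)) (norm_nonneg _)).trans h2
    have h4 : ‖(1 : ℂ)‖ - ‖(L : ℂ) * lap 1 z‖ ≤ ‖disp L z‖ := by
      have := norm_sub_norm_le (1 : ℂ) (-((L : ℂ) * lap 1 z))
      rwa [norm_neg, sub_neg_eq_add] at this
    rw [norm_one] at h4
    linarith
  -- The compact set is empty only if `[0, K]` is, and then any constant will do.
  rcases S.eq_empty_or_nonempty with h | h
  · refine ⟨1, one_pos, fun L hL z hz => ?_⟩
    exfalso
    have : (L, (0 : ℂ)) ∈ S := ⟨hL, by simp; linarith, by simp⟩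
    rw [h] at this; exact this
  · obtain ⟨p, hp, hmin⟩ := hSc.exists_isMinOn h hcont.continuousOn
    have hp0 : 0 < ‖disp p.1 p.2‖ := norm_pos_iff.2 (disp_ne_zero hp.1.1 hp.2.2)
    refine ⟨min (1 / 2) ‖disp p.1 p.2‖, lt_min (by norm_num) hp0, fun L hL z hz => ?_⟩
    rcases le_total ‖z‖ R with hzR | hzR
    · exact (min_le_right _ _).trans (hmin (a := (L, z)) ⟨hL, by simpa using hzR, hz⟩)
    · exact (min_le_left _ _).trans (far L hL z hz hzR)

/-! ### The correction to free transport in the density response -/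

/-- `L ∈ [0, K]` is a coupling whose dispersion function is bounded below by `c`. -/
structure Stable (K c L : ℝ) : Prop where
  nonneg : 0 ≤ L
  le : L ≤ K
  pos : 0 < c
  bound : ∀ z : ℂ, 0 ≤ z.re → c ≤ ‖disp L z‖

/-- The Laplace transform of the correction to free transport. -/
def corrLap (L : ℝ) (z : ℂ) : ℂ := -L * (lap 0 z * lap 1 z * (disp L z)⁻¹)

/-- The first derivative of `corrLap`. -/
def corrLap' (L : ℝ) (z : ℂ) : ℂ :=
  -L * (-(lap 1 z * lap 1 z * (disp L z)⁻¹) - lap 0 z * lap 2 z * (disp L z)⁻¹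
    + L * (lap 0 z * lap 1 z * lap 2 z * (disp L z)⁻¹ ^ 2))

/-- The second derivative of `corrLap`. -/
def corrLap'' (L : ℝ) (z : ℂ) : ℂ :=
  -L * (3 * (lap 1 z * lap 2 z * (disp L z)⁻¹) + lap 0 z * lap 3 z * (disp L z)⁻¹
    - 2 * L * (lap 1 z * lap 1 z * lap 2 z * (disp L z)⁻¹ ^ 2)
    - 2 * L * (lap 0 z * lap 2 z * lap 2 z * (disp L z)⁻¹ ^ 2)
    - L * (lap 0 z * lap 1 z * lap 3 z * (disp L z)⁻¹ ^ 2)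
    + 2 * L ^ 2 * (lap 0 z * lap 1 z * lap 2 z * lap 2 z * (disp L z)⁻¹ ^ 3))

lemma hasDerivAt_disp (L : ℝ) (z : ℂ) : HasDerivAt (disp L) (-(L * lap 2 z)) z :=
  (((hasDerivAt_lap 1 z).const_mul (L : ℂ)).const_add 1).congr_deriv (by ring)

lemma hasDerivAt_inv_disp {L : ℝ} {z : ℂ} (h : disp L z ≠ 0) :
    HasDerivAt (fun z => (disp L z)⁻¹) (L * lap 2 z * (disp L z)⁻¹ ^ 2) z :=
  ((hasDerivAt_disp L z).inv h).congr_deriv (by field_simp)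

lemma hasDerivAt_corrLap {L : ℝ} {z : ℂ} (h : disp L z ≠ 0) :
    HasDerivAt (corrLap L) (corrLap' L z) z := by
  have := ((((hasDerivAt_lap 0 z).mul (hasDerivAt_lap 1 z)).mul
    (hasDerivAt_inv_disp h)).const_mul (-(L : ℂ)))
  refine this.congr_deriv ?_
  simp only [corrLap', Pi.mul_apply]; ring

lemma hasDerivAt_corrLap' {L : ℝ} {z : ℂ} (h : disp L z ≠ 0) :
    HasDerivAt (corrLap' L) (corrLap'' L z) z := by
  have l0 := hasDerivAt_lap 0 z
  have l1 := hasDerivAt_lap 1 z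
  have l2 := hasDerivAt_lap 2 z
  have di := hasDerivAt_inv_disp h
  have := (((((l1.mul l1).mul di).neg.sub ((l0.mul l2).mul di)).add
    ((((l0.mul l1).mul l2).mul (di.pow 2)).const_mul (L : ℂ))).const_mul (-(L : ℂ)))
  refine this.congr_deriv ?_
  simp only [corrLap'', Pi.mul_apply, Pi.pow_apply]; push_cast; ring

/-- A constant dominating `(1 + |z|²)` times `corrLap` and its derivatives. -/
def corrConst (K c : ℝ) : ℝ := 11 * (1 + K + lapConst + c⁻¹) ^ 10

variable {K c L : ℝ}

lemma Stable.nonneg_max (h : Stable K c L) : 0 ≤ K := h.nonneg.trans h.le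

lemma corrConst_nonneg (h : Stable K c L) : 0 ≤ corrConst K c := by
  have := h.nonneg_max
  have := lapConst_pos
  have := h.pos
  unfold corrConst; positivity

lemma Stable.ne_zero (h : Stable K c L) {z : ℂ} (hz : 0 ≤ z.re) :
    disp L z ≠ 0 := norm_pos_iff.1 (h.pos.trans_le (h.bound z hz))

/-- Each term contains a factor `lap n` with `n ≥ 1`, which supplies the decay `q`; every other
factor is at most `B ≥ 1`. The longest product has ten factors, hence the power `10`, and the second
derivative has eleven terms counted with multiplicity, hence the `11`. -/
lemma norm_corrLap_le_all (h : Stable K c L) {z : ℂ} (hz : 0 ≤ z.re) :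
    ‖corrLap L z‖ ≤ corrConst K c * (1 + ‖z‖ ^ 2)⁻¹ ∧
    ‖corrLap' L z‖ ≤ corrConst K c * (1 + ‖z‖ ^ 2)⁻¹ ∧
    ‖corrLap'' L z‖ ≤ corrConst K c * (1 + ‖z‖ ^ 2)⁻¹ := by
  have hM := lapConst_pos
  have hc := inv_pos.2 h.pos
  have hK := h.nonneg_max
  rw [corrConst]
  set B := 1 + K + lapConst + c⁻¹ with hB
  set q := (1 + ‖z‖ ^ 2)⁻¹ with hq
  have hB1 : 1 ≤ B := by linarith
  have hl : ‖(L : ℂ)‖ ≤ B := by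
    rw [norm_real, norm_of_nonneg h.nonneg]; linarith [h.le]
  have hL : ‖(L : ℂ)‖ ≤ B ^ 1 := hl.trans_eq (pow_one B).symm
  have h0 : ‖lap 0 z‖ ≤ B := (norm_lap_zero_le hz).trans (by linarith)
  have hn : ∀ n, 1 ≤ n → n ≤ 3 → ‖lap n z‖ ≤ B * q := fun n h1 h3 =>
    (norm_lap_le_div hz h1 h3).trans (mul_le_mul_of_nonneg_right (by linarith) (by positivity))
  have hq1 : B * q ≤ B := mul_le_of_le_one_right (by linarith)
    (inv_le_one_of_one_le₀ (by nlinarith [sq_nonneg ‖z‖]))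
  have q1 := hn 1 le_rfl (by norm_num)
  have q2 := hn 2 (by norm_num) (by norm_num)
  have q3 := hn 3 (by norm_num) le_rfl
  have h1 := q1.trans hq1
  have h2 := q2.trans hq1
  have hi : ‖(disp L z)⁻¹‖ ≤ B := by
    rw [norm_inv]; exact (inv_anti₀ h.pos (h.bound z hz)).trans (by linarith)
  set i := (disp L z)⁻¹ with hidef
  obtain ⟨E, hE⟩ : ∃ E, E = B ^ 10 * q := ⟨_, rfl⟩
  have s : ∀ {x y : ℂ} {k : ℕ}, ‖x‖ ≤ B ^ k → ‖y‖ ≤ B → ‖x * y‖ ≤ B ^ (k + 1) :=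
    fun hx hy => norm_mul_le_of_le hx hy
  have w : ∀ {x y : ℂ} {k : ℕ}, ‖x‖ ≤ B ^ k → k + 1 ≤ 10 → ‖y‖ ≤ B * q → ‖x * y‖ ≤ E :=
    fun {x y k} hx hk hy => (norm_mul_le_of_le hx hy).trans (by
      rw [← mul_assoc, ← pow_succ, hE]; gcongr)
  have e0 := w (s (s hL h0) hi) (by norm_num) q1
  have e1 := w (s (s hL h1) hi) (by norm_num) q1
  have e2 := w (s (s hL h0) hi) (by norm_num) q2
  have e3 := w (s (s (s (s (s hL hl) h0) h1) hi) hi) (by norm_num) q2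
  have e4 := w (s (s hL h1) hi) (by norm_num) q2
  have e5 := w (s (s hL h0) hi) (by norm_num) q3
  have e6 := w (s (s (s (s (s hL hl) h1) h1) hi) hi) (by norm_num) q2
  have e7 := w (s (s (s (s (s hL hl) h0) h2) hi) hi) (by norm_num) q2
  have e8 := w (s (s (s (s (s hL hl) h0) h1) hi) hi) (by norm_num) q3
  have e9 := w (s (s (s (s (s (s (s (s hL hl) hl) h0) h1) h2) hi) hi) hi) (by norm_num) q2
  have hP : 0 ≤ E := hE ▸ by positivity
  rw [mul_assoc, ← hE]
  clear_value B
  refine ⟨?_, ?_, ?_⟩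
  · rw [corrLap, ← hidef, show -(L : ℂ) * (lap 0 z * lap 1 z * i) = -(L * lap 0 z * i * lap 1 z) by
      ring, norm_neg]
    linarith
  · refine (congrArg norm ?_).trans_le ((norm_sub_le_of_le (norm_add_le_of_le e1 e2) e3).trans
      (by linarith))
    rw [corrLap', ← hidef]; ring
  · have a := @norm_add_le_of_le ℂ _
    rw [← norm_neg]
    refine (congrArg norm ?_).trans_le ((norm_sub_le_of_le
      (a e4 (a e4 (a e4 (a e5 (a e9 e9))))) (a e6 (a e6 (a e7 (a e7 e8))))).trans (by linarith))
    rw [corrLap'', ← hidef]; ring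

/-- The boundary point `x + 2πiη` of the Laplace variable. -/
def linePt (x η : ℝ) : ℂ := x + 2 * π * I * η

lemma linePt_re (x η : ℝ) : (linePt x η).re = x := by simp [linePt]

lemma linePt_im (x η : ℝ) : (linePt x η).im = 2 * π * η := by simp [linePt]

lemma inv_one_add_linePt_le (x η : ℝ) : (1 + ‖linePt x η‖ ^ 2)⁻¹ ≤ (1 + η ^ 2)⁻¹ := by
  apply inv_anti₀ (by positivity)
  have h1 : |(linePt x η).im| ≤ ‖linePt x η‖ := abs_im_le_norm _
  rw [linePt_im, abs_mul, abs_of_pos (by positivity : 0 < 2 * π)] at h1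
  have h2 : |η| ≤ 2 * π * |η| := by
    have := Real.pi_gt_three
    nlinarith [abs_nonneg η]
  have h3 := h2.trans h1
  nlinarith [sq_abs η, abs_nonneg η]

lemma norm_corrLap_linePt_le (h : Stable K c L) {x : ℝ} (hx : 0 ≤ x) (η : ℝ) :
    ‖corrLap L (linePt x η)‖ ≤ corrConst K c * (1 + η ^ 2)⁻¹ ∧
    ‖corrLap' L (linePt x η)‖ ≤ corrConst K c * (1 + η ^ 2)⁻¹ ∧
    ‖corrLap'' L (linePt x η)‖ ≤ corrConst K c * (1 + η ^ 2)⁻¹ := by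
  have hb := norm_corrLap_le_all h (z := linePt x η) (by rwa [linePt_re])
  have hq := mul_le_mul_of_nonneg_left (inv_one_add_linePt_le x η) (corrConst_nonneg h)
  exact ⟨hb.1.trans hq, hb.2.1.trans hq, hb.2.2.trans hq⟩

lemma hasDerivAt_linePt_right (x η : ℝ) : HasDerivAt (linePt x) (2 * π * I) η := by
  have := ((hasDerivAt_id (η : ℂ)).comp_ofReal.const_mul (2 * π * I)).const_add (x : ℂ)
  exact this.congr_deriv (by ring)

lemma hasDerivAt_linePt_left (x η : ℝ) : HasDerivAt (fun x => linePt x η) 1 x :=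
  ((hasDerivAt_id (x : ℂ)).comp_ofReal.add_const (2 * π * I * (η : ℂ)))

lemma Stable.ne_zero_linePt (h : Stable K c L) {x : ℝ} (hx : 0 ≤ x) (η : ℝ) :
    disp L (linePt x η) ≠ 0 := h.ne_zero (by rwa [linePt_re])

lemma hasDerivAt_corrLap_right (h : Stable K c L) {x : ℝ} (hx : 0 ≤ x) (η : ℝ) :
    HasDerivAt (fun η => corrLap L (linePt x η)) (2 * π * I * corrLap' L (linePt x η)) η :=
  (((hasDerivAt_corrLap (h.ne_zero_linePt hx η)).comp η
    (hasDerivAt_linePt_right x η))).congr_deriv (by ring)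

lemma hasDerivAt_corrLap'_right (h : Stable K c L) {x : ℝ} (hx : 0 ≤ x) (η : ℝ) :
    HasDerivAt (fun η => corrLap' L (linePt x η))
      (2 * π * I * corrLap'' L (linePt x η)) η :=
  (((hasDerivAt_corrLap' (h.ne_zero_linePt hx η)).comp η
    (hasDerivAt_linePt_right x η))).congr_deriv (by ring)

lemma continuous_corrLap_right (h : Stable K c L) {x : ℝ} (hx : 0 ≤ x) :
    Continuous fun η => corrLap L (linePt x η) :=
  continuous_iff_continuousAt.2 fun η => (hasDerivAt_corrLap_right h hx η).continuousAt

lemma continuous_corrLap'_right (h : Stable K c L) {x : ℝ} (hx : 0 ≤ x) :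
    Continuous fun η => corrLap' L (linePt x η) :=
  continuous_iff_continuousAt.2 fun η => (hasDerivAt_corrLap'_right h hx η).continuousAt

lemma measurable_corrLap'' : Measurable (corrLap'' L) := by
  have h0 := (continuous_lap 0).measurable
  have h1 := (continuous_lap 1).measurable
  have h2 := (continuous_lap 2).measurable
  have h3 := (continuous_lap 3).measurable
  unfold corrLap'' disp
  fun_prop

lemma integrable_corr_bound (C : ℝ) : Integrable fun η : ℝ => C * (1 + η ^ 2)⁻¹ :=
  integrable_inv_one_add_sq.const_mul C

lemma integrable_corrLap (h : Stable K c L) {x : ℝ} (hx : 0 ≤ x) :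
    Integrable fun η => corrLap L (linePt x η) :=
  (integrable_corr_bound (corrConst K c)).mono'
    (continuous_corrLap_right h hx).aestronglyMeasurable
    (ae_of_all _ fun η => (norm_corrLap_linePt_le h hx η).1)

lemma integrable_corrLap' (h : Stable K c L) {x : ℝ} (hx : 0 ≤ x) :
    Integrable fun η => corrLap' L (linePt x η) :=
  (integrable_corr_bound (corrConst K c)).mono'
    (continuous_corrLap'_right h hx).aestronglyMeasurable
    (ae_of_all _ fun η => (norm_corrLap_linePt_le h hx η).2.1)

lemma integrable_corrLap'' (h : Stable K c L) {x : ℝ} (hx : 0 ≤ x) :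
    Integrable fun η => corrLap'' L (linePt x η) := by
  refine (integrable_corr_bound (corrConst K c)).mono'
    (Measurable.aestronglyMeasurable ?_)
    (ae_of_all _ fun η => (norm_corrLap_linePt_le h hx η).2.2)
  exact measurable_corrLap''.comp (by unfold linePt; fun_prop)

lemma integral_norm_le_of_le {f : ℝ → ℂ} {C : ℝ} (hf : ∀ η, ‖f η‖ ≤ C * (1 + η ^ 2)⁻¹) :
    ∫ η, ‖f η‖ ≤ C * π := by
  calc ∫ η, ‖f η‖ ≤ ∫ η : ℝ, C * (1 + η ^ 2)⁻¹ :=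
        integral_mono_of_nonneg (ae_of_all _ fun _ => norm_nonneg _) (integrable_corr_bound C)
          (ae_of_all _ hf)
    _ = C * π := by rw [integral_const_mul, integral_univ_inv_one_add_sq]

/-- The correction to free transport in the density response. -/
def corr (L t : ℝ) : ℂ := 𝓕⁻ (fun η : ℝ => corrLap L (linePt 0 η)) t

lemma continuous_corr (h : Stable K c L) : Continuous (corr L) := by
  have h1 : Continuous (𝓕 (fun η : ℝ => corrLap L (linePt 0 η))) :=
    VectorFourier.fourierIntegral_continuous Real.continuous_fourierChar
      (by exact continuous_inner) (integrable_corrLap h le_rfl)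
  have h2 : corr L = fun t => 𝓕 (fun η : ℝ => corrLap L (linePt 0 η)) (-t) := by
    funext t; exact Real.fourierInv_eq_fourier_neg _ _
  rw [h2]; exact h1.comp continuous_neg

/-- A uniform constant for the decay of `corr`. -/
def corrDecay (K c : ℝ) : ℝ := corrConst K c * π * (1 + (2 * π) ^ 2)

/-- Two integrable derivatives of the transform give quadratic decay in time. The free part decays
like a Gaussian, so only this correction requires the argument. -/
lemma norm_corr_le (h : Stable K c L) (t : ℝ) : ‖corr L t‖ ≤ corrDecay K c * (1 + t ^ 2)⁻¹ := by
  set f : ℝ → ℂ := fun η => corrLap L (linePt 0 η) with hf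
  have hd1 : deriv f = fun η => 2 * π * I * corrLap' L (linePt 0 η) :=
    funext fun η => (hasDerivAt_corrLap_right h le_rfl η).deriv
  have hd2 : deriv (deriv f) = fun η => (2 * π * I) ^ 2 * corrLap'' L (linePt 0 η) := by
    rw [hd1]; funext η
    rw [((hasDerivAt_corrLap'_right h le_rfl η).const_mul (2 * π * I)).deriv]; ring
  have i0 : Integrable f := integrable_corrLap h le_rfl
  have i1 : Integrable (deriv f) := by
    rw [hd1]; exact (integrable_corrLap' h le_rfl).const_mul _
  have i2 : Integrable (deriv (deriv f)) := by
    rw [hd2]; exact (integrable_corrLap'' h le_rfl).const_mul _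
  have D0 : Differentiable ℝ f := fun η =>
    (hasDerivAt_corrLap_right h le_rfl η).differentiableAt
  have D1 : Differentiable ℝ (deriv f) := by
    rw [hd1]; exact fun η => ((hasDerivAt_corrLap'_right h le_rfl η).const_mul _).differentiableAt
  have F1 := Real.fourier_deriv i0 D0 i1
  have F2 := Real.fourier_deriv i1 D1 i2
  have e : corr L t = 𝓕 f (-t) := Real.fourierInv_eq_fourier_neg _ _
  have B0 : ‖𝓕 f (-t)‖ ≤ corrConst K c * π :=
    (VectorFourier.norm_fourierIntegral_le_integral_norm _ _ _ _ _).trans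
      (integral_norm_le_of_le fun η => (norm_corrLap_linePt_le h le_rfl η).1)
  have B2 : ‖𝓕 (deriv (deriv f)) (-t)‖ ≤ (2 * π) ^ 2 * corrConst K c * π := by
    refine (VectorFourier.norm_fourierIntegral_le_integral_norm _ _ _ _ _).trans
      (integral_norm_le_of_le fun η => ?_)
    rw [hd2, norm_mul]
    have : ‖(2 * π * I : ℂ) ^ 2‖ = (2 * π) ^ 2 := by
      simp [abs_of_pos Real.pi_pos]
    rw [this, mul_assoc ((2 * π) ^ 2)]
    exact mul_le_mul_of_nonneg_left (norm_corrLap_linePt_le h le_rfl η).2.2 (by positivity)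
  have e2 : ‖𝓕 (deriv (deriv f)) (-t)‖ = (2 * π) ^ 2 * t ^ 2 * ‖𝓕 f (-t)‖ := by
    rw [F2, F1]
    simp [abs_of_pos Real.pi_pos]
    rw [← sq_abs t]; ring
  rw [e2] at B2
  rw [e, ← div_eq_mul_inv, le_div_iff₀ (by positivity), corrDecay]
  have hpi : (1 : ℝ) ≤ (2 * π) ^ 2 := by nlinarith [Real.pi_gt_three]
  have hn := norm_nonneg (𝓕 f (-t))
  nlinarith [mul_nonneg (sub_nonneg.2 hpi) (mul_nonneg (sq_nonneg t) hn)]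

/-! ### Causality -/

/-- The inverse Laplace integral of `corrLap` along the line of abscissa `x`. -/
def bromwich (L t x : ℝ) : ℂ := ∫ η : ℝ, cexp (linePt x η * t) * corrLap L (linePt x η)

lemma norm_exp_linePt (x η t : ℝ) : ‖cexp (linePt x η * t)‖ = rexp (x * t) := by
  rw [norm_exp, re_mul_ofReal, linePt_re]

lemma exp_mul_le_one_of_nonpos {x t : ℝ} (hx : 0 ≤ x) (ht : t ≤ 0) : rexp (x * t) ≤ 1 :=
  Real.exp_le_one_iff.2 (mul_nonpos_of_nonneg_of_nonpos hx ht)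

lemma continuous_linePt_right (x : ℝ) : Continuous (linePt x) := by unfold linePt; fun_prop

lemma integrable_bromwich (h : Stable K c L) {t : ℝ} (ht : t ≤ 0) {x : ℝ} (hx : 0 ≤ x) :
    Integrable fun η : ℝ => cexp (linePt x η * t) * corrLap L (linePt x η) := by
  refine (integrable_corrLap h hx).bdd_mul (c := 1) ?_ (ae_of_all _ fun η => ?_)
  · have := continuous_linePt_right x
    fun_prop
  · rw [norm_exp_linePt]; exact exp_mul_le_one_of_nonpos hx ht

lemma corr_eq_bromwich (t : ℝ) : corr L t = bromwich L t 0 := by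
  rw [corr, Real.fourierInv_eq', bromwich]
  congr 1; funext η
  rw [smul_eq_mul]
  congr 2
  simp [linePt]; ring

lemma hasDerivAt_bromwich_integrand_left (h : Stable K c L) (t : ℝ) {x : ℝ} (hx : 0 ≤ x)
    (η : ℝ) : HasDerivAt (fun x => cexp (linePt x η * t) * corrLap L (linePt x η))
      (cexp (linePt x η * t) * (t * corrLap L (linePt x η) + corrLap' L (linePt x η))) x := by
  have h1 := ((hasDerivAt_linePt_left x η).mul_const (t : ℂ)).cexp
  have h2 : HasDerivAt (fun x => corrLap L (linePt x η)) (corrLap' L (linePt x η) * 1) x :=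
    HasDerivAt.comp (h₂ := corrLap L) x (hasDerivAt_corrLap (h.ne_zero_linePt hx η))
      (hasDerivAt_linePt_left x η)
  exact (h1.mul h2).congr_deriv (by ring)

lemma hasDerivAt_bromwich_integrand_right (h : Stable K c L) (t : ℝ) {x : ℝ} (hx : 0 ≤ x)
    (η : ℝ) : HasDerivAt (fun η => cexp (linePt x η * t) * corrLap L (linePt x η))
      (2 * π * I *
        (cexp (linePt x η * t) * (t * corrLap L (linePt x η) + corrLap' L (linePt x η)))) η := by
  have h1 := ((hasDerivAt_linePt_right x η).mul_const (t : ℂ)).cexp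
  exact (h1.mul (hasDerivAt_corrLap_right h hx η)).congr_deriv (by ring)

lemma norm_bromwich_deriv_le (h : Stable K c L) {t : ℝ} (ht : t ≤ 0) {x : ℝ} (hx : 0 ≤ x) (η : ℝ) :
    ‖cexp (linePt x η * t) * (t * corrLap L (linePt x η) + corrLap' L (linePt x η))‖
      ≤ (|t| + 1) * corrConst K c * (1 + η ^ 2)⁻¹ := by
  obtain ⟨h0, h1, -⟩ := norm_corrLap_linePt_le h hx η
  rw [norm_mul, norm_exp_linePt]
  have h2 := exp_mul_le_one_of_nonpos hx ht
  have h3 : ‖(t : ℂ) * corrLap L (linePt x η) + corrLap' L (linePt x η)‖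
      ≤ |t| * (corrConst K c * (1 + η ^ 2)⁻¹) + corrConst K c * (1 + η ^ 2)⁻¹ := by
    refine (norm_add_le _ _).trans (add_le_add ?_ h1)
    rw [norm_mul, norm_real, norm_eq_abs]
    exact mul_le_mul_of_nonneg_left h0 (abs_nonneg _)
  calc _ ≤ 1 * _ := mul_le_mul h2 h3 (norm_nonneg _) zero_le_one
    _ = _ := by ring

lemma continuous_bromwich_deriv (h : Stable K c L) (t : ℝ) {x : ℝ} (hx : 0 ≤ x) :
    Continuous fun η => cexp (linePt x η * t) *
      (t * corrLap L (linePt x η) + corrLap' L (linePt x η)) := by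
  have h0 := continuous_linePt_right x
  have h1 := continuous_corrLap_right h hx
  have h2 := continuous_corrLap'_right h hx
  fun_prop

/-- A contour shift without contours. By the Cauchy–Riemann relation the derivative in the abscissa
is, up to `2πi`, the derivative along the line, and the integral of the latter is zero. -/
lemma hasDerivAt_bromwich (h : Stable K c L) {t : ℝ} (ht : t ≤ 0) {x : ℝ} (hx : 0 < x) :
    HasDerivAt (bromwich L t) 0 x := by
  have hnear : ∀ᶠ y in 𝓝 x, 0 ≤ y := (lt_mem_nhds hx).mono fun y hy => le_of_lt hy
  have key := hasDerivAt_integral_of_dominated_loc_of_deriv_le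
    (μ := volume) (𝕜 := ℝ)
    (F := fun x η => cexp (linePt x η * t) * corrLap L (linePt x η))
    (F' := fun x η => cexp (linePt x η * t) *
      (t * corrLap L (linePt x η) + corrLap' L (linePt x η)))
    (x₀ := x) (s := {y | 0 ≤ y})
    (bound := fun η => (|t| + 1) * corrConst K c * (1 + η ^ 2)⁻¹) hnear
    (hnear.mono fun y hy => (integrable_bromwich h ht hy).aestronglyMeasurable)
    (integrable_bromwich h ht hx.le)
    (continuous_bromwich_deriv h t hx.le).aestronglyMeasurable
    (ae_of_all _ fun η y hy => norm_bromwich_deriv_le h ht hy η)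
    (integrable_corr_bound _)
    (ae_of_all _ fun η y hy => hasDerivAt_bromwich_integrand_left h t hy η)
  refine key.2.congr_deriv ?_
  have h2 := integral_eq_zero_of_hasDerivAt_of_integrable
    (hasDerivAt_bromwich_integrand_right h t hx.le) (key.1.const_mul _)
    (integrable_bromwich h ht hx.le)
  rw [integral_const_mul] at h2
  rcases mul_eq_zero.1 h2 with h3 | h3
  · exact absurd h3 (by simp [Real.pi_ne_zero])
  · exact h3

lemma norm_bromwich_le (h : Stable K c L) (t : ℝ) {x : ℝ} (hx : 0 ≤ x) :
    ‖bromwich L t x‖ ≤ rexp (x * t) * corrConst K c * π := by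
  refine (norm_integral_le_integral_norm _).trans (integral_norm_le_of_le fun η => ?_)
  rw [norm_mul, norm_exp_linePt, mul_assoc]
  exact mul_le_mul_of_nonneg_left (norm_corrLap_linePt_le h hx η).1 (Real.exp_pos _).le

/-- The integral does not depend on the abscissa, while its bound contains `exp (xt)`. For `t < 0`
this tends to zero as the abscissa goes to infinity. -/
lemma bromwich_eq_zero (h : Stable K c L) {t : ℝ} (ht : t < 0) {x : ℝ} (hx : 0 < x) :
    bromwich L t x = 0 := by
  have hconst : ∀ y ∈ Ioi (0 : ℝ), bromwich L t x = bromwich L t y := fun y hy =>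
    isOpen_Ioi.is_const_of_deriv_eq_zero isPreconnected_Ioi
      (fun w hw => (hasDerivAt_bromwich h ht.le hw).differentiableAt.differentiableWithinAt)
      (fun w hw => (hasDerivAt_bromwich h ht.le hw).deriv) hx hy
  have hlim : Tendsto (fun y : ℝ => rexp (y * t) * corrConst K c * π) atTop (𝓝 0) := by
    have h1 : Tendsto (fun y : ℝ => y * t) atTop atBot := tendsto_id.atTop_mul_const_of_neg ht
    have := (Real.tendsto_exp_atBot.comp h1).mul_const (corrConst K c) |>.mul_const π
    simpa using this
  have hle : ∀ᶠ y in atTop, ‖bromwich L t x‖ ≤ rexp (y * t) * corrConst K c * π := by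
    filter_upwards [Ioi_mem_atTop (0 : ℝ)] with y hy
    rw [hconst y hy]; exact norm_bromwich_le h t (le_of_lt hy)
  exact norm_le_zero_iff.1 (ge_of_tendsto hlim hle)

/-- The vanishing on positive abscissas passes to abscissa zero by dominated convergence, and then
to `t = 0` by continuity. -/
lemma corr_eq_zero (h : Stable K c L) {t : ℝ} (ht : t ≤ 0) : corr L t = 0 := by
  have hneg : ∀ t < 0, corr L t = 0 := by
    intro t ht
    rw [corr_eq_bromwich]
    have hlim : Tendsto (bromwich L t) (𝓝[>] 0) (𝓝 (bromwich L t 0)) := by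
      refine tendsto_integral_filter_of_dominated_convergence
        (fun η => corrConst K c * (1 + η ^ 2)⁻¹) ?_ ?_ (integrable_corr_bound _) ?_
      · filter_upwards [self_mem_nhdsWithin] with x hx
        exact (integrable_bromwich h ht.le (le_of_lt hx)).aestronglyMeasurable
      · filter_upwards [self_mem_nhdsWithin] with x hx
        refine ae_of_all _ fun η => ?_
        rw [norm_mul, norm_exp_linePt]
        refine (mul_le_mul (exp_mul_le_one_of_nonpos (le_of_lt hx) ht.le)
          (norm_corrLap_linePt_le h (le_of_lt hx) η).1 (norm_nonneg _) zero_le_one).trans ?_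
        rw [one_mul]
      · refine ae_of_all _ fun η => ?_
        exact ((hasDerivAt_bromwich_integrand_left h t le_rfl η).continuousAt.tendsto).mono_left
          nhdsWithin_le_nhds
    have hz : Tendsto (bromwich L t) (𝓝[>] 0) (𝓝 0) := by
      refine tendsto_const_nhds.congr' ?_
      filter_upwards [self_mem_nhdsWithin] with x hx
      exact (bromwich_eq_zero h ht hx).symm
    exact tendsto_nhds_unique hlim hz
  have hcl : IsClosed {t | corr L t = 0} := isClosed_eq (continuous_corr h) continuous_const
  have : Iic (0 : ℝ) ⊆ {t | corr L t = 0} := by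
    rw [← closure_Iio]
    exact hcl.closure_subset_iff.2 fun t ht => hneg t ht
  exact this ht

/-! ### The Volterra equation -/

/-- The causal extension of `t exp(-t²/2)`. -/
def causalKer (t : ℝ) : ℂ := gMoment 1 (max t 0)

/-- The causal extension of `exp(-t²/2)`. -/
def causalGauss : ℝ → ℂ := (Ioi (0 : ℝ)).indicator fun t => (gMoment 0 t : ℂ)

lemma causalKer_eq_indicator : causalKer = (Ioi (0 : ℝ)).indicator fun t => (gMoment 1 t : ℂ) := by
  funext t
  by_cases ht : 0 < t
  · rw [indicator_of_mem (show t ∈ Ioi 0 from ht), causalKer, max_eq_left ht.le]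
  · rw [indicator_of_notMem (show t ∉ Ioi 0 from ht), causalKer, max_eq_right (not_lt.1 ht)]
    simp [gMoment]

lemma continuous_causalKer : Continuous causalKer := by
  have := continuous_gMoment 1
  unfold causalKer; fun_prop

lemma causalKer_of_nonpos {t : ℝ} (ht : t ≤ 0) : causalKer t = 0 := by
  rw [causalKer, max_eq_right ht]; simp [gMoment]

lemma causalKer_of_nonneg {t : ℝ} (ht : 0 ≤ t) : causalKer t = gMoment 1 t := by
  rw [causalKer, max_eq_left ht]

lemma integrable_causalKer : Integrable causalKer := by
  rw [causalKer_eq_indicator]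
  exact ((integrable_gMoment 1).ofReal).indicator measurableSet_Ioi

lemma integrable_causalGauss : Integrable causalGauss :=
  ((integrable_gMoment 0).ofReal).indicator measurableSet_Ioi

lemma abs_gMoment_one_le (t : ℝ) : |gMoment 1 t| ≤ 1 := by
  rw [gMoment, pow_one, abs_mul, abs_of_pos (Real.exp_pos _), Real.exp_neg,
    ← div_eq_mul_inv, div_le_one (Real.exp_pos _)]
  have := Real.add_one_le_exp (t ^ 2 / 2)
  nlinarith [sq_abs t, sq_nonneg (|t| - 1)]

lemma norm_causalKer_le (t : ℝ) : ‖causalKer t‖ ≤ 1 := by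
  rw [causalKer, norm_real]; exact abs_gMoment_one_le _

lemma fourier_indicator_gMoment (n : ℕ) (η : ℝ) :
    𝓕 ((Ioi (0 : ℝ)).indicator fun t => (gMoment n t : ℂ)) η = lap n (linePt 0 η) := by
  rw [Real.fourier_real_eq_integral_exp_smul, lap, ← integral_indicator measurableSet_Ioi]
  congr 1; funext t
  by_cases ht : t ∈ Ioi (0 : ℝ)
  · rw [indicator_of_mem ht, indicator_of_mem ht, smul_eq_mul]
    congr 2
    simp [linePt]; ring
  · rw [indicator_of_notMem ht, indicator_of_notMem ht, smul_zero]

lemma integrable_corr (h : Stable K c L) : Integrable (corr L) :=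
  (integrable_corr_bound _).mono' (continuous_corr h).aestronglyMeasurable
    (ae_of_all _ (norm_corr_le h))

lemma fourier_corr (h : Stable K c L) : 𝓕 (corr L) = fun η : ℝ => corrLap L (linePt 0 η) := by
  have hi : Integrable (𝓕 (fun η : ℝ => corrLap L (linePt 0 η))) := by
    have := (integrable_corr h).comp_neg
    refine this.congr (ae_of_all _ fun t => ?_)
    change corr L (-t) = _
    rw [corr, Real.fourierInv_eq_fourier_neg, neg_neg]
  exact Continuous.fourier_fourierInv_eq (continuous_corrLap_right h le_rfl)
    (integrable_corrLap h le_rfl) hi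

-- The transform of the left side vanishes by the very definition of `corrLap`. Fourier inversion
-- gives the identity at every time because all three terms are continuous. For the convolutions
-- this uses that `t exp(-t²/2)` vanishes at the origin, so that its causal extension is continuous.
open scoped Convolution in
lemma corr_volterra_conv (h : Stable K c L) (t : ℝ) :
    corr L t + L * ((corr L ⋆[ContinuousLinearMap.mul ℂ ℂ] causalKer) t)
      + L * ((causalGauss ⋆[ContinuousLinearMap.mul ℂ ℂ] causalKer) t) = 0 := by
  set M := ContinuousLinearMap.mul ℂ ℂ
  set A : ℝ → ℂ := corr L ⋆[M] causalKer with hA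
  set B : ℝ → ℂ := causalGauss ⋆[M] causalKer with hB
  have hbdd : BddAbove (range fun x => ‖causalKer x‖) :=
    ⟨1, by rintro _ ⟨x, rfl⟩; exact norm_causalKer_le x⟩
  have cA : Continuous A := BddAbove.continuous_convolution_right_of_integrable _ hbdd
    (integrable_corr h) continuous_causalKer
  have cB : Continuous B := BddAbove.continuous_convolution_right_of_integrable _ hbdd
    integrable_causalGauss continuous_causalKer
  have iA : Integrable A := (integrable_corr h).integrable_convolution _ integrable_causalKer
  have iB : Integrable B := integrable_causalGauss.integrable_convolution _ integrable_causalKer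
  set E : ℝ → ℂ := corr L + ((L : ℂ) • A + (L : ℂ) • B) with hE
  have cE : Continuous E := (continuous_corr h).add ((cA.const_smul _).add (cB.const_smul _))
  have iAB : Integrable ((L : ℂ) • A + (L : ℂ) • B) := (iA.smul (L : ℂ)).add (iB.smul (L : ℂ))
  have iE : Integrable E := (integrable_corr h).add iAB
  have hadd : ∀ {f g : ℝ → ℂ}, Integrable f → Integrable g → 𝓕 (f + g) = 𝓕 f + 𝓕 g :=
    fun hf hg => VectorFourier.fourierIntegral_add Real.continuous_fourierChar
      (by exact continuous_inner) hf hg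
  have hsmul : ∀ (f : ℝ → ℂ), 𝓕 ((L : ℂ) • f) = (L : ℂ) • 𝓕 f := fun f =>
    VectorFourier.fourierIntegral_const_smul _ _ _ _ _
  have fE : 𝓕 E = 0 := by
    rw [hE, hadd (integrable_corr h) iAB, hadd (iA.smul (L : ℂ)) (iB.smul (L : ℂ)), hsmul, hsmul,
      fourier_corr h]
    funext η
    simp only [Pi.add_apply, Pi.smul_apply, smul_eq_mul, Pi.zero_apply]
    rw [hA, hB, Real.fourier_mul_convolution_eq (integrable_corr h) integrable_causalKer,
      Real.fourier_mul_convolution_eq integrable_causalGauss integrable_causalKer,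
      fourier_corr h, causalKer_eq_indicator, causalGauss, fourier_indicator_gMoment,
      fourier_indicator_gMoment]
    have hD := h.ne_zero_linePt le_rfl η
    have hD' : disp L (linePt 0 η) = 1 + L * lap 1 (linePt 0 η) := rfl
    simp only [corrLap]
    field_simp
    rw [hD']; ring
  have : E = 0 := by
    have h1 := cE.fourierInv_fourier_eq iE (by rw [fE]; exact integrable_zero _ _ _)
    rw [← h1, fE]
    funext t
    rw [Real.fourierInv_eq']
    simp
  have h2 := congrFun this t
  simp only [hE, Pi.add_apply, Pi.smul_apply, smul_eq_mul, Pi.zero_apply] at h2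
  rw [add_assoc]; exact h2

/-- The density response `t ↦ ⟨1, e^{-tA} 1⟩` of the linearized Vlasov flow. -/
def resp (L t : ℝ) : ℂ := gMoment 0 t + corr L t

/-- The restriction of the density response to positive times. -/
def causalResp (L : ℝ) : ℝ → ℂ := (Ioi (0 : ℝ)).indicator (resp L)

lemma continuous_resp (h : Stable K c L) : Continuous (resp L) := by
  have h1 := continuous_gMoment 0
  have h2 := continuous_corr h
  unfold resp; fun_prop

lemma resp_zero (h : Stable K c L) : resp L 0 = 1 := by
  simp [resp, gMoment, corr_eq_zero h le_rfl]

lemma causalResp_eq (h : Stable K c L) : causalResp L = fun t => causalGauss t + corr L t := by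
  funext t
  by_cases ht : t ∈ Ioi (0 : ℝ)
  · simp [causalResp, causalGauss, indicator_of_mem ht, resp]
  · simp [causalResp, causalGauss, indicator_of_notMem ht, corr_eq_zero h (not_lt.1 ht)]

lemma integrable_causalResp (h : Stable K c L) : Integrable (causalResp L) := by
  rw [causalResp_eq h]; exact integrable_causalGauss.add (integrable_corr h)

lemma integrable_mul_causalKer {f : ℝ → ℂ} (hf : Integrable f) (t : ℝ) :
    Integrable fun s => f s * causalKer (t - s) :=
  hf.mul_bdd (c := 1)
    (continuous_causalKer.comp (by fun_prop : Continuous fun s => t - s)).aestronglyMeasurable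
    (ae_of_all _ fun s => norm_causalKer_le _)

/-- The form with an integral over the whole line holds for all real times, which allows
differentiation in `t` without treating an endpoint. -/
lemma resp_volterra_full (h : Stable K c L) (t : ℝ) :
    resp L t = gMoment 0 t - L * ∫ s, causalResp L s * causalKer (t - s) := by
  have h1 := corr_volterra_conv h t
  rw [convolution_mul, convolution_mul] at h1
  have h2 : ∫ s, causalResp L s * causalKer (t - s)
      = (∫ s, causalGauss s * causalKer (t - s)) + ∫ s, corr L s * causalKer (t - s) := by
    rw [← integral_add (integrable_mul_causalKer integrable_causalGauss t)
      (integrable_mul_causalKer (integrable_corr h) t)]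
    congr 1; funext s; rw [causalResp_eq h]; ring
  rw [h2, resp]
  linear_combination h1

lemma integral_causalResp_mul {φ : ℝ → ℂ} {t : ℝ} (ht : 0 ≤ t) (hφ : ∀ s, t < s → φ s = 0) :
    ∫ s, causalResp L s * φ s = ∫ s in (0 : ℝ)..t, resp L s * φ s := by
  rw [intervalIntegral.integral_of_le ht, ← integral_indicator measurableSet_Ioc]
  congr 1; funext s
  by_cases hs : s ∈ Ioc 0 t
  · rw [indicator_of_mem hs, causalResp, indicator_of_mem (show s ∈ Ioi 0 from hs.1)]
  · rw [indicator_of_notMem hs]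
    by_cases h0 : 0 < s
    · rw [hφ s (not_le.1 fun h1 => hs ⟨h0, h1⟩), mul_zero]
    · rw [causalResp, indicator_of_notMem (show s ∉ Ioi 0 from h0), zero_mul]

lemma resp_volterra (h : Stable K c L) {t : ℝ} (ht : 0 ≤ t) : resp L t = gMoment 0 t
      - L * ∫ s in (0 : ℝ)..t, resp L s * (gMoment 1 (t - s) : ℂ) := by
  rw [resp_volterra_full h t, integral_causalResp_mul ht]
  · congr 2
    refine intervalIntegral.integral_congr fun s hs => ?_
    rw [uIcc_of_le ht] at hs
    rw [causalKer_of_nonneg (by linarith [hs.2])]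
  · exact fun s hs => causalKer_of_nonpos (by linarith)

/-- A uniform bound on the density response, on its `L¹` norm and on that of its derivative. -/
def respConst (K c : ℝ) : ℝ := 1 + lapBound 0 + corrDecay K c * (1 + π)

lemma corrDecay_nonneg (h : Stable K c L) : 0 ≤ corrDecay K c := by
  have := corrConst_nonneg h
  have := Real.pi_pos
  unfold corrDecay; positivity

lemma respConst_nonneg (h : Stable K c L) : 0 ≤ respConst K c := by
  have := corrDecay_nonneg h
  have := lapBound_nonneg 0
  have := Real.pi_pos
  unfold respConst; positivity

lemma norm_resp_le (h : Stable K c L) (t : ℝ) : ‖resp L t‖ ≤ respConst K c := by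
  have h1 := norm_corr_le h t
  have h2 := corrDecay_nonneg h
  have h3 := lapBound_nonneg 0
  have h4 : (1 + t ^ 2)⁻¹ ≤ 1 := inv_le_one_of_one_le₀ (by nlinarith [sq_nonneg t])
  have h5 : ‖(gMoment 0 t : ℂ)‖ ≤ 1 := by
    rw [norm_real, gMoment, pow_zero, one_mul, norm_of_nonneg (Real.exp_pos _).le,
      Real.exp_le_one_iff]
    nlinarith [sq_nonneg t]
  have h6 := norm_add_le (gMoment 0 t : ℂ) (corr L t)
  have h7 := mul_le_mul_of_nonneg_left h4 h2
  have h8 := mul_nonneg h2 Real.pi_pos.le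
  unfold resp respConst
  linarith

lemma integrableOn_resp (h : Stable K c L) : IntegrableOn (resp L) (Ioi 0) :=
  ((integrable_gMoment 0).ofReal.add (integrable_corr h)).integrableOn

lemma integral_norm_resp_le (h : Stable K c L) :
    ∫ t in Ioi (0 : ℝ), ‖resp L t‖ ≤ respConst K c := by
  have h2 := corrDecay_nonneg h
  have i1 : IntegrableOn (fun t => |gMoment 0 t|) (Ioi 0) := (integrable_gMoment 0).abs.integrableOn
  have i2 : Integrable fun t => ‖corr L t‖ := (integrable_corr h).norm
  calc ∫ t in Ioi (0 : ℝ), ‖resp L t‖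
      ≤ ∫ t in Ioi (0 : ℝ), (|gMoment 0 t| + ‖corr L t‖) := by
        refine setIntegral_mono (integrableOn_resp h).norm (i1.add i2.integrableOn) fun t => ?_
        refine (norm_add_le _ _).trans ?_
        rw [norm_real, norm_eq_abs]
    _ = lapBound 0 + ∫ t in Ioi (0 : ℝ), ‖corr L t‖ := integral_add i1 i2.integrableOn
    _ ≤ lapBound 0 + corrDecay K c * π := by
        gcongr
        exact (setIntegral_le_integral i2 (ae_of_all _ fun _ => norm_nonneg _)).trans
          (integral_norm_le_of_le (norm_corr_le h))
    _ ≤ respConst K c := by unfold respConst; linarith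

/-- The derivative of the causal kernel, away from the origin. -/
def causalKer' : ℝ → ℂ := (Ioi (0 : ℝ)).indicator fun t => ((gMoment 0 t - gMoment 2 t : ℝ) : ℂ)

/-- The derivative of the density response at positive times. -/
def resp' (L t : ℝ) : ℂ := -gMoment 1 t - L * ∫ s, causalResp L s * causalKer' (t - s)

lemma abs_gMoment_zero_sub_two_le (t : ℝ) : |gMoment 0 t - gMoment 2 t| ≤ 3 := by
  have e : gMoment 0 t - gMoment 2 t = (1 - t ^ 2) * (rexp (t ^ 2 / 2))⁻¹ := by
    simp only [gMoment, Real.exp_neg]; ring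
  have h := Real.add_one_le_exp (t ^ 2 / 2)
  have hp := Real.exp_pos (t ^ 2 / 2)
  rw [e, abs_mul, abs_inv, abs_of_pos hp, ← div_eq_mul_inv, div_le_iff₀ hp, abs_le]
  constructor <;> nlinarith [sq_nonneg t]

lemma lipschitzWith_causalKer : LipschitzWith 3 causalKer := by
  have h1 : LipschitzWith 3 (gMoment 1) := by
    refine lipschitzWith_of_nnnorm_deriv_le
      (fun t => (hasDerivAt_gMoment_succ 0 t).differentiableAt) fun t => ?_
    rw [(hasDerivAt_gMoment_succ 0 t).deriv, ← NNReal.coe_le_coe]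
    simpa using abs_gMoment_zero_sub_two_le t
  have h2 : LipschitzWith 1 fun t : ℝ => max t 0 := LipschitzWith.id.max_const 0
  have h3 := h1.comp h2
  rw [mul_one] at h3
  have h4 : LipschitzWith 1 (fun x : ℝ => (x : ℂ)) := isometry_ofReal.lipschitz
  have := h4.comp h3
  rwa [one_mul] at this

lemma hasDerivAt_causalKer {t : ℝ} (ht : t ≠ 0) : HasDerivAt causalKer (causalKer' t) t := by
  rcases ht.lt_or_gt with ht | ht
  · have e : causalKer =ᶠ[𝓝 t] fun _ => 0 := by
      filter_upwards [gt_mem_nhds ht] with s hs using causalKer_of_nonpos (le_of_lt hs)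
    rw [causalKer', indicator_of_notMem (by simpa using ht.le)]
    exact (hasDerivAt_const t (0 : ℂ)).congr_of_eventuallyEq e
  · have e : causalKer =ᶠ[𝓝 t] fun t => (gMoment 1 t : ℂ) := by
      filter_upwards [lt_mem_nhds ht] with s hs using causalKer_of_nonneg (le_of_lt hs)
    rw [causalKer', indicator_of_mem (show t ∈ Ioi 0 from ht)]
    refine HasDerivAt.congr_of_eventuallyEq ?_ e
    exact (hasDerivAt_gMoment_succ 0 t).ofReal_comp.congr_deriv (by simp)

lemma measurable_causalKer' : Measurable causalKer' := by
  have h0 := (continuous_gMoment 0).measurable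
  have h2 := (continuous_gMoment 2).measurable
  exact Measurable.indicator (by fun_prop) measurableSet_Ioi

lemma integrable_causalKer' : Integrable causalKer' :=
  (((integrable_gMoment 0).sub (integrable_gMoment 2)).ofReal).indicator measurableSet_Ioi

/-- The causal kernel has a kink at the origin, so differentiation under the integral rests on its
Lipschitz bound. The single bad point `s = t` is negligible. -/
lemma hasDerivAt_resp (h : Stable K c L) (t : ℝ) : HasDerivAt (resp L) (resp' L t) t := by
  have hi := integrable_causalResp h
  have key := hasDerivAt_integral_of_dominated_loc_of_lip (μ := volume) (𝕜 := ℝ)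
    (F := fun t s => causalResp L s * causalKer (t - s))
    (F' := fun s => causalResp L s * causalKer' (t - s))
    (x₀ := t) (s := univ) (bound := fun s => 3 * ‖causalResp L s‖) univ_mem
    (Eventually.of_forall fun w => (integrable_mul_causalKer hi w).aestronglyMeasurable)
    (integrable_mul_causalKer hi t)
    (hi.aestronglyMeasurable.mul
      (measurable_causalKer'.comp (by fun_prop)).aestronglyMeasurable)
    (ae_of_all _ fun s => ?_) (hi.norm.const_mul 3) ?_
  · have hg := (hasDerivAt_gMoment_zero t).ofReal_comp
    have := hg.sub (key.2.const_mul (L : ℂ))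
    refine hasDerivAt_congr_both this ?_ ?_
    · funext w; exact resp_volterra_full h w
    · rw [resp']; push_cast; rfl
  · refine LipschitzOnWith.of_dist_le_mul fun x _ y _ => ?_
    rw [dist_eq_norm, ← mul_sub, norm_mul, Real.coe_nnabs, abs_of_nonneg (by positivity)]
    have h1 := lipschitzWith_causalKer.dist_le_mul (x - s) (y - s)
    rw [dist_eq_norm, dist_sub_right] at h1
    calc _ ≤ ‖causalResp L s‖ * (3 * dist x y) := by
          refine mul_le_mul_of_nonneg_left (h1.trans (le_of_eq ?_)) (norm_nonneg _)
          norm_num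
      _ = _ := by ring
  · have : ∀ᵐ s : ℝ, s ≠ t := by simp [ae_iff, measure_singleton]
    filter_upwards [this] with s hs
    have h1 : HasDerivAt (fun x : ℝ => x - s) 1 t := (hasDerivAt_id t).sub_const s
    have h2 := (hasDerivAt_causalKer (sub_ne_zero.2 (Ne.symm hs))).scomp t h1
    exact (h2.const_mul (causalResp L s)).congr_deriv (by simp)

/-- A uniform bound on the `L¹` norm of the derivative of the density response. -/
def respConst' (K c : ℝ) : ℝ := (∫ t, |gMoment 1 t|) + K * (respConst K c * ∫ t, ‖causalKer' t‖)

lemma integrable_resp'_conv (h : Stable K c L) :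
    Integrable fun t => ∫ s, causalResp L s * causalKer' (t - s) := by
  have := (integrable_causalResp h).integrable_convolution (ContinuousLinearMap.mul ℂ ℂ)
    integrable_causalKer'
  refine this.congr (ae_of_all _ fun t => ?_)
  rw [convolution_mul]

lemma integrable_resp' (h : Stable K c L) : Integrable (resp' L) :=
  ((integrable_gMoment 1).ofReal.neg).sub ((integrable_resp'_conv h).const_mul _)

lemma integral_norm_causalResp_le (h : Stable K c L) : ∫ t, ‖causalResp L t‖ ≤ respConst K c := by
  refine le_trans (le_of_eq ?_) (integral_norm_resp_le h)
  rw [← integral_indicator measurableSet_Ioi]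
  congr 1; funext t
  by_cases ht : t ∈ Ioi (0 : ℝ)
  · rw [causalResp, indicator_of_mem ht, indicator_of_mem ht]
  · rw [causalResp, indicator_of_notMem ht, indicator_of_notMem ht, norm_zero]

/-- Young's inequality for the convolution of two integrable functions. Integrability of the
derivative is what makes the later integration by parts in time possible. -/
lemma integral_norm_resp'_le (h : Stable K c L) :
    ∫ t in Ioi (0 : ℝ), ‖resp' L t‖ ≤ respConst' K c := by
  have i1 := integrable_causalResp h
  have i2 := integrable_causalKer'
  have hconv : ∫ t, ‖∫ s, causalResp L s * causalKer' (t - s)‖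
      ≤ respConst K c * ∫ t, ‖causalKer' t‖ := by
    have hc := i1.norm.integrable_convolution (ContinuousLinearMap.mul ℝ ℝ) i2.norm
    calc ∫ t, ‖∫ s, causalResp L s * causalKer' (t - s)‖
        ≤ ∫ t, (convolution (fun s => ‖causalResp L s‖) (fun s => ‖causalKer' s‖)
            (ContinuousLinearMap.mul ℝ ℝ) volume) t := by
          refine integral_mono_of_nonneg (ae_of_all _ fun _ => norm_nonneg _) hc
            (ae_of_all _ fun t => ?_)
          simp only
          rw [convolution_mul]
          refine (norm_integral_le_integral_norm _).trans (le_of_eq ?_)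
          simp_rw [norm_mul]
      _ = (∫ t, ‖causalResp L t‖) * ∫ t, ‖causalKer' t‖ := by
          rw [integral_convolution _ i1.norm i2.norm]; rfl
      _ ≤ _ := mul_le_mul_of_nonneg_right (integral_norm_causalResp_le h)
          (integral_nonneg fun _ => norm_nonneg _)
  have i3 := (integrable_resp'_conv h).norm
  have i4 := (integrable_gMoment 1).abs
  calc ∫ t in Ioi (0 : ℝ), ‖resp' L t‖ ≤ ∫ t, ‖resp' L t‖ :=
        setIntegral_le_integral (integrable_resp' h).norm (ae_of_all _ fun _ => norm_nonneg _)
    _ ≤ ∫ t, (|gMoment 1 t| + L * ‖∫ s, causalResp L s * causalKer' (t - s)‖) := by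
        refine integral_mono (integrable_resp' h).norm (i4.add (i3.const_mul L)) fun t => ?_
        refine (norm_sub_le _ _).trans (le_of_eq ?_)
        rw [norm_neg, norm_real, norm_eq_abs, norm_mul, norm_real, norm_of_nonneg h.nonneg]
    _ = (∫ t, |gMoment 1 t|)
        + L * ∫ t, ‖∫ s, causalResp L s * causalKer' (t - s)‖ := by
        rw [integral_add i4 (i3.const_mul L), integral_const_mul]
    _ ≤ respConst' K c := by
        unfold respConst'
        gcongr
        · exact h.nonneg_max
        · exact h.le

/-! ### The linearized Vlasov flow of the constant function -/

/-- The function `∫₀ᵗ exp(isξ) a(s) ds` with `a` the density response. -/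
def flowAux (L t ξ : ℝ) : ℂ := ∫ s in (0 : ℝ)..t, cexp (I * (s * ξ)) * resp L s

/-- The derivative of `flowAux` in `ξ`. -/
def flowAux' (L t ξ : ℝ) : ℂ := ∫ s in (0 : ℝ)..t, I * s * (cexp (I * (s * ξ)) * resp L s)

/-- The solution at time `t` of the linearized Vlasov equation with initial datum `1`. -/
def flow (L t ξ : ℝ) : ℂ := cexp (-(I * (t * ξ))) * (1 - L * (I * ξ) * flowAux L t ξ)

/-- The derivative of `flow` in `ξ`. -/
def flow' (L t ξ : ℝ) : ℂ := -(I * t) * flow L t ξ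
    - cexp (-(I * (t * ξ))) * (L * I * flowAux L t ξ + L * (I * ξ) * flowAux' L t ξ)

lemma norm_exp_I_mul_mul (x y : ℝ) : ‖cexp (I * (x * y))‖ = 1 := by
  rw [norm_exp]; simp

lemma continuous_flowAux (h : Stable K c L) : Continuous fun p : ℝ × ℝ => flowAux L p.1 p.2 := by
  have h1 := continuous_resp h
  unfold flowAux
  exact intervalIntegral.continuous_parametric_intervalIntegral_of_continuous
    (f := fun (p : ℝ × ℝ) s => cexp (I * (s * p.2)) * resp L s)
    (by fun_prop) continuous_fst

lemma continuous_flowAux' (h : Stable K c L) : Continuous fun p : ℝ × ℝ => flowAux' L p.1 p.2 := by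
  have h1 := continuous_resp h
  unfold flowAux'
  exact intervalIntegral.continuous_parametric_intervalIntegral_of_continuous
    (f := fun (p : ℝ × ℝ) s => I * s * (cexp (I * (s * p.2)) * resp L s))
    (by fun_prop) continuous_fst

lemma continuous_flow (h : Stable K c L) : Continuous fun p : ℝ × ℝ => flow L p.1 p.2 := by
  have := continuous_flowAux h
  unfold flow; fun_prop

lemma continuous_flow' (h : Stable K c L) : Continuous fun p : ℝ × ℝ => flow' L p.1 p.2 := by
  have h1 := continuous_flowAux h
  have h2 := continuous_flowAux' h
  have h3 := continuous_flow h
  unfold flow'; fun_prop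

lemma integral_norm_resp_interval_le (h : Stable K c L) {t : ℝ} (ht : 0 ≤ t) :
    ∫ s in (0 : ℝ)..t, ‖resp L s‖ ≤ respConst K c := by
  rw [intervalIntegral.integral_of_le ht]
  exact (setIntegral_mono_set (integrableOn_resp h).norm (ae_of_all _ fun _ => norm_nonneg _)
    (Ioc_subset_Ioi_self.eventuallyLE)).trans (integral_norm_resp_le h)

lemma norm_flowAux_le (h : Stable K c L) {t : ℝ} (ht : 0 ≤ t) (ξ : ℝ) :
    ‖flowAux L t ξ‖ ≤ respConst K c := by
  refine (intervalIntegral.norm_integral_le_integral_norm ht).trans ?_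
  simp_rw [norm_mul, norm_exp_I_mul_mul, one_mul]
  exact integral_norm_resp_interval_le h ht

lemma norm_flowAux'_le (h : Stable K c L) {t : ℝ} (ht : 0 ≤ t) (ξ : ℝ) :
    ‖flowAux' L t ξ‖ ≤ t * respConst K c := by
  have hc := continuous_resp h
  refine (intervalIntegral.norm_integral_le_integral_norm ht).trans ?_
  calc _ ≤ ∫ s in (0 : ℝ)..t, t * ‖resp L s‖ := by
        refine intervalIntegral.integral_mono_on ht
          (Continuous.intervalIntegrable (by fun_prop) _ _)
          (Continuous.intervalIntegrable (by fun_prop) _ _) fun s hs => ?_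
        rw [norm_mul, norm_mul, norm_mul, norm_exp_I_mul_mul, norm_I, one_mul, one_mul, norm_real,
          norm_of_nonneg hs.1]
        exact mul_le_mul_of_nonneg_right hs.2 (norm_nonneg _)
    _ ≤ _ := by
        rw [intervalIntegral.integral_const_mul]
        exact mul_le_mul_of_nonneg_left (integral_norm_resp_interval_le h ht) ht

/-- A uniform constant bounding the flow. -/
def flowConst (K c : ℝ) : ℝ := 1 + 2 * (K * respConst K c)

lemma one_le_flowConst (h : Stable K c L) : 1 ≤ flowConst K c := by
  have := mul_nonneg h.nonneg_max (respConst_nonneg h)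
  unfold flowConst; linarith

lemma norm_flow_le (h : Stable K c L) {t : ℝ} (ht : 0 ≤ t) (ξ : ℝ) :
    ‖flow L t ξ‖ ≤ flowConst K c * (1 + |ξ|) := by
  have h1 := norm_flowAux_le h ht ξ
  have h2 := respConst_nonneg h
  have h3 := h.nonneg_max
  have h4 : ‖(L : ℂ) * (I * ξ) * flowAux L t ξ‖ ≤ K * |ξ| * respConst K c := by
    rw [norm_mul, norm_mul, norm_mul, norm_I, one_mul, norm_real, norm_real,
      norm_of_nonneg h.nonneg, norm_eq_abs]
    have := h.le
    have := h.nonneg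
    gcongr
  rw [flow, norm_mul, norm_exp_neg_I_mul_mul, one_mul]
  refine (norm_sub_le _ _).trans ?_
  rw [norm_one, flowConst]
  have := mul_nonneg h3 h2
  nlinarith [abs_nonneg ξ, mul_nonneg this (abs_nonneg ξ)]

lemma norm_flow'_le (h : Stable K c L) {t : ℝ} (ht : 0 ≤ t) (ξ : ℝ) :
    ‖flow' L t ξ‖ ≤ 2 * flowConst K c * (1 + |ξ|) * (1 + t) := by
  have h0 := norm_flow_le h ht ξ
  have h1 := norm_flowAux_le h ht ξ
  have h1' := norm_flowAux'_le h ht ξ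
  have h2 := respConst_nonneg h
  have h3 := h.nonneg_max
  have hL := h.le
  have hL0 := h.nonneg
  have hA := mul_nonneg h3 h2
  have e1 : ‖-(I * (t : ℂ)) * flow L t ξ‖ ≤ t * (flowConst K c * (1 + |ξ|)) := by
    rw [norm_mul, norm_neg, norm_mul, norm_I, one_mul, norm_real, norm_of_nonneg ht]
    gcongr
  have e2 : ‖(L : ℂ) * I * flowAux L t ξ‖ ≤ K * respConst K c := by
    rw [norm_mul, norm_mul, norm_I, mul_one, norm_real, norm_of_nonneg hL0]
    gcongr
  have e3 : ‖(L : ℂ) * (I * ξ) * flowAux' L t ξ‖ ≤ K * |ξ| * (t * respConst K c) := by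
    rw [norm_mul, norm_mul, norm_mul, norm_I, one_mul, norm_real, norm_real,
      norm_of_nonneg hL0, norm_eq_abs]
    gcongr
  rw [flow']
  refine (norm_sub_le _ _).trans ?_
  rw [norm_mul _ (_ + _), norm_exp_neg_I_mul_mul, one_mul]
  have e4 := norm_add_le ((L : ℂ) * I * flowAux L t ξ) ((L : ℂ) * (I * ξ) * flowAux' L t ξ)
  have e5 : K * respConst K c ≤ flowConst K c := by unfold flowConst; linarith
  have e6 : 0 ≤ flowConst K c := hA.trans e5
  have hx := abs_nonneg ξ
  have e7 : K * |ξ| * (t * respConst K c) ≤ flowConst K c * (|ξ| * t) := by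
    calc _ = K * respConst K c * (|ξ| * t) := by ring
      _ ≤ _ := mul_le_mul_of_nonneg_right e5 (mul_nonneg hx ht)
  nlinarith [mul_nonneg e6 hx, mul_nonneg e6 ht, mul_nonneg e6 (mul_nonneg hx ht)]

lemma flow_zero (ξ : ℝ) : flow L 0 ξ = 1 := by simp [flow, flowAux]

/-- At this stage the density `resp` is a prescribed forcing term, so this is a linear ordinary
differential equation for each `ξ`. The coupling is closed in `integral_flow`. -/
lemma hasDerivAt_flow_time (h : Stable K c L) (t ξ : ℝ) :
    HasDerivAt (fun t => flow L t ξ) (-(I * ξ) * (flow L t ξ + L * resp L t)) t := by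
  have hc := continuous_resp h
  have hcont : Continuous fun s : ℝ => cexp (I * (s * ξ)) * resp L s := by fun_prop
  have h1 : HasDerivAt (fun t => flowAux L t ξ) (cexp (I * (t * ξ)) * resp L t) t :=
    intervalIntegral.integral_hasDerivAt_right (hcont.intervalIntegrable _ _)
      (hcont.stronglyMeasurableAtFilter _ _) hcont.continuousAt
  have h2 : HasDerivAt (fun w : ℝ => -(I * (w * ξ))) (-(I * (1 * (ξ : ℂ)))) t :=
    (((hasDerivAt_id (t : ℂ)).comp_ofReal.mul_const (ξ : ℂ)).const_mul I).neg
  have h3 := h2.cexp.mul ((h1.const_mul ((L : ℂ) * (I * ξ))).const_sub 1)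
  refine h3.congr_deriv ?_
  have e : cexp (-(I * (t * ξ))) * cexp (I * (t * ξ)) = 1 := by
    rw [← exp_add, neg_add_cancel, exp_zero]
  simp only [flow]
  linear_combination (-(L : ℂ) * (I * ξ) * resp L t) * e

lemma hasDerivAt_flowAux (h : Stable K c L) (t ξ : ℝ) :
    HasDerivAt (fun ξ => flowAux L t ξ) (flowAux' L t ξ) ξ := by
  have hc := continuous_resp h
  have key := intervalIntegral.hasDerivAt_integral_of_dominated_loc_of_deriv_le (μ := volume)
    (F := fun (ξ : ℝ) s => cexp (I * (s * ξ)) * resp L s)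
    (F' := fun (ξ : ℝ) s => I * s * (cexp (I * (s * ξ)) * resp L s))
    (x₀ := ξ) (s := univ) (a := 0) (b := t)
    (bound := fun s => |s| * ‖resp L s‖) univ_mem
    (Eventually.of_forall fun w => by fun_prop)
    (Continuous.intervalIntegrable (by fun_prop) _ _)
    (by fun_prop) ?_
    (Continuous.intervalIntegrable (by fun_prop) _ _) ?_
  · exact key.2
  · refine ae_of_all _ fun s _ w _ => ?_
    rw [norm_mul, norm_mul, norm_mul, norm_exp_I_mul_mul, norm_I, one_mul, one_mul, norm_real,
      norm_eq_abs]
  · refine ae_of_all _ fun s _ w _ => ?_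
    have h2 : HasDerivAt (fun w : ℝ => I * ((s : ℂ) * w)) (I * (s * 1)) w :=
      (((hasDerivAt_id (w : ℂ)).comp_ofReal.const_mul (s : ℂ)).const_mul I)
    exact (h2.cexp.mul_const (resp L s)).congr_deriv (by ring)

lemma hasDerivAt_flow (h : Stable K c L) (t ξ : ℝ) :
    HasDerivAt (fun ξ => flow L t ξ) (flow' L t ξ) ξ := by
  have h2 : HasDerivAt (fun w : ℝ => -(I * ((t : ℂ) * w))) (-(I * (t * 1))) ξ :=
    (((hasDerivAt_id (ξ : ℂ)).comp_ofReal.const_mul (t : ℂ)).const_mul I).neg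
  have h1 : HasDerivAt (fun w : ℝ => (L : ℂ) * (I * w)) (L * (I * 1)) ξ :=
    (((hasDerivAt_id (ξ : ℂ)).comp_ofReal.const_mul I).const_mul (L : ℂ))
  have h3 := h2.cexp.mul ((h1.mul (hasDerivAt_flowAux h t ξ)).const_sub 1)
  refine h3.congr_deriv ?_
  simp only [flow', flow, Pi.mul_apply]; ring

lemma integrable_pow_mul_flow_mul (h : Stable K c L) (n : ℕ) {m : ℝ → ℂ} {B : ℝ}
    (hm : Measurable m) (hB : ∀ ξ, ‖m ξ‖ ≤ B) {t : ℝ} (ht : 0 ≤ t) :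
    Integrable (fun ξ : ℝ => (I * ξ) ^ n * flow L t ξ * m ξ) gauss := by
  have hf : Continuous fun ξ => flow L t ξ :=
    (continuous_flow h).comp (by fun_prop : Continuous fun ξ : ℝ => (t, ξ))
  refine ((integrable_one_add_pow_gauss (n + 1)).const_mul (flowConst K c * B)).mono'
    (by fun_prop) (ae_of_all _ fun ξ => ?_)
  have hB0 : 0 ≤ B := (norm_nonneg _).trans (hB ξ)
  have hf0 : 0 ≤ flowConst K c := zero_le_one.trans (one_le_flowConst h)
  rw [norm_mul, norm_mul, norm_pow, norm_mul, norm_I, one_mul, norm_real, norm_eq_abs]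
  calc |ξ| ^ n * ‖flow L t ξ‖ * ‖m ξ‖
      ≤ (1 + |ξ|) ^ n * (flowConst K c * (1 + |ξ|)) * B := by
        gcongr
        · linarith
        · exact norm_flow_le h ht ξ
        · exact hB ξ
    _ = _ := by ring

/-- Duhamel's formula averaged against a bounded multiplier, which reduces the flow to free
transport. The multiplier `1` yields the density, and `(iξ + z)⁻¹` yields `flowRes`. -/
lemma integral_pow_mul_flow_mul (h : Stable K c L) (n : ℕ) {m : ℝ → ℂ} {B : ℝ}
    (hm : Measurable m) (hB : ∀ ξ, ‖m ξ‖ ≤ B) {t : ℝ} (ht : 0 ≤ t) :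
    ∫ ξ : ℝ, (I * ξ) ^ n * flow L t ξ * m ξ ∂gauss
      = (∫ ξ : ℝ, (I * ξ) ^ n * cexp (-(I * (t * ξ))) * m ξ ∂gauss)
        - L * ∫ s in (0 : ℝ)..t, resp L s *
          ∫ ξ : ℝ, (I * ξ) ^ (n + 1) * cexp (-(I * ((t - s : ℝ) * ξ))) * m ξ ∂gauss := by
  have hc := continuous_resp h
  have i1 : Integrable (fun ξ : ℝ => (I * ξ) ^ n * cexp (-(I * (t * ξ))) * m ξ) gauss :=
    (integrable_gaussExp n t).mul_bdd (c := B) hm.aestronglyMeasurable (ae_of_all _ hB)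
  have i2 := (integrable_pow_mul_flow_mul h n hm hB ht).sub i1
  have e1 : ∀ ξ : ℝ, (I * ξ) ^ n * flow L t ξ * m ξ - (I * ξ) ^ n * cexp (-(I * (t * ξ))) * m ξ
      = -L * ∫ s in (0 : ℝ)..t, resp L s *
          ((I * ξ) ^ (n + 1) * cexp (-(I * ((t - s : ℝ) * ξ))) * m ξ) := by
    intro ξ
    have : ∀ s : ℝ, resp L s * ((I * ξ) ^ (n + 1) * cexp (-(I * ((t - s : ℝ) * ξ))) * m ξ)
        = ((I * ξ) ^ (n + 1) * m ξ * cexp (-(I * (t * ξ)))) * (cexp (I * (s * ξ)) * resp L s) := by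
      intro s
      rw [show -(I * (((t - s : ℝ) : ℂ) * ξ)) = -(I * (t * ξ)) + I * (s * ξ) by push_cast; ring,
        exp_add]
      ring
    simp_rw [this]
    rw [intervalIntegral.integral_const_mul, flow, flowAux]
    ring
  have e2 := integral_sub (integrable_pow_mul_flow_mul h n hm hB ht) i1
  simp_rw [e1] at e2
  rw [integral_const_mul] at e2
  have e3 : ∫ ξ : ℝ, (∫ s in (0 : ℝ)..t, resp L s *
          ((I * ξ) ^ (n + 1) * cexp (-(I * ((t - s : ℝ) * ξ))) * m ξ)) ∂gauss
      = ∫ s in (0 : ℝ)..t, resp L s *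
          ∫ ξ : ℝ, (I * ξ) ^ (n + 1) * cexp (-(I * ((t - s : ℝ) * ξ))) * m ξ ∂gauss := by
    simp_rw [intervalIntegral.integral_of_le ht, ← integral_const_mul]
    rw [integral_integral_swap]
    have g1 : Integrable (fun s => resp L s) (volume.restrict (Ioc 0 t)) :=
      (integrableOn_resp h).mono_set Ioc_subset_Ioi_self
    have g2 := (((integrable_pow_gauss (n + 1)).mul_const B).mul_prod g1.norm)
    refine g2.mono' ?_ (ae_of_all _ fun x => ?_)
    · refine Measurable.aestronglyMeasurable ?_
      have := hc.measurable
      fun_prop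
    · simp only [Function.uncurry, norm_mul, norm_exp_neg_I_mul_mul, norm_pow, norm_I, one_mul,
        norm_real, mul_one, norm_eq_abs]
      have := mul_le_mul_of_nonneg_left (hB x.1)
        (mul_nonneg (norm_nonneg (resp L x.2)) (pow_nonneg (abs_nonneg x.1) (n + 1)))
      linarith
  rw [e3] at e2
  linear_combination -e2

/-- Self-consistency: the averaged Duhamel formula is exactly the Volterra equation, so the density
that drives the flow is the density of the flow. -/
lemma integral_flow (h : Stable K c L) {t : ℝ} (ht : 0 ≤ t) :
    ∫ ξ : ℝ, flow L t ξ ∂gauss = resp L t := by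
  have := integral_pow_mul_flow_mul h 0 (m := fun _ => 1) (B := 1) measurable_const (by simp) ht
  simp only [pow_zero, one_mul, mul_one, zero_add, pow_one] at this
  rw [this, resp_volterra h ht, ← gaussExp_zero]
  congr 2
  · simp
  · congr 1; funext s
    rw [← gaussExp_one, gaussExp]
    simp only [pow_one]

lemma integral_flow_neg (h : Stable K c L) {t : ℝ} (ht : 0 ≤ t) :
    ∫ ξ : ℝ, flow L t (-ξ) ∂gauss = resp L t := by
  rw [← integral_flow h ht]
  have hmap : Measure.map (fun x : ℝ => -x) gauss = gauss := by
    have := gaussianReal_map_neg (μ := 0) (v := 1)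
    simpa using this
  conv_rhs => rw [← hmap]
  rw [integral_map (by fun_prop)]
  exact ((continuous_flow h).comp
    (by fun_prop : Continuous fun ξ : ℝ => (t, ξ))).aestronglyMeasurable

/-- `E[(iξ)ⁿ U_t(ξ) / (iξ + z)]`. -/
def flowRes (L : ℝ) (n : ℕ) (z : ℂ) (t : ℝ) : ℂ :=
  ∫ ξ : ℝ, (I * ξ) ^ n * flow L t ξ * (I * ξ + z)⁻¹ ∂gauss

/-- Duhamel's formula raises the order of the moment by one, and moments are integrable in time up
to order two; this is the reason for `n ≤ 1`. -/
lemma norm_flowRes_le (h : Stable K c L) {n : ℕ} (hn : n ≤ 1) {z : ℂ} (hz : 0 < z.re)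
    {t : ℝ} (ht : 0 ≤ t) :
    ‖flowRes L n z t‖ ≤ gaussBound n + K * (respConst K c * gaussBound (n + 1)) := by
  have hc := continuous_resp h
  have e := integral_pow_mul_flow_mul h n (m := fun ξ => (I * ξ + z)⁻¹) (B := z.re⁻¹)
    (by fun_prop) (norm_inv_I_mul_add_le hz) ht
  rw [flowRes, e]
  refine (norm_sub_le _ _).trans (add_le_add (norm_gaussRes_le (by omega) hz t) ?_)
  rw [norm_mul, norm_real, norm_of_nonneg h.nonneg]
  have hg := gaussBound_nonneg (n + 1)
  refine mul_le_mul h.le ?_ (norm_nonneg _) h.nonneg_max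
  calc _ ≤ ∫ s in (0 : ℝ)..t, ‖resp L s‖ * gaussBound (n + 1) := by
        refine intervalIntegral.norm_integral_le_of_norm_le ht (ae_of_all _ fun s _ => ?_)
          (Continuous.intervalIntegrable (by fun_prop) _ _)
        rw [norm_mul]
        exact mul_le_mul_of_nonneg_left (norm_gaussRes_le (by omega) hz (t - s)) (norm_nonneg _)
    _ ≤ _ := by
        rw [intervalIntegral.integral_mul_const]
        exact mul_le_mul_of_nonneg_right (integral_norm_resp_interval_le h ht) hg

/-! ### Solution of the resolvent equations along one Fourier mode -/

/-- The solution of the rescaled resolvent equations along one Fourier mode: `h` is the resolvent of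
the two-particle operator applied to `1`, `p` its one-particle marginal, `q` the resolvent of the
tagged particle operator applied to `p`, and `Y` the density of `q`. -/
structure ModeSolution (C L L' : ℝ) (w : ℂ) where
  h : ℝ → ℝ → ℂ
  p : ℝ → ℂ
  q : ℝ → ℝ → ℂ
  Y : ℝ → ℂ
  measurable_h : Measurable fun x : ℝ × ℝ => h x.1 x.2
  measurable_q : Measurable fun x : ℝ × ℝ => q x.1 x.2
  measurable_Y : Measurable Y
  differentiable_p : Differentiable ℝ p
  norm_h_le : ∀ ξ η, ‖h ξ η‖ ≤ C / w.im * (1 + |ξ|) * (1 + |η|)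
  norm_p_le : ∀ ξ, ‖p ξ‖ ≤ C * (1 + |ξ|)
  norm_deriv_p_le : ∀ ξ, ‖deriv p ξ‖ ≤ C * (1 + w.im⁻¹) * (1 + |ξ|)
  norm_q_le : ∀ ζ ξ, ‖q ζ ξ‖ ≤ C / w.im * (1 + |ξ|)
  norm_Y_le : ∀ ζ, ‖Y ζ‖ ≤ C
  norm_mul_Y_le : ∀ ζ, ‖w‖ * ‖Y ζ‖ ≤ C
  h_eq : ∀ ξ η : ℝ, I * (ξ - η - w) * h ξ η + L * (I * ξ) * p (-η) - L * (I * η) * p ξ = 1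
  integral_h_right : ∀ ξ, ∫ η, h ξ η ∂gauss = p ξ
  integral_h_left : ∀ η, ∫ ξ, h ξ η ∂gauss = p (-η)
  q_eq : ∀ ζ ξ : ℝ, I * (ξ - ζ - w) * q ζ ξ + L' * (I * ξ) * Y ζ = p ξ
  integral_q : ∀ ζ, ∫ ξ, q ζ ξ ∂gauss = Y ζ

lemma norm_exp_I_mul (w : ℂ) (t : ℝ) : ‖cexp (I * w * t)‖ = rexp (-(w.im * t)) := by
  rw [norm_exp]; simp

lemma norm_exp_I_mul_le_one {w : ℂ} (hw : 0 < w.im) {t : ℝ} (ht : 0 ≤ t) :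
    ‖cexp (I * w * t)‖ ≤ 1 := by
  rw [norm_exp_I_mul, Real.exp_le_one_iff]; nlinarith

lemma integrableOn_exp_neg_im {w : ℂ} (hw : 0 < w.im) :
    IntegrableOn (fun t : ℝ => rexp (-(w.im * t))) (Ioi 0) := by
  simpa using integrableOn_exp_mul_Ioi (neg_lt_zero.2 hw) 0

lemma integral_exp_neg_im {w : ℂ} (hw : 0 < w.im) :
    ∫ t in Ioi (0 : ℝ), rexp (-(w.im * t)) = (w.im)⁻¹ := by
  have := integral_exp_mul_Ioi (neg_lt_zero.2 hw) 0
  simp only [neg_mul] at this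
  rw [this]; simp [neg_div_neg_eq, one_div]

/-- The correlation of two particles along a Fourier mode. -/
def pairCorr (L : ℝ) (w : ℂ) (ξ η : ℝ) : ℂ :=
  ∫ t in Ioi (0 : ℝ), cexp (I * w * t) * (flow L t ξ * flow L t (-η))

/-- Time integrals of the flow against a density `b`. -/
def flowInt (L : ℝ) (w : ℂ) (b : ℝ → ℂ) (ξ : ℝ) : ℂ :=
  ∫ t in Ioi (0 : ℝ), cexp (I * w * t) * b t * flow L t ξ

lemma continuous_flow_comp (h : Stable K c L) {X : Type*} [TopologicalSpace X]
    {u v : X → ℝ} (hu : Continuous u) (hv : Continuous v) :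
    Continuous fun x => flow L (u x) (v x) :=
  (continuous_flow h).comp' (hu.prodMk hv)

lemma continuous_flow_left (h : Stable K c L) (ξ : ℝ) : Continuous fun t => flow L t ξ :=
  continuous_flow_comp h (by fun_prop) (by fun_prop)

lemma norm_pairCorr_integrand_le (h : Stable K c L) (w : ℂ) {t : ℝ} (ht : 0 ≤ t)
    (ξ η : ℝ) : ‖cexp (I * w * t) * (flow L t ξ * flow L t (-η))‖
      ≤ flowConst K c ^ 2 * (1 + |ξ|) * (1 + |η|) * rexp (-(w.im * t)) := by
  have h1 := norm_flow_le h ht ξ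
  have h2 := norm_flow_le h ht (-η)
  rw [abs_neg] at h2
  rw [norm_mul, norm_mul, norm_exp_I_mul]
  have h0 : 0 ≤ flowConst K c := zero_le_one.trans (one_le_flowConst h)
  have h3 := mul_le_mul h1 h2 (norm_nonneg _) (mul_nonneg h0 (by positivity))
  have := mul_le_mul_of_nonneg_left h3 (Real.exp_pos (-(w.im * t))).le
  linarith

lemma integrableOn_pairCorr (h : Stable K c L) {w : ℂ} (hw : 0 < w.im) (ξ η : ℝ) :
    IntegrableOn (fun t : ℝ => cexp (I * w * t) * (flow L t ξ * flow L t (-η))) (Ioi 0) := by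
  refine ((integrableOn_exp_neg_im hw).const_mul
    (flowConst K c ^ 2 * (1 + |ξ|) * (1 + |η|))).mono' ?_ ?_
  · have h1 := continuous_flow_left h ξ
    have h2 := continuous_flow_left h (-η)
    fun_prop
  · filter_upwards [ae_Ioi] with t ht
    exact norm_pairCorr_integrand_le h w (le_of_lt ht) ξ η

lemma norm_pairCorr_le (h : Stable K c L) {w : ℂ} (hw : 0 < w.im) (ξ η : ℝ) :
    ‖pairCorr L w ξ η‖ ≤ flowConst K c ^ 2 / w.im * (1 + |ξ|) * (1 + |η|) := by
  calc _ ≤ ∫ t in Ioi (0 : ℝ),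
        flowConst K c ^ 2 * (1 + |ξ|) * (1 + |η|) * rexp (-(w.im * t)) := by
        refine norm_integral_le_of_norm_le ((integrableOn_exp_neg_im hw).const_mul _) ?_
        filter_upwards [ae_Ioi] with t ht
        exact norm_pairCorr_integrand_le h w (le_of_lt ht) ξ η
    _ = _ := by rw [integral_const_mul, integral_exp_neg_im hw]; ring

lemma measurable_pairCorr (h : Stable K c L) (w : ℂ) :
    Measurable fun x : ℝ × ℝ => pairCorr L w x.1 x.2 := by
  refine StronglyMeasurable.measurable (StronglyMeasurable.integral_prod_right
    (f := fun (x : ℝ × ℝ) (t : ℝ) => cexp (I * w * t) * (flow L t x.1 * flow L t (-x.2))) ?_)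
  refine Continuous.stronglyMeasurable ?_
  have h1 : Continuous fun y : (ℝ × ℝ) × ℝ => flow L y.2 y.1.1 :=
    continuous_flow_comp h (by fun_prop) (by fun_prop)
  have h2 : Continuous fun y : (ℝ × ℝ) × ℝ => flow L y.2 (-y.1.2) :=
    continuous_flow_comp h (by fun_prop) (by fun_prop)
  unfold Function.uncurry
  fun_prop

lemma norm_flowInt_integrand_le (h : Stable K c L) {w : ℂ} (hw : 0 < w.im) (b : ℝ → ℂ)
    {t : ℝ} (ht : 0 ≤ t) (ξ : ℝ) : ‖cexp (I * w * t) * b t * flow L t ξ‖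
      ≤ flowConst K c * (1 + |ξ|) * ‖b t‖ := by
  rw [norm_mul, norm_mul]
  have h1 := norm_flow_le h ht ξ
  have h2 := norm_exp_I_mul_le_one hw ht
  calc _ ≤ 1 * ‖b t‖ * (flowConst K c * (1 + |ξ|)) := by gcongr
    _ = _ := by ring

lemma integrableOn_flowInt (h : Stable K c L) {w : ℂ} (hw : 0 < w.im) {b : ℝ → ℂ}
    (hb : IntegrableOn b (Ioi 0)) (ξ : ℝ) :
    IntegrableOn (fun t : ℝ => cexp (I * w * t) * b t * flow L t ξ) (Ioi 0) := by
  refine (hb.norm.const_mul (flowConst K c * (1 + |ξ|))).mono' ?_ ?_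
  · have h1 := continuous_flow_left h ξ
    refine (AEStronglyMeasurable.mul ?_ hb.aestronglyMeasurable).mul h1.aestronglyMeasurable
    fun_prop
  · filter_upwards [ae_Ioi] with t ht
    exact norm_flowInt_integrand_le h hw b (le_of_lt ht) ξ

lemma norm_flowInt_resp_le (h : Stable K c L) {w : ℂ} (hw : 0 < w.im) (ξ : ℝ) :
    ‖flowInt L w (resp L) ξ‖ ≤ flowConst K c * respConst K c * (1 + |ξ|) := by
  have h0 : 0 ≤ flowConst K c := zero_le_one.trans (one_le_flowConst h)
  calc _ ≤ ∫ t in Ioi (0 : ℝ), flowConst K c * (1 + |ξ|) * ‖resp L t‖ := by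
        refine norm_integral_le_of_norm_le ((integrableOn_resp h).norm.const_mul _) ?_
        filter_upwards [ae_Ioi] with t ht
        exact norm_flowInt_integrand_le h hw _ (le_of_lt ht) ξ
    _ ≤ flowConst K c * (1 + |ξ|) * respConst K c := by
        rw [integral_const_mul]
        exact mul_le_mul_of_nonneg_left (integral_norm_resp_le h)
          (mul_nonneg h0 (by positivity))
    _ = _ := by ring

lemma one_add_mul_exp_le {b t : ℝ} (hb : 0 < b) (ht : 0 ≤ t) :
    (1 + t) * rexp (-(b * t)) ≤ 1 + b⁻¹ := by
  rw [Real.exp_neg, ← div_eq_mul_inv, div_le_iff₀ (Real.exp_pos _)]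
  have h1 := Real.add_one_le_exp (b * t)
  have h2 : 0 ≤ b * t := by positivity
  have h3 : b⁻¹ * (b * t + 1) ≤ b⁻¹ * rexp (b * t) := mul_le_mul_of_nonneg_left h1 (by positivity)
  have h4 : b⁻¹ * (b * t + 1) = t + b⁻¹ := by field_simp
  have h5 : 0 < b⁻¹ := by positivity
  nlinarith

/-- A derivative in `ξ` produces a factor `1 + t`, absorbed by `exp (-Im w t)` at the price of `1 +
1/Im w`. The loss is harmless: this derivative enters only the homogeneous part of `K₂` and `H₂`,
which does not contribute to the final distribution. -/
lemma hasDerivAt_flowInt (h : Stable K c L) {w : ℂ} (hw : 0 < w.im) (ξ : ℝ) :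
    HasDerivAt (flowInt L w (resp L))
      (∫ t in Ioi (0 : ℝ), cexp (I * w * t) * resp L t * flow' L t ξ) ξ ∧
    ‖∫ t in Ioi (0 : ℝ), cexp (I * w * t) * resp L t * flow' L t ξ‖
      ≤ 2 * flowConst K c * respConst K c * (1 + w.im⁻¹) * (1 + |ξ|) := by
  have h0 : 0 ≤ flowConst K c := zero_le_one.trans (one_le_flowConst h)
  have hc := continuous_resp h
  have bd : ∀ (x : ℝ) {t : ℝ}, 0 ≤ t → ‖cexp (I * w * t) * resp L t * flow' L t x‖
      ≤ 2 * flowConst K c * (1 + w.im⁻¹) * (1 + |x|) * ‖resp L t‖ := by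
    intro x t ht
    have h1 := norm_flow'_le h ht x
    have h2 := one_add_mul_exp_le hw ht
    rw [norm_mul, norm_mul, norm_exp_I_mul]
    calc _ ≤ rexp (-(w.im * t)) * ‖resp L t‖ *
          (2 * flowConst K c * (1 + |x|) * (1 + t)) := by gcongr
      _ = 2 * flowConst K c * (1 + |x|) * ‖resp L t‖ * ((1 + t) * rexp (-(w.im * t))) := by ring
      _ ≤ 2 * flowConst K c * (1 + |x|) * ‖resp L t‖ * (1 + w.im⁻¹) := by gcongr
      _ = _ := by ring
  have key := hasDerivAt_integral_of_dominated_loc_of_deriv_le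
    (μ := volume.restrict (Ioi (0 : ℝ))) (𝕜 := ℝ)
    (F := fun ξ t => cexp (I * w * t) * resp L t * flow L t ξ)
    (F' := fun ξ t => cexp (I * w * t) * resp L t * flow' L t ξ)
    (x₀ := ξ) (s := Metric.ball ξ 1)
    (bound := fun t => 2 * flowConst K c * (1 + w.im⁻¹) * (1 + (|ξ| + 1)) * ‖resp L t‖)
    (Metric.ball_mem_nhds ξ one_pos)
    (Eventually.of_forall fun x =>
      (integrableOn_flowInt h hw (integrableOn_resp h) x).aestronglyMeasurable)
    (integrableOn_flowInt h hw (integrableOn_resp h) ξ) ?_ ?_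
    ((integrableOn_resp h).norm.const_mul _) ?_
  · refine ⟨key.2, ?_⟩
    calc _ ≤ ∫ t in Ioi (0 : ℝ),
          2 * flowConst K c * (1 + w.im⁻¹) * (1 + |ξ|) * ‖resp L t‖ := by
          refine norm_integral_le_of_norm_le ((integrableOn_resp h).norm.const_mul _) ?_
          filter_upwards [ae_Ioi] with t ht
          exact bd ξ (le_of_lt ht)
      _ ≤ 2 * flowConst K c * (1 + w.im⁻¹) * (1 + |ξ|) * respConst K c := by
          rw [integral_const_mul]
          refine mul_le_mul_of_nonneg_left (integral_norm_resp_le h) ?_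
          positivity
      _ = _ := by ring
  · have := (continuous_flow' h).comp (by fun_prop : Continuous fun t : ℝ => (t, ξ))
    have h2 : Continuous fun t => flow' L t ξ := this
    fun_prop
  · filter_upwards [ae_Ioi] with t ht x hx
    refine (bd x (le_of_lt ht)).trans ?_
    have hx' : |x| ≤ |ξ| + 1 := by
      rw [Metric.mem_ball, Real.dist_eq] at hx
      have := abs_sub_abs_le_abs_sub x ξ
      linarith
    have : 0 ≤ w.im⁻¹ := by positivity
    gcongr
  · exact ae_of_all _ fun t x _ => (hasDerivAt_flow h t x).const_mul _

/-- A product of two flows solves the two-particle evolution with initial datum `1`. Integrating the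
time derivative of its damped version over the half line leaves the boundary value `1`. -/
lemma pairCorr_eq (h : Stable K c L) {w : ℂ} (hw : 0 < w.im) (ξ η : ℝ) :
    I * (ξ - η - w) * pairCorr L w ξ η + L * (I * ξ) * flowInt L w (resp L) (-η)
      - L * (I * η) * flowInt L w (resp L) ξ = 1 := by
  have hr := integrableOn_resp h
  have i1 := integrableOn_pairCorr h hw ξ η
  have i2 := integrableOn_flowInt h hw hr (-η)
  have i3 := integrableOn_flowInt h hw hr ξ
  have hd : ∀ t : ℝ, HasDerivAt (fun t : ℝ => cexp (I * w * t) * (flow L t ξ * flow L t (-η)))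
      (-(I * (ξ - η - w)) * (cexp (I * w * t) * (flow L t ξ * flow L t (-η)))
        - L * (I * ξ) * (cexp (I * w * t) * resp L t * flow L t (-η))
        + L * (I * η) * (cexp (I * w * t) * resp L t * flow L t ξ)) t := by
    intro t
    have h1 : HasDerivAt (fun t : ℝ => I * w * t) (I * w * 1) t :=
      (hasDerivAt_id (t : ℂ)).comp_ofReal.const_mul (I * w)
    refine (h1.cexp.mul ((hasDerivAt_flow_time h t ξ).mul
      (hasDerivAt_flow_time h t (-η)))).congr_deriv ?_
    simp only [Pi.mul_apply]
    push_cast; ring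
  have hint := ((i1.const_mul (-(I * (ξ - η - w)))).sub (i2.const_mul (L * (I * ξ)))).add
    (i3.const_mul (L * (I * η)))
  have hlim := tendsto_zero_of_hasDerivAt_of_integrableOn_Ioi (a := 0) (fun t _ => hd t) hint i1
  have key := integral_Ioi_of_hasDerivAt_of_tendsto (a := 0)
    (hd 0).continuousAt.continuousWithinAt (fun t _ => hd t) hint hlim
  have e1 := integral_add ((i1.const_mul (-(I * (ξ - η - w)))).sub (i2.const_mul (L * (I * ξ))))
    (i3.const_mul (L * (I * η)))
  have e2 := integral_sub (i1.const_mul (-(I * (ξ - η - w)))) (i2.const_mul (L * (I * ξ)))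
  simp only [Pi.sub_apply] at e1 e2
  rw [e1, e2, integral_const_mul, integral_const_mul, integral_const_mul] at key
  simp only [flow_zero, ofReal_zero, mul_zero, exp_zero, mul_one, zero_sub] at key
  simp only [pairCorr, flowInt]
  linear_combination -key

/-- Averaging over one variable replaces one flow by its density, which is integrable in time. Hence
the marginal, unlike `pairCorr` itself, is bounded without any loss in `Im w`. -/
lemma integral_pairCorr_right (h : Stable K c L) {w : ℂ} (hw : 0 < w.im) (ξ : ℝ) :
    ∫ η, pairCorr L w ξ η ∂gauss = flowInt L w (resp L) ξ := by
  have h0 : 0 ≤ flowConst K c := zero_le_one.trans (one_le_flowConst h)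
  unfold pairCorr flowInt
  rw [integral_integral_swap]
  · refine setIntegral_congr_fun measurableSet_Ioi fun t ht => ?_
    rw [integral_const_mul, integral_const_mul, integral_flow_neg h (le_of_lt ht)]
    ring
  · have g := ((integrable_one_add_pow_gauss 1).mul_prod (integrableOn_exp_neg_im hw)).const_mul
      (flowConst K c ^ 2 * (1 + |ξ|))
    refine g.mono' (Continuous.aestronglyMeasurable ?_) ?_
    · have h1 : Continuous fun y : ℝ × ℝ => flow L y.2 ξ :=
        continuous_flow_comp h (by fun_prop) (by fun_prop)
      have h2 : Continuous fun y : ℝ × ℝ => flow L y.2 (-y.1) :=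
        continuous_flow_comp h (by fun_prop) (by fun_prop)
      unfold Function.uncurry
      fun_prop
    · have hae : ∀ᵐ x : ℝ × ℝ ∂(gauss.prod (volume.restrict (Ioi 0))), 0 < x.2 := by
        have : ∀ᵐ t : ℝ ∂(volume.restrict (Ioi 0)), 0 < t := ae_restrict_mem measurableSet_Ioi
        exact Measure.quasiMeasurePreserving_snd.ae this
      filter_upwards [hae] with x hx
      refine (norm_pairCorr_integrand_le h w hx.le ξ x.1).trans (le_of_eq ?_)
      simp only [pow_one]; ring

lemma pairCorr_swap (w : ℂ) (ξ η : ℝ) : pairCorr L w ξ η = pairCorr L w (-η) (-ξ) := by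
  unfold pairCorr
  congr 1; funext t; rw [neg_neg]; ring

lemma gauss_map_neg : Measure.map (fun x : ℝ => -x) gauss = gauss := by
  have := gaussianReal_map_neg (μ := 0) (v := 1)
  simpa using this

lemma integral_pairCorr_left (h : Stable K c L) {w : ℂ} (hw : 0 < w.im) (η : ℝ) :
    ∫ ξ, pairCorr L w ξ η ∂gauss = flowInt L w (resp L) (-η) := by
  rw [← integral_pairCorr_right h hw (-η)]
  conv_rhs => rw [← gauss_map_neg]
  rw [integral_map (by fun_prop)]
  · congr 1; funext ξ; exact pairCorr_swap w ξ η
  · exact ((measurable_pairCorr h w).comp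
      (by fun_prop : Measurable fun ξ : ℝ => (-η, ξ))).aestronglyMeasurable

/-! ### The density of the tagged resolvent -/

lemma integral_flowInt_res (h : Stable K c L) {w : ℂ} (hw : 0 < w.im) {b : ℝ → ℂ}
    (hb : IntegrableOn b (Ioi 0)) (n : ℕ) {z : ℂ} (hz : 0 < z.re) :
    ∫ ξ : ℝ, (I * ξ) ^ n * flowInt L w b ξ * (I * ξ + z)⁻¹ ∂gauss
      = ∫ t in Ioi (0 : ℝ), cexp (I * w * t) * b t * flowRes L n z t := by
  have h0 : 0 ≤ flowConst K c := zero_le_one.trans (one_le_flowConst h)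
  have e : ∀ ξ : ℝ, (I * ξ) ^ n * flowInt L w b ξ * (I * ξ + z)⁻¹
      = ∫ t in Ioi (0 : ℝ), ((I * ξ) ^ n * (I * ξ + z)⁻¹) *
        (cexp (I * w * t) * b t * flow L t ξ) := by
    intro ξ; rw [integral_const_mul, flowInt]; ring
  simp_rw [e]
  rw [integral_integral_swap]
  · congr 1; funext t
    rw [flowRes, ← integral_const_mul]
    congr 1; funext ξ; ring
  · have g := ((integrable_one_add_pow_gauss (n + 1)).mul_prod hb.norm).const_mul
      (flowConst K c * z.re⁻¹)
    refine g.mono' ?_ ?_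
    · have hb2 : AEStronglyMeasurable (fun x : ℝ × ℝ => b x.2)
          (gauss.prod (volume.restrict (Ioi 0))) := hb.aestronglyMeasurable.comp_snd
      have h1 : Continuous fun y : ℝ × ℝ => flow L y.2 y.1 :=
        continuous_flow_comp h (by fun_prop) (by fun_prop)
      have h2 : Measurable fun x : ℝ × ℝ => (I * (x.1 : ℂ)) ^ n * (I * x.1 + z)⁻¹ := by fun_prop
      have h3 : Continuous fun x : ℝ × ℝ => cexp (I * w * x.2) := by fun_prop
      exact h2.aestronglyMeasurable.mul
        ((h3.aestronglyMeasurable.mul hb2).mul h1.aestronglyMeasurable)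
    · have hae : ∀ᵐ x : ℝ × ℝ ∂(gauss.prod (volume.restrict (Ioi 0))), 0 < x.2 := by
        have : ∀ᵐ t : ℝ ∂(volume.restrict (Ioi 0)), 0 < t := ae_restrict_mem measurableSet_Ioi
        exact Measure.quasiMeasurePreserving_snd.ae this
      filter_upwards [hae] with x hx
      have k1 := norm_flowInt_integrand_le h hw b hx.le x.1
      have k2 := norm_inv_I_mul_add_le hz x.1
      have k3 : 0 ≤ z.re⁻¹ := by positivity
      simp only [Function.uncurry]
      rw [norm_mul, norm_mul ((I * (x.1 : ℂ)) ^ n), norm_pow, norm_mul I, norm_I, one_mul, norm_real,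
        norm_eq_abs]
      calc _ ≤ (1 + |x.1|) ^ n * z.re⁻¹ * (flowConst K c * (1 + |x.1|) * ‖b x.2‖) := by
            gcongr
            linarith
        _ = _ := by ring

/-- Integration by parts in time: `iw` is absorbed as a derivative of `exp (iwt)`. The derivative
then falls on the density, which has an integrable derivative, or on the flow, where it costs one
factor `iξ`. -/
lemma I_mul_mul_flowInt (h : Stable K c L) {w : ℂ} (hw : 0 < w.im) (ξ : ℝ) :
    I * w * flowInt L w (resp L) ξ = -1 - flowInt L w (resp' L) ξ + I * ξ * flowInt L w (resp L) ξ
      + L * (I * ξ) * ∫ t in Ioi (0 : ℝ), cexp (I * w * t) * (resp L t * resp L t) := by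
  have hr := integrableOn_resp h
  have hr' : IntegrableOn (resp' L) (Ioi 0) := (integrable_resp' h).integrableOn
  have i1 := integrableOn_flowInt h hw hr ξ
  have i2 := integrableOn_flowInt h hw hr' ξ
  have hc := continuous_resp h
  have i3 : IntegrableOn (fun t : ℝ => cexp (I * w * t) * (resp L t * resp L t))
      (Ioi 0) := by
    refine (hr.norm.const_mul (respConst K c)).mono'
      (by fun_prop) ?_
    filter_upwards [ae_Ioi] with t ht
    rw [norm_mul, norm_mul]
    have := respConst_nonneg h
    calc _ ≤ 1 * (respConst K c * ‖resp L t‖) := by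
          gcongr
          · exact norm_exp_I_mul_le_one hw (le_of_lt ht)
          · exact norm_resp_le h t
      _ = _ := one_mul _
  have hd : ∀ t : ℝ, HasDerivAt (fun t : ℝ => cexp (I * w * t) * resp L t * flow L t ξ)
      (I * w * (cexp (I * w * t) * resp L t * flow L t ξ)
        + cexp (I * w * t) * resp' L t * flow L t ξ
        - I * ξ * (cexp (I * w * t) * resp L t * flow L t ξ)
        - L * (I * ξ) * (cexp (I * w * t) * (resp L t * resp L t))) t := by
    intro t
    have h1 : HasDerivAt (fun t : ℝ => I * w * t) (I * w * 1) t :=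
      (hasDerivAt_id (t : ℂ)).comp_ofReal.const_mul (I * w)
    refine ((h1.cexp.mul (hasDerivAt_resp h t)).mul
      (hasDerivAt_flow_time h t ξ)).congr_deriv ?_
    simp only [Pi.mul_apply]; ring
  have j1 := (i1.const_mul (I * w)).add i2
  have j2 := j1.sub (i1.const_mul (I * ξ))
  have hint := j2.sub (i3.const_mul (L * (I * ξ)))
  have hlim := tendsto_zero_of_hasDerivAt_of_integrableOn_Ioi (a := 0) (fun t _ => hd t) hint i1
  have key := integral_Ioi_of_hasDerivAt_of_tendsto (a := 0)
    (hd 0).continuousAt.continuousWithinAt (fun t _ => hd t) hint hlim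
  have e1 := integral_sub j2 (i3.const_mul (L * (I * ξ)))
  have e2 := integral_sub j1 (i1.const_mul (I * ξ))
  have e3 := integral_add (i1.const_mul (I * w)) i2
  simp only [Pi.add_apply, Pi.sub_apply] at e1 e2 e3
  rw [e1, e2, e3, integral_const_mul, integral_const_mul, integral_const_mul] at key
  simp only [flow_zero, resp_zero h, ofReal_zero, mul_zero, exp_zero, mul_one, zero_sub] at key
  simp only [flowInt]
  linear_combination key

/-- A uniform bound on `E[Uₜ / (iξ + z)]` and `E[iξ Uₜ / (iξ + z)]`. -/
def flowResConst (K c : ℝ) : ℝ := gaussBound 0 + gaussBound 1 + K * (respConst K c * gaussBound 1)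
    + K * (respConst K c * gaussBound 2)

lemma norm_flowRes_le' (h : Stable K c L) {n : ℕ} (hn : n ≤ 1) {z : ℂ} (hz : 0 < z.re)
    {t : ℝ} (ht : 0 ≤ t) : ‖flowRes L n z t‖ ≤ flowResConst K c := by
  have h1 := norm_flowRes_le h hn hz ht
  have h2 := respConst_nonneg h
  have h3 := h.nonneg_max
  have g := gaussBound_nonneg
  have a1 := mul_nonneg h3 (mul_nonneg h2 (g 1))
  have a2 := mul_nonneg h3 (mul_nonneg h2 (g 2))
  unfold flowResConst
  interval_cases n
  · norm_num at h1; linarith [g 0, g 1]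
  · norm_num at h1; linarith [g 0, g 1]

lemma flowResConst_nonneg (h : Stable K c L) : 0 ≤ flowResConst K c :=
  (norm_nonneg _).trans (norm_flowRes_le' h (n := 0) (by norm_num) (z := 1) (by simp) le_rfl)

lemma norm_integral_flowRes_le (h : Stable K c L) {w : ℂ} (hw : 0 < w.im) {b : ℝ → ℂ}
    (hb : IntegrableOn b (Ioi 0)) {n : ℕ} (hn : n ≤ 1) {z : ℂ} (hz : 0 < z.re) :
    ‖∫ t in Ioi (0 : ℝ), cexp (I * w * t) * b t * flowRes L n z t‖
      ≤ (∫ t in Ioi (0 : ℝ), ‖b t‖) * flowResConst K c := by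
  rw [← integral_mul_const]
  refine norm_integral_le_of_norm_le (hb.norm.mul_const _) ?_
  filter_upwards [ae_Ioi] with t ht
  rw [norm_mul, norm_mul]
  have h1 := norm_exp_I_mul_le_one hw (le_of_lt ht)
  have h2 := norm_flowRes_le' h hn hz (le_of_lt ht)
  calc _ ≤ 1 * ‖b t‖ * flowResConst K c := by gcongr
    _ = _ := by ring

/-- `E[p(ξ) / (iξ + z)]` where `p` is the marginal of the pair correlation. -/
def margRes (L : ℝ) (w z : ℂ) : ℂ := ∫ ξ : ℝ, flowInt L w (resp L) ξ * (I * ξ + z)⁻¹ ∂gauss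

/-- After the `ξ`-average is taken first, only the integrability of the density is used. The bound
therefore does not degenerate as `Im w` or `Re z` tends to zero. -/
lemma norm_margRes_le (h : Stable K c L) {w : ℂ} (hw : 0 < w.im) {z : ℂ}
    (hz : 0 < z.re) : ‖margRes L w z‖ ≤ respConst K c * flowResConst K c := by
  have e := integral_flowInt_res h hw (integrableOn_resp h) 0 hz
  simp only [pow_zero, one_mul] at e
  rw [margRes, e]
  exact (norm_integral_flowRes_le h hw (integrableOn_resp h) (by norm_num) hz).trans
    (mul_le_mul_of_nonneg_right (integral_norm_resp_le h) (flowResConst_nonneg h))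

lemma aestronglyMeasurable_flowInt (h : Stable K c L) {w : ℂ} {b : ℝ → ℂ}
    (hb : AEStronglyMeasurable b (volume.restrict (Ioi 0))) :
    AEStronglyMeasurable (flowInt L w b) gauss := by
  refine AEStronglyMeasurable.integral_prod_right'
    (f := fun x : ℝ × ℝ => cexp (I * w * x.2) * b x.2 * flow L x.2 x.1) ?_
  have h1 : Continuous fun y : ℝ × ℝ => flow L y.2 y.1 :=
    continuous_flow_comp h (by fun_prop) (by fun_prop)
  have h3 : Continuous fun x : ℝ × ℝ => cexp (I * w * x.2) := by fun_prop
  exact (h3.aestronglyMeasurable.mul hb.comp_snd).mul h1.aestronglyMeasurable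

lemma integrable_flowInt_res (h : Stable K c L) {w : ℂ} (hw : 0 < w.im) {b : ℝ → ℂ}
    (hb : IntegrableOn b (Ioi 0)) (n : ℕ) {z : ℂ} (hz : 0 < z.re) :
    Integrable (fun ξ : ℝ => (I * ξ) ^ n * flowInt L w b ξ * (I * ξ + z)⁻¹) gauss := by
  have h0 : 0 ≤ flowConst K c := zero_le_one.trans (one_le_flowConst h)
  refine ((integrable_one_add_pow_gauss (n + 1)).const_mul
    (flowConst K c * (∫ t in Ioi (0 : ℝ), ‖b t‖) * z.re⁻¹)).mono' ?_ (ae_of_all _ fun ξ => ?_)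
  · have h1 : Measurable fun ξ : ℝ => (I * (ξ : ℂ)) ^ n := by fun_prop
    have h2 : Measurable fun ξ : ℝ => (I * (ξ : ℂ) + z)⁻¹ := by fun_prop
    exact (h1.aestronglyMeasurable.mul (aestronglyMeasurable_flowInt h hb.aestronglyMeasurable)).mul
      h2.aestronglyMeasurable
  · have k1 : ‖flowInt L w b ξ‖ ≤ flowConst K c * (1 + |ξ|) * ∫ t in Ioi (0 : ℝ), ‖b t‖ := by
      rw [← integral_const_mul]
      refine norm_integral_le_of_norm_le (hb.norm.const_mul _) ?_
      filter_upwards [ae_Ioi] with t ht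
      exact norm_flowInt_integrand_le h hw b (le_of_lt ht) ξ
    have k2 := norm_inv_I_mul_add_le hz ξ
    have k3 : 0 ≤ z.re⁻¹ := by positivity
    have k4 : 0 ≤ ∫ t in Ioi (0 : ℝ), ‖b t‖ := integral_nonneg fun _ => norm_nonneg _
    rw [norm_mul, norm_mul ((I * (ξ : ℂ)) ^ n), norm_pow, norm_mul I, norm_I, one_mul, norm_real,
      norm_eq_abs]
    calc _ ≤ (1 + |ξ|) ^ n * (flowConst K c * (1 + |ξ|) * ∫ t in Ioi (0 : ℝ), ‖b t‖) * z.re⁻¹ := by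
          gcongr
          linarith
      _ = _ := by ring

/-- A uniform bound on `|w E[p / (iξ + z)]|`. -/
def margConst (K c : ℝ) : ℝ := gaussBound 0 + respConst' K c * flowResConst K c
    + respConst K c * flowResConst K c
    + K * (respConst K c * respConst K c) * gaussBound 1

/-- The additional factor `|w|` is what keeps the final flux bounded for large frequencies. After
integration by parts, only `flowRes` of order at most one and Gaussian resolvents of order at most
one remain. -/
lemma norm_mul_margRes_le (h : Stable K c L) {w : ℂ} (hw : 0 < w.im) {z : ℂ}
    (hz : 0 < z.re) : ‖w‖ * ‖margRes L w z‖ ≤ margConst K c := by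
  have hr := integrableOn_resp h
  have hr' : IntegrableOn (resp' L) (Ioi 0) := (integrable_resp' h).integrableOn
  set S := ∫ t in Ioi (0 : ℝ), cexp (I * w * t) * (resp L t * resp L t) with hS
  have e : I * w * margRes L w z = -gaussRes 0 z 0
      - (∫ t in Ioi (0 : ℝ), cexp (I * w * t) * resp' L t * flowRes L 0 z t)
      + (∫ t in Ioi (0 : ℝ), cexp (I * w * t) * resp L t * flowRes L 1 z t)
      + L * S * gaussRes 1 z 0 := by
    rw [← integral_flowInt_res h hw hr' 0 hz, ← integral_flowInt_res h hw hr 1 hz, margRes,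
      ← integral_const_mul, gaussRes, gaussRes, ← integral_const_mul, ← integral_neg]
    have g0 := (integrable_gaussRes 0 hz 0).neg
    have g1 := integrable_flowInt_res h hw hr' 0 hz
    have g2 := integrable_flowInt_res h hw hr 1 hz
    have g3 := (integrable_gaussRes 1 hz 0).const_mul (L * S)
    have a1 := integral_sub g0 g1
    have a2 := integral_add (g0.sub g1) g2
    have a3 := integral_add ((g0.sub g1).add g2) g3
    simp only [Pi.add_apply, Pi.sub_apply, Pi.neg_apply] at a1 a2 a3
    rw [← a1, ← a2, ← a3]
    congr 1; funext ξ
    have := I_mul_mul_flowInt h hw ξ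
    rw [← hS] at this
    rw [show I * w * (flowInt L w (resp L) ξ * (I * ξ + z)⁻¹)
      = I * w * flowInt L w (resp L) ξ * (I * ξ + z)⁻¹ by ring, this]
    simp only [ofReal_zero, zero_mul, mul_zero, neg_zero, exp_zero]
    ring
  have n1 : ‖w‖ * ‖margRes L w z‖ = ‖I * w * margRes L w z‖ := by
    rw [norm_mul, norm_mul, norm_I, one_mul]
  have hSle : ‖S‖ ≤ respConst K c * respConst K c := by
    have hA := respConst_nonneg h
    calc ‖S‖ ≤ ∫ t in Ioi (0 : ℝ), respConst K c * ‖resp L t‖ := by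
          refine norm_integral_le_of_norm_le (hr.norm.const_mul _) ?_
          filter_upwards [ae_Ioi] with t ht
          rw [norm_mul, norm_mul]
          calc _ ≤ 1 * (respConst K c * ‖resp L t‖) := by
                gcongr
                · exact norm_exp_I_mul_le_one hw (le_of_lt ht)
                · exact norm_resp_le h t
            _ = _ := one_mul _
      _ ≤ _ := by
          rw [integral_const_mul]
          exact mul_le_mul_of_nonneg_left (integral_norm_resp_le h) hA
  have b0 : ‖gaussRes 0 z 0‖ ≤ gaussBound 0 := norm_gaussRes_le (by norm_num) hz 0
  have b1 : ‖gaussRes 1 z 0‖ ≤ gaussBound 1 := norm_gaussRes_le (by norm_num) hz 0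
  have b2 := (norm_integral_flowRes_le h hw hr' (n := 0) (by norm_num) hz).trans
    (mul_le_mul_of_nonneg_right (integral_norm_resp'_le h) (flowResConst_nonneg h))
  have b3 := (norm_integral_flowRes_le h hw hr (n := 1) (by norm_num) hz).trans
    (mul_le_mul_of_nonneg_right (integral_norm_resp_le h) (flowResConst_nonneg h))
  have b4 : ‖(L : ℂ) * S * gaussRes 1 z 0‖
      ≤ K * (respConst K c * respConst K c) * gaussBound 1 := by
    rw [norm_mul, norm_mul, norm_real, norm_of_nonneg h.nonneg]
    have := h.le
    have := h.nonneg_max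
    have hA := respConst_nonneg h
    gcongr
  rw [n1, e, margConst]
  refine (norm_add_le _ _).trans (add_le_add ((norm_add_le _ _).trans
    (add_le_add ((norm_sub_le _ _).trans (add_le_add ?_ b2)) b3)) b4)
  rwa [norm_neg]

lemma measurable_margRes (h : Stable K c L) {w : ℂ} (hw : 0 < w.im) : Measurable (margRes L w) := by
  have hp : Measurable (flowInt L w (resp L)) :=
    (continuous_iff_continuousAt.2 fun ξ =>
      (hasDerivAt_flowInt h hw ξ).1.continuousAt).measurable
  refine StronglyMeasurable.measurable (StronglyMeasurable.integral_prod_right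
    (f := fun (z : ℂ) (ξ : ℝ) => flowInt L w (resp L) ξ * (I * ξ + z)⁻¹) ?_)
  refine Measurable.stronglyMeasurable ?_
  unfold Function.uncurry
  fun_prop

/-- Solvability of the mode equations, with bounds that are uniform in the coupling, and in the
frequency for the density of the tagged resolvent. -/
theorem exists_modeSolution (K : ℝ) :
    ∃ C : ℝ, 0 ≤ C ∧ ∀ L ∈ Icc 0 K, ∀ L' ∈ Icc 0 K, ∀ w : ℂ, 0 < w.im →
      Nonempty (ModeSolution C L L' w) := by
  obtain ⟨c, hc, hbound⟩ := exists_le_norm_disp K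
  set F := flowConst K c
  set A := respConst K c
  set R := flowResConst K c
  set M := margConst K c
  set C := |F ^ 2| + |F * A| + |2 * F * A| + |A * R| * c⁻¹ + |M| * c⁻¹
    + |K| * (|A * R| * c⁻¹) with hC
  have hci : 0 ≤ c⁻¹ := by positivity
  have p1 := abs_nonneg (F ^ 2)
  have p2 := abs_nonneg (F * A)
  have p3 := abs_nonneg (2 * F * A)
  have p4 := mul_nonneg (abs_nonneg (A * R)) hci
  have p5 := mul_nonneg (abs_nonneg M) hci
  have p6 := mul_nonneg (abs_nonneg K) p4
  refine ⟨C, by positivity, fun L hL L' hL' w hw => ?_⟩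
  have h : Stable K c L := ⟨hL.1, hL.2, hc, hbound L hL⟩
  have h' : Stable K c L' := ⟨hL'.1, hL'.2, hc, hbound L' hL'⟩
  set p := flowInt L w (resp L) with hp
  -- Chosen so that `i(ξ - ζ - w) = iξ + z`; then `Re z = Im w` whatever the value of `ζ`.
  set z : ℝ → ℂ := fun ζ => -(I * (w + ζ)) with hz
  have hzre : ∀ ζ, 0 < (z ζ).re := by intro ζ; simpa [hz] using hw
  -- Dividing the tagged equation by `iξ + z` and averaging gives `Y = margRes - L' Y lap 1`, hence
  -- `Y disp = margRes`. With this choice, `q` has density `Y`.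
  set Y : ℝ → ℂ := fun ζ => margRes L w (z ζ) * (disp L' (z ζ))⁻¹ with hY
  set q : ℝ → ℝ → ℂ := fun ζ ξ => (p ξ - L' * (I * ξ) * Y ζ) * (I * ξ + z ζ)⁻¹ with hq
  have hpd : ∀ ξ, HasDerivAt p _ ξ := fun ξ => (hasDerivAt_flowInt h hw ξ).1
  have hpc : Continuous p := continuous_iff_continuousAt.2 fun ξ => (hpd ξ).continuousAt
  have hD : ∀ ζ, ‖(disp L' (z ζ))⁻¹‖ ≤ c⁻¹ := fun ζ => by
    rw [norm_inv]; exact inv_anti₀ hc (h'.bound _ (hzre ζ).le)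
  have hYn : ∀ ζ, ‖Y ζ‖ ≤ |A * R| * c⁻¹ := fun ζ => by
    rw [hY]; simp only [norm_mul]
    exact mul_le_mul ((norm_margRes_le h hw (hzre ζ)).trans (le_abs_self _)) (hD ζ)
      (norm_nonneg _) (abs_nonneg _)
  have hzm : Measurable z := by rw [hz]; fun_prop
  have hYm : Measurable Y := ((measurable_margRes h hw).comp hzm).mul
      ((continuous_iff_continuousAt.2 fun x =>
        (hasDerivAt_disp L' x).continuousAt).measurable.comp hzm).inv
  have hne : ∀ ζ ξ : ℝ, I * ξ + z ζ ≠ 0 := fun ζ ξ => I_mul_add_ne_zero (hzre ζ) ξ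
  have hzI : ∀ ζ ξ : ℝ, I * (ξ - ζ - w) = I * ξ + z ζ := fun ζ ξ => by simp only [hz]; ring
  have hpn : ∀ ξ, ‖p ξ‖ ≤ C * (1 + |ξ|) := fun ξ => by
    refine (norm_flowInt_resp_le h hw ξ).trans ?_
    refine mul_le_mul_of_nonneg_right ?_ (by positivity)
    have := le_abs_self (F * A)
    rw [hC]; linarith
  refine ⟨{
    h := pairCorr L w, p := p, q := q, Y := Y, measurable_h := measurable_pairCorr h w,
    measurable_q := ?_, measurable_Y := hYm,
    differentiable_p := fun ξ => (hpd ξ).differentiableAt,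
    norm_h_le := ?_, norm_p_le := hpn, norm_deriv_p_le := ?_, norm_q_le := ?_, norm_Y_le := ?_,
    norm_mul_Y_le := ?_, h_eq := pairCorr_eq h hw, integral_h_right := integral_pairCorr_right h hw,
    integral_h_left := integral_pairCorr_left h hw, q_eq := ?_, integral_q := ?_ }⟩
  · have := hpc.measurable
    rw [hq]; fun_prop
  · intro ξ η
    refine (norm_pairCorr_le h hw ξ η).trans ?_
    gcongr
    have := le_abs_self (F ^ 2)
    rw [hC]; linarith
  · intro ξ
    rw [(hpd ξ).deriv]
    refine (hasDerivAt_flowInt h hw ξ).2.trans ?_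
    have : 0 ≤ w.im⁻¹ := by positivity
    gcongr
    have := le_abs_self (2 * F * A)
    rw [hC]; linarith
  · intro ζ ξ
    rw [hq]; simp only [norm_mul]
    have k1 : ‖(I * (ξ : ℂ) + z ζ)⁻¹‖ ≤ w.im⁻¹ := by
      refine (norm_inv_I_mul_add_le (hzre ζ) ξ).trans (le_of_eq ?_)
      simp [hz]
    have k2 : ‖p ξ - L' * (I * ξ) * Y ζ‖ ≤ C * (1 + |ξ|) := by
      refine (norm_sub_le _ _).trans ?_
      have a1 := norm_flowInt_resp_le h hw ξ
      have a2 : ‖(L' : ℂ) * (I * ξ) * Y ζ‖ ≤ |K| * |ξ| * (|A * R| * c⁻¹) := by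
        rw [norm_mul, norm_mul, norm_mul, norm_I, one_mul, norm_real, norm_real,
          norm_of_nonneg h'.nonneg, norm_eq_abs]
        have := h'.le.trans (le_abs_self K)
        gcongr
        exact hYn ζ
      have a3 := le_abs_self (F * A)
      have a4 : F * A * (1 + |ξ|) ≤ |F * A| * (1 + |ξ|) := by gcongr
      have a5 : |K| * |ξ| * (|A * R| * c⁻¹) ≤ |K| * (|A * R| * c⁻¹) * (1 + |ξ|) := by
        nlinarith [abs_nonneg ξ]
      have a6 : 0 ≤ (|F ^ 2| + |2 * F * A| + |A * R| * c⁻¹ + |M| * c⁻¹) * (1 + |ξ|) := by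
        positivity
      rw [hC]
      change ‖p ξ‖ ≤ F * A * (1 + |ξ|) at a1
      linarith
    calc _ ≤ C * (1 + |ξ|) * w.im⁻¹ := mul_le_mul k2 k1 (norm_nonneg _) (by positivity)
      _ = _ := by ring
  · intro ζ
    refine (hYn ζ).trans ?_
    rw [hC]; linarith
  · intro ζ
    rw [hY]; simp only [norm_mul]
    have := mul_le_mul ((norm_mul_margRes_le h hw (hzre ζ)).trans (le_abs_self _)) (hD ζ)
      (norm_nonneg _) (abs_nonneg _)
    rw [← mul_assoc]
    refine this.trans ?_
    rw [hC]
    linarith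
  · intro ζ ξ
    rw [hzI, hq]
    have := hne ζ ξ
    field_simp
    ring
  · intro ζ
    rw [hq]
    have g1 := integrable_flowInt_res h hw (integrableOn_resp h) 0 (hzre ζ)
    have g2 := (integrable_gaussRes 1 (hzre ζ) 0).const_mul (L' * Y ζ)
    have e : ∀ ξ : ℝ, (p ξ - L' * (I * ξ) * Y ζ) * (I * ξ + z ζ)⁻¹
        = (I * ξ) ^ 0 * p ξ * (I * ξ + z ζ)⁻¹
          - L' * Y ζ * ((I * ξ) ^ 1 * cexp (-(I * (((0 : ℝ) : ℂ) * ξ))) * (I * ξ + z ζ)⁻¹) := by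
      intro ξ
      simp only [ofReal_zero, zero_mul, mul_zero, neg_zero, exp_zero]
      ring
    simp_rw [e]
    rw [integral_sub g1 g2, integral_const_mul]
    have e1 : ∫ ξ : ℝ, (I * ξ) ^ 0 * p ξ * (I * ξ + z ζ)⁻¹ ∂gauss = margRes L w (z ζ) := by
      simp only [pow_zero, one_mul]; rfl
    rw [e1, show (∫ ξ : ℝ, (I * ξ) ^ 1 * cexp (-(I * (((0 : ℝ) : ℂ) * ξ))) * (I * ξ + z ζ)⁻¹
      ∂gauss) = gaussRes 1 (z ζ) 0 from rfl, gaussRes_one_zero (hzre ζ)]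
    have hn := h'.ne_zero (hzre ζ).le
    have hYD : Y ζ * disp L' (z ζ) = margRes L w (z ζ) := by
      rw [hY]; field_simp
    rw [← hYD, disp]; ring

end

/-! ### Phase space, and the hierarchy read on its Fourier modes. -/

variable {d n : ℕ} {β : ℝ}

local notation "ϖ" => velMeasure d β
local notation "Ψ" => phaseMeasure d β
local notation "Obs" n:max => (Fin n → Phase d) → ℂ
local notation "Λ" => Fin d → ℤ
local notation "𝕍" n:max => Fin n → Vel d
local notation "Λ₀" => {k : Fin d → ℤ // k ≠ 0}

/-! ### The Maxwellian measure -/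

lemma maxwellian_pos (hβ : 0 < β) (v : Vel d) : 0 < maxwellian d β v := by
  unfold maxwellian; positivity

@[fun_prop]
lemma continuous_maxwellian : Continuous (maxwellian d β) := by
  unfold maxwellian; fun_prop

lemma integral_velMeasure (hβ : 0 < β) {E : Type*} [NormedAddCommGroup E] [NormedSpace ℝ E]
    (f : Vel d → E) : ∫ v, f v ∂ϖ = ∫ v, maxwellian d β v • f v := by
  rw [velMeasure, integral_withDensity_eq_integral_toReal_smul (by fun_prop)
    (ae_of_all _ fun _ => ENNReal.ofReal_lt_top)]
  simp_rw [ENNReal.toReal_ofReal (maxwellian_pos hβ _).le]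

lemma integrable_velMeasure_iff (hβ : 0 < β) {E : Type*} [NormedAddCommGroup E] [NormedSpace ℝ E]
    (f : Vel d → E) : Integrable f ϖ ↔ Integrable fun v => maxwellian d β v • f v := by
  rw [velMeasure, integrable_withDensity_iff_integrable_smul' (by fun_prop)
    (ae_of_all _ fun _ => ENNReal.ofReal_lt_top)]
  simp_rw [ENNReal.toReal_ofReal (maxwellian_pos hβ _).le]

lemma integral_cexp_inner_maxwellian (hβ : 0 < β) (n : Vel d) (t : ℝ) :
    ∫ v : Vel d, cexp (t * inner ℝ n v * I) ∂ϖ = cexp (-(t ^ 2 * ‖n‖ ^ 2 / (2 * β))) := by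
  rw [integral_velMeasure hβ]
  have key := GaussianFourier.integral_cexp_neg_mul_sq_norm_add (V := Vel d) (b := (β / 2 : ℝ))
    (by simpa using hβ) (t * I) n
  have e : ∀ v : Vel d, maxwellian d β v • cexp (t * inner ℝ n v * I)
      = ((β / (2 * π)) ^ ((d : ℝ) / 2) : ℝ) *
        cexp (-((β / 2 : ℝ) : ℂ) * ‖v‖ ^ 2 + t * I * inner ℝ n v) := by
    intro v
    rw [maxwellian, exp_add, real_smul]
    push_cast
    ring_nf
  simp_rw [e]
  rw [integral_const_mul, key]
  have hb : (0 : ℝ) ≤ β / (2 * π) := by positivity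
  have h2 : ((π : ℂ) / ((β / 2 : ℝ) : ℂ)) ^ ((Module.finrank ℝ (Vel d) : ℂ) / 2)
      = (((2 * π) / β) ^ ((d : ℝ) / 2) : ℝ) := by
    rw [ofReal_cpow (by positivity)]
    congr 1
    · push_cast
      have : (β : ℂ) ≠ 0 := by exact_mod_cast hβ.ne'
      field_simp
    · simp
  rw [h2, ← mul_assoc, ← ofReal_mul, ← Real.mul_rpow hb (by positivity)]
  have h3 : β / (2 * π) * (2 * π / β) = 1 := by field_simp
  rw [h3, Real.one_rpow, ofReal_one, one_mul]
  congr 1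
  have : (β : ℂ) ≠ 0 := by exact_mod_cast hβ.ne'
  push_cast
  rw [mul_pow, I_sq]
  field_simp
  ring

lemma prob_vel (hβ : 0 < β) : IsProbabilityMeasure ϖ := by
  have h := integral_cexp_inner_maxwellian (d := d) hβ 0 0
  have hi : Integrable (maxwellian d β) := by
    -- Without integrability the integral of the characteristic function at zero would take the
    -- default value `0`, whereas it was computed to be `1`.
    by_contra hn
    rw [integral_velMeasure hβ] at h
    rw [integral_undef] at h
    · simp at h
    · intro hh
      refine hn ?_
      have := hh.re
      simpa using this
  refine ⟨?_⟩
  rw [velMeasure, withDensity_apply _ MeasurableSet.univ, setLIntegral_univ,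
    ← ofReal_integral_eq_lintegral_ofReal hi (ae_of_all _ fun v => (maxwellian_pos hβ v).le)]
  rw [integral_velMeasure hβ] at h
  have h1 : ∫ v : Vel d, ((maxwellian d β v : ℝ) : ℂ) = 1 := by simpa using h
  have h1 : ((∫ v : Vel d, maxwellian d β v : ℝ) : ℂ) = 1 :=
    (integral_ofReal (𝕜 := ℂ) (f := maxwellian d β)).symm.trans h1
  rw [show ∫ v : Vel d, maxwellian d β v = 1 by exact_mod_cast h1]
  simp

/-- The normalization `‖n‖² = β` turns every component along a wave vector into a standard Gaussian,
so that all modes share the scalar problem solved above. -/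
lemma map_inner_velMeasure (hβ : 0 < β) {n : Vel d} (hn : ‖n‖ ^ 2 = β) :
    Measure.map (fun v => inner ℝ n v) ϖ = gauss := by
  have := prob_vel (d := d) hβ
  have : IsProbabilityMeasure (Measure.map (fun v => inner ℝ n v) ϖ) :=
    Measure.isProbabilityMeasure_map (by fun_prop)
  refine Measure.ext_of_charFun ?_
  funext t
  rw [charFun_apply_real, charFun_gaussianReal, integral_map (by fun_prop) (by fun_prop),
    integral_cexp_inner_maxwellian hβ]
  congr 1
  have : (β : ℂ) ≠ 0 := by exact_mod_cast hβ.ne'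
  have h2 : ((‖n‖ : ℂ)) ^ 2 = β := by exact_mod_cast hn
  rw [h2]
  simp
  field_simp

lemma preserves_inner (hβ : 0 < β) {n : Vel d} (hn : ‖n‖ ^ 2 = β) :
    MeasurePreserving (fun v => inner ℝ n v) ϖ gauss :=
  ⟨by fun_prop, map_inner_velMeasure hβ hn⟩

lemma memLp_coord_velMeasure (hβ : 0 < β) (a : Fin d) (p : ℝ≥0∞) (hp : p ≠ ∞) :
    MemLp (fun v : Vel d => v a) p ϖ := by
  have hn : ‖EuclideanSpace.single a (Real.sqrt β)‖ ^ 2 = β := by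
    rw [PiLp.norm_single, norm_eq_abs, sq_abs, Real.sq_sqrt hβ.le]
  have h1 : MemLp (id : ℝ → ℝ) p gauss := by
    lift p to NNReal using hp
    exact memLp_id_gaussianReal p
  have h2 := (h1.comp_measurePreserving (preserves_inner hβ hn)).const_mul (Real.sqrt β)⁻¹
  convert h2 using 2 with v
  have := Real.sqrt_pos.2 hβ
  simp [EuclideanSpace.inner_single_left]
  field_simp

lemma memLp_norm_velMeasure (hβ : 0 < β) (p : ℝ≥0∞) (hp : p ≠ ∞) :
    MemLp (fun v : Vel d => ‖v‖) p ϖ := by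
  have h1 : MemLp (fun v : Vel d => ∑ a, ‖v a‖) p ϖ :=
    memLp_finsetSum _ fun a _ => (memLp_coord_velMeasure hβ a p hp).norm
  refine h1.mono (by fun_prop) (ae_of_all _ fun v => ?_)
  have h2 : 0 ≤ ∑ a, ‖v a‖ := Finset.sum_nonneg fun a _ => norm_nonneg _
  rw [norm_norm, norm_of_nonneg h2]
  have := (EuclideanSpace.basisFun (Fin d) ℝ).sum_repr v
  calc ‖v‖ = ‖∑ a, v a • EuclideanSpace.basisFun (Fin d) ℝ a‖ := by
        conv_lhs => rw [← this]
        simp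
    _ ≤ ∑ a, ‖v a • EuclideanSpace.basisFun (Fin d) ℝ a‖ := norm_sum_le _ _
    _ = _ := by simp [norm_smul]

lemma memLp_pow_velMeasure (hβ : 0 < β) (k : ℕ) : MemLp (fun v : Vel d => (1 + ‖v‖) ^ k) 2 ϖ := by
  have := prob_vel (d := d) hβ
  have h1 : ∀ p : ℝ≥0∞, p ≠ ∞ → MemLp (fun v : Vel d => 1 + ‖v‖) p ϖ :=
    fun p hp => (memLp_const (1 : ℝ)).add (memLp_norm_velMeasure hβ p hp)
  have h2 := (h1 _ (ENNReal.natCast_ne_top (k * 2))).integrable_norm_pow'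
  rw [memLp_two_iff_integrable_sq (by fun_prop)]
  refine h2.congr (ae_of_all _ fun v => ?_)
  change ‖1 + ‖v‖‖ ^ (k * 2) = ((1 + ‖v‖) ^ k) ^ 2
  rw [norm_of_nonneg (by positivity), pow_mul]

instance : IsProbabilityMeasure (volume : Measure (Torus d)) := by
  have : IsProbabilityMeasure (volume : Measure UnitAddCircle) := ⟨by simp⟩
  exact inferInstanceAs (IsProbabilityMeasure (Measure.pi fun _ : Fin d => volume))

lemma ae_velMeasure_iff (hβ : 0 < β) {p : Vel d → Prop} : (∀ᵐ v ∂ϖ, p v) ↔ ∀ᵐ v, p v := by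
  rw [velMeasure, ae_withDensity_iff (by fun_prop)]
  refine eventually_congr (ae_of_all _ fun v => ?_)
  simp [maxwellian_pos hβ v]

lemma prob_one (hβ : 0 < β) : IsProbabilityMeasure (oneMeasure d β) := by
  have := prob_vel (d := d) hβ
  unfold oneMeasure; infer_instance

lemma prob_phase (hβ : 0 < β) (n : ℕ) : IsProbabilityMeasure (Ψ n) := by
  have := prob_one (d := d) hβ
  unfold phaseMeasure; infer_instance

/-! ### Resampling one coordinate of a product measure -/

section Resample

variable {X : Type*} [MeasurableSpace X] {m : Measure X} [IsProbabilityMeasure m] {n : ℕ}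

local notation "m⊗" => Measure.pi fun _ => m
local notation "F⊗" => (Fin n → X) → ℂ

/-- Exchanging coordinate `j` with an independent sample permutes the sides of a measurable
rectangle, and rectangles determine the product measure. Averages and transposes of one-coordinate
operators follow from this. -/
lemma preserves_exchange (j : Fin n) :
    MeasurePreserving (fun x : (Fin n → X) × X => (update x.1 j x.2, x.1 j))
      (m⊗.prod m) (m⊗.prod m) := by
  have hm : Measurable fun x : (Fin n → X) × X => (update x.1 j x.2, x.1 j) := by
    refine Measurable.prodMk (measurable_pi_lambda _ fun i => ?_)
      ((measurable_pi_apply j).comp measurable_fst)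
    rcases eq_or_ne i j with rfl | h
    · simpa using measurable_snd
    · simpa [h, Function.comp_def] using (measurable_pi_apply i).comp measurable_fst
  refine ⟨hm, (Measure.prod_eq_generateFrom generateFrom_pi.symm.symm
    (MeasurableSpace.generateFrom_measurableSet (α := X)) isPiSystem_pi
    MeasurableSpace.isPiSystem_measurableSet
    ⟨fun _ => univ, fun _ => ⟨fun _ => univ, by simp, by simp⟩, by simp, by simp [iUnion_const]⟩
    m.toFiniteSpanningSetsIn ?_).symm⟩
  rintro _ ⟨S, hS, rfl⟩ t ht
  simp only [Set.mem_pi, mem_univ, forall_const, mem_ofPred_eq] at hS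
  have ht' : MeasurableSet t := ht
  rw [Measure.map_apply hm ((MeasurableSet.univ_pi hS).prod ht')]
  have e : (fun x : (Fin n → X) × X => (update x.1 j x.2, x.1 j)) ⁻¹'
      ((univ.pi S) ×ˢ t) = (univ.pi (update S j t)) ×ˢ (S j) := by
    ext x
    simp only [mem_preimage, mem_prod, Set.mem_pi, mem_univ, forall_const]
    constructor
    · rintro ⟨h1, h2⟩
      refine ⟨fun i => ?_, by simpa using h1 j⟩
      rcases eq_or_ne i j with rfl | h
      · simpa using h2
      · simpa [h] using h1 i
    · rintro ⟨h1, h2⟩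
      refine ⟨fun i => ?_, by simpa using h1 j⟩
      rcases eq_or_ne i j with rfl | h
      · simpa using h2
      · simpa [h] using h1 i
  rw [e, Measure.prod_prod, Measure.pi_pi, Measure.pi_pi, ← mul_prod_erase _ _ (mem_univ j),
    ← mul_prod_erase (a := j) _ (fun i => m (S i)) (mem_univ j)]
  have : ∏ i ∈ Finset.univ.erase j, m (update S j t i) = ∏ i ∈ Finset.univ.erase j, m (S i) :=
    prod_congr rfl fun i hi => by simp [Finset.ne_of_mem_erase hi]
  rw [this, update_self]; ring

lemma preserves_resample (j : Fin n) :
    MeasurePreserving (fun x : (Fin n → X) × X => update x.1 j x.2)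
      (m⊗.prod m) m⊗ :=
  measurePreserving_fst.comp (preserves_exchange j)

variable {E : Type*} [NormedAddCommGroup E]

lemma integral_exchange [NormedSpace ℝ E] (j : Fin n) {Φ : (Fin n → X) × X → E}
    (hΦ : Integrable Φ (m⊗.prod m)) : ∫ z, ∫ y, Φ (z, y) ∂m ∂m⊗
      = ∫ z, ∫ y, Φ (update z j y, z j) ∂m ∂m⊗ := by
  have mp := preserves_exchange (m := m) j
  have h2 : Integrable (fun x : (Fin n → X) × X => Φ (update x.1 j x.2, x.1 j))
      (m⊗.prod m) := mp.integrable_comp_of_integrable hΦ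
  rw [integral_integral (f := fun z y => Φ (z, y)) hΦ,
    integral_integral (f := fun z y => Φ (update z j y, z j)) h2]
  have := integral_map (μ := m⊗.prod m) (f := Φ) mp.measurable.aemeasurable
    (by rw [mp.map_eq]; exact hΦ.aestronglyMeasurable)
  rw [mp.map_eq] at this
  exact this

end Resample

/-! ### Averages and kernel operators in one coordinate. -/

section Resample

variable {X : Type*} [MeasurableSpace X] {m : Measure X} {n : ℕ}

local notation "m⊗" => Measure.pi fun _ => m
local notation "F⊗" => (Fin n → X) → ℂ

/-- The integral operator with kernel `k` acting on the coordinate `j`. -/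
def coordOp (m : Measure X) (k : X → X → ℂ) (j : Fin n) (f : F⊗) (v : Fin n → X) : ℂ :=
  ∫ y, k (v j) y * f (update v j y) ∂m

/-- The average over the coordinate `j`. -/
def avg (m : Measure X) (j : Fin n) (f : F⊗) (v : Fin n → X) : ℂ := ∫ y, f (update v j y) ∂m

lemma avg_eq_coordOp (j : Fin n) (f : F⊗) : avg m j f = coordOp m (fun _ _ => 1) j f := by
  funext v; simp [avg, coordOp]

lemma avg_update (j : Fin n) (f : F⊗) (v : Fin n → X) (y : X) :
    avg m j f (update v j y) = avg m j f v := by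
  simp [avg]

lemma avg_mul_left (j : Fin n) {c f : F⊗} (hc : ∀ v y, c (update v j y) = c v) :
    avg m j (fun v => c v * f v) = fun v => c v * avg m j f v := by
  funext v
  simp only [avg, hc, integral_const_mul]

lemma avg_conj (j : Fin n) (f : F⊗) (v : Fin n → X) :
    avg m j (fun v => conj (f v)) v = conj (avg m j f v) := integral_conj

lemma avg_const [IsProbabilityMeasure m] (j : Fin n) {f : F⊗}
    (hf : ∀ v y, f (update v j y) = f v) : avg m j f = f := by
  funext v; simp [avg, hf]

variable [IsProbabilityMeasure m]

lemma memLp_comp_update (j : Fin n) {f : F⊗} {p : ℝ≥0∞} (hf : MemLp f p m⊗) :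
    MemLp (fun x : (Fin n → X) × X => f (update x.1 j x.2)) p
      (m⊗.prod m) :=
  hf.comp_measurePreserving (preserves_resample j)

lemma memLp_kernel_mul (j : Fin n) {k : X → X → ℂ} (hk : Measurable fun x : X × X => k x.1 x.2)
    {B : ℝ} (hB : ∀ x y, ‖k x y‖ ≤ B) {f : F⊗} {p : ℝ≥0∞} (hf : MemLp f p m⊗) :
    MemLp (fun x : (Fin n → X) × X => k (x.1 j) x.2 * f (update x.1 j x.2)) p
      (m⊗.prod m) := by
  have hkm : Measurable fun x : (Fin n → X) × X => k (x.1 j) x.2 :=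
    Measurable.fun_comp (g := fun x : X × X => k x.1 x.2)
      (f := fun x : (Fin n → X) × X => (x.1 j, x.2)) hk
      (((measurable_pi_apply j).comp measurable_fst).prodMk measurable_snd)
  refine ((memLp_comp_update j hf).const_mul (B : ℂ)).mono
    (hkm.aestronglyMeasurable.mul (memLp_comp_update j hf).aestronglyMeasurable)
    (ae_of_all _ fun x => ?_)
  rw [norm_mul, norm_mul, norm_real]
  exact mul_le_mul_of_nonneg_right ((hB _ _).trans (le_abs_self _)) (norm_nonneg _)

lemma sq_norm_integral_le {Y : Type*} [MeasurableSpace Y] {ν : Measure Y} [IsProbabilityMeasure ν]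
    {f : Y → ℂ} (hf : MemLp f 2 ν) : ‖∫ y, f y ∂ν‖ ^ 2 ≤ ∫ y, ‖f y‖ ^ 2 ∂ν := by
  have i1 : Integrable f ν := hf.integrable (by norm_num)
  have i2 : Integrable (fun y => ‖f y‖ ^ 2) ν := hf.integrable_norm_pow (by norm_num)
  set A := ∫ y, ‖f y‖ ∂ν with hA
  have h1 : ‖∫ y, f y ∂ν‖ ≤ A := norm_integral_le_integral_norm _
  have h2 : 0 ≤ ∫ y, (‖f y‖ - A) ^ 2 ∂ν := integral_nonneg fun y => sq_nonneg _
  have h3 : ∫ y, (‖f y‖ - A) ^ 2 ∂ν = ∫ y, ‖f y‖ ^ 2 ∂ν - 2 * A * A + A ^ 2 := by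
    have e : ∀ y, (‖f y‖ - A) ^ 2 = ‖f y‖ ^ 2 - 2 * A * ‖f y‖ + A ^ 2 := fun y => by ring
    simp_rw [e]
    have a1 := integral_add (i2.sub (i1.norm.const_mul (2 * A))) (integrable_const (μ := ν) (A ^ 2))
    have a2 := integral_sub i2 (i1.norm.const_mul (2 * A))
    simp only [Pi.sub_apply] at a1
    rw [a1, a2, integral_const_mul]
    simp [hA]
  have h4 : ‖∫ y, f y ∂ν‖ ^ 2 ≤ A ^ 2 := by gcongr
  nlinarith

lemma memLp_integral_prod {Y Z : Type*} [MeasurableSpace Y] [MeasurableSpace Z] {μ : Measure Y}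
    [IsFiniteMeasure μ] {ν : Measure Z} [IsProbabilityMeasure ν] {f : Y × Z → ℂ}
    (hf : MemLp f 2 (μ.prod ν)) : MemLp (fun y => ∫ z, f (y, z) ∂ν) 2 μ := by
  have i2 : Integrable (fun x => ‖f x‖ ^ 2) (μ.prod ν) := hf.integrable_norm_pow (by norm_num)
  have hm : AEStronglyMeasurable (fun y => ∫ z, f (y, z) ∂ν) μ :=
    hf.aestronglyMeasurable.integral_prod_right'
  refine (memLp_two_iff_integrable_sq_norm hm).2 (i2.integral_prod_left.mono' (hm.norm.pow 2) ?_)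
  filter_upwards [i2.prod_right_ae, hf.aestronglyMeasurable.prodMk_left] with y h1 h2
  rw [norm_of_nonneg (by positivity)]
  exact sq_norm_integral_le ((memLp_two_iff_integrable_sq_norm h2).2 h1)

lemma memLp_coordOp (j : Fin n) {k : X → X → ℂ} (hk : Measurable fun x : X × X => k x.1 x.2)
    {B : ℝ} (hB : ∀ x y, ‖k x y‖ ≤ B) {f : F⊗} (hf : MemLp f 2 m⊗) : MemLp (coordOp m k j f) 2 m⊗ :=
  memLp_integral_prod (memLp_kernel_mul j hk hB hf)

lemma memLp_avg (j : Fin n) {f : F⊗} (hf : MemLp f 2 m⊗) : MemLp (avg m j f) 2 m⊗ := by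
  rw [avg_eq_coordOp]
  exact memLp_coordOp j measurable_const (B := 1) (by simp) hf

/-- The exchange of the old and the new value of coordinate `j` swaps the two arguments of the
kernel. -/
lemma integral_mul_coordOp (j : Fin n) {k : X → X → ℂ} (hk : Measurable fun x : X × X => k x.1 x.2)
    {B : ℝ} (hB : ∀ x y, ‖k x y‖ ≤ B) {f g : F⊗}
    (hf : MemLp f 2 m⊗) (hg : MemLp g 2 m⊗) : ∫ v, g v * coordOp m k j f v ∂m⊗
      = ∫ v, f v * coordOp m (fun x y => k y x) j g v ∂m⊗ := by
  have i1 : Integrable (fun x : (Fin n → X) × X =>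
      g x.1 * (k (x.1 j) x.2 * f (update x.1 j x.2))) (m⊗.prod m) :=
    (hg.comp_fst m).integrable_mul (memLp_kernel_mul j hk hB hf)
  have key := integral_exchange (m := m) j i1
  simp only [update_self, update_idem, update_eq_self] at key
  simp only [coordOp, ← integral_const_mul]
  rw [key]
  refine integral_congr_ae (ae_of_all _ fun v => integral_congr_ae (ae_of_all _ fun y => ?_))
  simp only; ring

lemma integral_mul_avg (j : Fin n) {f g : F⊗} (hf : MemLp f 2 m⊗) (hg : MemLp g 2 m⊗) :
    ∫ v, g v * avg m j f v ∂m⊗ = ∫ v, f v * avg m j g v ∂m⊗ := by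
  simp only [avg_eq_coordOp]
  exact integral_mul_coordOp j measurable_const (B := 1) (by simp) hf hg

lemma integral_avg (j : Fin n) {f : F⊗} (hf : Integrable f m⊗) :
    ∫ v, avg m j f v ∂m⊗ = ∫ v, f v ∂m⊗ := by
  have h1 := integral_map (preserves_resample (m := m) j).measurable.aemeasurable (f := f)
    (by rw [(preserves_resample (m := m) j).map_eq]; exact hf.aestronglyMeasurable)
  rw [(preserves_resample (m := m) j).map_eq] at h1
  rw [h1]
  exact integral_integral (f := fun v y => f (update v j y))
    ((preserves_resample (m := m) j).integrable_comp_of_integrable hf)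

/-- Fubini's theorem needs integrability of the two-coordinate section, available only for almost
every `v`; this is why the averages commute only almost everywhere. -/
lemma avg_comm {i j : Fin n} (hij : i ≠ j) {f : F⊗} (hf : Integrable f m⊗) :
    avg m i (avg m j f) =ᵐ[m⊗] avg m j (avg m i f) := by
  have mp := (preserves_resample (m := m) (n := n) j).comp
    (((preserves_resample (m := m) (n := n) i).prod (MeasurePreserving.id m)).comp
      (measurePreserving_prodAssoc (Measure.pi fun _ : Fin n => m) m m).symm)
  have h1 := (mp.integrable_comp_of_integrable hf).prod_right_ae
  filter_upwards [h1] with v hv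
  simp only [avg]
  rw [integral_integral_swap (f := fun y x => f (update (update v i y) j x))]
  · congr 1; funext x; congr 1; funext y
    rw [update_comm hij]
  · exact hv

/-- The two factors are independent, so square integrability of each suffices and no boundedness is
needed. Integrability is tested after resampling coordinate `j`, where the product becomes a tensor
product. -/
lemma memLp_mul_of_invariant (j : Fin n) {b : X → ℝ} (hb : MemLp b 2 m) {f : F⊗}
    (hf : MemLp f 2 m⊗) (hinv : ∀ v y, f (update v j y) = f v) :
    MemLp (fun v => (b (v j) : ℂ) * f v) 2 m⊗ := by
  have mj : MeasurePreserving (fun v : Fin n → X => v j) m⊗ m := measurePreserving_eval _ j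
  have hbm : AEStronglyMeasurable (fun v : Fin n → X => (b (v j) : ℂ)) m⊗ :=
    continuous_ofReal.comp_aestronglyMeasurable
      (hb.aestronglyMeasurable.comp_measurePreserving mj)
  have hm : AEStronglyMeasurable (fun v : Fin n → X => (b (v j) : ℂ) * f v)
    m⊗ := hbm.mul hf.aestronglyMeasurable
  refine (memLp_two_iff_integrable_sq_norm hm).2 ?_
  refine ((preserves_resample (m := m) j).integrable_comp
    (g := fun v => ‖(b (v j) : ℂ) * f v‖ ^ 2) (hm.norm.pow 2)).1 ?_
  have i1 : Integrable (fun v => ‖f v‖ ^ 2) m⊗ := hf.integrable_norm_pow (by norm_num)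
  have i2 : Integrable (fun v => ‖b v‖ ^ 2) m := hb.integrable_norm_pow (by norm_num)
  refine (i1.mul_prod i2).congr (ae_of_all _ fun x => ?_)
  simp [hinv, mul_pow, mul_comm]

lemma integral_mul_conj_avg (j : Fin n) {f g : F⊗}
    (hf : MemLp f 2 m⊗) (hg : MemLp g 2 m⊗) : ∫ v, g v * conj (avg m j f v) ∂m⊗
      = ∫ v, avg m j g v * conj (f v) ∂m⊗ := by
  simp_rw [← avg_conj]
  rw [integral_mul_avg j (f := fun v => conj (f v)) hf.star hg]
  simp_rw [mul_comm]

omit [IsProbabilityMeasure m] in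
lemma integral_mul_conj_self (c : (Fin n → X) → ℝ) (u : F⊗) :
    ∫ v, (c v : ℂ) * u v * conj (u v) ∂m⊗ = ((∫ v, c v * ‖u v‖ ^ 2 ∂m⊗ : ℝ) : ℂ) := by
  refine Eq.trans ?_ (integral_ofReal (𝕜 := ℂ))
  congr 1; funext v
  rw [mul_assoc, mul_conj, normSq_eq_norm_sq]
  simp

/-- Averaging is an orthogonal projection that commutes with the real multiplier `c`, so the form is
a weighted square norm of the projection and in particular is real. -/
lemma integral_mul_conj_avg_self (j : Fin n) {c : (Fin n → X) → ℝ}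
    (hc : ∀ v y, c (update v j y) = c v) {f : F⊗} (hf : MemLp f 2 m⊗)
    (hcf : MemLp (fun v => (c v : ℂ) * f v) 2 m⊗) : ∫ v, (c v : ℂ) * f v * conj (avg m j f v) ∂m⊗
      = ((∫ v, c v * ‖avg m j f v‖ ^ 2 ∂m⊗ : ℝ) : ℂ) := by
  have h1 := integral_mul_conj_avg j (memLp_avg j hf) hcf
  rw [avg_const j (avg_update j f), avg_mul_left j (fun v y => by rw [hc])] at h1
  rw [h1, integral_mul_conj_self]

/-! ### Uniqueness for two coupled coordinates -/

/-- The mode equation for a function of several velocities, two of which carry a mean-field term. -/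
structure IsNullMode (m : Measure X) (i j : Fin n) (c : (Fin n → X) → ℝ) (bi bj : X → ℝ)
    (li lj : ℝ) (w : ℂ) (h : (Fin n → X) → ℂ) : Prop where
  measurable_c : Measurable c
  c_update_left : ∀ v y, c (update v i y) = c v
  c_update_right : ∀ v y, c (update v j y) = c v
  measurable_left : Measurable bi
  measurable_right : Measurable bj
  memLp_left : MemLp (fun x => bi x ^ 2) 2 m
  memLp_right : MemLp (fun x => bj x ^ 2) 2 m
  nonneg_left : 0 ≤ li
  nonneg_right : 0 ≤ lj
  im_pos : 0 < w.im
  memLp : MemLp h 2 (Measure.pi fun _ => m)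
  eq : ∀ᵐ v ∂(Measure.pi fun _ => m), (c v + bi (v i) + bj (v j) - w) * h v
    + li * (bi (v i) * avg m i h v) + lj * (bj (v j) * avg m j h v) = 0

namespace IsNullMode

variable {i j : Fin n} {c : (Fin n → X) → ℝ} {bi bj : X → ℝ} {li lj : ℝ} {w : ℂ}
  {h : (Fin n → X) → ℂ}

omit [IsProbabilityMeasure m] in
lemma symm (H : IsNullMode m i j c bi bj li lj w h) : IsNullMode m j i c bj bi lj li w h :=
  ⟨H.measurable_c, H.c_update_right, H.c_update_left, H.measurable_right, H.measurable_left,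
    H.memLp_right, H.memLp_left, H.nonneg_right, H.nonneg_left, H.im_pos, H.memLp, by
      filter_upwards [H.eq] with v hv
      rw [← hv]; ring⟩

lemma memLp_of_sq {b : X → ℝ} (hb : Measurable b) (h2 : MemLp (fun x => b x ^ 2) 2 m) :
    MemLp b 2 m := by
  refine ((memLp_const (1 : ℝ)).add h2).mono hb.aestronglyMeasurable (ae_of_all _ fun x => ?_)
  rw [Pi.add_apply, norm_eq_abs, norm_of_nonneg (by positivity)]
  nlinarith [sq_nonneg (|b x| - 1), sq_abs (b x)]

/-- The multiplier is unbounded, so the product is not square integrable a priori. The equation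
expresses `h` through its averages divided by a denominator `D` with `|D| ≥ Im w`, and `|b_i|/|D| ≤
1 + (R + |w| + |b_j|)/Im w`. Each average does not depend on the coordinate that multiplies it, so
the fourth moments of `b_i` and `b_j` suffice. -/
lemma memLp_mul_left (H : IsNullMode m i j c bi bj li lj w h) {R : ℝ} (hR : ∀ v, |c v| ≤ R) :
    MemLp (fun v => (bi (v i) : ℂ) * h v) 2 m⊗ := by
  have hy := H.im_pos
  set y := w.im with hydef
  have hR0 : ∀ v : Fin n → X, 0 ≤ R := fun v => (abs_nonneg _).trans (hR v)
  have hAi := memLp_avg i H.memLp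
  have hAj := memLp_avg j H.memLp
  have m1 := (memLp_mul_of_invariant i H.memLp_left hAi (avg_update i h)).norm.const_mul (li / y)
  have m2 := (memLp_mul_of_invariant j H.memLp_right hAj (avg_update j h)).norm.const_mul (lj / y)
  have m3 := (memLp_mul_of_invariant j (memLp_of_sq H.measurable_right H.memLp_right) hAj
    (avg_update j h)).norm.const_mul (lj * (1 + (R + ‖w‖) / y))
  have hmeas : AEStronglyMeasurable (fun v => (bi (v i) : ℂ) * h v) m⊗ := by
    have := H.measurable_left
    have h1 : Measurable fun v : Fin n → X => (bi (v i) : ℂ) := by fun_prop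
    exact h1.aestronglyMeasurable.mul H.memLp.aestronglyMeasurable
  refine ((m1.add m2).add m3).mono hmeas ?_
  filter_upwards [H.eq] with v hv
  set D : ℂ := c v + bi (v i) + bj (v j) - w with hD
  have hDim : y ≤ ‖D‖ := by
    have h1 := abs_im_le_norm D
    have h2 : D.im = -y := by simp [hD, hydef]
    rw [h2, abs_neg] at h1
    exact (le_abs_self _).trans h1
  have hDpos : 0 < ‖D‖ := hy.trans_le hDim
  have hD0 : D ≠ 0 := norm_pos_iff.1 hDpos
  have hh : h v = -(li * (bi (v i) * avg m i h v) + lj * (bj (v j) * avg m j h v)) / D := by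
    rw [eq_div_iff hD0]; linear_combination hv
  have hbD : |bi (v i)| / ‖D‖ ≤ 1 + (R + ‖w‖ + |bj (v j)|) / y := by
    have h1 : |bi (v i)| ≤ ‖D‖ + (R + ‖w‖ + |bj (v j)|) := by
      have e : (bi (v i) : ℂ) = D - c v - bj (v j) + w := by rw [hD]; ring
      calc |bi (v i)| = ‖(bi (v i) : ℂ)‖ := by rw [norm_real, norm_eq_abs]
        _ ≤ ‖D‖ + ‖(c v : ℂ)‖ + ‖(bj (v j) : ℂ)‖ + ‖w‖ := by
          rw [e]
          exact (norm_add_le _ _).trans (add_le_add_left ((norm_sub_le _ _).trans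
            (add_le_add_left (norm_sub_le _ _) _)) _)
        _ ≤ _ := by
          rw [norm_real, norm_real, norm_eq_abs, norm_eq_abs]
          linarith [hR v]
    have h2 : 0 ≤ R + ‖w‖ + |bj (v j)| := by have := hR0 v; positivity
    calc _ ≤ (‖D‖ + (R + ‖w‖ + |bj (v j)|)) / ‖D‖ := by gcongr
      _ = 1 + (R + ‖w‖ + |bj (v j)|) / ‖D‖ := by rw [add_div, div_self hDpos.ne']
      _ ≤ _ := by gcongr
  have hl := H.nonneg_left
  have hl' := H.nonneg_right
  set P := ‖avg m i h v‖
  set Q := ‖avg m j h v‖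
  set x := |bi (v i)|
  set x' := |bj (v j)|
  have h1 : ‖(bi (v i) : ℂ) * h v‖ ≤ x * ((li * (x * P) + lj * (x' * Q)) / ‖D‖) := by
    rw [norm_mul, norm_real, norm_eq_abs, hh, norm_div, norm_neg]
    gcongr
    refine (norm_add_le _ _).trans (le_of_eq ?_)
    simp only [norm_mul, norm_real, norm_eq_abs, abs_of_nonneg hl, abs_of_nonneg hl']
    rfl
  have h2 : x * ((li * (x * P) + lj * (x' * Q)) / ‖D‖)
      ≤ li / y * (x ^ 2 * P) + lj * (x' * Q) * (1 + (R + ‖w‖ + x') / y) := by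
    calc x * ((li * (x * P) + lj * (x' * Q)) / ‖D‖)
        = li * (x ^ 2 * P) / ‖D‖ + lj * (x' * Q) * (x / ‖D‖) := by ring
      _ ≤ li * (x ^ 2 * P) / y + lj * (x' * Q) * (1 + (R + ‖w‖ + x') / y) := by gcongr
      _ = _ := by ring
  refine (h1.trans h2).trans (le_of_eq ?_)
  have e : ∀ (r : ℝ) (u : ℂ), ‖(r : ℂ) * u‖ = |r| * ‖u‖ := fun r u => by
    rw [norm_mul, norm_real, norm_eq_abs]
  simp only [Pi.add_apply]
  rw [e, e, e, abs_pow, abs_pow, norm_of_nonneg]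
  · ring
  · have := hR0 v; positivity

/-- The equation is tested against `S = (1 + l_i A_i)(1 + l_j A_j) h`, which symmetrizes both
mean-field terms at once. As the averages are commuting projections and the couplings are
nonnegative, the pairing of `h` with `S` is a sum of nonnegative square norms that contains `‖h‖²`.
All other pairings are real, so the imaginary part of the equation is `Im w` times this sum. -/
lemma ae_eq_zero_of_bounded (H : IsNullMode m i j c bi bj li lj w h) (hij : i ≠ j) {R : ℝ}
    (hR : ∀ v, |c v| ≤ R) : h =ᵐ[m⊗] 0 := by
  set μ : Measure (Fin n → X) := m⊗ with hμ
  have hm := H.memLp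
  set f := avg m i h with hf
  set g := avg m j h with hg
  have mf : MemLp f 2 μ := memLp_avg i hm
  have mg : MemLp g 2 μ := memLp_avg j hm
  have mfg : MemLp (avg m j f) 2 μ := memLp_avg j mf
  have hcomm : avg m j f =ᵐ[μ] avg m i g := (avg_comm hij (hm.integrable (by norm_num))).symm
  have mc : ∀ {u : F⊗}, MemLp u 2 μ → MemLp (fun v => (c v : ℂ) * u v) 2 μ := by
    intro u hu
    refine (hu.const_mul (R : ℂ)).mono ?_ (ae_of_all _ fun v => ?_)
    · have := H.measurable_c
      have h1 : Measurable fun v : Fin n → X => (c v : ℂ) := by fun_prop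
      exact h1.aestronglyMeasurable.mul hu.aestronglyMeasurable
    · rw [norm_mul, norm_mul, norm_real, norm_real]
      exact mul_le_mul_of_nonneg_right ((hR v).trans (le_abs_self _)) (norm_nonneg _)
  -- the doubly averaged form
  have hX : ∀ a : (Fin n → X) → ℝ, (∀ v y, a (update v i y) = a v) →
      (∀ v y, a (update v j y) = a v) →
      (∀ {u : F⊗}, MemLp u 2 μ → MemLp (fun v => (a v : ℂ) * u v) 2 μ) →
      ∫ v, (a v : ℂ) * h v * conj (avg m j f v) ∂μ
        = ((∫ v, a v * ‖avg m j f v‖ ^ 2 ∂μ : ℝ) : ℂ) := by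
    intro a hai haj ha
    have s1 : ∫ v, (a v : ℂ) * h v * conj (avg m j f v) ∂μ
        = ∫ v, (a v : ℂ) * h v * conj (avg m i g v) ∂μ :=
      integral_congr_ae (by filter_upwards [hcomm] with v hv; rw [hv])
    have s2 := integral_mul_conj_avg i mg (ha hm)
    rw [avg_mul_left i (fun v y => by rw [hai])] at s2
    have s3 := integral_mul_conj_avg i mg (ha mf)
    rw [avg_mul_left i (fun v y => by rw [hai]), hf, avg_const i (avg_update i h), ← hf] at s3
    have s4 : ∫ v, (a v : ℂ) * f v * conj (avg m i g v) ∂μ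
        = ∫ v, (a v : ℂ) * f v * conj (avg m j f v) ∂μ :=
      integral_congr_ae (by filter_upwards [hcomm] with v hv; rw [hv])
    rw [s1, s2, ← s3, s4]
    exact integral_mul_conj_avg_self j haj mf (ha mf)
  have mS := ((hm.add (mf.const_mul (li : ℂ))).add (mg.const_mul (lj : ℂ))).add
    (mfg.const_mul ((li : ℂ) * lj))
  set S : F⊗ := fun v => h v + li * f v + lj * g v + li * lj * avg m j f v with hS
  have mS : MemLp S 2 μ := mS
  have ip : ∀ {u k : F⊗}, MemLp u 2 μ → MemLp k 2 μ →
      Integrable (fun v => u v * conj (k v)) μ := fun hu hk => hu.integrable_mul hk.star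
  -- forms with a multiplier invariant in both coordinates are real
  have hform : ∀ a : (Fin n → X) → ℝ, (∀ v y, a (update v i y) = a v) →
      (∀ v y, a (update v j y) = a v) →
      (∀ {u : F⊗}, MemLp u 2 μ → MemLp (fun v => (a v : ℂ) * u v) 2 μ) →
      ∫ v, (a v : ℂ) * h v * conj (S v) ∂μ = ((∫ v, a v * ‖h v‖ ^ 2 ∂μ : ℝ) : ℂ)
        + li * ((∫ v, a v * ‖f v‖ ^ 2 ∂μ : ℝ) : ℂ) + lj * ((∫ v, a v * ‖g v‖ ^ 2 ∂μ : ℝ) : ℂ)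
        + li * lj * ((∫ v, a v * ‖avg m j f v‖ ^ 2 ∂μ : ℝ) : ℂ) := by
    intro a hai haj ha
    rw [← integral_mul_conj_self a h, ← integral_mul_conj_avg_self i hai hm (ha hm),
      ← integral_mul_conj_avg_self j haj hm (ha hm), ← hX a hai haj ha]
    have i0 := ip (ha hm) hm
    have i1 := (ip (ha hm) mf).const_mul (li : ℂ)
    have i2 := (ip (ha hm) mg).const_mul (lj : ℂ)
    have i3 := (ip (ha hm) mfg).const_mul ((li : ℂ) * lj)
    have a1 := integral_add i0 i1
    have a2 := integral_add (i0.add i1) i2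
    have a3 := integral_add ((i0.add i1).add i2) i3
    simp only [Pi.add_apply] at a1 a2 a3
    rw [← integral_const_mul, ← integral_const_mul, ← integral_const_mul, ← a1, ← a2, ← a3]
    congr 1; funext v
    simp only [hS, map_add, map_mul, conj_ofReal]
    ring
  -- the two coupled terms are real
  have mbu : ∀ {i' : Fin n} {b : X → ℝ} {l : ℝ}, Measurable b → MemLp (fun x => b x ^ 2) 2 m →
      MemLp (fun v => (b (v i') : ℂ) * h v) 2 μ →
      MemLp (fun v => (b (v i') : ℂ) * (h v + l * avg m i' h v)) 2 μ :=
    fun {i' b l} hb hb2 hbh => (hbh.add ((memLp_mul_of_invariant i' (memLp_of_sq hb hb2)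
      (memLp_avg i' hm) (avg_update i' h)).const_mul (l : ℂ))).ae_eq (ae_of_all _ fun v => by
        simp only [Pi.add_apply]; ring)
  -- With `u = h + l A_i h` the test function is `u + l' A_j u`. The multiplier does not depend on
  -- coordinate `j`, hence commutes with `A_j`, and both resulting forms are real.
  have hreal : ∀ {i' j' : Fin n} {b : X → ℝ} {l l' : ℝ}, i' ≠ j' →
      MemLp (fun v => (b (v i') : ℂ) * (h v + l * avg m i' h v)) 2 μ →
      (S =ᵐ[μ] fun v => (h v + l * avg m i' h v)
        + l' * avg m j' (fun v => h v + l * avg m i' h v) v) →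
      (∫ v, ((b (v i') : ℂ) * (h v + l * avg m i' h v)) * conj (S v) ∂μ).im = 0 := by
    intro i' j' b l l' hne mbu hSe
    set u : F⊗ := fun v => h v + l * avg m i' h v with hu
    have mu : MemLp u 2 μ := hm.add ((memLp_avg i' hm).const_mul _)
    have e1 : ∫ v, ((b (v i') : ℂ) * u v) * conj (S v) ∂μ = ∫ v, ((b (v i') : ℂ) * u v * conj (u v)
          + l' * ((b (v i') : ℂ) * u v * conj (avg m j' u v))) ∂μ := by
      refine integral_congr_ae ?_
      filter_upwards [hSe] with v hv
      rw [hv, show h v + l * avg m i' h v = u v from rfl]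
      simp only [map_add, map_mul, conj_ofReal]
      ring
    change (∫ v, ((b (v i') : ℂ) * u v) * conj (S v) ∂μ).im = 0
    rw [e1, integral_add (ip mbu mu) ((ip mbu (memLp_avg j' mu)).const_mul _),
      integral_mul_conj_self (fun v => b (v i')) u,
      integral_const_mul, integral_mul_conj_avg_self j' (c := fun v => b (v i'))
        (fun v y => by simp [hne]) mu mbu, ← ofReal_mul, ← ofReal_add, ofReal_im]
  have avg_lin : ∀ (a : Fin n) (l : ℝ) {u : F⊗}, MemLp u 2 μ →
      avg m a (fun v => h v + l * u v) =ᵐ[μ] fun v => avg m a h v + l * avg m a u v := by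
    intro a l u hu
    have k1 := ((preserves_resample (m := m) a).integrable_comp_of_integrable
      (hm.integrable (by norm_num))).prod_right_ae
    have k2 := ((preserves_resample (m := m) a).integrable_comp_of_integrable
      (hu.integrable (by norm_num))).prod_right_ae
    filter_upwards [k1, k2] with v h1 h2
    simp only [Function.comp_def] at h1 h2
    simp only [avg]
    rw [integral_add h1 (h2.const_mul _), integral_const_mul]
  have hSi : S =ᵐ[μ] fun v => (h v + li * f v) + lj * avg m j (fun v => h v + li * f v) v := by
    filter_upwards [avg_lin j li mf] with v hv
    rw [hv]; simp only [hS, hf, hg]; ring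
  have hSj : S =ᵐ[μ] fun v => (h v + lj * g v) + li * avg m i (fun v => h v + lj * g v) v := by
    filter_upwards [avg_lin i lj mg, hcomm] with v hv hv2
    rw [hv]; simp only [hS]; rw [hv2]; ring
  have mui := mbu (l := li) H.measurable_left H.memLp_left (H.memLp_mul_left hR)
  have muj := mbu (l := lj) H.measurable_right H.memLp_right (H.symm.memLp_mul_left hR)
  have r1 := hreal hij mui hSi
  have r2 := hreal hij.symm muj hSj
  have total : ∫ v, w * (h v * conj (S v)) ∂μ = ∫ v, (c v : ℂ) * h v * conj (S v) ∂μ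
        + ∫ v, ((bi (v i) : ℂ) * (h v + li * avg m i h v)) * conj (S v) ∂μ
        + ∫ v, ((bj (v j) : ℂ) * (h v + lj * avg m j h v)) * conj (S v) ∂μ := by
    have j0 := ip (mc hm) mS
    have j1 := ip mui mS
    have j2 := ip muj mS
    have a1 := integral_add j0 j1
    have a2 := integral_add (j0.add j1) j2
    simp only [Pi.add_apply] at a1 a2
    rw [← a1, ← a2]
    refine integral_congr_ae ?_
    filter_upwards [H.eq] with v hv
    linear_combination (-(conj (S v))) * hv
  have c0 := hform c H.c_update_left H.c_update_right mc
  have c1 := hform (fun _ => 1) (fun _ _ => rfl) (fun _ _ => rfl) (fun hu => by simpa using hu)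
  simp only [ofReal_one, one_mul] at c1
  rw [integral_const_mul, c1, c0] at total
  -- Only the factor `w` carries an imaginary part.
  have him := congrArg Complex.im total
  simp only [← ofReal_mul, ← ofReal_add, add_im, ofReal_im, r1, r2, mul_im, ofReal_re, mul_zero,
    zero_add, add_zero] at him
  have n : ∀ u : F⊗, 0 ≤ ∫ v, ‖u v‖ ^ 2 ∂μ := fun u =>
    integral_nonneg fun v => by positivity
  have p1 := mul_nonneg H.nonneg_left (n f)
  have p2 := mul_nonneg H.nonneg_right (n g)
  have p3 := mul_nonneg (mul_nonneg H.nonneg_left H.nonneg_right) (n (avg m j f))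
  have hz : ∫ v, ‖h v‖ ^ 2 ∂μ = 0 := by
    rcases mul_eq_zero.1 him with h0 | h0
    · exact absurd h0 H.im_pos.ne'
    · linarith [n h]
  have hint : Integrable (fun v => ‖h v‖ ^ 2) μ := hm.integrable_norm_pow (by norm_num)
  filter_upwards [(integral_eq_zero_iff_of_nonneg (fun v => by positivity) hint).1 hz] with v hv
  simpa using hv

/-- The multiplier `c` does not depend on the two averaged coordinates, so the equation is preserved
by the cutoff `|c| ≤ R`. The bounded case applies for every integer `R`. -/
theorem ae_eq_zero (H : IsNullMode m i j c bi bj li lj w h) (hij : i ≠ j) : h =ᵐ[m⊗] 0 := by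
  have key : ∀ R : ℕ, ∀ᵐ v ∂m⊗, |c v| ≤ R → h v = 0 := by
    intro R
    set ρ : F⊗ := fun v => if |c v| ≤ R then 1 else 0 with hρ
    have hset : MeasurableSet {v | |c v| ≤ (R : ℝ)} :=
      measurableSet_le (by have := H.measurable_c; fun_prop) measurable_const
    have hρm : Measurable ρ := Measurable.ite hset measurable_const measurable_const
    have hρi : ∀ v y, ρ (update v i y) = ρ v := fun v y => by
      simp only [hρ, H.c_update_left]
    have hρj : ∀ v y, ρ (update v j y) = ρ v := fun v y => by
      simp only [hρ, H.c_update_right]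
    set c' : (Fin n → X) → ℝ := fun v => if |c v| ≤ R then c v else 0 with hc'
    have H' : IsNullMode m i j c' bi bj li lj w (fun v => ρ v * h v) := by
      refine ⟨Measurable.ite hset H.measurable_c measurable_const,
        fun v y => by simp only [hc', H.c_update_left],
        fun v y => by simp only [hc', H.c_update_right], H.measurable_left, H.measurable_right,
        H.memLp_left, H.memLp_right, H.nonneg_left, H.nonneg_right, H.im_pos, ?_, ?_⟩
      · refine H.memLp.mono (hρm.aestronglyMeasurable.mul H.memLp.aestronglyMeasurable)
          (ae_of_all _ fun v => ?_)
        rw [norm_mul]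
        have : ‖ρ v‖ ≤ 1 := by simp only [hρ]; split_ifs <;> simp
        exact mul_le_of_le_one_left (norm_nonneg _) this
      · filter_upwards [H.eq] with v hv
        rw [avg_mul_left i hρi, avg_mul_left j hρj]
        simp only [hρ, hc']
        split_ifs
        · linear_combination hv
        · simp
    have hb : ∀ v, |c' v| ≤ R := fun v => by
      simp only [hc']; split_ifs with h1
      · exact h1
      · simp
    filter_upwards [H'.ae_eq_zero_of_bounded hij hb] with v hv hcv
    simpa [hρ, hcv] using hv
  filter_upwards [ae_all_iff.2 key] with v hv
  obtain ⟨R, hR⟩ := exists_nat_ge |c v|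
  exact hv R hR

end IsNullMode

end Resample

/-! ### Fourier series on tori -/

section Fourier

variable {ι : Type*} [Fintype ι]

lemma volume_unitAddTorus :
    (volume : Measure (UnitAddTorus ι)) = Measure.pi fun _ => AddCircle.haarAddCircle := by
  have : (volume : Measure UnitAddCircle) = AddCircle.haarAddCircle := by
    rw [AddCircle.volume_eq_smul_haarAddCircle]; simp
  rw [← this]; rfl

instance : IsProbabilityMeasure (volume : Measure (UnitAddTorus ι)) := by
  rw [volume_unitAddTorus]; infer_instance

lemma mFourierCoeff_eq (f : UnitAddTorus ι → ℂ) (n : ι → ℤ) :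
    mFourierCoeff f n = ∫ x, f x * mFourier (-n) x := by
  rw [volume_unitAddTorus]
  simp_rw [mul_comm (f _)]
  rfl

/-- Parseval's identity for the pair formed by `f` and the conjugate of `g`, stated in the bilinear
form used throughout for pairings with test functions. -/
lemma hasSum_fourier_mul {f g : UnitAddTorus ι → ℂ} (hf : MemLp f 2) (hg : MemLp g 2) :
    HasSum (fun k : ι → ℤ => (∫ x, f x * mFourier (-k) x) * ∫ x, g x * mFourier k x)
      (∫ x, f x * g x) := by
  rw [volume_unitAddTorus] at hf hg
  have hgs := hg.star
  have key := hasSum_prod_mFourierCoeff (hgs.toLp _) (hf.toLp _)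
  have e1 : ∀ k : ι → ℤ, mFourierCoeff (hgs.toLp _) k = ∫ x, conj (g x) * mFourier (-k) x := by
    intro k
    rw [← mFourierCoeff_eq]
    refine integral_congr_ae ?_
    filter_upwards [hgs.coeFn_toLp] with x hx
    rw [hx]; rfl
  have e2 : ∀ k : ι → ℤ, mFourierCoeff (hf.toLp _) k = ∫ x, f x * mFourier (-k) x := by
    intro k
    rw [← mFourierCoeff_eq]
    refine integral_congr_ae ?_
    filter_upwards [hf.coeFn_toLp] with x hx
    rw [hx]
  have e3 : ∀ k : ι → ℤ, conj (∫ x, conj (g x) * mFourier (-k) x) = ∫ x, g x * mFourier k x := by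
    intro k
    rw [← integral_conj]
    congr 1; funext x
    rw [map_mul, conj_conj, mFourier_neg, conj_conj]
  have e4 : ∫ t, conj ((hgs.toLp _ : UnitAddTorus ι → ℂ) t) * (hf.toLp _ : UnitAddTorus ι → ℂ) t
      ∂(Measure.pi fun _ : ι => AddCircle.haarAddCircle) = ∫ x, f x * g x := by
    rw [volume_unitAddTorus]
    refine integral_congr_ae ?_
    filter_upwards [hgs.coeFn_toLp, hf.coeFn_toLp] with x hx hx2
    rw [hx, hx2]
    simp [mul_comm]
  rw [← e4]
  refine key.congr_fun fun k => ?_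
  rw [e1, e2, e3, mul_comm]

lemma summable_sq_fourier {f : UnitAddTorus ι → ℂ} (hf : MemLp f 2) :
    Summable fun k : ι → ℤ => ‖∫ x, f x * mFourier (-k) x‖ ^ 2 := by
  have h := (hasSum_fourier_mul hf hf.star).summable.norm
  refine h.congr fun k => ?_
  have : ∫ x, star f x * mFourier k x = conj (∫ x, f x * mFourier (-k) x) := by
    rw [← integral_conj]
    congr 1; funext x
    rw [map_mul, mFourier_neg, conj_conj]; rfl
  rw [this, norm_mul, RCLike.norm_conj, sq]

lemma ae_eq_zero_of_fourier {f : UnitAddTorus ι → ℂ} (hf : MemLp f 2)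
    (h : ∀ k : ι → ℤ, ∫ x, f x * mFourier k x = 0) : f =ᵐ[volume] 0 := by
  have key := hasSum_fourier_mul hf hf.star
  simp only [h, zero_mul] at key
  have h0 := key.unique hasSum_zero
  have e : ∫ x, f x * star f x = ((∫ x, ‖f x‖ ^ 2 : ℝ) : ℂ) := by
    refine Eq.trans ?_ (integral_ofReal (𝕜 := ℂ))
    congr 1; funext x
    change f x * conj (f x) = _
    rw [mul_conj, normSq_eq_norm_sq]; rfl
  rw [e, ofReal_eq_zero] at h0
  have hint : Integrable (fun v => ‖f v‖ ^ 2) := hf.integrable_norm_pow (by norm_num)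
  filter_upwards [(integral_eq_zero_iff_of_nonneg (fun v => by positivity) hint).1 h0] with v hv
  simpa using hv

lemma norm_mFourier_apply (k : ι → ℤ) (x : UnitAddTorus ι) : ‖mFourier k x‖ = 1 := by
  simp only [mFourier, ContinuousMap.coe_mk, fourier_apply, norm_prod]
  exact Finset.prod_eq_one fun i _ => Circle.norm_coe _

lemma mFourier_add_arg (k : ι → ℤ) (x y : UnitAddTorus ι) :
    mFourier k (x + y) = mFourier k x * mFourier k y := by
  simp only [mFourier, ContinuousMap.coe_mk, Pi.add_apply, ← prod_mul_distrib]
  refine prod_congr rfl fun i _ => ?_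
  simp [fourier_apply, smul_add, AddCircle.toCircle_add]

lemma mFourier_neg_arg (k : ι → ℤ) (x : UnitAddTorus ι) : mFourier k (-x) = mFourier (-k) x := by
  simp only [mFourier, ContinuousMap.coe_mk, Pi.neg_apply]
  refine prod_congr rfl fun i _ => ?_
  simp [fourier_apply]

lemma mFourier_sub_arg (k : ι → ℤ) (x y : UnitAddTorus ι) :
    mFourier k (x - y) = mFourier k x * mFourier (-k) y := by
  rw [sub_eq_add_neg, mFourier_add_arg, mFourier_neg_arg]

lemma integral_mFourier (k : ι → ℤ) :
    ∫ x : UnitAddTorus ι, mFourier k x = if k = 0 then 1 else 0 := by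
  split_ifs with h
  · subst h; simp [mFourier_zero]
  · obtain ⟨i, hi⟩ := Function.ne_iff.1 h
    have hi : k i ≠ 0 := hi
    rw [volume_unitAddTorus]
    simp only [mFourier, ContinuousMap.coe_mk]
    rw [integral_fintype_prod_eq_prod (fun i (x : UnitAddCircle) => (fourier (k i) x : ℂ))]
    refine Finset.prod_eq_zero (mem_univ i) ?_
    have h2 := (orthonormal_iff_ite.mp (orthonormal_fourier (T := 1))) 0 (k i)
    rw [if_neg hi.symm, ContinuousMap.inner_toLp] at h2
    simpa using h2

end Fourier

/-! ### Splitting positions and velocities -/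

section Split

/-- The measure `M_β^{⊗n} dv` on velocities. -/
def velPi (d : ℕ) (β : ℝ) (n : ℕ) : Measure (Fin n → Vel d) := Measure.pi fun _ => velMeasure d β

/-- The configuration with given positions and velocities. -/
def zipPV (x : Fin n → Torus d) (v : 𝕍 n) : Fin n → Phase d := fun j => (x j, v j)

lemma prob_velPi (hβ : 0 < β) (n : ℕ) : IsProbabilityMeasure (velPi d β n) := by
  have := prob_vel (d := d) hβ
  unfold velPi; infer_instance

lemma preserves_zipPV (hβ : 0 < β) :
    MeasurePreserving (fun p : (Fin n → Torus d) × (Fin n → Vel d) => zipPV p.1 p.2)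
      (volume.prod (velPi d β n)) (Ψ n) := by
  have := prob_vel (d := d) hβ
  exact (measurePreserving_arrowProdEquivProdArrow (Torus d) (Vel d) (Fin n)
    (fun _ => volume) (fun _ => ϖ)).symm

lemma preserves_zipPV' (hβ : 0 < β) :
    MeasurePreserving (fun p : (Fin n → Vel d) × (Fin n → Torus d) => zipPV p.2 p.1)
      ((velPi d β n).prod volume) (Ψ n) := by
  have := prob_velPi (d := d) hβ n
  exact (preserves_zipPV hβ).comp Measure.measurePreserving_swap

lemma measurableEmbedding_zipPV' :
    MeasurableEmbedding (fun p : (𝕍 n) × (Fin n → Torus d) => zipPV p.2 p.1) :=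
  (MeasurableEquiv.prodComm.trans
    (MeasurableEquiv.arrowProdEquivProdArrow (Torus d) (Vel d) (Fin n)).symm).measurableEmbedding

lemma preserves_vel (hβ : 0 < β) : MeasurePreserving (fun (z : Fin n → Phase d) j => (z j).2) (Ψ n)
      (velPi d β n) := by
  have := prob_vel (d := d) hβ
  exact measurePreserving_snd.comp (measurePreserving_arrowProdEquivProdArrow (Torus d) (Vel d)
    (Fin n) (fun _ => volume) (fun _ => ϖ))

/-- The plane wave `∏_j e_{k_j}(x_j)`. -/
def wave (k : Fin n → Λ) (x : Fin n → Torus d) : ℂ := ∏ j, mFourier (k j) (x j)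

@[fun_prop]
lemma continuous_wave (k : Fin n → Λ) : Continuous (wave k) := by
  unfold wave; fun_prop

lemma norm_wave (k : Fin n → Λ) (x : Fin n → Torus d) : ‖wave k x‖ = 1 := by
  simp [wave, norm_prod, norm_mFourier_apply]

/-- The Fourier coefficient of `f` in the positions, against the plane wave `k`. -/
def modeCoeff (k : Fin n → Λ) (f : Obs n) (v : 𝕍 n) : ℂ := ∫ x, f (zipPV x v) * wave k x

lemma memLp_wave_mul_zip (hβ : 0 < β) (k : Fin n → Λ) {f : Obs n}
    {p : ℝ≥0∞} (hf : MemLp f p (Ψ n)) :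
    MemLp (fun q : (𝕍 n) × (Fin n → Torus d) => f (zipPV q.2 q.1) * wave k q.2) p
      ((velPi d β n).prod volume) := by
  have h1 := hf.comp_measurePreserving (preserves_zipPV' hβ)
  refine h1.mono (h1.aestronglyMeasurable.mul (by fun_prop))
    (ae_of_all _ fun q => ?_)
  rw [norm_mul, norm_wave, mul_one]; rfl

lemma memLp_modeCoeff (hβ : 0 < β) (k : Fin n → Λ) {f : Obs n}
    (hf : MemLp f 2 (Ψ n)) : MemLp (modeCoeff k f) 2 (velPi d β n) := by
  have := prob_velPi (d := d) hβ n
  exact memLp_integral_prod (memLp_wave_mul_zip hβ k hf)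

lemma integral_phase (hβ : 0 < β) {f : Obs n} (hf : Integrable f (Ψ n)) :
    ∫ z, f z ∂Ψ n = ∫ v, (∫ x, f (zipPV x v)) ∂velPi d β n := by
  have := prob_velPi (d := d) hβ n
  rw [← (preserves_zipPV' hβ).integral_comp measurableEmbedding_zipPV']
  exact integral_prod _ ((preserves_zipPV' hβ).integrable_comp_of_integrable hf)

lemma integral_mul_wave_mul (hβ : 0 < β) (k : Fin n → Λ) {f : Obs n}
    (hf : MemLp f 2 (Ψ n)) {φ : (Fin n → Vel d) → ℂ} (hφ : MemLp φ 2 (velPi d β n)) :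
    ∫ z, f z * (wave k (fun j => (z j).1) * φ fun j => (z j).2) ∂Ψ n
      = ∫ v, modeCoeff k f v * φ v ∂velPi d β n := by
  have := prob_velPi (d := d) hβ n
  have h1 := hφ.comp_measurePreserving (preserves_vel hβ)
  have h2 : MemLp (fun z : Fin n → Phase d => wave k (fun j => (z j).1) * φ fun j => (z j).2) 2
      (Ψ n) := by
    refine h1.mono ((Continuous.aestronglyMeasurable (by fun_prop)).mul h1.aestronglyMeasurable)
      (ae_of_all _ fun q => ?_)
    rw [norm_mul, norm_wave, one_mul]; rfl
  have key := integral_phase hβ (f := fun z => f z * (wave k (fun j => (z j).1) *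
    φ fun j => (z j).2)) (hf.integrable_mul h2)
  rw [key]
  congr 1; funext v
  rw [modeCoeff, ← integral_mul_const]
  congr 1; funext x
  simp only [zipPV]; ring

/-- Configurations of `n` points of the torus are identified with one torus of dimension `nd`, to
which the Fourier theory applies. -/
lemma preserves_curry : MeasurePreserving
    (fun (y : UnitAddTorus (Fin n × Fin d)) (j : Fin n) (a : Fin d) => y (j, a)) volume volume := by
  refine ⟨by fun_prop, ?_⟩
  have key := Measure.infinitePi_map_curry (ι := Fin n) (κ := Fin d) (X := UnitAddCircle)
    (fun _ _ => AddCircle.haarAddCircle)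
  simp only [Measure.infinitePi_eq_pi] at key
  have e : (volume : Measure (Fin n → Torus d))
      = Measure.pi fun _ => Measure.pi fun _ => AddCircle.haarAddCircle := by
    rw [← volume_unitAddTorus]; rfl
  rw [e, ← key, volume_unitAddTorus]
  rfl

lemma wave_curry (k : Fin n × Fin d → ℤ) (y : UnitAddTorus (Fin n × Fin d)) :
    wave (fun j a => k (j, a)) (fun j a => y (j, a)) = mFourier k y := by
  simp [wave, mFourier, Fintype.prod_prod_type]

lemma ae_eq_zero_of_wave {f : (Fin n → Torus d) → ℂ} (hf : MemLp f 2)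
    (h : ∀ k, ∫ x, f x * wave k x = 0) : f =ᵐ[volume] 0 := by
  have mp := preserves_curry (n := n) (d := d)
  have me : MeasurableEmbedding
      (fun (y : UnitAddTorus (Fin n × Fin d)) (j : Fin n) (a : Fin d) => y (j, a)) :=
    (MeasurableEquiv.curry (Fin n) (Fin d) UnitAddCircle).measurableEmbedding
  have key := ae_eq_zero_of_fourier (hf.comp_measurePreserving mp) fun k => by
    rw [← h fun j a => k (j, a), ← mp.integral_comp me]
    simp_rw [wave_curry]; rfl
  rw [← mp.map_eq]
  refine (me.ae_map_iff).2 ?_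
  filter_upwards [key] with y hy using hy

/-- For almost every velocity all the position coefficients vanish and the section is square
integrable, so the section vanishes. Fubini's theorem then gives the claim. -/
lemma ae_eq_zero_of_modeCoeff (hβ : 0 < β) {f : Obs n}
    (hf : MemLp f 2 (Ψ n)) (h : ∀ k, modeCoeff k f =ᵐ[velPi d β n] 0) : f =ᵐ[Ψ n] 0 := by
  have := prob_velPi (d := d) hβ n
  have h1 := hf.comp_measurePreserving (preserves_zipPV' hβ)
  have h2 : Integrable (fun q : (Fin n → Vel d) × (Fin n → Torus d) => ‖f (zipPV q.2 q.1)‖ ^ 2)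
      ((velPi d β n).prod volume) := h1.integrable_norm_pow (by norm_num)
  have h3 : ∀ᵐ v ∂velPi d β n, ∀ᵐ x : Fin n → Torus d, f (zipPV x v) = 0 := by
    filter_upwards [ae_all_iff.2 h, h2.prod_right_ae, h1.aestronglyMeasurable.prodMk_left]
      with v k1 k2 k3
    have k4 : MemLp (fun x : Fin n → Torus d => f (zipPV x v)) 2 :=
      (memLp_two_iff_integrable_sq_norm k3).2 k2
    filter_upwards [ae_eq_zero_of_wave k4 k1] with x hx using hx
  rw [← (preserves_zipPV' hβ).map_eq]
  refine (measurableEmbedding_zipPV'.ae_map_iff).2 ?_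
  have h4 := h1.aestronglyMeasurable
  have h5 : ∀ᵐ v ∂velPi d β n, ∀ᵐ x : Fin n → Torus d, ‖f (zipPV x v)‖ ^ 2 = 0 := by
    filter_upwards [h3] with v hv
    filter_upwards [hv] with x hx
    simp [hx]
  have h6 : ∫ q : (Fin n → Vel d) × (Fin n → Torus d), ‖f (zipPV q.2 q.1)‖ ^ 2
      ∂(velPi d β n).prod volume = 0 := by
    rw [integral_prod _ h2]
    refine (integral_congr_ae (g := 0) ?_).trans (by simp)
    filter_upwards [h5] with v hv
    exact (integral_congr_ae (g := 0) hv).trans (by simp)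
  filter_upwards [(integral_eq_zero_iff_of_nonneg (fun v => by positivity) h2).1 h6] with q hq
  simpa using hq

lemma ae_eq_zero_of_velTest (hβ : 0 < β) {h : (Fin n → Vel d) → ℂ} (hh : MemLp h 2 (velPi d β n))
    (H : ∀ φ : (Fin n → Vel d) → ℂ, ContDiff ℝ (⊤ : ℕ∞) φ → HasCompactSupport φ →
      ∫ v, h v * φ v ∂velPi d β n = 0) : h =ᵐ[velPi d β n] 0 := by
  have := prob_velPi (d := d) hβ n
  refine ae_eq_zero_of_integral_contDiff_smul_eq_zero
    (hh.integrable (by norm_num)).locallyIntegrable fun g hg hgs => ?_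
  rw [← H (fun v => (g v : ℂ)) (ofRealCLM.contDiff.comp hg) (hgs.comp_left (g := ofReal) rfl)]
  congr 1; funext v
  rw [real_smul, mul_comm]

end Split

/-! ### Test functions -/

/-- The covering of `𝔻ⁿ` by `(ℝᵈ × ℝᵈ)ⁿ`. -/
def cover (y : Fin n → (Fin d → ℝ) × Vel d) : Fin n → Phase d :=
  fun i => ((fun a => ((y i).1 a : UnitAddCircle)), (y i).2)

/-- Smoothness of test functions is defined on the covering space. Being an open quotient map lets
the continuity of their derivatives descend to phase space. -/
lemma isOpenQuotientMap_cover : IsOpenQuotientMap (cover (d := d) (n := n)) := by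
  have h1 : IsOpenQuotientMap (fun t : ℝ => (t : UnitAddCircle)) :=
    QuotientAddGroup.isOpenQuotientMap_mk
  have h2 : IsOpenQuotientMap (Pi.map fun (_ : Fin d) (t : ℝ) => (t : UnitAddCircle)) :=
    IsOpenQuotientMap.piMap fun _ => h1
  exact IsOpenQuotientMap.piMap fun (_ : Fin n) => h2.prodMap (IsOpenQuotientMap.id (X := Vel d))

lemma cover_surjective (z : Fin n → Phase d) : ∃ y, cover y = z :=
  isOpenQuotientMap_cover.surjective z

/-- Translation of the positions. -/
def shift (s : Fin n → Torus d) (z : Fin n → Phase d) : Fin n → Phase d :=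
  fun i => ((z i).1 + s i, (z i).2)

lemma continuous_shift (s : Fin n → Torus d) : Continuous (shift s) := by
  unfold shift; fun_prop

lemma preserves_shift (hβ : 0 < β) (s : Fin n → Torus d) :
    MeasurePreserving (shift s) (Ψ n) (Ψ n) := by
  have := prob_vel (d := d) hβ
  have := prob_one (d := d) hβ
  exact measurePreserving_pi _ _ fun i =>
    (measurePreserving_add_right (volume : Measure (Torus d)) (s i)).prod
      (MeasurePreserving.id ϖ)

lemma measurableEmbedding_shift (s : Fin n → Torus d) : MeasurableEmbedding (shift s) := by
  have h : ∀ s : Fin n → Torus d, Function.LeftInverse (shift (-s)) (shift s) := fun s z => by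
    funext i; simp [shift]
  have hm : ∀ s : Fin n → Torus d, Measurable (shift s) := fun s => by unfold shift; fun_prop
  have h' : Function.RightInverse (shift (-s)) (shift s) := fun z => by
    funext i; simp [shift]
  exact (⟨⟨shift s, shift (-s), h s, h'⟩, hm s, hm (-s)⟩ : (Fin n → Phase d) ≃ᵐ (Fin n → Phase d)).measurableEmbedding

/-- The unit translation of coordinate `a` of particle `j`. -/
def unitShift (j : Fin n) (a : Fin d) (t : ℝ) : Fin n → Torus d :=
  Pi.single j (Pi.single a (t : UnitAddCircle))

lemma update_eq_shift (j : Fin n) (a : Fin d) (t : ℝ) (z : Fin n → Phase d) :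
    update z j ((z j).1 + Pi.single a (t : UnitAddCircle), (z j).2)
      = shift (unitShift j a t) z := by
  funext i
  rcases eq_or_ne i j with rfl | h
  · simp [shift, unitShift]
  · simp [shift, unitShift, h]

lemma shift_cover (j : Fin n) (a : Fin d) (t : ℝ) (y : Fin n → (Fin d → ℝ) × Vel d) :
    shift (unitShift j a t) (cover y)
      = cover (y + t • (Pi.single j (Pi.single a 1, 0) : Fin n → (Fin d → ℝ) × Vel d)) := by
  funext i
  rcases eq_or_ne i j with rfl | h
  · simp only [shift, unitShift, cover, Pi.single_eq_same, Pi.add_apply, Pi.smul_apply,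
      Prod.fst_add, Prod.snd_add, Prod.smul_mk, smul_zero, add_zero]
    congr 1
    funext b
    rcases eq_or_ne b a with rfl | hb
    · simp
    · simp [hb]
  · simp [shift, unitShift, cover, h]

lemma update_cover (j : Fin n) (w : Vel d) (y : Fin n → (Fin d → ℝ) × Vel d) :
    update (cover y) j ((cover y j).1, w) = cover (y + Pi.single j (0, w - (y j).2)) := by
  funext i
  rcases eq_or_ne i j with rfl | h
  · simp [cover]
  · simp [cover, h]

namespace IsTest

variable {ψ : (Fin n → Phase d) → ℂ}

lemma contDiff_comp_cover (h : IsTest ψ) : ContDiff ℝ (⊤ : ℕ∞) fun y => ψ (cover y) := h.smooth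

lemma continuous (h : IsTest ψ) : Continuous ψ :=
  isOpenQuotientMap_cover.continuous_comp_iff.1 h.contDiff_comp_cover.continuous

lemma hasFDerivAt (h : IsTest ψ) (y : Fin n → (Fin d → ℝ) × Vel d) :
    HasFDerivAt (fun y => ψ (cover y)) (fderiv ℝ (fun y => ψ (cover y)) y) y :=
  (h.contDiff_comp_cover.differentiable (by simp) y).hasFDerivAt

lemma hasDerivAt_cover (h : IsTest ψ) (j : Fin n) (a : Fin d) (y : Fin n → (Fin d → ℝ) × Vel d) :
    HasDerivAt (fun t : ℝ => ψ (shift (unitShift j a t) (cover y)))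
      (fderiv ℝ (fun y => ψ (cover y)) y (Pi.single j (Pi.single a 1, 0))) 0 := by
  simp_rw [shift_cover]
  set e : Fin n → (Fin d → ℝ) × Vel d := Pi.single j (Pi.single a 1, 0)
  have h1 : HasDerivAt (fun t : ℝ => y + t • e) ((1 : ℝ) • e) 0 :=
    ((hasDerivAt_id (0 : ℝ)).smul_const e).const_add y
  have h2 : HasFDerivAt (fun y => ψ (cover y)) (fderiv ℝ (fun y => ψ (cover y)) y)
      (y + (0 : ℝ) • e) := by simpa using h.hasFDerivAt y
  simpa [Function.comp_def] using h2.comp_hasDerivAt (0 : ℝ) h1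

lemma dx_cover (h : IsTest ψ) (j : Fin n) (a : Fin d) (y : Fin n → (Fin d → ℝ) × Vel d) :
    dx j a ψ (cover y) = fderiv ℝ (fun y => ψ (cover y)) y (Pi.single j (Pi.single a 1, 0)) := by
  simp only [dx, update_eq_shift]
  exact (h.hasDerivAt_cover j a y).deriv

lemma dv_cover (h : IsTest ψ) (j : Fin n) (a : Fin d) (y : Fin n → (Fin d → ℝ) × Vel d) :
    dv j a ψ (cover y)
      = fderiv ℝ (fun y => ψ (cover y)) y (Pi.single j (0, EuclideanSpace.single a 1)) := by
  simp only [dv, velDeriv, update_cover]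
  have h1 : HasFDerivAt (fun w : Vel d =>
      y + (Pi.single j ((0 : Fin d → ℝ), w - (y j).2) : Fin n → (Fin d → ℝ) × Vel d))
      ((ContinuousLinearMap.single ℝ (fun _ : Fin n => (Fin d → ℝ) × Vel d) j).comp
        (ContinuousLinearMap.inr ℝ (Fin d → ℝ) (Vel d))) (cover y j).2 := by
    refine HasFDerivAt.const_add _ ?_
    have h3 : HasFDerivAt (fun w : Vel d => w - (y j).2) (ContinuousLinearMap.id ℝ (Vel d))
      (cover y j).2 := (hasFDerivAt_id _).sub_const _
    exact (((ContinuousLinearMap.single ℝ (fun _ : Fin n => (Fin d → ℝ) × Vel d) j).comp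
        (ContinuousLinearMap.inr ℝ (Fin d → ℝ) (Vel d))).hasFDerivAt).comp (cover y j).2 h3
  have h2 : HasFDerivAt (fun y => ψ (cover y)) (fderiv ℝ (fun y => ψ (cover y)) y)
      (y + (Pi.single j ((0 : Fin d → ℝ), (cover y j).2 - (y j).2) :
        Fin n → (Fin d → ℝ) × Vel d)) := by
    have h0 : (Pi.single j ((0 : Fin d → ℝ), (cover y j).2 - (y j).2) :
        Fin n → (Fin d → ℝ) × Vel d) = 0 := by
      simp only [cover, sub_self]
      exact Pi.single_zero j
    rw [h0, add_zero]
    exact h.hasFDerivAt y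
  have h4 := (h2.comp (cover y j).2 h1).fderiv
  simp only [Function.comp_def] at h4
  rw [h4]; simp

lemma continuous_dx (h : IsTest ψ) (j : Fin n) (a : Fin d) : Continuous (dx j a ψ) := by
  refine isOpenQuotientMap_cover.continuous_comp_iff.1 ?_
  have : dx j a ψ ∘ cover = fun y =>
      fderiv ℝ (fun y => ψ (cover y)) y (Pi.single j (Pi.single a 1, 0)) :=
    funext fun y => h.dx_cover j a y
  rw [this]
  exact (h.contDiff_comp_cover.continuous_fderiv (by simp)).clm_apply continuous_const

lemma continuous_dv (h : IsTest ψ) (j : Fin n) (a : Fin d) : Continuous (dv j a ψ) := by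
  refine isOpenQuotientMap_cover.continuous_comp_iff.1 ?_
  have : dv j a ψ ∘ cover = fun y =>
      fderiv ℝ (fun y => ψ (cover y)) y (Pi.single j (0, EuclideanSpace.single a 1)) :=
    funext fun y => h.dv_cover j a y
  rw [this]
  exact (h.contDiff_comp_cover.continuous_fderiv (by simp)).clm_apply continuous_const

lemma hasDerivAt_shift (h : IsTest ψ) (j : Fin n) (a : Fin d) (z : Fin n → Phase d) (t : ℝ) :
    HasDerivAt (fun t : ℝ => ψ (shift (unitShift j a t) z))
      (dx j a ψ (shift (unitShift j a t) z)) t := by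
  obtain ⟨y, hy⟩ := cover_surjective (shift (unitShift j a t) z)
  have h1 := h.hasDerivAt_cover j a y
  rw [← h.dx_cover, hy] at h1
  have h2 : HasDerivAt (fun s : ℝ => s - t) 1 t := (hasDerivAt_id t).sub_const t
  have h3 := HasDerivAt.scomp (𝕜 := ℝ) t (h := fun s : ℝ => s - t)
    (g₁ := fun s : ℝ => ψ (shift (unitShift j a s) (shift (unitShift j a t) z)))
    (g₁' := dx j a ψ (shift (unitShift j a t) z)) (h' := 1) (by simpa using h1) h2
  rw [one_smul] at h3
  refine h3.congr_of_eventuallyEq (Eventually.of_forall fun s => ?_)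
  simp only [Function.comp_def]
  congr 1
  funext i
  simp only [shift]
  congr 1
  rw [add_assoc, ← Pi.add_apply, unitShift, unitShift, unitShift, ← Pi.single_add,
    ← Pi.single_add, ← AddCircle.coe_add]
  simp

lemma eventually_eq_zero {z : Fin n → Phase d} (hz : z ∉ tsupport ψ) : ∀ᶠ z' in 𝓝 z, ψ z' = 0 := by
  filter_upwards [(isClosed_tsupport ψ).isOpen_compl.mem_nhds hz] with z' hz'
  exact image_eq_zero_of_notMem_tsupport hz'

lemma hasCompactSupport_dx (h : IsTest ψ) (j : Fin n) (a : Fin d) :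
    HasCompactSupport (dx j a ψ) := by
  refine HasCompactSupport.intro h.compactSupport fun z hz => ?_
  simp only [dx, update_eq_shift]
  have hc : ContinuousAt (fun t : ℝ => shift (unitShift j a t) z) 0 := by
    refine Continuous.continuousAt ?_
    refine continuous_pi fun i => ?_
    have h1 : Continuous fun t : ℝ => unitShift j a t i := by
      have : Continuous fun t : ℝ => (Pi.single a (t : UnitAddCircle) : Torus d) :=
        (continuous_single a).comp (AddCircle.continuous_mk' 1)
      exact (continuous_apply i).comp ((continuous_single j).comp this)
    exact (continuous_const.add h1).prodMk continuous_const
  have h0 : shift (unitShift j a 0) z = z := by funext i; simp [shift, unitShift]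
  have hev := hc.eventually (p := fun z' => ψ z' = 0) (by
    change ∀ᶠ y in 𝓝 (shift (unitShift j a 0) z), ψ y = 0
    rw [h0]; exact eventually_eq_zero hz)
  have : (fun t : ℝ => ψ (shift (unitShift j a t) z)) =ᶠ[𝓝 0] fun _ => 0 := hev
  rw [this.deriv_eq]; simp

lemma hasCompactSupport_dv (h : IsTest ψ) (j : Fin n) (a : Fin d) :
    HasCompactSupport (dv j a ψ) := by
  refine HasCompactSupport.intro h.compactSupport fun z hz => ?_
  simp only [dv, velDeriv]
  have hc : ContinuousAt (fun w : Vel d => update z j ((z j).1, w)) (z j).2 := by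
    refine Continuous.continuousAt ?_
    exact continuous_const.update j (continuous_const.prodMk continuous_id)
  have hev := hc.eventually (p := fun z' => ψ z' = 0) (by simpa using eventually_eq_zero hz)
  have : (fun w : Vel d => ψ (update z j ((z j).1, w))) =ᶠ[𝓝 (z j).2] fun _ => 0 := hev
  rw [this.fderiv_eq]; simp

lemma exists_bound (h : IsTest ψ) : ∃ B, 0 ≤ B ∧ ∀ z, ‖ψ z‖ ≤ B := by
  obtain ⟨B, hB⟩ := h.compactSupport.exists_bound_of_continuous h.continuous
  exact ⟨max B 0, le_max_right _ _, fun z => (hB z).trans (le_max_left _ _)⟩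

lemma exists_bound_dx (h : IsTest ψ) (j : Fin n) (a : Fin d) :
    ∃ B, 0 ≤ B ∧ ∀ z, ‖dx j a ψ z‖ ≤ B := by
  obtain ⟨B, hB⟩ := (h.hasCompactSupport_dx j a).exists_bound_of_continuous (h.continuous_dx j a)
  exact ⟨max B 0, le_max_right _ _, fun z => (hB z).trans (le_max_left _ _)⟩

lemma exists_bound_dv (h : IsTest ψ) (j : Fin n) (a : Fin d) :
    ∃ B, 0 ≤ B ∧ ∀ z, ‖dv j a ψ z‖ ≤ B := by
  obtain ⟨B, hB⟩ := (h.hasCompactSupport_dv j a).exists_bound_of_continuous (h.continuous_dv j a)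
  exact ⟨max B 0, le_max_right _ _, fun z => (hB z).trans (le_max_left _ _)⟩

end IsTest

/-! ### Product test functions -/

lemma mFourier_single_coe (k : Λ) (a : Fin d) (t : ℝ) :
    mFourier k (Pi.single a (t : UnitAddCircle)) = cexp (2 * π * I * k a * t) := by
  simp only [mFourier, ContinuousMap.coe_mk]
  rw [Finset.prod_eq_single a]
  · rw [Pi.single_eq_same, fourier_coe_apply]; simp
  · intro b _ hb
    rw [Pi.single_eq_of_ne hb]; simp
  · simp

lemma wave_shift (k : Fin n → Λ) (j : Fin n) (a : Fin d) (t : ℝ) (x : Fin n → Torus d) :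
    wave k (x + unitShift j a t) = cexp (2 * π * I * k j a * t) * wave k x := by
  simp only [wave, Pi.add_apply, mFourier_add_arg, prod_mul_distrib]
  rw [mul_comm]
  congr 1
  rw [Finset.prod_eq_single j]
  · simp [unitShift, mFourier_single_coe]
  · intro b _ hb
    simp [unitShift, hb, mFourier]
  · simp

lemma mFourier_coe (k : Λ) (y : Fin d → ℝ) :
    mFourier k (fun a => (y a : UnitAddCircle)) = cexp (2 * π * I * ∑ a, k a * y a) := by
  simp only [mFourier, ContinuousMap.coe_mk, fourier_coe_apply, ← Complex.exp_sum]
  congr 1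
  rw [ofReal_sum, mul_sum]
  refine sum_congr rfl fun a _ => ?_
  simp; ring

/-- The function `e_k(x) φ(v)` on `𝔻ⁿ`. -/
def waveMul (k : Fin n → Λ) (φ : 𝕍 n → ℂ) (z : Fin n → Phase d) : ℂ :=
  wave k (fun j => (z j).1) * φ fun j => (z j).2

lemma isTest_waveMul (k : Fin n → Λ) {φ : 𝕍 n → ℂ}
    (hφ : ContDiff ℝ (⊤ : ℕ∞) φ) (hc : HasCompactSupport φ) : IsTest (waveMul k φ) := by
  constructor
  · simp only [waveMul, wave, mFourier_coe]
    refine ContDiff.mul ?_ ?_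
    · have hs : ∀ j, ContDiff ℝ (⊤ : ℕ∞) fun y : Fin n → (Fin d → ℝ) × Vel d =>
          ∑ a, (k j a : ℝ) * (y j).1 a := fun j => by
        refine ContDiff.sum fun a _ => contDiff_const.mul ?_
        have h1 : ContDiff ℝ (⊤ : ℕ∞) fun y : Fin n → (Fin d → ℝ) × Vel d => (y j).1 :=
          contDiff_fst.comp (contDiff_apply ℝ _ j)
        exact (contDiff_apply ℝ ℝ a).comp h1
      exact contDiff_prod fun j _ => ContDiff.cexp (contDiff_const.mul
        (ofRealCLM.contDiff.comp (hs j)))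
    · refine hφ.comp (contDiff_pi.2 fun j => ?_)
      exact contDiff_snd.comp (contDiff_apply ℝ _ j)
  · refine HasCompactSupport.intro (K := (fun p : (Fin n → Torus d) × (𝕍 n) =>
      zipPV p.1 p.2) '' (univ ×ˢ tsupport φ)) ?_ fun z hz => ?_
    · refine (isCompact_univ.prod hc).image ?_
      unfold zipPV; fun_prop
    · have : (fun j => (z j).2) ∉ tsupport φ := fun h =>
        hz ⟨(fun j => (z j).1, fun j => (z j).2), ⟨mem_univ _, h⟩, rfl⟩
      simp [waveMul, image_eq_zero_of_notMem_tsupport this]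

lemma waveMul_shift (k : Fin n → Λ) (φ : 𝕍 n → ℂ) (j : Fin n) (a : Fin d)
    (t : ℝ) (z : Fin n → Phase d) : waveMul k φ (shift (unitShift j a t) z)
      = cexp (2 * π * I * k j a * t) * waveMul k φ z := by
  have := wave_shift k j a t fun i => (z i).1
  simp only [waveMul, shift] at this ⊢
  rw [show (fun i => (z i).1 + unitShift j a t i) = (fun i => (z i).1) + unitShift j a t from rfl,
    this, mul_assoc]

lemma hasDerivAt_cexp_mul_zero (c : ℂ) : HasDerivAt (fun t : ℝ => cexp (c * t)) c 0 := by
  have h : HasDerivAt (fun t : ℝ => c * (t : ℂ)) (c * 1) 0 :=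
    (hasDerivAt_id ((0 : ℝ) : ℂ)).comp_ofReal.const_mul c
  simpa using h.cexp

lemma dx_waveMul (k : Fin n → Λ) (φ : 𝕍 n → ℂ) (j : Fin n) (a : Fin d)
    (z : Fin n → Phase d) : dx j a (waveMul k φ) z = 2 * π * I * k j a * waveMul k φ z := by
  simp only [dx, update_eq_shift, waveMul_shift]
  exact ((hasDerivAt_cexp_mul_zero _).mul_const _).deriv

/-- The velocity profile is only integrable. The integral against a translated test function is
differentiated in two ways: under the integral, and after moving the translation onto the plane
wave, where it is an explicit exponential. -/
lemma integral_waveMul_mul_dx (hβ : 0 < β) (k : Fin n → Λ) {h : 𝕍 n → ℂ}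
    (hh : Integrable h (velPi d β n)) {ψ : Obs n} (hψ : IsTest ψ) (j : Fin n) (a : Fin d) :
    ∫ z, waveMul k h z * dx j a ψ z ∂Ψ n
      = -(2 * π * I * k j a) * ∫ z, waveMul k h z * ψ z ∂Ψ n := by
  have hint : Integrable (waveMul k h) (Ψ n) := by
    have h1 := (preserves_vel hβ).integrable_comp_of_integrable hh
    exact h1.bdd_mul (c := 1) (Continuous.aestronglyMeasurable (by fun_prop))
      (ae_of_all _ fun z => by rw [norm_wave])
  obtain ⟨B, hB0, hB⟩ := hψ.exists_bound
  obtain ⟨B', hB'0, hB'⟩ := hψ.exists_bound_dx j a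
  have c0 := hψ.continuous
  have c1 := hψ.continuous_dx j a
  have i1 : ∀ t : ℝ, Integrable (fun z => waveMul k h z * ψ (shift (unitShift j a t) z))
      (Ψ n) := fun t =>
    hint.mul_bdd (c := B) (c0.comp (continuous_shift _)).aestronglyMeasurable
      (ae_of_all _ fun z => hB _)
  have key := hasDerivAt_integral_of_dominated_loc_of_deriv_le (μ := Ψ n) (𝕜 := ℝ)
    (F := fun (t : ℝ) z => waveMul k h z * ψ (shift (unitShift j a t) z))
    (F' := fun (t : ℝ) z => waveMul k h z * dx j a ψ (shift (unitShift j a t) z))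
    (x₀ := 0) (s := univ) (bound := fun z => ‖waveMul k h z‖ * B') univ_mem
    (Eventually.of_forall fun t => (i1 t).aestronglyMeasurable) (i1 0)
    (hint.aestronglyMeasurable.mul (c1.comp (continuous_shift _)).aestronglyMeasurable)
    (ae_of_all _ fun z t _ => by
      rw [norm_mul]; exact mul_le_mul_of_nonneg_left (hB' _) (norm_nonneg _))
    (hint.norm.mul_const _)
    (ae_of_all _ fun z t _ => (hψ.hasDerivAt_shift j a z t).const_mul _)
  have h0 : ∀ z : Fin n → Phase d, shift (unitShift j a 0) z = z := fun z => by
    funext i; simp [shift, unitShift]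
  have k1 := key.2
  simp only [h0] at k1
  have e : ∀ t : ℝ, ∫ z, waveMul k h z * ψ (shift (unitShift j a t) z) ∂Ψ n
      = cexp (-(2 * π * I * k j a) * t) * ∫ z, waveMul k h z * ψ z ∂Ψ n := by
    intro t
    rw [← (preserves_shift hβ (unitShift j a t)).integral_comp
      (measurableEmbedding_shift _) (fun z => waveMul k h z * ψ z), ← integral_const_mul]
    congr 1; funext z
    rw [waveMul_shift, ← mul_assoc, ← mul_assoc, ← exp_add]
    simp
  simp only [e] at k1
  exact k1.unique ((hasDerivAt_cexp_mul_zero _).mul_const _)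

/-- A bounded gradient field whose potential has nonnegative, even, summable Fourier coefficients
`Vh`. -/
structure GradField (F : Torus d → Vel d) (K : ℝ) (Vh : Λ → ℝ) : Prop where
  measurable : Measurable F
  bound : ∀ x, ‖F x‖ ≤ K
  coeff : ∀ (a : Fin d) (k : Λ),
    ∫ x, (F x a : ℂ) * mFourier (-k) x = 2 * π * I * k a * Vh k
  nonneg : ∀ k, 0 ≤ Vh k
  neg : ∀ k, Vh (-k) = Vh k
  sum_le : ∀ s : Finset Λ, ∑ k ∈ s, Vh k ≤ K

/-! ### `L²` functions on phase space -/

section L2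

variable {X : Type*} [MeasurableSpace X] {μ : Measure X}

lemma hasSum_integral_mul {κ : Type*} {f : κ → Lp ℂ 2 μ} {F : Lp ℂ 2 μ} (hs : HasSum f F)
    {χ : X → ℂ} (hχ : MemLp χ 2 μ) :
    HasSum (fun k => ∫ x, (f k : X → ℂ) x * χ x ∂μ) (∫ x, (F : X → ℂ) x * χ x ∂μ) := by
  have h1 := hs.mapL (innerSL ℂ (hχ.star.toLp _))
  have e : ∀ u : Lp ℂ 2 μ, innerSL ℂ (hχ.star.toLp _) u = ∫ x, (u : X → ℂ) x * χ x ∂μ := by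
    intro u
    rw [innerSL_apply_apply, L2.inner_def]
    refine integral_congr_ae ?_
    filter_upwards [hχ.star.coeFn_toLp] with x hx
    rw [hx]
    simp
  simpa only [e] using h1

end L2

lemma memLp_vel (hβ : 0 < β) (j : Fin n) (a : Fin d) :
    MemLp (fun z : Fin n → Phase d => ((z j).2 a : ℂ)) 2 (Ψ n) := by
  have := prob_vel (d := d) hβ
  have := prob_one (d := d) hβ
  have h1 : MeasurePreserving (fun z : Fin n → Phase d => (z j).2) (Ψ n)
      ϖ :=
    (measurePreserving_snd (μ := (volume : Measure (Torus d)))).comp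
      (measurePreserving_eval (fun _ : Fin n => oneMeasure d β) j)
  exact ((memLp_coord_velMeasure hβ a 2 (by norm_num)).comp_measurePreserving h1).ofReal

lemma memLp_of_continuous_bounded (hβ : 0 < β) {f : Obs n} (hf : Continuous f)
    {B : ℝ} (hB : ∀ z, ‖f z‖ ≤ B) {p : ℝ≥0∞} : MemLp f p (Ψ n) := by
  have := prob_phase (d := d) hβ n
  exact MemLp.of_bound hf.aestronglyMeasurable B (ae_of_all _ hB)

lemma memLp_mul_continuous_bounded {f g : Obs n} {p : ℝ≥0∞}
    (hf : MemLp f p (Ψ n)) (hg : Continuous g) {B : ℝ} (hB : ∀ z, ‖g z‖ ≤ B) :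
    MemLp (fun z => f z * g z) p (Ψ n) := by
  refine (hf.const_mul (B : ℂ)).mono (hf.aestronglyMeasurable.mul hg.aestronglyMeasurable)
    (ae_of_all _ fun z => ?_)
  rw [norm_mul, norm_mul, norm_real, mul_comm]
  exact mul_le_mul_of_nonneg_right ((hB z).trans (le_abs_self _)) (norm_nonneg _)

/-! ### The transposed Vlasov operator -/

/-- The kernel `∂_a V(x - y)`. -/
def forceKer (F : Torus d → Vel d) (a : Fin d) (x y : Phase d) : ℂ := (F (x.1 - y.1) a : ℂ)

lemma measurable_forceKer {F : Torus d → Vel d} (hF : Measurable F) (a : Fin d) :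
    Measurable fun p : Phase d × Phase d => forceKer F a p.1 p.2 := by
  unfold forceKer
  have : Measurable fun v : Vel d => (v a : ℂ) := by fun_prop
  exact this.comp (hF.comp (by fun_prop))

lemma measurable_forceKer_swap {F : Torus d → Vel d} (hF : Measurable F) (a : Fin d) :
    Measurable fun p : Phase d × Phase d => forceKer F a p.2 p.1 :=
  Measurable.fun_comp (g := fun p : Phase d × Phase d => forceKer F a p.1 p.2)
    (f := fun p : Phase d × Phase d => (p.2, p.1)) (measurable_forceKer hF a) measurable_swap

lemma norm_forceKer_le {F : Torus d → Vel d} {K : ℝ} (hF : ∀ x, ‖F x‖ ≤ K) (a : Fin d)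
    (x y : Phase d) : ‖forceKer F a x y‖ ≤ K := by
  rw [forceKer, norm_real]
  exact (PiLp.norm_apply_le _ _).trans (hF _)

/-- The transpose of the Vlasov operator, acting on test functions. -/
def vlasovAdj (β : ℝ) (F : Torus d → Vel d) (N m : ℕ) (ψ : Obs (m + 1))
    (z : Fin (m + 1) → Phase d) : ℂ :=
  -transport ψ z + ∑ j, if j = 0 then 0 else (((N : ℝ) + 1 - m) / N * β : ℝ) *
    ∑ a, coordOp (oneMeasure d β) (fun x y => forceKer F a y x) j
      (fun z => ((z j).2 a : ℂ) * ψ z) z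

variable {F : Torus d → Vel d} {K : ℝ} {Vh : (Fin d → ℤ) → ℝ} {N m : ℕ}

lemma memLp_transport (hβ : 0 < β) {ψ : Obs n} (hψ : IsTest ψ) : MemLp (transport ψ) 2 (Ψ n) := by
  refine memLp_finsetSum _ fun j _ => memLp_finsetSum _ fun a _ => ?_
  obtain ⟨B, -, hB⟩ := hψ.exists_bound_dx j a
  exact memLp_mul_continuous_bounded (memLp_vel hβ j a) (hψ.continuous_dx j a) hB

lemma memLp_vel_mul (hβ : 0 < β) {ψ : Obs n} (hψ : IsTest ψ) (j : Fin n)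
    (a : Fin d) : MemLp (fun z => ((z j).2 a : ℂ) * ψ z) 2 (Ψ n) := by
  obtain ⟨B, -, hB⟩ := hψ.exists_bound
  exact memLp_mul_continuous_bounded (memLp_vel hβ j a) hψ.continuous hB

lemma IsTest.memLp (hβ : 0 < β) {ψ : Obs n} (hψ : IsTest ψ) : MemLp ψ 2 (Ψ n) := by
  obtain ⟨B, -, hB⟩ := hψ.exists_bound
  exact memLp_of_continuous_bounded hβ hψ.continuous hB

lemma memLp_vlasovAdj (hβ : 0 < β) (hF : GradField F K Vh) {ψ : Obs (m + 1)} (hψ : IsTest ψ) :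
    MemLp (vlasovAdj β F N m ψ) 2 (Ψ (m + 1)) := by
  have := prob_one (d := d) hβ
  have h2 : ∀ j : Fin (m + 1), MemLp (fun z => if j = 0 then 0 else
      (((N : ℝ) + 1 - m) / N * β : ℝ) *
      ∑ a, coordOp (oneMeasure d β) (fun x y => forceKer F a y x) j
        (fun z => ((z j).2 a : ℂ) * ψ z) z) 2 (Ψ (m + 1)) := ?_
  · exact (memLp_transport hβ hψ).neg.add (memLp_finsetSum _ fun j _ => h2 j)
  intro j
  split_ifs
  · exact MemLp.zero'
  · have h3 : ∀ a : Fin d, MemLp (fun z => coordOp (oneMeasure d β)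
        (fun x y => forceKer F a y x) j (fun z => ((z j).2 a : ℂ) * ψ z) z) 2
        (Ψ (m + 1)) := fun a =>
      memLp_coordOp j (measurable_forceKer_swap hF.measurable a)
        (fun x y => norm_forceKer_le hF.bound a y x) (memLp_vel_mul hβ hψ j a)
    exact (memLp_finsetSum _ fun a _ => h3 a).const_mul _

lemma integral_vlasov (hβ : 0 < β) (hF : GradField F K Vh)
    {H : Obs (m + 1)} (hH : MemLp H 2 (Ψ (m + 1))) {ψ : Obs (m + 1)} (hψ : IsTest ψ) :
    ∫ z, (-(H z * transport ψ z) + meanFieldTerm β F N m H z * ψ z) ∂Ψ (m + 1)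
      = ∫ z, H z * vlasovAdj β F N m ψ z ∂Ψ (m + 1) := by
  have := prob_one (d := d) hβ
  set μ := Ψ (m + 1)
  set c : ℂ := ((((N : ℝ) + 1 - m) / N * β : ℝ) : ℂ)
  have hk := fun a : Fin d => measurable_forceKer hF.measurable a
  have hB := fun a : Fin d => norm_forceKer_le hF.bound a
  have iT : Integrable (fun z => -(H z * transport ψ z)) μ :=
    (hH.integrable_mul (memLp_transport hβ hψ)).neg
  have i1 : ∀ (j : Fin (m + 1)) (a : Fin d), Integrable (fun z =>
      ((z j).2 a : ℂ) * ψ z * coordOp (oneMeasure d β) (forceKer F a) j H z) μ := fun j a =>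
    (memLp_vel_mul hβ hψ j a).integrable_mul (memLp_coordOp j (hk a) (hB a) hH)
  have i2 : ∀ (j : Fin (m + 1)) (a : Fin d), Integrable (fun z =>
      H z * coordOp (oneMeasure d β) (fun x y => forceKer F a y x) j
        (fun z => ((z j).2 a : ℂ) * ψ z) z) μ := fun j a =>
    hH.integrable_mul (memLp_coordOp j (measurable_forceKer_swap hF.measurable a) (fun x y => hB a y x)
      (memLp_vel_mul hβ hψ j a))
  have e1 : ∀ z, meanFieldTerm β F N m H z * ψ z = ∑ j, if j = 0 then 0 else c *
      ∑ a, ((z j).2 a : ℂ) * ψ z * coordOp (oneMeasure d β) (forceKer F a) j H z := by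
    intro z
    rw [meanFieldTerm, sum_mul]
    refine sum_congr rfl fun j _ => ?_
    split_ifs
    · simp
    · rw [mul_assoc, sum_mul]
      congr 1
      refine sum_congr rfl fun a _ => ?_
      simp only [coordOp, forceKer]; ring
  have e2 : ∀ z, H z * vlasovAdj β F N m ψ z = -(H z * transport ψ z) +
      ∑ j, if j = 0 then 0 else c * ∑ a, H z * coordOp (oneMeasure d β)
        (fun x y => forceKer F a y x) j (fun z => ((z j).2 a : ℂ) * ψ z) z := by
    intro z
    rw [vlasovAdj, mul_add, mul_sum]
    congr 1
    · ring
    · refine sum_congr rfl fun j _ => ?_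
      split_ifs
      · simp
      · rw [mul_left_comm, mul_sum]
  simp_rw [e1, e2]
  have s1 : ∀ j : Fin (m + 1), Integrable (fun z => if j = 0 then 0 else c *
      ∑ a, ((z j).2 a : ℂ) * ψ z * coordOp (oneMeasure d β) (forceKer F a) j H z) μ := by
    intro j
    split_ifs
    · exact integrable_zero _ _ _
    · exact (integrable_finsetSum _ fun a _ => i1 j a).const_mul _
  have s2 : ∀ j : Fin (m + 1), Integrable (fun z => if j = 0 then 0 else c *
      ∑ a, H z * coordOp (oneMeasure d β)
        (fun x y => forceKer F a y x) j (fun z => ((z j).2 a : ℂ) * ψ z) z) μ := by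
    intro j
    split_ifs
    · exact integrable_zero _ _ _
    · exact (integrable_finsetSum _ fun a _ => i2 j a).const_mul _
  rw [integral_add iT (integrable_finsetSum _ fun j _ => s1 j),
    integral_add iT (integrable_finsetSum _ fun j _ => s2 j),
    integral_finsetSum _ fun j _ => s1 j, integral_finsetSum _ fun j _ => s2 j]
  congr 1
  refine sum_congr rfl fun j _ => ?_
  split_ifs
  · rfl
  · rw [integral_const_mul, integral_const_mul, integral_finsetSum _ fun a _ => i1 j a,
      integral_finsetSum _ fun a _ => i2 j a]
    congr 1
    refine sum_congr rfl fun a _ => ?_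
    exact integral_mul_coordOp j (hk a) (hB a) hH (memLp_vel_mul hβ hψ j a)

/-! ### The collision operator as a functional -/

lemma preserves_snoc {X : Type*} [MeasurableSpace X] (μ : Measure X)
    [IsProbabilityMeasure μ] (n : ℕ) :
    MeasurePreserving (fun p : (Fin n → X) × X => (Fin.snoc p.1 p.2 : Fin (n + 1) → X))
      ((Measure.pi fun _ => μ).prod μ) (Measure.pi fun _ => μ) := by
  have h1 := (measurePreserving_piFinSuccAbove (fun _ : Fin (n + 1) => μ) (Fin.last n)).symm
  have h2 := h1.comp (Measure.measurePreserving_swap (μ := Measure.pi fun _ : Fin n => μ) (ν := μ))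
  convert! h2 using 1
  funext p
  simp [MeasurableEquiv.piFinSuccAbove, Fin.insertNthEquiv, Fin.insertNth_last']

lemma measurableEmbedding_snoc {X : Type*} [MeasurableSpace X] (n : ℕ) :
    MeasurableEmbedding (fun p : (Fin n → X) × X => (Fin.snoc p.1 p.2 : Fin (n + 1) → X)) := by
  have := (MeasurableEquiv.prodComm.trans
    (MeasurableEquiv.piFinSuccAbove (fun _ : Fin (n + 1) => X)
      (Fin.last n)).symm).measurableEmbedding
  convert! this using 1
  funext p
  simp [MeasurableEquiv.piFinSuccAbove, Fin.insertNthEquiv, Fin.insertNth_last']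
  exact ⟨rfl, rfl⟩

/-- The transpose of `M_{m+2}^{m+1}`, acting on test functions. -/
def collisionAdj (F : Torus d → Vel d) (N m : ℕ) (ψ : Obs (m + 1))
    (z : Fin (m + 2) → Phase d) : ℂ :=
  -∑ j : Fin (m + 1), ∑ a, (((N : ℝ) - m) / N : ℝ) *
    (forceKer F a (z j.castSucc) (z (Fin.last _)) * dv j a ψ fun i => z i.castSucc)

lemma memLp_collisionTerm (hβ : 0 < β) (hF : GradField F K Vh)
    {ψ : Obs (m + 1)} (hψ : IsTest ψ) (j : Fin (m + 1)) (a : Fin d) :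
    MemLp (fun z : Fin (m + 2) → Phase d => forceKer F a (z j.castSucc) (z (Fin.last _)) *
      dv j a ψ fun i => z i.castSucc) 2 (Ψ (m + 2)) := by
  have := prob_phase (d := d) hβ (m + 2)
  obtain ⟨B, hB0, hB⟩ := hψ.exists_bound_dv j a
  have h1 : Measurable fun z : Fin (m + 2) → Phase d =>
      forceKer F a (z j.castSucc) (z (Fin.last _)) :=
    Measurable.fun_comp (g := fun p : Phase d × Phase d => forceKer F a p.1 p.2)
      (f := fun z : Fin (m + 2) → Phase d => (z j.castSucc, z (Fin.last _)))
      (measurable_forceKer hF.measurable a) (by fun_prop)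
  refine MemLp.of_bound (h1.aestronglyMeasurable.mul
    ((hψ.continuous_dv j a).comp (by fun_prop)).aestronglyMeasurable) (K * B)
    (ae_of_all _ fun z => ?_)
  rw [norm_mul]
  exact mul_le_mul (norm_forceKer_le hF.bound a _ _) (hB _) (norm_nonneg _)
    ((norm_nonneg _).trans (hF.bound 0))

lemma memLp_collisionAdj (hβ : 0 < β) (hF : GradField F K Vh) {ψ : Obs (m + 1)} (hψ : IsTest ψ) :
    MemLp (collisionAdj F N m ψ) 2 (Ψ (m + 2)) :=
  (memLp_finsetSum _ fun j _ => memLp_finsetSum _ fun a _ =>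
    (memLp_collisionTerm hβ hF hψ j a).const_mul _).neg

/-- Fubini's theorem rewrites the collision pairing as integration against a fixed `L²` function. It
therefore depends only on the class of `H` and passes to `L²` series. -/
lemma mPairing_eq (hβ : 0 < β) (hF : GradField F K Vh)
    {H : Obs (m + 2)} (hH : MemLp H 2 (Ψ (m + 2))) {ψ : Obs (m + 1)} (hψ : IsTest ψ) :
    mPairing β F N m H ψ = ∫ z, H z * collisionAdj F N m ψ z ∂Ψ (m + 2) := by
  have := prob_one (d := d) hβ
  have it : ∀ (j : Fin (m + 1)) (a : Fin d), Integrable (fun z => (((N : ℝ) - m) / N : ℝ) *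
      (H z * (forceKer F a (z j.castSucc) (z (Fin.last _)) *
        dv j a ψ fun i => z i.castSucc))) (Ψ (m + 2)) := fun j a =>
    (hH.integrable_mul (memLp_collisionTerm hβ hF hψ j a)).const_mul _
  have e1 : ∀ z, H z * collisionAdj F N m ψ z = -∑ j, ∑ a, (((N : ℝ) - m) / N : ℝ) *
      (H z * (forceKer F a (z j.castSucc) (z (Fin.last _)) * dv j a ψ fun i => z i.castSucc)) := by
    intro z
    rw [collisionAdj, mul_neg, mul_sum]
    congr 1
    refine sum_congr rfl fun j _ => ?_
    rw [mul_sum]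
    refine sum_congr rfl fun a _ => ?_
    ring
  simp_rw [e1]
  rw [integral_neg, integral_finsetSum _ fun j _ => integrable_finsetSum _ fun a _ => it j a,
    mPairing]
  congr 1
  refine sum_congr rfl fun j _ => ?_
  rw [integral_finsetSum _ fun a _ => it j a]
  refine sum_congr rfl fun a _ => ?_
  have mp := preserves_snoc (oneMeasure d β) (m + 1)
  have i3 := mp.integrable_comp_of_integrable (it j a)
  have i4 := (integral_prod _ i3).symm
  refine Eq.trans (Eq.trans ?_ i4) (mp.integral_comp (measurableEmbedding_snoc _)
    (fun z => (((N : ℝ) - m) / N : ℝ) * (H z * (forceKer F a (z j.castSucc) (z (Fin.last _)) *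
        dv j a ψ fun i => z i.castSucc))))
  refine integral_congr_ae (ae_of_all _ fun z => ?_)
  simp only [forceMoment, Function.comp_def, Fin.snoc_castSucc, Fin.snoc_last, forceKer]
  rw [integral_const_mul, mul_assoc, ← integral_mul_const]
  congr 2
  funext y; ring

/-! ### Uniqueness for the resolvents -/

lemma isVlasov_iff (hβ : 0 < β) (hF : GradField F K Vh) {H G : Obs (m + 1)} :
    IsVlasov β F N m H G ↔ MemLp H 2 (Ψ (m + 1)) ∧ MemLp G 2 (Ψ (m + 1)) ∧ ∀ ψ, IsTest ψ →
      ∫ z, H z * vlasovAdj β F N m ψ z ∂Ψ (m + 1) = ∫ z, G z * ψ z ∂Ψ (m + 1) :=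
  ⟨fun h => ⟨h.1, h.2, fun ψ hψ => by rw [← integral_vlasov hβ hF h.1 hψ, h.3 ψ hψ]⟩,
    fun h => ⟨h.1, h.2.1, fun ψ hψ => by rw [integral_vlasov hβ hF h.1 hψ, h.2.2 ψ hψ]⟩⟩

/-- The phase velocity `-2π k · v`. -/
def phaseVel (k : Λ) (v : Vel d) : ℝ := -(2 * π * ∑ a, k a * v a)

@[fun_prop]
lemma continuous_phaseVel (k : Λ) : Continuous (phaseVel k) := by
  unfold phaseVel; fun_prop

lemma abs_phaseVel_le (k : Λ) (v : Vel d) :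
    |phaseVel k v| ≤ (2 * π * ∑ a, |(k a : ℝ)|) * (1 + ‖v‖) := by
  rw [phaseVel, abs_neg, abs_mul, abs_of_pos Real.two_pi_pos]
  refine (mul_le_mul_of_nonneg_left ?_ Real.two_pi_pos.le).trans_eq (mul_assoc _ _ _).symm
  refine (Finset.abs_sum_le_sum_abs _ _).trans ?_
  rw [sum_mul]
  refine sum_le_sum fun a _ => ?_
  rw [abs_mul]
  refine mul_le_mul_of_nonneg_left ?_ (abs_nonneg _)
  have := PiLp.norm_apply_le v a
  rw [norm_eq_abs] at this
  linarith

lemma memLp_phaseVel_pow (hβ : 0 < β) (k : Λ) (i : ℕ) : MemLp (fun v => phaseVel k v ^ i) 2 ϖ := by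
  refine ((memLp_pow_velMeasure hβ i).const_mul ((2 * π * ∑ a, |(k a : ℝ)|) ^ i)).mono
    (by fun_prop) (ae_of_all _ fun v => ?_)
  rw [norm_pow, norm_eq_abs, ← mul_pow, norm_pow]
  exact pow_le_pow_left₀ (abs_nonneg _) ((abs_phaseVel_le k v).trans (le_abs_self _)) i

lemma integral_force_mul_mFourier (hF : GradField F K Vh) (a : Fin d) (k : Λ) :
    ∫ x, (F x a : ℂ) * mFourier k x = -(2 * π * I * k a * Vh k) := by
  have := hF.coeff a (-k)
  rw [neg_neg, hF.neg] at this
  rw [this]; simp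

lemma integral_oneMeasure_mul (hβ : 0 < β) (f : Torus d → ℂ) (g : Vel d → ℂ) :
    ∫ y, f y.1 * g y.2 ∂oneMeasure d β = (∫ x, f x) * ∫ v, g v ∂ϖ := by
  have := prob_vel (d := d) hβ
  exact integral_prod_mul f g

lemma wave_update (k : Fin n → Λ) (j : Fin n) (x : Fin n → Torus d) (y : Torus d) :
    wave k (update x j y) = wave k x * mFourier (k j) (y - x j) := by
  rw [wave, wave, ← mul_prod_erase _ _ (mem_univ j),
    ← mul_prod_erase _ (fun i => mFourier (k i) (x i)) (mem_univ j),
    update_self]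
  have h1 : ∏ i ∈ Finset.univ.erase j, mFourier (k i) (update x j y i)
      = ∏ i ∈ Finset.univ.erase j, mFourier (k i) (x i) :=
    prod_congr rfl fun i hi => by rw [update_of_ne (Finset.ne_of_mem_erase hi)]
  have h2 : mFourier (k j) y = mFourier (k j) (x j) * mFourier (k j) (y - x j) := by
    rw [← mFourier_add_arg]; simp
  rw [h1, h2]; ring

lemma waveMul_update (k : Fin n → Λ) (φ : 𝕍 n → ℂ) (j : Fin n)
    (z : Fin n → Phase d) (y : Phase d) : waveMul k φ (update z j y) = wave k (fun i => (z i).1) *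
      (mFourier (k j) (y.1 - (z j).1) * φ (update (fun i => (z i).2) j y.2)) := by
  have e1 : (fun i => (update z j y i).1) = update (fun i => (z i).1) j y.1 := by
    funext i; rcases eq_or_ne i j with rfl | h <;> simp [*]
  have e2 : (fun i => (update z j y i).2) = update (fun i => (z i).2) j y.2 := by
    funext i; rcases eq_or_ne i j with rfl | h <;> simp [*]
  simp only [waveMul, e1, e2]
  rw [wave_update, mul_assoc]

/-- A convolution with the force acts on a plane wave as multiplication by a Fourier coefficient.
The kernel is transposed, which reverses the sign of the coefficient because the force is odd. -/
lemma coordOp_swap_waveMul (hβ : 0 < β) (hF : GradField F K Vh) (k : Fin n → Λ)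
    (φ : 𝕍 n → ℂ) (j : Fin n) (a : Fin d) (z : Fin n → Phase d) :
    coordOp (oneMeasure d β) (fun x y => forceKer F a y x) j
      (fun z => ((z j).2 a : ℂ) * waveMul k φ z) z
      = wave k (fun i => (z i).1) * (-(2 * π * I * k j a * Vh (k j)) *
        avg ϖ j (fun v => (v j a : ℂ) * φ v) fun i => (z i).2) := by
  have e : ∀ y : Phase d, forceKer F a y (z j) * (((update z j y j).2 a : ℂ) *
      waveMul k φ (update z j y)) = wave k (fun i => (z i).1) *
      (((F (y.1 - (z j).1) a : ℂ) * mFourier (k j) (y.1 - (z j).1)) *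
        ((y.2 a : ℂ) * φ (update (fun i => (z i).2) j y.2))) := by
    intro y
    rw [waveMul_update, update_self, forceKer]; ring
  rw [coordOp]
  simp_rw [e]
  rw [integral_const_mul, integral_oneMeasure_mul hβ
    (fun x => (F (x - (z j).1) a : ℂ) * mFourier (k j) (x - (z j).1))
    (fun v => (v a : ℂ) * φ (update (fun i => (z i).2) j v)),
    integral_sub_right_eq_self (fun x => (F x a : ℂ) * mFourier (k j) x) (z j).1,
    integral_force_mul_mFourier hF]
  simp [avg]

/-- The transposed Vlasov operator on a Fourier mode. -/
def modeAdj (β : ℝ) (Vh : Λ → ℝ) (N m : ℕ) (k : Fin (m + 1) → Λ)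
    (φ : 𝕍 (m + 1) → ℂ) (v : 𝕍 (m + 1)) : ℂ :=
  I * ((∑ j, phaseVel (k j) (v j) : ℝ) : ℂ) * φ v + ∑ j, if j = 0 then 0 else
    (((N : ℝ) + 1 - m) / N * β : ℝ) * ∑ a, -(2 * π * I * k j a * Vh (k j)) *
      avg (velMeasure d β) j (fun v => (v j a : ℂ) * φ v) v

lemma transport_waveMul (k : Fin n → Λ) (φ : 𝕍 n → ℂ) (z : Fin n → Phase d) :
    -transport (waveMul k φ) z = I * ((∑ j, phaseVel (k j) (z j).2 : ℝ) : ℂ) * waveMul k φ z := by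
  simp only [transport, dx_waveMul, phaseVel, ofReal_sum, ofReal_neg, ofReal_mul, ofReal_intCast,
    ofReal_ofNat, mul_sum, sum_mul, ← sum_neg_distrib]
  refine sum_congr rfl fun j _ => sum_congr rfl fun a _ => ?_
  ring

lemma vlasovAdj_waveMul (hβ : 0 < β) (hF : GradField F K Vh) (k : Fin (m + 1) → Λ)
    (φ : 𝕍 (m + 1) → ℂ) (z : Fin (m + 1) → Phase d) :
    vlasovAdj β F N m (waveMul k φ) z = waveMul k (modeAdj β Vh N m k φ) z := by
  rw [vlasovAdj, transport_waveMul]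
  simp only [coordOp_swap_waveMul hβ hF]
  rw [waveMul, waveMul, modeAdj, mul_add, mul_sum]
  congr 1
  · ring
  · refine sum_congr rfl fun j _ => ?_
    split_ifs
    · simp
    · rw [← mul_sum, mul_left_comm]

section VelPi

lemma memLp_velPi_coord (hβ : 0 < β) {f : Vel d → ℂ} {p : ℝ≥0∞} (hf : MemLp f p ϖ)
    (j : Fin n) : MemLp (fun v => f (v j)) p (velPi d β n) := by
  have := prob_vel (d := d) hβ
  exact hf.comp_measurePreserving (measurePreserving_eval (fun _ : Fin n => ϖ) j)

lemma memLp_mul_bounded {X : Type*} [MeasurableSpace X] {μ : Measure X} {p : ℝ≥0∞} {f g : X → ℂ}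
    (hf : MemLp f p μ) (hg : AEStronglyMeasurable g μ) {B : ℝ} (hB : ∀ x, ‖g x‖ ≤ B) :
    MemLp (fun x => f x * g x) p μ := by
  refine (hf.const_mul (B : ℂ)).mono (hf.aestronglyMeasurable.mul hg) (ae_of_all _ fun z => ?_)
  rw [norm_mul, norm_mul, norm_real, mul_comm]
  exact mul_le_mul_of_nonneg_right ((hB z).trans (le_abs_self _)) (norm_nonneg _)

lemma memLp_vel_coord (hβ : 0 < β) (j : Fin n) (a : Fin d) :
    MemLp (fun v : 𝕍 n => (v j a : ℂ)) 2 (velPi d β n) :=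
  memLp_velPi_coord hβ (memLp_coord_velMeasure hβ a 2 (by norm_num)).ofReal j

lemma memLp_phaseVel_coord (hβ : 0 < β) (k : Λ) (j : Fin n) :
    MemLp (fun v : Fin n → Vel d => (phaseVel k (v j) : ℂ)) 2 (velPi d β n) := by
  have := (memLp_phaseVel_pow (d := d) hβ k 1).ofReal (K := ℂ)
  simp only [pow_one] at this
  exact memLp_velPi_coord hβ this j

end VelPi

local notation "Φ" => velPi d β

/-- Testing with plane waves times a velocity profile turns the distributional equation in phase
space into an equation in the velocities alone. The coefficient is taken against the wave of wave
number `k`, hence the minus sign in `phaseVel`. -/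
lemma IsVlasov.modeCoeff_eq (hβ : 0 < β) (hF : GradField F K Vh)
    {H G : Obs (m + 1)} (hV : IsVlasov β F N m H G) (k : Fin (m + 1) → Λ) :
    ∀ᵐ v ∂Φ (m + 1), I * ((∑ j, phaseVel (k j) (v j) : ℝ) : ℂ) * modeCoeff k H v
      + ∑ j, (if j = 0 then 0 else (((N : ℝ) + 1 - m) / N * β * Vh (k j) : ℝ) *
        (I * phaseVel (k j) (v j) * avg ϖ j (modeCoeff k H) v))
      = modeCoeff k G v := by
  have := prob_vel (d := d) hβ
  have := prob_velPi (d := d) hβ (m + 1)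
  obtain ⟨hH, hG, hw⟩ := (isVlasov_iff hβ hF).1 hV
  set μ := Φ (m + 1) with hμ
  set c : ℂ := ((((N : ℝ) + 1 - m) / N * β : ℝ) : ℂ) with hc
  set h := modeCoeff k H with hh
  have mh : MemLp h 2 μ := memLp_modeCoeff hβ k hH
  have mg := memLp_modeCoeff hβ k hG
  have mav : ∀ j, MemLp (avg ϖ j h) 2 μ := fun j => memLp_avg j mh
  set A : (Fin (m + 1) → Vel d) → ℂ := fun v => I * ((∑ j, phaseVel (k j) (v j) : ℝ) : ℂ) with hA
  have mA : MemLp A 2 μ := by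
    have h1 : MemLp (fun v : Fin (m + 1) → Vel d => ∑ j, (phaseVel (k j) (v j) : ℂ)) 2 μ :=
      memLp_finsetSum _ fun j _ => memLp_phaseVel_coord hβ (k j) j
    have := h1.const_mul I
    simpa only [hA, ofReal_sum] using this
  set B : Fin (m + 1) → (Fin (m + 1) → Vel d) → ℂ := fun j v => if j = 0 then 0 else
      (((N : ℝ) + 1 - m) / N * β * Vh (k j) : ℝ) * (I * phaseVel (k j) (v j) * avg ϖ j h v) with hB
  have iA : Integrable (fun v => A v * h v) μ := mA.integrable_mul mh
  have iB : ∀ j, Integrable (B j) μ := by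
    intro j
    simp only [hB]
    split_ifs
    · exact integrable_zero _ _ _
    · exact (((memLp_phaseVel_coord hβ (k j) j).const_mul I).integrable_mul (mav j)).const_mul _
  have iS : Integrable (fun v => ∑ j, B j v) μ := integrable_finsetSum _ fun j _ => iB j
  have ig : Integrable (modeCoeff k G) μ := mg.integrable (by norm_num)
  have key : (fun v => A v * h v + ∑ j, B j v - modeCoeff k G v) =ᵐ[μ] 0 := by
    refine ae_eq_zero_of_integral_contDiff_smul_eq_zero
      ((iA.add iS).sub ig).locallyIntegrable fun g hg hgs => ?_
    set φ : (Fin (m + 1) → Vel d) → ℂ := fun v => (g v : ℂ) with hφ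
    have cφ : ContDiff ℝ (⊤ : ℕ∞) φ := ofRealCLM.contDiff.comp hg
    have sφ : HasCompactSupport φ := hgs.comp_left (g := ofReal) rfl
    obtain ⟨R, hR⟩ := sφ.exists_bound_of_continuous cφ.continuous
    have bφ := cφ.continuous.aestronglyMeasurable (μ := μ)
    have mφ : MemLp φ 2 μ := MemLp.of_bound bφ R (ae_of_all _ hR)
    have mv : ∀ j a, MemLp (fun v : Fin (m + 1) → Vel d => (v j a : ℂ) * φ v) 2 μ := fun j a =>
      memLp_mul_bounded (memLp_vel_coord hβ j a) bφ hR
    have mT1 : MemLp (fun v => A v * φ v) 2 μ := memLp_mul_bounded mA bφ hR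
    set s : Fin (m + 1) → Fin d → ℂ := fun j a => -(2 * π * I * k j a * Vh (k j)) with hs
    set q : Fin (m + 1) → Fin d → 𝕍 (m + 1) → ℂ := fun j a => avg ϖ j fun v => (v j a : ℂ) * φ v
    have mq : ∀ j a, MemLp (q j a) 2 μ := fun j a => memLp_avg j (mv j a)
    set T : Fin (m + 1) → 𝕍 (m + 1) → ℂ := fun j v => if j = 0 then 0 else c * ∑ a, s j a * q j a v
      with hT
    have mT2 : ∀ j, MemLp (T j) 2 μ := by
      intro j
      simp only [hT]
      split_ifs
      · exact MemLp.zero'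
      · exact (memLp_finsetSum _ fun a _ => (mq j a).const_mul (s j a)).const_mul _
    have madj : MemLp (modeAdj β Vh N m k φ) 2 μ := mT1.add (memLp_finsetSum _ fun j _ => mT2 j)
    have w1 := hw _ (isTest_waveMul k cφ sφ)
    -- The velocity average destroys compact support, so `modeAdj φ` is not a test profile. It is
    -- square integrable, which is all that the splitting into modes requires.
    have w2 : ∫ v, h v * modeAdj β Vh N m k φ v ∂μ = ∫ v, modeCoeff k G v * φ v ∂μ := by
      rw [← integral_mul_wave_mul hβ k hH madj, ← integral_mul_wave_mul hβ k hG mφ]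
      simp only [vlasovAdj_waveMul hβ hF] at w1
      exact w1
    have w3 : ∫ v, h v * modeAdj β Vh N m k φ v ∂μ
        = ∫ v, A v * h v * φ v ∂μ + ∑ j, ∫ v, B j v * φ v ∂μ := by
      have i1 : Integrable (fun v => h v * (A v * φ v)) μ := mh.integrable_mul mT1
      have i2 : ∀ j, Integrable (fun v => h v * T j v) μ := fun j => mh.integrable_mul (mT2 j)
      have e : ∀ v, h v * modeAdj β Vh N m k φ v = h v * (A v * φ v) + ∑ j, h v * T j v := by
        intro v; rw [modeAdj, mul_add, mul_sum]
      simp_rw [e]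
      rw [integral_add i1 (integrable_finsetSum _ fun j _ => i2 j),
        integral_finsetSum _ fun j _ => i2 j]
      congr 1
      · congr 1; funext v; ring
      refine sum_congr rfl fun j _ => ?_
      simp only [hB, hT]
      split_ifs
      · simp
      have i3 : ∀ a : Fin d, Integrable (fun v => h v * q j a v) μ := fun a =>
        mh.integrable_mul (mq j a)
      have i4 : ∀ a : Fin d, Integrable (fun v => (v j a : ℂ) * φ v * avg ϖ j h v) μ := fun a =>
        (mv j a).integrable_mul (mav j)
      have e1 : ∀ v, h v * (c * ∑ a, s j a * q j a v) = ∑ a, c * s j a * (h v * q j a v) := by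
        intro v
        rw [mul_sum, mul_sum]
        refine sum_congr rfl fun a _ => by ring
      have e2 : ∀ v : Fin (m + 1) → Vel d, (((N : ℝ) + 1 - m) / N * β * Vh (k j) : ℝ) *
          (I * phaseVel (k j) (v j) * avg ϖ j h v) * φ v
          = ∑ a, c * s j a * ((v j a : ℂ) * φ v * avg ϖ j h v) := by
        intro v
        rw [phaseVel, hc, hs]
        push_cast
        simp only [mul_sum, sum_mul, mul_neg, neg_mul, ← sum_neg_distrib]
        refine sum_congr rfl fun a _ => by ring
      simp_rw [e1, e2]
      rw [integral_finsetSum _ fun a _ => (i3 a).const_mul _,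
        integral_finsetSum _ fun a _ => (i4 a).const_mul _]
      refine sum_congr rfl fun a _ => ?_
      rw [integral_const_mul, integral_const_mul]
      congr 1
      exact (integral_mul_avg j mh (mv j a)).symm
    have j1 : Integrable (fun v => A v * h v * φ v) μ := iA.mul_bdd (c := R) bφ (ae_of_all _ hR)
    have j2 : ∀ j, Integrable (fun v => B j v * φ v) μ := fun j =>
      (iB j).mul_bdd (c := R) bφ (ae_of_all _ hR)
    have j3 : Integrable (fun v => modeCoeff k G v * φ v) μ :=
      ig.mul_bdd (c := R) bφ (ae_of_all _ hR)
    have e : ∀ v, g v • (A v * h v + ∑ j, B j v - modeCoeff k G v)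
        = A v * h v * φ v + ∑ j, B j v * φ v - modeCoeff k G v * φ v := by
      intro v
      rw [real_smul, ← sum_mul]; ring
    have a1 := integral_sub (j1.add (integrable_finsetSum Finset.univ fun j _ => j2 j)) j3
    have a2 := integral_add j1 (integrable_finsetSum Finset.univ fun j _ => j2 j)
    simp only [Pi.add_apply] at a1
    change ∫ v, g v • (A v * h v + ∑ j, B j v - modeCoeff k G v) ∂μ = 0
    simp_rw [e]
    rw [a1, a2, integral_finsetSum _ fun j _ => j2 j, ← w3, w2, sub_self]
  filter_upwards [key] with v hv
  exact sub_eq_zero.1 hv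

lemma IsResolvent.sub (hβ : 0 < β) (hF : GradField F K Vh) {ω : ℂ}
    {G G' H H' : Obs (m + 1)} (h : IsResolvent β F N m ω G H)
    (h' : IsResolvent β F N m ω G' H') (hG : G =ᵐ[Ψ (m + 1)] G') :
    IsVlasov β F N m (fun z => H z - H' z) fun z => I * ω * (H z - H' z) := by
  obtain ⟨m1, m2, w⟩ := (isVlasov_iff hβ hF).1 h
  obtain ⟨m1', m2', w'⟩ := (isVlasov_iff hβ hF).1 h'
  refine (isVlasov_iff hβ hF).2 ⟨m1.sub m1', (m1.sub m1').const_mul _, fun ψ hψ => ?_⟩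
  have i1 : Integrable (fun z => H z * vlasovAdj β F N m ψ z) _ :=
    m1.integrable_mul (memLp_vlasovAdj hβ hF hψ)
  have i2 : Integrable (fun z => H' z * vlasovAdj β F N m ψ z) _ :=
    m1'.integrable_mul (memLp_vlasovAdj hβ hF hψ)
  have i3 : Integrable (fun z => (G z + I * ω * H z) * ψ z) _ := m2.integrable_mul (hψ.memLp hβ)
  have i4 : Integrable (fun z => (G' z + I * ω * H' z) * ψ z) _ := m2'.integrable_mul (hψ.memLp hβ)
  simp_rw [sub_mul]
  rw [integral_sub i1 i2, w ψ hψ, w' ψ hψ, ← integral_sub i3 i4]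
  refine integral_congr_ae ?_
  filter_upwards [hG] with z hz
  rw [hz]; ring

lemma modeCoeff_const_mul (k : Fin n → Λ) (c : ℂ) (f : Obs n)
    (v : 𝕍 n) : modeCoeff k (fun z => c * f z) v = c * modeCoeff k f v := by
  simp only [modeCoeff, ← integral_const_mul, mul_assoc]

lemma memLp_sq_phaseVel (hβ : 0 < β) (k : Λ) :
    MemLp (fun v => phaseVel k v ^ 2) 2 ϖ := memLp_phaseVel_pow hβ k 2

/-- The tagged particle carries no mean-field term, so its phase velocity plays the role of the
unbounded multiplier `c`. The couplings of the two background particles are nonnegative by positive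
definiteness and `N ≥ 1`. -/
theorem IsResolvent.unique_three (hβ : 0 < β) (hF : GradField F K Vh) (hN : 1 ≤ N) {ω : ℂ}
    (hω : 0 < ω.im) {G G' H H' : Obs 3} (h : IsResolvent β F N 2 ω G H)
    (h' : IsResolvent β F N 2 ω G' H') (hG : G =ᵐ[Ψ 3] G') : H =ᵐ[Ψ 3] H' := by
  have := prob_vel (d := d) hβ
  have hs := h.sub hβ hF h' hG
  have hN' : (1 : ℝ) ≤ N := by exact_mod_cast hN
  have key : (fun z => H z - H' z) =ᵐ[Ψ 3] 0 := by
    refine ae_eq_zero_of_modeCoeff hβ hs.1 fun k => ?_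
    have hnull : IsNullMode ϖ (1 : Fin 3) 2 (fun v => phaseVel (k 0) (v 0))
        (phaseVel (k 1)) (phaseVel (k 2)) (((N : ℝ) + 1 - (2 : ℕ)) / N * β * Vh (k 1))
        (((N : ℝ) + 1 - (2 : ℕ)) / N * β * Vh (k 2)) ω (modeCoeff k fun z => H z - H' z) := by
      have hc : 0 ≤ ((N : ℝ) + 1 - (2 : ℕ)) / N * β := by
        refine mul_nonneg (div_nonneg ?_ (by positivity)) hβ.le
        push_cast; linarith
      refine ⟨by fun_prop, fun v y => by simp, fun v y => by simp, by fun_prop, by fun_prop,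
        memLp_sq_phaseVel hβ _, memLp_sq_phaseVel hβ _, mul_nonneg hc (hF.nonneg _),
        mul_nonneg hc (hF.nonneg _), hω, memLp_modeCoeff hβ k hs.1, ?_⟩
      filter_upwards [hs.modeCoeff_eq hβ hF k] with v hv
      rw [modeCoeff_const_mul] at hv
      have e1 : ∀ f : Fin (2 + 1) → ℝ, ∑ j, f j = f 0 + f 1 + f 2 := Fin.sum_univ_three
      have e2 : ∀ f : Fin (2 + 1) → ℂ, ∑ j, f j = f 0 + f 1 + f 2 := Fin.sum_univ_three
      rw [e1, e2, if_pos rfl, if_neg (by decide), if_neg (by decide), zero_add] at hv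
      refine mul_left_cancel₀ I_ne_zero ?_
      push_cast at hv ⊢
      linear_combination hv
    exact hnull.ae_eq_zero (by decide)
  filter_upwards [key] with z hz
  exact sub_eq_zero.1 hz

/-- The same scheme applies with `c = 0`, the tagged particle being regarded as a second coupled
coordinate of coupling zero. -/
theorem IsResolvent.unique_two (hβ : 0 < β) (hF : GradField F K Vh) {ω : ℂ}
    (hω : 0 < ω.im) {G G' H H' : Obs 2} (h : IsResolvent β F N 1 ω G H)
    (h' : IsResolvent β F N 1 ω G' H') (hG : G =ᵐ[Ψ 2] G') : H =ᵐ[Ψ 2] H' := by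
  have := prob_vel (d := d) hβ
  have hs := h.sub hβ hF h' hG
  have key : (fun z => H z - H' z) =ᵐ[Ψ 2] 0 := by
    refine ae_eq_zero_of_modeCoeff hβ hs.1 fun k => ?_
    have hnull : IsNullMode ϖ (1 : Fin 2) 0 (fun v => 0)
        (phaseVel (k 1)) (phaseVel (k 0)) (((N : ℝ) + 1 - (1 : ℕ)) / N * β * Vh (k 1))
        0 ω (modeCoeff k fun z => H z - H' z) := by
      have hc : 0 ≤ ((N : ℝ) + 1 - (1 : ℕ)) / N * β := by
        refine mul_nonneg (div_nonneg ?_ (by positivity)) hβ.le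
        push_cast; linarith [Nat.cast_nonneg (α := ℝ) N]
      refine ⟨by fun_prop, fun v y => by simp, fun v y => by simp, by fun_prop, by fun_prop,
        memLp_sq_phaseVel hβ _, memLp_sq_phaseVel hβ _, mul_nonneg hc (hF.nonneg _),
        le_rfl, hω, memLp_modeCoeff hβ k hs.1, ?_⟩
      filter_upwards [hs.modeCoeff_eq hβ hF k] with v hv
      rw [modeCoeff_const_mul] at hv
      have e1 : ∀ f : Fin (1 + 1) → ℝ, ∑ j, f j = f 0 + f 1 := Fin.sum_univ_two
      have e2 : ∀ f : Fin (1 + 1) → ℂ, ∑ j, f j = f 0 + f 1 := Fin.sum_univ_two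
      rw [e1, e2, if_pos rfl, if_neg (by decide), zero_add] at hv
      refine mul_left_cancel₀ I_ne_zero ?_
      push_cast at hv ⊢
      linear_combination hv
    exact hnull.ae_eq_zero (by decide)
  filter_upwards [key] with z hz
  exact sub_eq_zero.1 hz

/-- A square integrable function is determined by its pairings with plane waves times smooth
velocity profiles, and these pairings see only the class of `H`. -/
lemma IsMApplied.unique (hβ : 0 < β) (hF : GradField F K Vh)
    {H H' : Obs (m + 2)} {K₁ K₂ : Obs (m + 1)} (mH : MemLp H 2 (Ψ (m + 2)))
    (hH : H =ᵐ[Ψ (m + 2)] H') (h : IsMApplied β F N m H K₁)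
    (h' : IsMApplied β F N m H' K₂) : K₁ =ᵐ[Ψ (m + 1)] K₂ := by
  have hd : MemLp (fun z => K₁ z - K₂ z) 2 (Ψ (m + 1)) := h.memLp.sub h'.memLp
  have key : (fun z => K₁ z - K₂ z) =ᵐ[Ψ (m + 1)] 0 := by
    refine ae_eq_zero_of_modeCoeff hβ hd fun k => ?_
    refine ae_eq_zero_of_velTest hβ (memLp_modeCoeff hβ k hd) fun φ hφ hs => ?_
    have hψ := isTest_waveMul k hφ hs
    have := prob_velPi (d := d) hβ (m + 1)
    obtain ⟨R, hR⟩ := hs.exists_bound_of_continuous hφ.continuous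
    have mφ : MemLp φ 2 (Φ (m + 1)) :=
      MemLp.of_bound hφ.continuous.aestronglyMeasurable R (ae_of_all _ hR)
    rw [← integral_mul_wave_mul hβ k hd mφ]
    change ∫ z, (K₁ z - K₂ z) * waveMul k φ z ∂_ = 0
    have i1 : Integrable (fun z => K₁ z * waveMul k φ z) (Ψ (m + 1)) :=
      h.memLp.integrable_mul (hψ.memLp hβ)
    have i2 : Integrable (fun z => K₂ z * waveMul k φ z) (Ψ (m + 1)) :=
      h'.memLp.integrable_mul (hψ.memLp hβ)
    simp_rw [sub_mul]
    rw [integral_sub i1 i2, h.weak _ hψ, h'.weak _ hψ, mPairing_eq hβ hF mH hψ,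
      mPairing_eq hβ hF (mH.ae_eq hH) hψ, sub_eq_zero]
    refine integral_congr_ae ?_
    filter_upwards [hH] with z hz
    rw [hz]
  filter_upwards [key] with z hz
  exact sub_eq_zero.1 hz

theorem IsInitCorrelation.unique (hβ : 0 < β) (hF : GradField F K Vh) (hN : 1 ≤ N) {ω : ℂ}
    (hω : 0 < ω.im) {V : Torus d → ℝ} {f : Vel d → ℝ} {H₃ H₃' : Obs 3}
    {K₂ H₂ K₂' H₂' : Obs 2} (h : IsInitCorrelation β V F f N ω H₃ K₂ H₂)
    (h' : IsInitCorrelation β V F f N ω H₃' K₂' H₂') : H₃ =ᵐ[Ψ 3] H₃' ∧ K₂ =ᵐ[Ψ 2] K₂' ∧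
      H₂ =ᵐ[Ψ 2] H₂' := by
  have h3 := h.resolvent_three.unique_three hβ hF hN hω h'.resolvent_three ae_eq_rfl
  have h2 := h.apply_M.unique hβ hF h.resolvent_three.memLp_left h3 h'.apply_M
  exact ⟨h3, h2, h.resolvent_two.unique_two hβ hF hω h'.resolvent_two h2⟩

/-! ### The operators on Fourier modes -/

lemma memLp_waveMul (hβ : 0 < β) (k : Fin n → Λ) {h : 𝕍 n → ℂ} {p : ℝ≥0∞}
    (hh : MemLp h p (Φ n)) : MemLp (waveMul k h) p (Ψ n) := by
  have h1 := hh.comp_measurePreserving (preserves_vel hβ)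
  refine h1.mono ((Continuous.aestronglyMeasurable (by fun_prop)).mul h1.aestronglyMeasurable)
    (ae_of_all _ fun q => ?_)
  rw [waveMul, norm_mul, norm_wave, one_mul]; rfl

/-- Translation by half a period changes the sign of the wave. The argument needs no integrability
of the velocity profile. -/
lemma integral_waveMul_eq_zero (hβ : 0 < β) {k : Fin n → Λ} (hk : k ≠ 0)
    (h : 𝕍 n → ℂ) : ∫ z, waveMul k h z ∂Ψ n = 0 := by
  obtain ⟨j, hj⟩ := Function.ne_iff.1 hk
  obtain ⟨a, ha⟩ := Function.ne_iff.1 hj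
  have ha : (k j a : ℂ) ≠ 0 := by exact_mod_cast ha
  set t : ℝ := 1 / (2 * (k j a : ℝ)) with ht
  have h1 := (preserves_shift hβ (unitShift j a t)).integral_comp
    (measurableEmbedding_shift _) (waveMul k h)
  simp only [waveMul_shift, integral_const_mul] at h1
  have h2 : cexp (2 * π * I * k j a * t) = -1 := by
    rw [← exp_pi_mul_I]
    congr 1
    rw [ht]; push_cast
    field_simp
  rw [h2] at h1
  linear_combination (-1 / 2 : ℂ) * h1

instance {ι : Type*} [Fintype ι] : (volume : Measure (UnitAddTorus ι)).IsNegInvariant := by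
  have : (AddCircle.haarAddCircle : Measure UnitAddCircle).IsNegInvariant := by
    have : (AddCircle.haarAddCircle : Measure UnitAddCircle).Regular := by
      unfold AddCircle.haarAddCircle; infer_instance
    infer_instance
  rw [volume_unitAddTorus]; infer_instance

lemma coordOp_waveMul (hβ : 0 < β) (hF : GradField F K Vh) (k : Fin n → Λ)
    (h : 𝕍 n → ℂ) (j : Fin n) (a : Fin d) (z : Fin n → Phase d) :
    coordOp (oneMeasure d β) (forceKer F a) j (waveMul k h) z
      = wave k (fun i => (z i).1) * (2 * π * I * k j a * Vh (k j) *
        avg ϖ j h fun i => (z i).2) := by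
  have e : ∀ y : Phase d, forceKer F a (z j) y * waveMul k h (update z j y)
      = wave k (fun i => (z i).1) * (((F ((z j).1 - y.1) a : ℂ) * mFourier (-k j) ((z j).1 - y.1)) *
        h (update (fun i => (z i).2) j y.2)) := by
    intro y
    rw [waveMul_update, forceKer, ← neg_sub (z j).1 y.1, mFourier_neg_arg]; ring
  rw [coordOp]
  simp_rw [e]
  rw [integral_const_mul, integral_oneMeasure_mul hβ
    (fun x => (F ((z j).1 - x) a : ℂ) * mFourier (-k j) ((z j).1 - x))
    (fun v => h (update (fun i => (z i).2) j v)),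
    integral_sub_left_eq_self (fun x => (F x a : ℂ) * mFourier (-k j) x) volume (z j).1,
    hF.coeff]
  rfl

/-- The Vlasov operator on a Fourier mode. -/
def modeOp (β : ℝ) (Vh : Λ → ℝ) (N m : ℕ) (k : Fin (m + 1) → Λ)
    (h : 𝕍 (m + 1) → ℂ) (v : 𝕍 (m + 1)) : ℂ :=
  -(I * ((∑ j, phaseVel (k j) (v j) : ℝ) : ℂ) * h v) - ∑ j, if j = 0 then 0 else
    (((N : ℝ) + 1 - m) / N * β * Vh (k j) : ℝ) *
      (I * phaseVel (k j) (v j) * avg (velMeasure d β) j h v)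

lemma integral_waveMul_mul_transport (hβ : 0 < β) (k : Fin n → Λ)
    {h : 𝕍 n → ℂ} (hh : MemLp h 2 (Φ n)) {ψ : Obs n} (hψ : IsTest ψ) :
    ∫ z, waveMul k h z * transport ψ z ∂Ψ n
      = ∫ z, waveMul k (fun v => I * ((∑ j, phaseVel (k j) (v j) : ℝ) : ℂ) * h v) z * ψ z
        ∂Ψ n := by
  have i0 : ∀ (j : Fin n) (a : Fin d), Integrable (fun v : 𝕍 n => (v j a : ℂ) * h v)
      (Φ n) := fun j a => (memLp_vel_coord hβ j a).integrable_mul hh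
  have i1 : ∀ (j : Fin n) (a : Fin d), Integrable (fun z =>
      waveMul k (fun v => (v j a : ℂ) * h v) z * dx j a ψ z) (Ψ n) := by
    intro j a
    obtain ⟨B, -, hB⟩ := hψ.exists_bound_dx j a
    exact (memLp_one_iff_integrable.1 (memLp_waveMul hβ k
      (memLp_one_iff_integrable.2 (i0 j a)))).mul_bdd (c := B)
      (hψ.continuous_dx j a).aestronglyMeasurable (ae_of_all _ hB)
  have i2 : ∀ (j : Fin n) (a : Fin d), Integrable (fun z =>
      -(2 * π * I * k j a) * (waveMul k (fun v => (v j a : ℂ) * h v) z * ψ z))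
      (Ψ n) := by
    intro j a
    obtain ⟨B, -, hB⟩ := hψ.exists_bound
    exact ((memLp_one_iff_integrable.1 (memLp_waveMul hβ k
      (memLp_one_iff_integrable.2 (i0 j a)))).mul_bdd (c := B)
      hψ.continuous.aestronglyMeasurable (ae_of_all _ hB)).const_mul _
  have e1 : ∀ z, waveMul k h z * transport ψ z
      = ∑ j, ∑ a, waveMul k (fun v => (v j a : ℂ) * h v) z * dx j a ψ z := by
    intro z
    rw [transport, mul_sum]
    refine sum_congr rfl fun j _ => ?_
    rw [mul_sum]
    refine sum_congr rfl fun a _ => ?_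
    simp only [waveMul]; ring
  have e2 : ∀ z, waveMul k (fun v => I * ((∑ j, phaseVel (k j) (v j) : ℝ) : ℂ) * h v) z * ψ z
      = ∑ j, ∑ a, -(2 * π * I * k j a) * (waveMul k (fun v => (v j a : ℂ) * h v) z * ψ z) := by
    intro z
    simp only [waveMul, phaseVel, ofReal_sum, ofReal_neg, ofReal_mul, ofReal_intCast,
      ofReal_ofNat, mul_sum, sum_mul, ← sum_neg_distrib]
    refine sum_congr rfl fun j _ => sum_congr rfl fun a _ => ?_
    ring
  simp_rw [e1, e2]
  rw [integral_finsetSum _ fun j _ => integrable_finsetSum _ fun a _ => i1 j a,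
    integral_finsetSum _ fun j _ => integrable_finsetSum _ fun a _ => i2 j a]
  refine sum_congr rfl fun j _ => ?_
  rw [integral_finsetSum _ fun a _ => i1 j a, integral_finsetSum _ fun a _ => i2 j a]
  refine sum_congr rfl fun a _ => ?_
  rw [integral_const_mul]
  exact integral_waveMul_mul_dx hβ k (i0 j a) hψ j a

lemma integral_waveMul_mul_vlasovAdj (hβ : 0 < β) (hF : GradField F K Vh)
    (k : Fin (m + 1) → Λ) {h : (Fin (m + 1) → Vel d) → ℂ}
    (hh : MemLp h 2 (Φ (m + 1))) {ψ : Obs (m + 1)} (hψ : IsTest ψ) :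
    ∫ z, waveMul k h z * vlasovAdj β F N m ψ z ∂Ψ (m + 1)
      = ∫ z, waveMul k (modeOp β Vh N m k h) z * ψ z ∂Ψ (m + 1) := by
  have := prob_vel (d := d) hβ
  have hm := memLp_waveMul hβ k hh
  rw [← integral_vlasov hβ hF hm hψ]
  obtain ⟨B, -, hB⟩ := hψ.exists_bound
  set T : (Fin (m + 1) → Vel d) → ℂ := fun v => I * ((∑ j, phaseVel (k j) (v j) : ℝ) : ℂ) * h v
    with hT
  set S : (Fin (m + 1) → Vel d) → ℂ := fun v => ∑ j, if j = 0 then 0 else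
    (((N : ℝ) + 1 - m) / N * β * Vh (k j) : ℝ) * (I * phaseVel (k j) (v j) * avg ϖ j h v) with hS
  have iT : Integrable T (Φ (m + 1)) := by
    have h1 : MemLp (fun v : Fin (m + 1) → Vel d => ∑ j, (phaseVel (k j) (v j) : ℂ)) 2
        (Φ (m + 1)) := memLp_finsetSum _ fun j _ => memLp_phaseVel_coord hβ (k j) j
    have h2 : Integrable (fun v => I * ∑ j, (phaseVel (k j) (v j) : ℂ) * h v)
        (Φ (m + 1)) := by
      simp_rw [← sum_mul]
      exact (h1.integrable_mul hh).const_mul I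
    simpa only [hT, ofReal_sum, mul_assoc, sum_mul] using h2
  have iS : Integrable S (Φ (m + 1)) := by
    refine integrable_finsetSum _ fun j _ => ?_
    split_ifs
    · exact integrable_zero _ _ _
    · exact (((memLp_phaseVel_coord hβ (k j) j).const_mul I).integrable_mul
        (memLp_avg j hh)).const_mul _
  have iw : ∀ {u : (Fin (m + 1) → Vel d) → ℂ}, Integrable u (Φ (m + 1)) →
      Integrable (fun z => waveMul k u z * ψ z) (Ψ (m + 1)) := fun hu =>
    (memLp_one_iff_integrable.1 (memLp_waveMul hβ k (memLp_one_iff_integrable.2 hu))).mul_bdd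
      (c := B) hψ.continuous.aestronglyMeasurable (ae_of_all _ hB)
  have e1 : ∀ z, meanFieldTerm β F N m (waveMul k h) z = -waveMul k S z := by
    intro z
    rw [meanFieldTerm, waveMul, hS]
    simp only []
    rw [mul_sum, ← sum_neg_distrib]
    refine sum_congr rfl fun j _ => ?_
    split_ifs
    · simp
    · have e3 : ∀ a, ∫ y, (F ((z j).1 - y.1) a : ℂ) * waveMul k h (update z j y)
          ∂oneMeasure d β = _ := fun a => coordOp_waveMul hβ hF k h j a z
      simp only [e3]
      rw [phaseVel]
      push_cast
      simp only [mul_sum, sum_mul, mul_neg, neg_mul, neg_neg]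
      refine sum_congr rfl fun a _ => by ring
  have e2 : ∀ z, waveMul k (modeOp β Vh N m k h) z * ψ z
      = -(waveMul k T z * ψ z) + -(waveMul k S z * ψ z) := by
    intro z
    simp only [waveMul, modeOp, hT, hS]; ring
  have iTr : Integrable (fun z => waveMul k h z * transport ψ z) (Ψ (m + 1)) :=
    hm.integrable_mul (memLp_transport hβ hψ)
  simp_rw [e1, e2, neg_mul]
  have a1 := integral_add iTr.neg (iw iS).neg
  have a2 := integral_add (iw iT).neg (iw iS).neg
  simp only [Pi.neg_apply] at a1 a2
  rw [a1, a2, integral_neg, integral_neg, integral_neg, integral_waveMul_mul_transport hβ k hh hψ]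

/-! ### Integration by parts in the velocities -/

/-- `D = (D_a)_a` is the adapted gradient `(∇ - βv) u`, weakly in `L²_β`. -/
def HasAdaptedGrad (β : ℝ) (u : Vel d → ℂ) (D : Fin d → Vel d → ℂ) : Prop :=
  ∀ φ : Vel d → ℂ, IsVelTest φ → ∀ a : Fin d,
    ∫ v, u v * velDeriv a φ v ∂velMeasure d β = -∫ v, D a v * φ v ∂velMeasure d β

lemma IsTest.isVelTest_section {ψ : Obs n} (hψ : IsTest ψ) (j : Fin n)
    (z : Fin n → Phase d) (x : Torus d) : IsVelTest fun w => ψ (update z j (x, w)) := by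
  constructor
  · obtain ⟨y, hy⟩ := cover_surjective (update z j (x, 0))
    have e : ∀ w, update z j (x, w) = cover (y + Pi.single j (0, w - (y j).2)) := by
      intro w
      rw [← update_cover, hy]
      simp
    simp_rw [e]
    refine hψ.contDiff_comp_cover.comp (contDiff_const.add ?_)
    have h1 : ContDiff ℝ (⊤ : ℕ∞) fun w : Vel d => ((0 : Fin d → ℝ), w - (y j).2) :=
      contDiff_const.prodMk (contDiff_id.sub contDiff_const)
    exact (ContinuousLinearMap.single ℝ (fun _ : Fin n => (Fin d → ℝ) × Vel d) j).contDiff.comp h1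
  · refine HasCompactSupport.intro (K := (fun z : Fin n → Phase d => (z j).2) '' tsupport ψ)
      (hψ.compactSupport.image (by fun_prop)) fun w hw => ?_
    refine image_eq_zero_of_notMem_tsupport fun h => hw ⟨_, h, by simp⟩

lemma dv_update (ψ : Obs n) (j : Fin n) (a : Fin d) (z : Fin n → Phase d)
    (x : Torus d) (w : Vel d) : dv j a ψ (update z j (x, w))
      = velDeriv a (fun w => ψ (update z j (x, w))) w := by
  simp [dv]

lemma integral_mul_dv (hβ : 0 < β) {u : Vel d → ℂ} {D : Fin d → Vel d → ℂ}
    (hu : HasAdaptedGrad β u D) (j : Fin n) (a : Fin d) {E : Obs n}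
    (hE : ∀ z w, E (update z j ((z j).1, w)) = E z)
    (i1 : Integrable (fun z => E z * u (z j).2) (Ψ n))
    (i2 : Integrable (fun z => E z * D a (z j).2) (Ψ n)) {ψ : Obs n} (hψ : IsTest ψ) :
    ∫ z, E z * u (z j).2 * dv j a ψ z ∂Ψ n = -∫ z, E z * D a (z j).2 * ψ z ∂Ψ n := by
  have := prob_vel (d := d) hβ
  have := prob_one (d := d) hβ
  obtain ⟨B, -, hB⟩ := hψ.exists_bound
  obtain ⟨B', -, hB'⟩ := hψ.exists_bound_dv j a
  have k1 : Integrable (fun z => E z * u (z j).2 * dv j a ψ z) (Ψ n) :=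
    i1.mul_bdd (c := B') (hψ.continuous_dv j a).aestronglyMeasurable (ae_of_all _ hB')
  have k2 : Integrable (fun z => E z * D a (z j).2 * ψ z) (Ψ n) :=
    i2.mul_bdd (c := B) hψ.continuous.aestronglyMeasurable (ae_of_all _ hB)
  have r1 := ((preserves_resample (m := oneMeasure d β) j).integrable_comp_of_integrable
    k1).prod_right_ae
  have r2 := ((preserves_resample (m := oneMeasure d β) j).integrable_comp_of_integrable
    k2).prod_right_ae
  have s1 := integral_avg (m := oneMeasure d β) j k1
  have s2 := integral_avg (m := oneMeasure d β) j k2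
  rw [phaseMeasure, ← s1, ← s2, ← integral_neg]
  refine integral_congr_ae ?_
  filter_upwards [r1, r2] with z h1 h2
  simp only [Function.comp_def] at h1 h2
  simp only [avg]
  have hE' : ∀ x w, E (update z j (x, w)) = E (update z j (x, 0)) := by
    intro x w
    have := hE (update z j (x, 0)) w
    simpa using this
  have t1 := integral_prod (μ := (volume : Measure (Torus d))) (ν := ϖ) _ h1
  have t2 := integral_prod (μ := (volume : Measure (Torus d))) (ν := ϖ) _ h2
  refine t1.trans ((integral_congr_ae (ae_of_all _ fun x => ?_)).trans
    ((integral_neg _).trans (congrArg Neg.neg t2.symm)))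
  simp only [update_self, dv_update, hE', mul_assoc]
  rw [integral_const_mul, integral_const_mul, hu _ (hψ.isVelTest_section j z x) a]
  ring

lemma norm_velDeriv_le {𝕜 : Type} [RCLike 𝕜] (a : Fin d) (φ : Vel d → 𝕜) (v : Vel d) :
    ‖velDeriv a φ v‖ ≤ ‖fderiv ℝ φ v‖ := by
  have := (fderiv ℝ φ v).le_opNorm (EuclideanSpace.single a (1 : ℝ))
  simpa [velDeriv] using this

lemma IsVelTest.exists_bound {𝕜 : Type} [RCLike 𝕜] {φ : Vel d → 𝕜} (h : IsVelTest φ) :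
    ∃ B, 0 ≤ B ∧ ∀ v, ‖φ v‖ ≤ B := by
  obtain ⟨B, hB⟩ := h.compactSupport.exists_bound_of_continuous h.smooth.continuous
  exact ⟨max B 0, le_max_right _ _, fun z => (hB z).trans (le_max_left _ _)⟩

lemma IsVelTest.continuous_velDeriv {𝕜 : Type} [RCLike 𝕜] {φ : Vel d → 𝕜} (h : IsVelTest φ)
    (a : Fin d) : Continuous (velDeriv a φ) :=
  (h.smooth.continuous_fderiv (by simp)).clm_apply continuous_const

lemma IsVelTest.exists_bound_velDeriv {𝕜 : Type} [RCLike 𝕜] {φ : Vel d → 𝕜} (h : IsVelTest φ)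
    (a : Fin d) : ∃ B, 0 ≤ B ∧ ∀ v, ‖velDeriv a φ v‖ ≤ B := by
  obtain ⟨B, hB⟩ := (h.compactSupport.fderiv (𝕜 := ℝ)).exists_bound_of_continuous
    (h.smooth.continuous_fderiv (by simp))
  exact ⟨max B 0, le_max_right _ _, fun z =>
    (norm_velDeriv_le a φ z).trans ((hB z).trans (le_max_left _ _))⟩

lemma hasFDerivAt_maxwellian (v : Vel d) :
    HasFDerivAt (maxwellian d β) (-(β * maxwellian d β v) • innerSL ℝ v) v := by
  unfold maxwellian
  have h1 : HasFDerivAt (fun v : Vel d => ‖v‖ ^ 2) (2 • innerSL ℝ v) v :=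
    (hasStrictFDerivAt_norm_sq v).hasFDerivAt
  have h2 := ((h1.const_mul (-(β / 2))).exp).const_mul ((β / (2 * π)) ^ ((d : ℝ) / 2))
  refine h2.congr_fderiv ?_
  ext w
  simp
  ring

lemma contDiff_maxwellian : ContDiff ℝ (⊤ : ℕ∞) (maxwellian d β) := by
  unfold maxwellian
  exact contDiff_const.mul (Real.contDiff_exp.comp (contDiff_const.mul (contDiff_norm_sq ℝ)))

lemma velDeriv_maxwellian_smul {𝕜 : Type} [RCLike 𝕜] {φ : Vel d → 𝕜} (h : IsVelTest φ) (a : Fin d)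
    (v : Vel d) : velDeriv a (fun v => maxwellian d β v • φ v) v
      = maxwellian d β v • (velDeriv a φ v - (β * v a) • φ v) := by
  have h1 : HasFDerivAt φ (fderiv ℝ φ v) v := (h.smooth.differentiable (by simp) v).hasFDerivAt
  rw [velDeriv, ((hasFDerivAt_maxwellian v).fun_smul h1).fderiv]
  simp only [velDeriv, smul_smul, sub_eq_add_neg, smul_neg,
    smul_add, mul_left_comm (maxwellian d β v) β]
  simp [EuclideanSpace.inner_single_right, mul_assoc]

lemma IsVelTest.maxwellian_smul {𝕜 : Type} [RCLike 𝕜] {φ : Vel d → 𝕜} (h : IsVelTest φ) :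
    IsVelTest fun v => maxwellian d β v • φ v :=
  ⟨contDiff_maxwellian.smul h.smooth,
    HasCompactSupport.smul_left (f := maxwellian d β) h.compactSupport⟩

/-! ### Adapted gradients -/

lemma memLp_coord_mul_velTest {𝕜 : Type} [RCLike 𝕜] (hβ : 0 < β) {φ : Vel d → 𝕜}
    (hφ : IsVelTest φ) (a : Fin d) : MemLp (fun v => (β * v a) • φ v) 2 ϖ := by
  have := prob_vel (d := d) hβ
  obtain ⟨B, hB0, hB⟩ := hφ.exists_bound
  refine ((memLp_coord_velMeasure hβ a 2 (by simp)).const_mul (β * B)).mono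
    (Continuous.aestronglyMeasurable ?_) (ae_of_all _ fun v => ?_)
  · have := hφ.smooth.continuous
    fun_prop
  · rw [norm_smul, norm_mul, norm_mul, norm_mul, norm_of_nonneg hB0, mul_right_comm]
    gcongr
    exact hB v

lemma IsVelTest.memLp {𝕜 : Type} [RCLike 𝕜] (hβ : 0 < β) {φ : Vel d → 𝕜}
    (hφ : IsVelTest φ) {p : ℝ≥0∞} : MemLp φ p ϖ := by
  have := prob_vel (d := d) hβ
  obtain ⟨B, -, hB⟩ := hφ.exists_bound
  exact MemLp.of_bound hφ.smooth.continuous.aestronglyMeasurable B (ae_of_all _ hB)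

lemma IsVelTest.memLp_velDeriv {𝕜 : Type} [RCLike 𝕜] (hβ : 0 < β) {φ : Vel d → 𝕜}
    (hφ : IsVelTest φ) (a : Fin d) {p : ℝ≥0∞} : MemLp (velDeriv a φ) p ϖ := by
  have := prob_vel (d := d) hβ
  obtain ⟨B, -, hB⟩ := hφ.exists_bound_velDeriv a
  exact MemLp.of_bound (hφ.continuous_velDeriv a).aestronglyMeasurable B (ae_of_all _ hB)

/-- The unweighted weak gradient is tested with the Maxwellian times `φ`. The derivative of the
Maxwellian produces the term `-βv` of the adapted gradient. -/
lemma HasVelWeakGrad.integral_velMeasure (hβ : 0 < β) {g : Vel d → ℝ} {D : Vel d → Vel d}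
    (h : HasVelWeakGrad g D) (hg : MemLp g 2 ϖ)
    (hD : MemLp (fun v => D v - (β * g v) • v) 2 ϖ) {φ : Vel d → ℝ} (hφ : IsVelTest φ) (a : Fin d) :
    ∫ v, g v * velDeriv a φ v ∂ϖ = -∫ v, (D v - (β * g v) • v) a * φ v ∂ϖ := by
  have h1 := h _ (hφ.maxwellian_smul (β := β)) a
  simp only [velDeriv_maxwellian_smul hφ] at h1
  simp only [smul_eq_mul] at h1
  have e1 : ∀ v, g v * (maxwellian d β v * (velDeriv a φ v - β * v a * φ v))
      = maxwellian d β v • (g v * velDeriv a φ v - g v * (β * v a * φ v)) := by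
    intro v; rw [smul_eq_mul]; ring
  have e2 : ∀ v, D v a * (maxwellian d β v * φ v) = maxwellian d β v •
      ((D v - (β * g v) • v) a * φ v + g v * (β * v a * φ v)) := by
    intro v
    simp only [PiLp.sub_apply, PiLp.smul_apply, smul_eq_mul]; ring
  simp_rw [e1, e2] at h1
  rw [← TaggedParticle.integral_velMeasure hβ, ← TaggedParticle.integral_velMeasure hβ] at h1
  have i1 : Integrable (fun v => g v * velDeriv a φ v) ϖ :=
    hg.integrable_mul (hφ.memLp_velDeriv hβ a (p := 2))
  have i2 : Integrable (fun v => g v * (β * v a * φ v)) ϖ :=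
    hg.integrable_mul (memLp_coord_mul_velTest hβ hφ a)
  have i3 : Integrable (fun v => (D v - (β * g v) • v) a * φ v) ϖ :=
    (hD.eval_piLp a).integrable_mul (hφ.memLp hβ (p := 2))
  have a1 := integral_sub i1 i2
  have a2 := integral_add i3 i2
  simp only [] at a1 a2
  rw [a1, a2] at h1
  linarith

lemma IsVelTest.comp_clm {φ : Vel d → ℂ} (hφ : IsVelTest φ) (L : ℂ →L[ℝ] ℝ) :
    IsVelTest fun v => L (φ v) :=
  ⟨L.contDiff.comp hφ.smooth, hφ.compactSupport.comp_left (map_zero L)⟩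

lemma velDeriv_comp_clm {φ : Vel d → ℂ} (hφ : IsVelTest φ) (L : ℂ →L[ℝ] ℝ) (a : Fin d)
    (v : Vel d) : velDeriv a (fun v => L (φ v)) v = L (velDeriv a φ v) := by
  have h1 : HasFDerivAt φ (fderiv ℝ φ v) v := (hφ.smooth.differentiable (by simp) v).hasFDerivAt
  rw [velDeriv, (show HasFDerivAt (fun v => L (φ v)) _ v from
    L.hasFDerivAt.comp v h1).fderiv]
  rfl

/-- Complex test functions are reduced to real ones through their real and imaginary parts, as `g`
is real. -/
theorem HasVelWeakGrad.hasAdaptedGrad (hβ : 0 < β) {g : Vel d → ℝ} {D : Vel d → Vel d}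
    (h : HasVelWeakGrad g D) (hg : MemLp g 2 ϖ) (hD : MemLp (fun v => D v - (β * g v) • v) 2 ϖ) :
    HasAdaptedGrad β (fun v => (g v : ℂ)) fun a v => ((D v - (β * g v) • v) a : ℂ) := by
  intro φ hφ a
  have i1 : Integrable (fun v => (g v : ℂ) * velDeriv a φ v) ϖ :=
    hg.ofReal.integrable_mul (hφ.memLp_velDeriv hβ a (p := 2))
  have i3 : Integrable (fun v => (((D v - (β * g v) • v) a : ℝ) : ℂ) * φ v) ϖ :=
    (hD.eval_piLp a).ofReal.integrable_mul (hφ.memLp hβ (p := 2))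
  have key : ∀ L : ℂ →L[ℝ] ℝ, L (∫ v, (g v : ℂ) * velDeriv a φ v ∂ϖ)
      = L (-∫ v, (((D v - (β * g v) • v) a : ℝ) : ℂ) * φ v ∂ϖ) := by
    intro L
    rw [map_neg, ← L.integral_comp_comm i1, ← L.integral_comp_comm i3]
    simp only [← real_smul, map_smul, smul_eq_mul, ← velDeriv_comp_clm hφ L]
    exact h.integral_velMeasure hβ hg hD (hφ.comp_clm L) a
  exact Complex.ext (key reCLM) (key imCLM)

lemma memLp_one_add_inner (hβ : 0 < β) (n : Vel d) (c : ℝ) :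
    MemLp (fun v : Vel d => c * (1 + |inner ℝ n v|)) 2 ϖ := by
  refine ((memLp_pow_velMeasure hβ 1).const_mul (c * (1 + ‖n‖))).mono
    (by fun_prop) (ae_of_all _ fun v => ?_)
  rw [norm_mul, norm_mul, norm_mul, mul_assoc]
  gcongr
  rw [norm_of_nonneg (by positivity), norm_of_nonneg (by positivity),
    norm_of_nonneg (by positivity)]
  have := abs_real_inner_le_norm n v
  nlinarith [norm_nonneg n, norm_nonneg v]

/-- Needed for the profile `p(n·v)` of the background particle, which is differentiable with linear
growth. The decay of the Maxwellian justifies the integration by parts. -/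
theorem hasAdaptedGrad_profile (hβ : 0 < β) {p : ℝ → ℂ} (hp : Differentiable ℝ p) {c c' : ℝ}
    (h0 : ∀ ξ, ‖p ξ‖ ≤ c * (1 + |ξ|)) (h1 : ∀ ξ, ‖deriv p ξ‖ ≤ c' * (1 + |ξ|)) (n : Vel d) :
    HasAdaptedGrad β (fun v => p (inner ℝ n v)) fun a v =>
      (n a : ℂ) * deriv p (inner ℝ n v) - (β * v a : ℝ) * p (inner ℝ n v) := by
  intro φ hφ a
  have cp := hp.continuous
  have dp : ∀ v, HasFDerivAt (fun v => p (inner ℝ n v))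
      ((innerSL ℝ n).smulRight (deriv p (inner ℝ n v))) v := by
    intro v
    have := (hp (inner ℝ n v)).hasDerivAt.hasFDerivAt.comp v (innerSL ℝ n).hasFDerivAt
    refine this.congr_fderiv ?_
    ext w
    simp
  have m0 : MemLp (fun v => p (inner ℝ n v)) 2 (velMeasure d β) :=
    (memLp_one_add_inner hβ n c).mono' (by fun_prop)
      (ae_of_all _ fun v => h0 _)
  have m1 : MemLp (fun v => deriv p (inner ℝ n v)) 2 (velMeasure d β) :=
    (memLp_one_add_inner hβ n c').mono'
      ((measurable_deriv p).comp (by fun_prop : Measurable fun v : Vel d =>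
        (inner ℝ n v : ℝ))).aestronglyMeasurable (ae_of_all _ fun v => h1 _)
  have j0 : Integrable (fun v => p (inner ℝ n v) * φ v) (velMeasure d β) :=
    m0.integrable_mul (hφ.memLp hβ (p := 2))
  have j1 : Integrable (fun v => (n a : ℂ) * deriv p (inner ℝ n v) * φ v) (velMeasure d β) :=
    (m1.const_mul (n a : ℂ)).integrable_mul (hφ.memLp hβ (p := 2))
  have j2 : Integrable (fun v => p (inner ℝ n v) * velDeriv a φ v) (velMeasure d β) :=
    m0.integrable_mul (hφ.memLp_velDeriv hβ a (p := 2))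
  have j3 : Integrable (fun v => p (inner ℝ n v) * ((β * v a) • φ v)) (velMeasure d β) :=
    m0.integrable_mul (memLp_coord_mul_velTest hβ hφ a)
  have j4 : Integrable (fun v => p (inner ℝ n v) * velDeriv a φ v
    - p (inner ℝ n v) * ((β * v a) • φ v)) (velMeasure d β) := j2.sub j3
  have hT := hφ.maxwellian_smul (β := β)
  have e1 : ∀ v, fderiv ℝ (fun v => p (inner ℝ n v)) v (EuclideanSpace.single a 1)
      * (maxwellian d β v • φ v) = maxwellian d β v • ((n a : ℂ) * deriv p (inner ℝ n v) * φ v) := by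
    intro v
    rw [(dp v).fderiv]
    simp [EuclideanSpace.inner_single_right]; ring
  have e2 : ∀ v, p (inner ℝ n v) * fderiv ℝ (fun v => maxwellian d β v • φ v) v
      (EuclideanSpace.single a 1) = maxwellian d β v • (p (inner ℝ n v) * velDeriv a φ v
        - p (inner ℝ n v) * ((β * v a) • φ v)) := by
    intro v
    have := velDeriv_maxwellian_smul (β := β) hφ a v
    rw [velDeriv] at this
    rw [this, ← mul_sub, mul_smul_comm]
  have ibp := integral_mul_fderiv_eq_neg_fderiv_mul_of_integrable (μ := (volume : Measure (Vel d)))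
    (f := fun v => p (inner ℝ n v)) (g := fun v => maxwellian d β v • φ v)
    (v := EuclideanSpace.single a 1)
    (by simp_rw [e1]; exact (integrable_velMeasure_iff hβ _).1 j1)
    (by simp_rw [e2]; exact (integrable_velMeasure_iff hβ _).1 j4)
    (by simp_rw [mul_smul_comm]; exact (integrable_velMeasure_iff hβ _).1 j0)
    (fun v _ => (dp v).differentiableAt)
    (fun v _ => hT.smooth.differentiable (by simp) v)
  simp_rw [e1, e2] at ibp
  rw [← integral_velMeasure hβ, ← integral_velMeasure hβ] at ibp
  have a1 := integral_sub j2 j3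
  have a2 := integral_sub j1 j3
  have e3 : ∀ v, ((n a : ℂ) * deriv p (inner ℝ n v) - (β * v a : ℝ) * p (inner ℝ n v)) * φ v
      = (n a : ℂ) * deriv p (inner ℝ n v) * φ v - p (inner ℝ n v) * ((β * v a) • φ v) := by
    intro v; rw [real_smul]; ring
  simp_rw [e3]
  rw [a1] at ibp
  rw [a2]
  linear_combination ibp

/-! ### Geometry of a Fourier mode -/

/-- The frequency `2π|k|/√β` of the transport operator on the mode `k`. -/
def modeFreq (β : ℝ) (k : Λ) : ℝ := 2 * π * ‖(WithLp.toLp 2 fun a => (k a : ℝ) : Vel d)‖ / √β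

/-- The direction `√β k/|k|`. -/
def modeDir (β : ℝ) (k : Λ) : Vel d := (2 * π / modeFreq β k) • WithLp.toLp 2 fun a => (k a : ℝ)

local notation:max "mdot" k:max => inner ℝ (modeDir β k)

lemma modeFreq_pos (hβ : 0 < β) {k : Λ} (hk : k ≠ 0) : 0 < modeFreq β k := by
  have : (WithLp.toLp 2 fun a => (k a : ℝ) : Vel d) ≠ 0 := by
    intro h
    refine hk (funext fun a => ?_)
    have := congrArg (fun v : Vel d => v a) h
    simpa using this
  have := norm_pos_iff.2 this
  unfold modeFreq
  positivity

lemma modeFreq_mul_modeDir (hβ : 0 < β) {k : Λ} (hk : k ≠ 0) (a : Fin d) :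
    modeFreq β k * modeDir β k a = 2 * π * k a := by
  have := (modeFreq_pos hβ hk).ne'
  simp only [modeDir, PiLp.smul_apply, smul_eq_mul]
  field_simp

lemma norm_modeDir (hβ : 0 < β) {k : Λ} (hk : k ≠ 0) : ‖modeDir β k‖ = √β := by
  have h := modeFreq_pos hβ hk
  rw [modeDir, norm_smul, norm_of_nonneg (by positivity), div_mul_eq_mul_div,
    div_eq_iff h.ne', modeFreq]
  have := (Real.sqrt_pos.2 hβ).ne'
  field_simp

lemma norm_sq_modeDir (hβ : 0 < β) {k : Λ} (hk : k ≠ 0) : ‖modeDir β k‖ ^ 2 = β := by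
  rw [norm_modeDir hβ hk, Real.sq_sqrt hβ.le]

lemma phaseVel_eq (hβ : 0 < β) {k : Λ} (hk : k ≠ 0) (v : Vel d) :
    phaseVel k v = -(modeFreq β k * mdot k v) := by
  rw [phaseVel, PiLp.inner_apply, mul_sum, mul_sum]
  refine congrArg _ (sum_congr rfl fun a _ => ?_)
  rw [← mul_assoc, ← modeFreq_mul_modeDir hβ hk]
  simp; ring

lemma phaseVel_neg (k : Λ) (v : Vel d) : phaseVel (-k) v = -phaseVel k v := by
  simp [phaseVel]

lemma abs_inner_modeDir_le (hβ : 0 < β) {k : Λ} (hk : k ≠ 0) (v : Vel d) :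
    |mdot k v| ≤ √β * ‖v‖ := by
  simpa [norm_modeDir hβ hk] using abs_real_inner_le_norm (modeDir β k) v

/-! ### Solution of the hierarchy on a Fourier mode -/

lemma wave_snoc (k : Fin (n + 1) → Λ) (z : Fin n → Phase d) (y : Phase d) :
    wave k (fun i => (Fin.snoc (α := fun _ => Phase d) z y i).1)
      = wave (fun i => k i.castSucc) (fun i => (z i).1) * mFourier (k (Fin.last n)) y.1 := by
  simp [wave, Fin.prod_univ_castSucc]

lemma vel_snoc (z : Fin n → Phase d) (y : Phase d) :
    (fun i => (Fin.snoc (α := fun _ => Phase d) z y i).2)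
      = Fin.snoc (α := fun _ => Vel d) (fun i => (z i).2) y.2 := by
  funext i
  induction i using Fin.lastCases <;> simp

lemma forceMoment_waveMul (hβ : 0 < β) (hF : GradField F K Vh)
    (k : Fin (m + 2) → Λ) (h : 𝕍 (m + 2) → ℂ) (j : Fin (m + 1)) (a : Fin d)
    (z : Fin (m + 1) → Phase d) :
    forceMoment β F N m (waveMul k h) j a z = (((N : ℝ) - m) / N : ℝ) *
      ((2 * π * I * k (Fin.last _) a * Vh (k (Fin.last _))) *
        (mFourier (k (Fin.last _)) (z j).1 * wave (fun i => k i.castSucc) (fun i => (z i).1)) *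
        ∫ y, h (Fin.snoc (α := fun _ => Vel d) (fun i => (z i).2) y) ∂ϖ) := by
  rw [forceMoment]
  congr 1
  set l := k (Fin.last _)
  have e : ∀ y : Phase d, (F ((z j).1 - y.1) a : ℂ) *
      waveMul k h (Fin.snoc (α := fun _ => Phase d) z y)
      = (mFourier l (z j).1 * wave (fun i => k i.castSucc) (fun i => (z i).1)) *
        (((F ((z j).1 - y.1) a : ℂ) * mFourier (-l) ((z j).1 - y.1)) *
        h (Fin.snoc (α := fun _ => Vel d) (fun i => (z i).2) y.2)) := by
    intro y
    have h1 : mFourier l y.1 = mFourier l (z j).1 * mFourier (-l) ((z j).1 - y.1) := by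
      rw [← mFourier_neg_arg, ← mFourier_add_arg]; congr 1; abel
    rw [waveMul, wave_snoc, vel_snoc]
    change _ * (_ * mFourier l y.1 * _) = _
    rw [h1]; ring
  simp_rw [e]
  rw [integral_const_mul, integral_oneMeasure_mul hβ
    (fun x => (F ((z j).1 - x) a : ℂ) * mFourier (-l) ((z j).1 - x))
    (fun v => h (Fin.snoc (α := fun _ => Vel d) (fun i => (z i).2) v)),
    integral_sub_left_eq_self (fun x => (F x a : ℂ) * mFourier (-l) x) volume (z j).1, hF.coeff]
  ring

lemma integral_comp_inner (hβ : 0 < β) {v : Vel d} (hv : ‖v‖ ^ 2 = β) {f : ℝ → ℂ}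
    (hf : Measurable f) : ∫ y, f (inner ℝ v y) ∂ϖ = ∫ ξ, f ξ ∂gauss := by
  rw [← map_inner_velMeasure hβ hv, integral_map (by fun_prop) hf.aestronglyMeasurable]

lemma memLp_coord_mul (hβ : 0 < β) (j : Fin n) {b : Vel d → ℝ} (hb : MemLp b 2 ϖ)
    {f : (Fin n → Vel d) → ℝ} (hf : MemLp f 2 (Φ n)) (hinv : ∀ v y, f (update v j y) = f v) :
    MemLp (fun v => b (v j) * f v) 2 (Φ n) := by
  have := prob_vel (d := d) hβ
  have h := (memLp_mul_of_invariant j hb hf.ofReal fun v y => by rw [hinv]).re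
  simpa [velPi] using h

lemma memLp_coord_real (hβ : 0 < β) (j : Fin n) {b : Vel d → ℝ}
    (hb : MemLp b 2 ϖ) : MemLp (fun v => b (v j)) 2 (Φ n) := by
  have h := (memLp_velPi_coord hβ hb.ofReal j).re
  simpa using h

section Mode

variable {C : ℝ} {ω : ℂ} {k : Fin d → ℤ} {g : Vel d → ℝ} {D : Vel d → Vel d}

/-- The tagged-particle mode solution at wave number `k` and frequency `ω`. -/
abbrev KineticSolution (β C : ℝ) (Vh : Λ → ℝ) (N : ℕ) (ω : ℂ) (k : Λ) :=
  ModeSolution C (((N : ℝ) - 1) / N * β * Vh k) (β * Vh k) (ω / modeFreq β k)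

namespace KineticSolution

variable (S : KineticSolution β C Vh N ω k)

/-- The mode of `H₃`. -/
def three (g : Vel d → ℝ) (v : 𝕍 3) : ℂ :=
  g (v 0) * (S.h (mdot k (v 1)) (mdot k (v 2)) / modeFreq β k)

/-- The oscillating mode of `K₂`. -/
def source (D : Vel d → Vel d) (v : 𝕍 2) : ℂ := (mdot k (D (v 0)) : ℝ) * S.p (mdot k (v 1))

/-- The homogeneous mode of `K₂`. -/
def drift (g : Vel d → ℝ) (v : 𝕍 2) : ℂ := g (v 0) * (β * (deriv S.p (mdot k (v 1))
    - (mdot k (v 1) : ℝ) * S.p (mdot k (v 1))))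

/-- The oscillating mode of `H₂`. -/
def two (D : Vel d → Vel d) (v : 𝕍 2) : ℂ := (mdot k (D (v 0)) : ℝ) *
    (S.q (mdot k (v 0)) (mdot k (v 1)) / modeFreq β k)

/-- The mode equation is `modeFreq` times the scalar equation for `h`. The coupling is `(N - 1)/N β
V̂(k)` because the prefactor of `iL_3` is `(N + 1 - 2)/N`, and the tagged factor `g` is inert since
its wave number is zero. -/
lemma modeOp_three (hβ : 0 < β) (hk : k ≠ 0) (hV : Vh (-k) = Vh k) (v : 𝕍 3) :
    modeOp β Vh N 2 ![0, k, -k] (S.three g) v = g (v 0) + I * ω * S.three g v := by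
  have e : ∀ f : Fin (2 + 1) → ℂ, ∑ j, f j = f 0 + f 1 + f 2 := Fin.sum_univ_three
  have e' : ∀ f : Fin (2 + 1) → ℝ, ∑ j, f j = f 0 + f 1 + f 2 := Fin.sum_univ_three
  have hσ : (modeFreq β k : ℂ) ≠ 0 := by exact_mod_cast (modeFreq_pos hβ hk).ne'
  have hn := norm_sq_modeDir hβ hk
  have a1 : avg ϖ 1 (S.three g) v = g (v 0) * (S.p (-mdot k (v 2)) / modeFreq β k) := by
    have h1 : ∀ y, S.three g (update v 1 y) = g (v 0) *
      (S.h (mdot k y) (mdot k (v 2)) / modeFreq β k) := by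
      intro y
      simp [three]
    simp_rw [avg, h1]
    rw [integral_const_mul, integral_div, integral_comp_inner hβ hn
      (f := fun ξ => S.h ξ (mdot k (v 2)))
      (S.measurable_h.comp measurable_prodMk_right), S.integral_h_left]
  have a2 : avg ϖ 2 (S.three g) v = g (v 0) * (S.p (mdot k (v 1)) / modeFreq β k) := by
    have h1 : ∀ y, S.three g (update v 2 y) = g (v 0) *
      (S.h (mdot k (v 1)) (mdot k y) / modeFreq β k) := by
      intro y
      simp [three]
    simp_rw [avg, h1]
    rw [integral_const_mul, integral_div, integral_comp_inner hβ hn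
      (f := fun ξ => S.h (mdot k (v 1)) ξ)
      (S.measurable_h.comp measurable_prodMk_left), S.integral_h_right]
  have h := S.h_eq (mdot k (v 1)) (mdot k (v 2))
  have p0 : phaseVel (0 : Λ) (v 0) = 0 := by simp [phaseVel]
  rw [modeOp, e, e', if_pos rfl, if_neg (by decide), if_neg (by decide), a1, a2]
  simp only [Matrix.cons_val_zero, Matrix.cons_val_one, Matrix.cons_val, phaseVel_neg, p0,
    phaseVel_eq hβ hk, hV, three]
  push_cast at h ⊢
  field_simp at h ⊢
  linear_combination (g (v 0) : ℂ) * h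

/-- Here the prefactor `(N + 1 - 1)/N` equals one, so the coupling is `β V̂(k)`. The tagged particle
has wave number `-k` and no mean-field term, so that its velocity is only the parameter `ζ` of the
scalar equation. -/
lemma modeOp_two (hβ : 0 < β) (hk : k ≠ 0) (hN : 1 ≤ N) (v : 𝕍 2) :
    modeOp β Vh N 1 ![-k, k] (S.two D) v = S.source D v + I * ω * S.two D v := by
  have e : ∀ f : Fin (1 + 1) → ℂ, ∑ j, f j = f 0 + f 1 := Fin.sum_univ_two
  have e' : ∀ f : Fin (1 + 1) → ℝ, ∑ j, f j = f 0 + f 1 := Fin.sum_univ_two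
  have hσ : (modeFreq β k : ℂ) ≠ 0 := by exact_mod_cast (modeFreq_pos hβ hk).ne'
  have hn := norm_sq_modeDir hβ hk
  have a1 : avg ϖ 1 (S.two D) v = (mdot k (D (v 0)) : ℝ) * (S.Y (mdot k (v 0)) / modeFreq β k) := by
    have h1 : ∀ y, S.two D (update v 1 y) = (mdot k (D (v 0)) : ℝ) *
      (S.q (mdot k (v 0)) (mdot k y) / modeFreq β k) := by
      intro y
      simp [two]
    simp_rw [avg, h1]
    rw [integral_const_mul, integral_div, integral_comp_inner hβ hn
      (f := fun ξ => S.q (mdot k (v 0)) ξ)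
      (S.measurable_q.comp measurable_prodMk_left), S.integral_q]
  have h := S.q_eq (mdot k (v 0)) (mdot k (v 1))
  have hN' : ((N : ℝ) + 1 - (1 : ℕ)) / N = 1 := by
    have : (N : ℝ) ≠ 0 := by positivity
    push_cast; field_simp; ring
  rw [modeOp, e, e', if_pos rfl, if_neg (by decide), a1, hN']
  simp only [Matrix.cons_val_zero, Matrix.cons_val_one, phaseVel_neg,
    phaseVel_eq hβ hk, two, source]
  push_cast at h ⊢
  field_simp at h ⊢
  linear_combination ((mdot k (D (v 0)) : ℝ) : ℂ) * h

/-- The linear weight `1 + √β|v|`. -/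
def _root_.TaggedParticle.linWeight (β : ℝ) (v : Vel d) : ℝ := 1 + √β * ‖v‖

lemma _root_.TaggedParticle.one_le_linWeight (v : Vel d) : 1 ≤ linWeight β v := by
  unfold linWeight; have := Real.sqrt_nonneg β; nlinarith [norm_nonneg v]

lemma _root_.TaggedParticle.one_add_abs_inner_le (hβ : 0 < β) (hk : k ≠ 0) (v : Vel d) :
    1 + |mdot k v| ≤ linWeight β v := by
  unfold linWeight; linarith [abs_inner_modeDir_le hβ hk v]

lemma _root_.TaggedParticle.memLp_linWeight (hβ : 0 < β) (i : ℕ) :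
    MemLp (fun v => linWeight β v ^ i) 2 ϖ := by
  refine ((memLp_pow_velMeasure hβ i).const_mul ((1 + √β) ^ i)).mono
    (Continuous.aestronglyMeasurable (by unfold linWeight; fun_prop)) (ae_of_all _ fun v => ?_)
  have := Real.sqrt_nonneg β
  have h0 : 0 ≤ linWeight β v := zero_le_one.trans (one_le_linWeight v)
  rw [← mul_pow, norm_of_nonneg (by positivity), norm_of_nonneg (by positivity)]
  gcongr
  unfold linWeight
  nlinarith [norm_nonneg v]

lemma nonneg_const (S : KineticSolution β C Vh N ω k) : 0 ≤ C :=
  (norm_nonneg _).trans (S.norm_Y_le 0)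

lemma norm_three_le (hβ : 0 < β) (hk : k ≠ 0) (hω : 0 < ω.im) (v : 𝕍 3) :
    ‖S.three g v‖ ≤ C / ω.im * (|g (v 0)| * (linWeight β (v 1) * linWeight β (v 2))) := by
  have hσ := modeFreq_pos hβ hk
  have hC := S.nonneg_const
  have h := S.norm_h_le (mdot k (v 1)) (mdot k (v 2))
  rw [div_ofReal_im] at h
  have h1 := one_add_abs_inner_le hβ hk (v 1)
  have h2 := one_add_abs_inner_le hβ hk (v 2)
  rw [three, norm_mul, norm_real, norm_eq_abs, norm_div, norm_real,
    norm_of_nonneg hσ.le, mul_left_comm]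
  gcongr
  rw [div_le_iff₀ hσ]
  refine h.trans ?_
  calc C / (ω.im / modeFreq β k) * (1 + |mdot k (v 1)|) * (1 + |mdot k (v 2)|)
      ≤ C / (ω.im / modeFreq β k) * linWeight β (v 1) * linWeight β (v 2) := by
        have := one_le_linWeight (β := β) (v 1)
        gcongr
    _ = _ := by field_simp

/-- The common dominating function of the two-particle modes. -/
def _root_.TaggedParticle.pairWeight (β : ℝ) (g : Vel d → ℝ) (D : Vel d → Vel d)
    (v : 𝕍 2) : ℝ := (|g (v 0)| + ‖D (v 0)‖) * linWeight β (v 1) ^ 2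

lemma norm_inner_dir_le (hβ : 0 < β) (hk : k ≠ 0) (v : Vel d) :
    ‖((mdot k v : ℝ) : ℂ)‖ ≤ √β * ‖v‖ := by
  rw [norm_real]; exact abs_inner_modeDir_le hβ hk v

lemma norm_source_le (hβ : 0 < β) (hk : k ≠ 0) (v : 𝕍 2) :
    ‖S.source D v‖ ≤ √β * C * pairWeight β g D v := by
  have hC := S.nonneg_const
  have h := S.norm_p_le (mdot k (v 1))
  have h1 := one_add_abs_inner_le hβ hk (v 1)
  have h2 := one_le_linWeight (β := β) (v 1)
  rw [source, norm_mul, pairWeight]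
  calc _ ≤ (√β * ‖D (v 0)‖) * (C * linWeight β (v 1) ^ 2) := by
        gcongr
        · exact norm_inner_dir_le hβ hk _
        · refine h.trans ?_
          gcongr
          nlinarith
    _ ≤ _ := by
        rw [show √β * C * ((|g (v 0)| + ‖D (v 0)‖) * linWeight β (v 1) ^ 2)
          = (√β * (|g (v 0)| + ‖D (v 0)‖)) * (C * linWeight β (v 1) ^ 2) by ring]
        gcongr
        linarith [abs_nonneg (g (v 0))]

lemma norm_two_le (hβ : 0 < β) (hk : k ≠ 0) (hω : 0 < ω.im) (v : 𝕍 2) :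
    ‖S.two D v‖ ≤ √β * (C / ω.im) * pairWeight β g D v := by
  have hσ := modeFreq_pos hβ hk
  have hC := S.nonneg_const
  have h := S.norm_q_le (mdot k (v 0)) (mdot k (v 1))
  rw [div_ofReal_im] at h
  have h1 := one_add_abs_inner_le hβ hk (v 1)
  have h2 := one_le_linWeight (β := β) (v 1)
  rw [two, norm_mul, pairWeight, norm_div, norm_real (modeFreq β k), norm_of_nonneg hσ.le]
  calc _ ≤ (√β * ‖D (v 0)‖) * (C / ω.im * linWeight β (v 1) ^ 2) := by
        gcongr
        · exact norm_inner_dir_le hβ hk _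
        · rw [div_le_iff₀ hσ]
          refine h.trans ?_
          rw [show C / (ω.im / modeFreq β k) * (1 + |mdot k (v 1)|)
            = C / ω.im * (1 + |mdot k (v 1)|) * modeFreq β k by field_simp]
          gcongr
          nlinarith
    _ ≤ _ := by
        rw [show √β * (C / ω.im) * ((|g (v 0)| + ‖D (v 0)‖) * linWeight β (v 1) ^ 2)
          = (√β * (|g (v 0)| + ‖D (v 0)‖)) * (C / ω.im * linWeight β (v 1) ^ 2) by ring]
        gcongr
        linarith [abs_nonneg (g (v 0))]

/-- The rescaled frequency has imaginary part `Im ω / modeFreq`, so the loss in `deriv p` becomes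
one power of `modeFreq`. It will have to be summed over the modes. -/
lemma norm_drift_le (hβ : 0 < β) (hk : k ≠ 0) (hω : 0 < ω.im) (v : 𝕍 2) :
    ‖S.drift g v‖ ≤ β * C * (2 + ω.im⁻¹) * (1 + modeFreq β k) * pairWeight β g D v := by
  have hσ := modeFreq_pos hβ hk
  have hC := S.nonneg_const
  set ξ : ℝ := mdot k (v 1) with hξ
  have h := S.norm_p_le ξ
  have h' := S.norm_deriv_p_le ξ
  rw [div_ofReal_im, inv_div] at h'
  have h1 := one_add_abs_inner_le hβ hk (v 1)
  rw [← hξ] at h1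
  have h2 := one_le_linWeight (β := β) (v 1)
  have h3 := inv_pos.2 hω
  have k1 : ‖deriv S.p ξ - (ξ : ℂ) * S.p ξ‖
      ≤ C * ((2 + ω.im⁻¹) * (1 + modeFreq β k)) * linWeight β (v 1) ^ 2 := by
    have t1 : ‖(ξ : ℂ) * S.p ξ‖ ≤ C * linWeight β (v 1) ^ 2 := by
      rw [norm_mul, norm_real, norm_eq_abs]
      calc |ξ| * ‖S.p ξ‖ ≤ linWeight β (v 1) * (C * linWeight β (v 1)) := by
            gcongr
            · linarith
            · exact h.trans (by gcongr)
        _ = _ := by ring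
    have t2 : ‖deriv S.p ξ‖ ≤ C * (1 + modeFreq β k / ω.im) * linWeight β (v 1) ^ 2 := by
      refine h'.trans ?_
      gcongr
      nlinarith
    refine (norm_sub_le _ _).trans ((add_le_add t2 t1).trans ?_)
    rw [← add_mul]
    gcongr
    rw [div_eq_mul_inv]
    nlinarith [mul_pos hσ h3, mul_nonneg hC (mul_pos hσ h3).le, mul_nonneg hC hσ.le,
      mul_nonneg hC h3.le]
  rw [drift, norm_mul, norm_mul, norm_real, norm_real, norm_eq_abs, norm_of_nonneg hβ.le,
    pairWeight]
  calc _ ≤ (|g (v 0)| + ‖D (v 0)‖) * (β *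
        (C * ((2 + ω.im⁻¹) * (1 + modeFreq β k)) * linWeight β (v 1) ^ 2)) := by
        gcongr
        linarith [norm_nonneg (D (v 0))]
    _ = _ := by ring

lemma measurable_three (hg : Measurable g) : Measurable (S.three g) := by
  have h1 : Measurable fun v : 𝕍 3 =>
      S.h (mdot k (v 1)) (mdot k (v 2)) :=
    S.measurable_h.fun_comp (f := fun v : 𝕍 3 =>
      (mdot k (v 1), mdot k (v 2))) (by fun_prop)
  unfold three
  fun_prop

lemma measurable_two (hD : Measurable D) : Measurable (S.two D) := by
  have h1 : Measurable fun v : 𝕍 2 =>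
      S.q (mdot k (v 0)) (mdot k (v 1)) :=
    S.measurable_q.fun_comp (f := fun v : 𝕍 2 =>
      (mdot k (v 0), mdot k (v 1))) (by fun_prop)
  unfold two
  fun_prop

lemma measurable_p : Measurable S.p := S.differentiable_p.continuous.measurable

lemma measurable_source (hD : Measurable D) : Measurable (S.source D) := by
  have := S.measurable_p
  unfold source
  fun_prop

lemma measurable_drift (hg : Measurable g) : Measurable (S.drift g) := by
  have := S.measurable_p
  have := measurable_deriv S.p
  unfold drift
  fun_prop

lemma _root_.TaggedParticle.memLp_pairWeight (hβ : 0 < β) (hg : MemLp g 2 ϖ)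
    (hD : MemLp D 2 ϖ) : MemLp (pairWeight β g D) 2 (Φ 2) := by
  have h1 : MemLp (fun v : Vel d => |g v| + ‖D v‖) 2 ϖ := hg.norm.add hD.norm
  exact memLp_coord_mul hβ 0 h1 (memLp_coord_real hβ 1 (memLp_linWeight hβ 2))
    fun v y => by simp

end KineticSolution

end Mode

/-! ### The collision operators on Fourier modes -/

lemma modeOp_zero (h : 𝕍 (m + 1) → ℂ) (v : 𝕍 (m + 1)) : modeOp β Vh N m 0 h v = 0 := by
  simp [modeOp, phaseVel]

/-- The mean of `∇V` vanishes. This cancellation removes the part of `H₂` that carries the singular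
factor `1/ω`. -/
lemma mPairing_waveMul_zero (hβ : 0 < β) (hF : GradField F K Vh)
    (h : 𝕍 (m + 2) → ℂ) (ψ : Obs (m + 1)) : mPairing β F N m (waveMul 0 h) ψ = 0 := by
  simp [mPairing, forceMoment_waveMul hβ hF]

lemma preserves_vel_eval (hβ : 0 < β) (j : Fin n) :
    MeasurePreserving (fun z : Fin n → Phase d => (z j).2) (Ψ n)
      ϖ := by
  have := prob_vel (d := d) hβ
  exact (measurePreserving_eval (fun _ : Fin n => ϖ) j).comp (preserves_vel hβ)

lemma memLp_phase_coord (hβ : 0 < β) {E : Type*} [NormedAddCommGroup E] {f : Vel d → E}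
    {p : ℝ≥0∞} (hf : MemLp f p ϖ) (j : Fin n) : MemLp (fun z => f (z j).2) p (Ψ n) :=
  hf.comp_measurePreserving (preserves_vel_eval hβ j)

lemma integrable_wave_mul (k : Fin n → Λ) {f : Obs n} (hf : Integrable f (Ψ n)) :
    Integrable (fun z => wave k (fun i => (z i).1) * f z) (Ψ n) :=
  hf.bdd_mul (c := 1) (Continuous.aestronglyMeasurable (by
    have := continuous_wave k
    fun_prop)) (ae_of_all _ fun z => (norm_wave k _).le)

namespace KineticSolution

variable {C : ℝ} {ω : ℂ} {k : Fin d → ℤ} {g : Vel d → ℝ} {D : Vel d → Vel d}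
variable (S : KineticSolution β C Vh N ω k)

/-- The factor that the collision operator `M_3^2` produces on the mode `k`. -/
def _root_.TaggedParticle.collFactor (Vh : Λ → ℝ) (N : ℕ) (k : Λ) : ℂ :=
  ((((N : ℝ) - 1) / N * Vh k : ℝ) : ℂ) * -I

/-- The particle that is integrated out transfers its wave number `-k` to its partner. If the
partner is the tagged particle, `(0, k)` becomes `(-k, k)`; if it is the other background particle,
the wave numbers cancel. In the velocities, `h` is replaced by its marginal `p`. -/
lemma forceMoment_three (hβ : 0 < β) (hF : GradField F K Vh) (hk : k ≠ 0) (j : Fin 2)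
    (a : Fin d) (z : Fin 2 → Phase d) : forceMoment β F N 1 (waveMul ![0, k, -k] (S.three g)) j a z
      = collFactor Vh N k * modeDir β k a * (wave (![![-k, k], 0] j)
        (fun i => (z i).1) * (g (z 0).2 * S.p (mdot k (z 1).2))) := by
  have hσ : (modeFreq β k : ℂ) ≠ 0 := by exact_mod_cast (modeFreq_pos hβ hk).ne'
  have hn : (modeFreq β k : ℂ) * modeDir β k a = 2 * π * k a := by
    exact_mod_cast modeFreq_mul_modeDir hβ hk a
  have h1 : ∀ y, S.three g (Fin.snoc (α := fun _ => Vel d) (fun i : Fin 2 => (z i).2) y)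
      = g (z 0).2 * (S.h (mdot k (z 1).2) (mdot k y) / modeFreq β k) := fun y => rfl
  have h2 : mFourier (-k) (z j).1 * wave (fun i : Fin 2 => (![0, k, -k] : Fin 3 → _) i.castSucc)
      (fun i => (z i).1) = wave (![![-k, k], 0] j) (fun i => (z i).1) := by
    have e : ∀ x : Torus d, mFourier (-k) x * mFourier k x = 1 := fun x => by
      rw [← mFourier_add]; simp [mFourier_zero]
    fin_cases j
    · simp [wave, mFourier_zero]
    · simp [wave, mFourier_zero, e]
  simp_rw [forceMoment_waveMul hβ hF, h1]
  rw [integral_const_mul, integral_div, integral_comp_inner hβ (norm_sq_modeDir hβ hk)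
    (f := fun ξ => S.h (mdot k (z 1).2) ξ)
    (S.measurable_h.comp measurable_prodMk_left), S.integral_h_right, collFactor]
  change _ * (2 * _ * I * ((-k) a : ℤ) * (Vh (-k) : ℂ) * (mFourier (-k) (z j).1 * _) * _) = _
  rw [h2, hF.neg]
  push_cast [Pi.neg_apply]
  rw [show (modeDir β k a : ℂ) = 2 * π * k a / modeFreq β k by rw [← hn]; field_simp]
  field_simp

/-- The mode of `K₂`, up to the factor `collFactor`. -/
def pairSource (g : Vel d → ℝ) (D : Vel d → Vel d) (z : Fin 2 → Phase d) : ℂ :=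
  waveMul ![-k, k] (S.source D) z + waveMul 0 (S.drift g) z

/-- The mode of `H₂`, up to the factor `collFactor`. -/
def pairSolution (g : Vel d → ℝ) (D : Vel d → Vel d) (z : Fin 2 → Phase d) : ℂ :=
  waveMul ![-k, k] (S.two D) z + I / ω * waveMul 0 (S.drift g) z

lemma memLp_p (hβ : 0 < β) : MemLp (fun v : Vel d => S.p (mdot k v)) 2 ϖ :=
  (memLp_one_add_inner hβ _ C).mono' (S.measurable_p.fun_comp (f := fun v : Vel d =>
    (mdot k v)) (by fun_prop)).aestronglyMeasurable
    (ae_of_all _ fun v => S.norm_p_le _)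

/-- The velocity divergence is integrated by parts. On the tagged particle it acts on `g` and yields
`n·D`; on the background particle it acts on `p(n·v)` and yields `β(p' - ξp)`, since `|n|² = β`. -/
theorem mPairing_three (hβ : 0 < β) (hF : GradField F K Vh) (hk : k ≠ 0)
    (hg : MemLp g 2 ϖ) (hD : MemLp D 2 ϖ)
    (hgD : HasAdaptedGrad β (fun v => (g v : ℂ)) fun a v => (D v a : ℂ))
    {ψ : Obs 2} (hψ : IsTest ψ) : mPairing β F N 1 (waveMul ![0, k, -k] (S.three g)) ψ
      = ∫ z, collFactor Vh N k * S.pairSource g D z * ψ z ∂Ψ 2 := by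
  set c := collFactor Vh N k with hc
  set q : Vel d → ℂ := fun v => S.p (mdot k v) with hq
  set q' : Fin d → Vel d → ℂ := fun a v => (modeDir β k a : ℂ) * deriv S.p (mdot k v)
    - (β * v a : ℝ) * q v with hq'
  have hadj : HasAdaptedGrad β q q' :=
    hasAdaptedGrad_profile hβ S.differentiable_p S.norm_p_le S.norm_deriv_p_le _
  have mq : MemLp q 2 ϖ := S.memLp_p hβ
  have mq' : ∀ a, MemLp (q' a) 2 ϖ := by
    intro a
    have h1 : MemLp (fun v : Vel d => deriv S.p (mdot k v)) 2 ϖ :=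
      (memLp_one_add_inner hβ _ _).mono' ((measurable_deriv S.p).fun_comp (f := fun v : Vel d =>
        (mdot k v)) (by fun_prop)).aestronglyMeasurable
        (ae_of_all _ fun v => S.norm_deriv_p_le _)
    have h2 : MemLp (fun v : Vel d => ((β * v a : ℝ) : ℂ) * q v) 2 ϖ := by
      refine ((memLp_linWeight hβ 2).const_mul (β * (1 + β) * (C * (1 + ‖modeDir β k‖)) *
        (1 + (√β)⁻¹) ^ 2)).mono'
        ((by fun_prop : Measurable fun v : Vel d => ((β * v a : ℝ) : ℂ)).aestronglyMeasurable.mul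
          mq.aestronglyMeasurable) (ae_of_all _ fun v => ?_)
      have hC := S.nonneg_const
      have hs := Real.sqrt_pos.2 hβ
      have b1 : ‖v‖ ≤ (1 + (√β)⁻¹) * linWeight β v := by
        have : (√β)⁻¹ * (√β * ‖v‖) = ‖v‖ := by field_simp
        unfold linWeight
        nlinarith [norm_nonneg v, inv_pos.2 hs, mul_nonneg hs.le (norm_nonneg v)]
      have b2 : ‖q v‖ ≤ C * (1 + ‖modeDir β k‖) * ((1 + (√β)⁻¹) * linWeight β v) := by
        refine (S.norm_p_le _).trans ?_
        rw [mul_assoc]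
        gcongr
        have := abs_real_inner_le_norm (modeDir β k) v
        have b3 : 1 ≤ (1 + (√β)⁻¹) * linWeight β v :=
          one_le_mul_of_one_le_of_one_le (by linarith [inv_pos.2 hs]) (one_le_linWeight v)
        nlinarith [norm_nonneg v, norm_nonneg (modeDir β k)]
      rw [norm_mul, norm_real, norm_mul, norm_of_nonneg hβ.le]
      have b4 := (PiLp.norm_apply_le v a).trans b1
      have b5 : 0 ≤ linWeight β v := zero_le_one.trans (one_le_linWeight v)
      calc β * ‖v a‖ * ‖q v‖ ≤ β * ((1 + (√β)⁻¹) * linWeight β v) *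
            (C * (1 + ‖modeDir β k‖) * ((1 + (√β)⁻¹) * linWeight β v)) := by gcongr
        _ = β * 1 * (C * (1 + ‖modeDir β k‖)) * (1 + (√β)⁻¹) ^ 2 * linWeight β v ^ 2 := by ring
        _ ≤ _ := by gcongr; linarith
    exact (h1.const_mul _).sub h2
  have mg : MemLp (fun v => (g v : ℂ)) 2 ϖ := hg.ofReal
  have mD : ∀ a, MemLp (fun v => (D v a : ℂ)) 2 ϖ := fun a => (hD.eval_piLp a).ofReal
  have i1 : ∀ {u w : Vel d → ℂ}, MemLp u 2 ϖ → MemLp w 2 ϖ →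
      Integrable (fun z : Fin 2 → Phase d => u (z 0).2 * w (z 1).2) (Ψ 2) :=
    fun hu hw => (memLp_phase_coord hβ hu 0).integrable_mul (memLp_phase_coord hβ hw 1)
  obtain ⟨B, -, hB⟩ := hψ.exists_bound
  have i2 : ∀ (κ : Fin 2 → Λ) {u w : Vel d → ℂ}, MemLp u 2 ϖ →
      MemLp w 2 ϖ → ∀ a : Fin d, Integrable (fun z : Fin 2 → Phase d =>
        c * modeDir β k a * wave κ (fun i => (z i).1) * (u (z 0).2 * w (z 1).2))
        (Ψ 2) := by
    intro κ u w hu hw a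
    simp_rw [mul_assoc (c * (modeDir β k a : ℂ))]
    exact (integrable_wave_mul κ (i1 hu hw)).const_mul _
  have t0 : ∀ a, ∫ z, forceMoment β F N 1 (waveMul ![0, k, -k] (S.three g)) 0 a z * dv 0 a ψ z
      ∂Ψ 2 = -∫ z, c * modeDir β k a * wave ![-k, k] (fun i => (z i).1) *
        ((D (z 0).2 a : ℂ) * q (z 1).2) * ψ z ∂Ψ 2 := by
    intro a
    have := integral_mul_dv hβ hgD 0 a (E := fun z : Fin 2 → Phase d =>
      c * modeDir β k a * wave ![-k, k] (fun i => (z i).1) * q (z 1).2)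
      (fun z w => by simp [wave]) ((i2 ![-k, k] mg mq a).congr (ae_of_all _ fun z => by ring))
      ((i2 ![-k, k] (mD a) mq a).congr (ae_of_all _ fun z => by ring)) hψ
    refine (integral_congr_ae (ae_of_all _ fun z => ?_)).trans
      (this.trans (congrArg Neg.neg (integral_congr_ae (ae_of_all _ fun z => ?_))))
    · simp only [S.forceMoment_three hβ hF hk, hq, ← hc, Matrix.cons_val_zero]
      ring
    · simp only []; ring
  have t1 : ∀ a, ∫ z, forceMoment β F N 1 (waveMul ![0, k, -k] (S.three g)) 1 a z * dv 1 a ψ z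
      ∂Ψ 2 = -∫ z, c * modeDir β k a * wave 0 (fun i => (z i).1) *
        ((g (z 0).2 : ℂ) * q' a (z 1).2) * ψ z ∂Ψ 2 := by
    intro a
    have := integral_mul_dv hβ hadj 1 a (E := fun z : Fin 2 → Phase d =>
      c * modeDir β k a * wave 0 (fun i => (z i).1) * (g (z 0).2 : ℂ))
      (fun z w => by simp [wave]) ((i2 0 mg mq a).congr (ae_of_all _ fun z => by ring))
      ((i2 0 mg (mq' a) a).congr (ae_of_all _ fun z => by ring)) hψ
    refine (integral_congr_ae (ae_of_all _ fun z => ?_)).trans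
      (this.trans (congrArg Neg.neg (integral_congr_ae (ae_of_all _ fun z => ?_))))
    · simp only [S.forceMoment_three hβ hF hk, hq, ← hc, Matrix.cons_val_one, Matrix.cons_val_zero]
      ring
    · simp only []; ring
  have i3 : ∀ {f : Obs 2}, Integrable f (Ψ 2) → Integrable (fun z => f z * ψ z) (Ψ 2) := fun hf =>
    hf.mul_bdd (c := B) hψ.continuous.aestronglyMeasurable (ae_of_all _ hB)
  have e : ∀ f : Fin (1 + 1) → ℂ, ∑ j, f j = f 0 + f 1 := Fin.sum_univ_two
  rw [mPairing, e]
  change -(∑ a, ∫ z, _ * dv 0 a ψ z ∂Ψ 2 + ∑ a, ∫ z, _ * dv 1 a ψ z ∂Ψ 2) = _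
  simp_rw [t0, t1]
  rw [← sum_add_distrib, ← sum_neg_distrib]
  simp_rw [neg_add, neg_neg]
  have j0 := fun a => i3 (i2 ![-k, k] (mD a) mq a)
  have j1 := fun a => i3 (i2 0 mg (mq' a) a)
  have a1 : ∀ a, _ := fun a => integral_add (j0 a) (j1 a)
  simp_rw [← a1]
  have i4 := integral_finsetSum Finset.univ fun a _ => (j0 a).add (j1 a)
  simp only [Pi.add_apply] at i4
  rw [← i4]
  refine integral_congr_ae (ae_of_all _ fun z => ?_)
  simp only [← add_mul, ← sum_mul]
  congr 1
  have sx : ∀ x : Vel d, ((mdot k x : ℝ) : ℂ) = ∑ a, (modeDir β k a : ℂ) * (x a : ℂ) := fun x => by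
    rw [PiLp.inner_apply]; push_cast; simp [mul_comm]
  have s3 : (β : ℂ) = ∑ a, (modeDir β k a : ℂ) * (modeDir β k a : ℂ) := by
    rw [← sx, real_inner_self_eq_norm_sq, norm_sq_modeDir hβ hk]
  have s4 : (β : ℂ) * (deriv S.p (mdot k (z 1).2) - (mdot k (z 1).2 : ℝ) * S.p (mdot k (z 1).2))
      = ∑ a, (modeDir β k a : ℂ) * q' a (z 1).2 := by
    rw [mul_sub, show (β : ℂ) * deriv S.p (mdot k (z 1).2) = (∑ a, (modeDir β k a : ℂ) * (modeDir β k a : ℂ))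
      * deriv S.p (mdot k (z 1).2) by rw [← s3], sx, sum_mul, ← mul_assoc, mul_sum, sum_mul,
      ← sum_sub_distrib]
    refine sum_congr rfl fun a _ => ?_
    simp only [hq', hq]
    push_cast
    ring
  rw [pairSource, waveMul, waveMul, source, drift, sx, s4]
  simp only [mul_sum, sum_mul, mul_add, ← sum_add_distrib]
  refine sum_congr rfl fun a _ => ?_
  simp only [hq]
  ring

lemma dv_comp_vel (ψ : Vel d → ℂ) (a : Fin d) (z : Fin 1 → Phase d) :
    dv 0 a (fun z : Fin 1 → Phase d => ψ (z 0).2) z = velDeriv a ψ (z 0).2 := by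
  simp [dv]

/-- Integrating out the background particle restores wave number zero and leaves only the density
`Y` of the solution, for which the uniform bounds hold. -/
theorem mPairing_two (hβ : 0 < β) (hF : GradField F K Vh) (hN : 1 ≤ N) (hk : k ≠ 0)
    (hD : Measurable D) {ψ : Vel d → ℂ} (hψ : IsVelTest ψ) :
    mPairing β F N 0 (waveMul ![-k, k] (S.two D)) (fun z => ψ (z 0).2)
      = -∑ a, ∫ v, I * modeDir β k a * Vh k * ((mdot k (D v) : ℝ) *
        S.Y (mdot k v)) * velDeriv a ψ v ∂ϖ := by
  have hσ : (modeFreq β k : ℂ) ≠ 0 := by exact_mod_cast (modeFreq_pos hβ hk).ne'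
  have hN' : ((N : ℝ) - (0 : ℕ)) / N = 1 := by
    have : (N : ℝ) ≠ 0 := by positivity
    simp [this]
  have h3 : ∀ a z, forceMoment β F N 0 (waveMul ![-k, k] (S.two D)) 0 a z
      = I * modeDir β k a * Vh k * ((mdot k (D (z 0).2) : ℝ) * S.Y (mdot k (z 0).2)) := by
    intro a z
    have hn : (modeFreq β k : ℂ) * modeDir β k a = 2 * π * k a := by
      exact_mod_cast modeFreq_mul_modeDir hβ hk a
    have h1 : ∀ y, S.two D (Fin.snoc (α := fun _ => Vel d) (fun i : Fin 1 => (z i).2) y)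
        = (mdot k (D (z 0).2) : ℝ) * (S.q (mdot k (z 0).2)
          (mdot k y) / modeFreq β k) := fun y => rfl
    have h2 : mFourier k (z 0).1 * wave (fun i : Fin 1 => (![-k, k] : Fin 2 → _) i.castSucc)
        (fun i => (z i).1) = 1 := by
      simp only [wave, Fin.prod_univ_one]
      change mFourier k (z 0).1 * mFourier (-k) (z 0).1 = 1
      rw [← mFourier_add]; simp [mFourier_zero]
    simp_rw [forceMoment_waveMul hβ hF, h1]
    rw [integral_const_mul, integral_div, integral_comp_inner hβ (norm_sq_modeDir hβ hk)
      (f := fun ξ => S.q (mdot k (z 0).2) ξ)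
      (S.measurable_q.comp measurable_prodMk_left), S.integral_q, hN']
    change _ * (2 * _ * I * (k a : ℂ) * (Vh k : ℂ) * (mFourier k (z 0).1 * _) * _) = _
    rw [h2, show (modeDir β k a : ℂ) = 2 * π * k a / modeFreq β k by rw [← hn]; field_simp]
    push_cast
    field_simp
  rw [mPairing]
  have e : ∀ f : Fin (0 + 1) → ℂ, ∑ j, f j = f 0 := Fin.sum_univ_one
  rw [e]
  simp_rw [h3]
  congr 1
  refine sum_congr rfl fun a _ => ?_
  simp_rw [dv_comp_vel]
  rw [← (preserves_vel_eval hβ (0 : Fin 1)).map_eq, integral_map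
    (by fun_prop : Measurable fun z : Fin 1 → Phase d => (z 0).2).aemeasurable]
  have h5 := S.measurable_Y
  have h6 := (hψ.continuous_velDeriv a).measurable
  fun_prop

end KineticSolution

/-! ### Series in `L²` -/

section Series

variable {X ι : Type*} [MeasurableSpace X] {μ : Measure X} {f : ι → X → ℂ} {H : X → ℂ}

/-- `H` is in `L²` and is the weak sum of the functions `f k`. -/
structure IsL2Series (μ : Measure X) (f : ι → X → ℂ) (H : X → ℂ) : Prop where
  memLp : MemLp H 2 μ
  hasSum : ∀ χ : X → ℂ, MemLp χ 2 μ → HasSum (fun k => ∫ x, f k x * χ x ∂μ) (∫ x, H x * χ x ∂μ)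

lemma exists_l2Series_of_summable_toLp (hf : ∀ k, MemLp (f k) 2 μ)
    (hs : Summable fun k => (hf k).toLp (f k)) : ∃ H, IsL2Series μ f H := by
  refine ⟨_, Lp.memLp (∑' k, (hf k).toLp (f k)), fun χ hχ => ?_⟩
  have h := hasSum_integral_mul hs.hasSum hχ
  have e : ∀ k, ∫ x, ((hf k).toLp (f k) : X → ℂ) x * χ x ∂μ = ∫ x, f k x * χ x ∂μ := fun k =>
    integral_congr_ae ((hf k).coeFn_toLp.mono fun x hx => by simp only [hx])
  simpa only [e] using h

lemma memLp_of_le_weight {u : X → ℂ} {M : X → ℝ} {b : ℝ} (hM : MemLp M 2 μ)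
    (hu : AEStronglyMeasurable u μ) (hb : ∀ x, ‖u x‖ ≤ b * M x) : MemLp u 2 μ :=
  (hM.const_mul b).mono' hu (ae_of_all _ hb)

lemma norm_toLp_le_weight {u : X → ℂ} {M : X → ℝ} {b : ℝ} (hM : MemLp M 2 μ) (hb0 : 0 ≤ b)
    (hu : MemLp u 2 μ) (hb : ∀ x, ‖u x‖ ≤ b * M x) : ‖hu.toLp u‖ ≤ b * ‖hM.toLp M‖ := by
  refine Lp.norm_le_mul_norm_of_ae_le_mul ?_
  filter_upwards [hu.coeFn_toLp, hM.coeFn_toLp] with x h1 h2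
  rw [h1, h2]
  exact (hb x).trans (mul_le_mul_of_nonneg_left (le_abs_self _) hb0)

lemma exists_l2Series {M : X → ℝ} {b : ι → ℝ} (hM : MemLp M 2 μ)
    (hf : ∀ k, AEStronglyMeasurable (f k) μ) (hb0 : ∀ k, 0 ≤ b k)
    (hb : ∀ k x, ‖f k x‖ ≤ b k * M x) (hs : Summable b) : ∃ H, IsL2Series μ f H :=
  exists_l2Series_of_summable_toLp (fun k => memLp_of_le_weight hM (hf k) (hb k))
    (Summable.of_norm_bounded (hs.mul_right _) fun k => norm_toLp_le_weight hM (hb0 k) _ (hb k))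

/-- Orthogonality lets square summability of the norms replace absolute convergence. -/
lemma summable_of_orthogonal {E : Type*} [NormedAddCommGroup E] [InnerProductSpace ℂ E]
    [CompleteSpace E] {u : ι → E} (ho : Pairwise fun i j => inner ℂ (u i) (u j) = 0)
    (hs : Summable fun i => ‖u i‖ ^ 2) : Summable u := by
  have hV : OrthogonalFamily ℂ (fun i => (ℂ ∙ u i : Submodule ℂ E))
      fun i => (ℂ ∙ u i : Submodule ℂ E).subtypeₗᵢ := by
    refine OrthogonalFamily.of_pairwise fun i j hij => ?_
    change (ℂ ∙ u i) ⟂ (ℂ ∙ u j)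
    rw [Submodule.isOrtho_span]
    rintro _ rfl _ rfl
    exact ho hij
  exact (hV.summable_iff_norm_sq_summable fun i => ⟨u i, Submodule.mem_span_singleton_self _⟩).2 hs

/-- Used for `H₃`, whose coefficients are those of the Gibbs correlation and are known only to be
square summable. -/
lemma exists_l2Series_of_orthogonal {M : X → ℝ} {b : ι → ℝ} (hM : MemLp M 2 μ)
    (hf : ∀ k, AEStronglyMeasurable (f k) μ) (hb0 : ∀ k, 0 ≤ b k)
    (hb : ∀ k x, ‖f k x‖ ≤ b k * M x) (hs : Summable fun k => b k ^ 2)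
    (ho : Pairwise fun i j => ∫ x, f j x * conj (f i x) ∂μ = 0) : ∃ H, IsL2Series μ f H := by
  refine exists_l2Series_of_summable_toLp (fun k => memLp_of_le_weight hM (hf k) (hb k))
    (summable_of_orthogonal (fun i j hij => ?_)
      (Summable.of_nonneg_of_le (fun k => by positivity) (fun k => ?_) (hs.mul_right
        (‖hM.toLp M‖ ^ 2))))
  · refine Eq.trans ?_ (ho hij)
    rw [L2.inner_def]
    refine integral_congr_ae ?_
    filter_upwards [(memLp_of_le_weight hM (hf i) (hb i)).coeFn_toLp,
      (memLp_of_le_weight hM (hf j) (hb j)).coeFn_toLp] with x h1 h2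
    rw [h1, h2]; simp
  · rw [← mul_pow]
    gcongr
    exact norm_toLp_le_weight hM (hb0 k) _ (hb k)

end Series

/-- On the maximal domain the equation is a family of tested identities, so it passes from the terms
to the sum without any convergence of derivatives. -/
lemma isResolvent_of_series {ι : Type*} (hβ : 0 < β) (hF : GradField F K Vh) {ω : ℂ}
    {G H : Obs (m + 1)} {f s : ι → Obs (m + 1)}
    (hG : MemLp G 2 (Ψ (m + 1))) (hH : IsL2Series (Ψ (m + 1)) f H)
    (hs : ∀ ψ, IsTest ψ → HasSum (fun k => ∫ z, s k z * ψ z ∂Ψ (m + 1))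
      (∫ z, G z * ψ z ∂Ψ (m + 1)))
    (h : ∀ k ψ, IsTest ψ → ∫ z, f k z * vlasovAdj β F N m ψ z ∂Ψ (m + 1)
      = ∫ z, s k z * ψ z ∂Ψ (m + 1) + I * ω * ∫ z, f k z * ψ z ∂Ψ (m + 1)) :
    IsResolvent β F N m ω G H := by
  rw [IsResolvent, isVlasov_iff hβ hF]
  refine ⟨hH.memLp, hG.add (hH.memLp.const_mul _), fun ψ hψ => ?_⟩
  have h1 := hH.hasSum _ (memLp_vlasovAdj (N := N) hβ hF hψ)
  simp_rw [h _ ψ hψ] at h1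
  have h2 := (hs ψ hψ).add ((hH.hasSum ψ (hψ.memLp hβ)).mul_left (I * ω))
  rw [h1.unique h2, ← integral_const_mul]
  have i1 : Integrable (fun z => G z * ψ z) (Ψ (m + 1)) := hG.integrable_mul (hψ.memLp hβ)
  have i2 : Integrable (fun z => I * ω * (H z * ψ z)) (Ψ (m + 1)) :=
    (hH.memLp.integrable_mul (hψ.memLp hβ)).const_mul _
  have a1 := integral_add i1 i2
  rw [← a1]
  exact integral_congr_ae (ae_of_all _ fun z => by simp only []; ring)

/-! ### The source term -/

/-- The pairing sees `R` only through the difference of two positions, so it can be pushed forward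
to a single torus. Translating the first of the two positions by an arbitrary amount and averaging
yields a bounded, hence square integrable, density. -/
lemma exists_difference_density (hβ : 0 < β) {g : Vel d → ℝ} (hg : Measurable g)
    (mg : MemLp g 2 ϖ) {ψ : Obs 3} (hψ : Continuous ψ) {B : ℝ} (hB : ∀ z, ‖ψ z‖ ≤ B) :
    ∃ Θ : Torus d → ℂ, MemLp Θ 2 ∧ ∀ R : Torus d → ℂ, Measurable R → (∃ b, ∀ x, ‖R x‖ ≤ b) →
      ∫ z, R ((z 1).1 - (z 2).1) * (g (z 0).2 * ψ z) ∂Ψ 3 = ∫ u, R u * Θ u := by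
  have := prob_phase (d := d) hβ 3
  have := prob_vel (d := d) hβ
  have ig : Integrable (fun z : Fin 3 → Phase d => |g (z 0).2|) (Ψ 3) :=
    (memLp_phase_coord hβ mg 0).norm.integrable (by norm_num)
  have hB0 : 0 ≤ B := (norm_nonneg _).trans (hB 0)
  set T : Torus d → (Fin 3 → Phase d) → (Fin 3 → Phase d) := fun u z =>
    update z 1 (u + (z 2).1, (z 1).2) with hT
  have cT : Measurable fun p : Torus d × (Fin 3 → Phase d) => T p.1 p.2 := by
    refine measurable_pi_iff.2 fun i => ?_
    fin_cases i <;> simp [hT] <;> fun_prop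
  have key : ∀ (R : Torus d → ℂ), Measurable R → ∀ b, (∀ x, ‖R x‖ ≤ b) →
      ∀ (e : Torus d × (Fin 3 → Phase d) → Torus d), Measurable e →
      ∀ (S : Torus d × (Fin 3 → Phase d) → (Fin 3 → Phase d)), Measurable S →
      Integrable (fun p : Torus d × (Fin 3 → Phase d) =>
        R (e p) * (g (p.2 0).2 * ψ (S p))) ((volume : Measure (Torus d)).prod
          (Ψ 3)) := by
    intro R hR b hb e he S hS
    have h1 : Integrable (fun p : Torus d × (Fin 3 → Phase d) => b * B * |g (p.2 0).2|)
        ((volume : Measure (Torus d)).prod (Ψ 3)) :=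
      (ig.comp_snd volume).const_mul _
    have hb0 : 0 ≤ b := (norm_nonneg _).trans (hb 0)
    refine h1.mono' (Measurable.aestronglyMeasurable ?_) (ae_of_all _ fun p => ?_)
    · have m1 := hR.comp he
      have m2 : Measurable fun p => ψ (S p) := by
        have m3 : Measurable ψ := hψ.measurable
        exact m3.fun_comp (f := S) hS
      exact m1.mul (Measurable.mul (by fun_prop) m2)
    · rw [norm_mul, norm_mul, norm_real, norm_eq_abs]
      calc ‖R (e p)‖ * (|g (p.2 0).2| * ‖ψ (S p)‖) ≤ b * (|g (p.2 0).2| * B) := by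
            gcongr
            · exact hb _
            · exact hB _
        _ = _ := by ring
  refine ⟨fun u => ∫ z, g (z 0).2 * ψ (T u z) ∂Ψ 3, ?_, fun R hR hb => ?_⟩
  · have k1 := key (fun _ => 1) measurable_const 1 (by simp) Prod.fst measurable_fst
      (fun p => T p.1 p.2) cT
    have k2 := k1.integral_prod_left
    simp only [one_mul] at k2
    refine MemLp.of_bound k2.aestronglyMeasurable (B * ∫ z, |g (z 0).2| ∂Ψ 3)
      (ae_of_all _ fun u => (norm_integral_le_integral_norm _).trans ?_)
    rw [← integral_const_mul]
    refine integral_mono_of_nonneg (ae_of_all _ fun z => norm_nonneg _) (ig.const_mul _)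
      (ae_of_all _ fun z => ?_)
    simp only [norm_mul, norm_real, norm_eq_abs]
    rw [mul_comm]
    gcongr
    exact hB _
  · obtain ⟨b, hb⟩ := hb
    have k1 := key R hR b hb Prod.fst measurable_fst (fun p => T p.1 p.2) cT
    set sh : Torus d → Fin 3 → Torus d := fun u => Pi.single 1 u with hsh
    have k2 := key R hR b hb (fun p => p.1 + ((p.2 1).1 - (p.2 2).1)) (by fun_prop)
      (fun p => shift (sh p.1) p.2) (by
        refine measurable_pi_iff.2 fun i => ?_
        fin_cases i <;> simp [shift, hsh] <;> fun_prop)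
    have e1 : ∀ z : Fin 3 → Phase d, ∫ u, R u * (g (z 0).2 * ψ (T u z))
        = ∫ u, R (u + ((z 1).1 - (z 2).1)) * (g (z 0).2 * ψ (shift (sh u) z)) := by
      intro z
      rw [← integral_add_right_eq_self (fun u => R u * (g (z 0).2 * ψ (T u z)))
        ((z 1).1 - (z 2).1)]
      refine integral_congr_ae (ae_of_all _ fun u => ?_)
      have : T (u + ((z 1).1 - (z 2).1)) z = shift (sh u) z := by
        funext i
        fin_cases i
        · simp [hT, shift, hsh]
        · change update z 1 _ 1 = ((z 1).1 + (Pi.single 1 u : Fin 3 → Torus d) 1, (z 1).2)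
          rw [update_self, Pi.single_eq_same]
          exact Prod.ext (by simp only []; abel) rfl
        · simp [hT, shift, hsh]
      simp only [this]
    have e2 : ∀ u, ∫ z, R (u + ((z 1).1 - (z 2).1)) * (g (z 0).2 * ψ (shift (sh u) z))
        ∂Ψ 3 = ∫ z, R ((z 1).1 - (z 2).1) * (g (z 0).2 * ψ z)
        ∂Ψ 3 := by
      intro u
      refine Eq.trans (integral_congr_ae (ae_of_all _ fun z => ?_))
        ((preserves_shift hβ (sh u)).integral_comp (measurableEmbedding_shift _)
          fun z => R ((z 1).1 - (z 2).1) * (g (z 0).2 * ψ z))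
      have : (shift (sh u) z 1).1 - (shift (sh u) z 2).1 = u + ((z 1).1 - (z 2).1) := by
        simp [shift, hsh]; abel
      simp only [this]
      rfl
    have s1 := integral_integral_swap (f := fun (u : Torus d) z => R u * (g (z 0).2 * ψ (T u z))) k1
    have s2 := integral_integral_swap (f := fun (u : Torus d) (z : Fin 3 → Phase d) =>
      R (u + ((z 1).1 - (z 2).1)) * (g (z 0).2 * ψ (shift (sh u) z))) k2
    simp_rw [e2, integral_const] at s2
    simp_rw [integral_const_mul, e1] at s1
    rw [s1, ← s2]
    simp

lemma wave_three (k : Λ) (z : Fin 3 → Phase d) :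
    wave ![0, k, -k] (fun i => (z i).1) = mFourier k ((z 1).1 - (z 2).1) := by
  simp [wave, Fin.prod_univ_three, mFourier_zero, mFourier_sub_arg]

/-- Parseval's identity on the torus of the position difference. The mean of `R` vanishes, so the
zero mode may be omitted from the sum. -/
lemma hasSum_source (hβ : 0 < β) {g : Vel d → ℝ} (hg : Measurable g)
    (mg : MemLp g 2 ϖ) {R : Torus d → ℂ} (hR : Measurable R) {b : ℝ}
    (hb : ∀ x, ‖R x‖ ≤ b) (h0 : ∫ x, R x = 0) {ψ : Obs 3} (hψ : IsTest ψ) :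
    HasSum (fun k : Λ₀ => ∫ z, (∫ x, R x * mFourier (-k.1) x) *
      waveMul ![0, k.1, -k.1] (fun v => (g (v 0) : ℂ)) z * ψ z ∂Ψ 3)
      (∫ z, g (z 0).2 * R ((z 1).1 - (z 2).1) * ψ z ∂Ψ 3) := by
  obtain ⟨B, -, hB⟩ := hψ.exists_bound
  obtain ⟨Θ, mΘ, hΘ⟩ := exists_difference_density hβ hg mg hψ.continuous hB
  have h1 := hasSum_fourier_mul (MemLp.of_bound hR.aestronglyMeasurable b (ae_of_all _ hb)) mΘ
  rw [← hΘ R hR ⟨b, hb⟩] at h1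
  have e1 : ∀ k : Λ, ∫ u, Θ u * mFourier k u
      = ∫ z, waveMul ![0, k, -k] (fun v => (g (v 0) : ℂ)) z * ψ z ∂Ψ 3 := by
    intro k
    simp_rw [mul_comm (Θ _)]
    rw [← hΘ _ (map_continuous _).measurable ⟨1, fun x => (norm_mFourier_apply k x).le⟩]
    refine integral_congr_ae (ae_of_all _ fun z => ?_)
    simp only [waveMul, wave_three]; ring
  simp_rw [e1] at h1
  have e2 : ∀ z : Fin 3 → Phase d, R ((z 1).1 - (z 2).1) * (g (z 0).2 * ψ z)
    = g (z 0).2 * R ((z 1).1 - (z 2).1) * ψ z := fun z => by ring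
  simp_rw [e2] at h1
  rw [← hasSum_subtype_iff_of_support_subset (s := {k : Λ | k ≠ 0})] at h1
  · refine h1.congr_fun ?_
    intro k
    simp only [Function.comp_apply, mul_assoc, integral_const_mul]
  · intro k hk h
    have h : k = 0 := by simpa using h
    refine hk ?_
    simp [h, mFourier_zero, h0]

/-! ### Summability of the Fourier coefficients of the force -/

namespace GradField

lemma nonneg_bound (hF : GradField F K Vh) : 0 ≤ K := (norm_nonneg _).trans (hF.bound 0)

lemma summable (hF : GradField F K Vh) : Summable Vh := summable_of_sum_le hF.nonneg hF.sum_le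

lemma le_bound (hF : GradField F K Vh) (k : Λ) : Vh k ≤ K := by
  simpa using hF.sum_le {k}

/-- Up to `√β`, the product `modeFreq · V̂` is the modulus of the Fourier coefficient of `∇V`. It is
thus both bounded and square summable. -/
lemma sq_modeFreq_mul (hβ : 0 < β) (hF : GradField F K Vh) (k : Λ) :
    (modeFreq β k * Vh k) ^ 2 = β⁻¹ * ∑ a, ‖∫ x, (F x a : ℂ) * mFourier (-k) x‖ ^ 2 := by
  have e : ∀ a, ‖∫ x, (F x a : ℂ) * mFourier (-k) x‖ ^ 2 = (2 * π * Vh k) ^ 2 * (k a : ℝ) ^ 2 := by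
    intro a
    rw [hF.coeff a k]
    simp only [norm_mul, norm_I, norm_real, mul_one, norm_of_nonneg (hF.nonneg k),
      norm_of_nonneg Real.pi_pos.le, norm_intCast, norm_ofNat, mul_pow, sq_abs]
    ring
  simp_rw [e]
  rw [← mul_sum, modeFreq]
  have : ‖(WithLp.toLp 2 fun a => (k a : ℝ) : Vel d)‖ ^ 2 = ∑ a, (k a : ℝ) ^ 2 := by
    simp [EuclideanSpace.norm_sq_eq]
  rw [← this, mul_pow, div_pow, Real.sq_sqrt hβ.le]
  ring

lemma norm_coeff_le (hF : GradField F K Vh) (a : Fin d) (k : Λ) :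
    ‖∫ x, (F x a : ℂ) * mFourier (-k) x‖ ≤ K := by
  have := norm_integral_le_of_norm_le_const (μ := (volume : Measure (Torus d))) (C := K)
    (f := fun x => (F x a : ℂ) * mFourier (-k) x) (ae_of_all _ fun x => by
      rw [norm_mul, norm_mFourier_apply, mul_one, norm_real]
      exact (PiLp.norm_apply_le _ a).trans (hF.bound x))
  simpa using this

lemma modeFreq_mul_le (hβ : 0 < β) (hF : GradField F K Vh) (k : Λ) :
    modeFreq β k * Vh k ≤ √(β⁻¹ * (d * K ^ 2)) := by
  refine Real.le_sqrt_of_sq_le ?_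
  rw [hF.sq_modeFreq_mul hβ]
  gcongr
  calc ∑ a, ‖∫ x, (F x a : ℂ) * mFourier (-k) x‖ ^ 2 ≤ ∑ _a : Fin d, K ^ 2 := by
        gcongr with a
        exact hF.norm_coeff_le a k
    _ = _ := by simp

lemma summable_sq_modeFreq_mul (hβ : 0 < β) (hF : GradField F K Vh) :
    Summable fun k => (modeFreq β k * Vh k) ^ 2 := by
  simp_rw [hF.sq_modeFreq_mul hβ]
  refine (summable_sum fun a _ => summable_sq_fourier (MemLp.of_bound
    (by have := hF.measurable; fun_prop) K
    (ae_of_all _ fun x => ?_))).mul_left _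
  rw [norm_real]
  exact (PiLp.norm_apply_le _ a).trans (hF.bound x)

end GradField

/-! ### Summation over the Fourier modes. -/

lemma norm_collFactor_le (hF : GradField F K Vh) (hN : 1 ≤ N) (k : Λ) :
    ‖collFactor Vh N k‖ ≤ Vh k := by
  have hN' : (1 : ℝ) ≤ N := by exact_mod_cast hN
  have h1 : ((N : ℝ) - 1) / N ≤ 1 := by rw [div_le_one (by linarith)]; linarith
  have h0 : 0 ≤ ((N : ℝ) - 1) / N := div_nonneg (by linarith) (by linarith)
  rw [collFactor, norm_mul, norm_real, norm_neg, norm_I, mul_one,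
    norm_of_nonneg (mul_nonneg h0 (hF.nonneg k))]
  exact mul_le_of_le_one_left (hF.nonneg k) h1

lemma measurable_waveMul (k : Fin n → Λ) {h : 𝕍 n → ℂ} (hh : Measurable h) :
    Measurable (waveMul k h) := by
  have h1 : Measurable fun z : Fin n → Phase d => wave k fun j => (z j).1 :=
    Continuous.measurable (by have := continuous_wave k; fun_prop)
  exact h1.mul (hh.fun_comp (f := fun z : Fin n → Phase d => fun j => (z j).2) (by fun_prop))

lemma waveMul_mul_conj (k k' : Fin n → Λ) (h h' : 𝕍 n → ℂ)
    (z : Fin n → Phase d) : waveMul k h z * conj (waveMul k' h' z)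
      = waveMul (k - k') (fun v => h v * conj (h' v)) z := by
  have : wave (k - k') (fun j => (z j).1)
      = wave k (fun j => (z j).1) * conj (wave k' fun j => (z j).1) := by
    simp only [wave, map_prod, ← prod_mul_distrib, ← mFourier_neg, Pi.sub_apply,
      sub_eq_add_neg, mFourier_add]
  rw [waveMul, waveMul, waveMul, this, map_mul]; ring

lemma norm_waveMul (k : Fin n → Λ) (h : 𝕍 n → ℂ) (z : Fin n → Phase d) :
    ‖waveMul k h z‖ = ‖h fun j => (z j).2‖ := by
  rw [waveMul, norm_mul, norm_wave, one_mul]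

lemma IsVelTest.isTest {ψ : Vel d → ℂ} (hψ : IsVelTest ψ) :
    IsTest fun z : Fin 1 → Phase d => ψ (z 0).2 := by
  have h1 : HasCompactSupport fun v : 𝕍 1 => ψ (v 0) :=
    hψ.compactSupport.comp_homeomorph (Homeomorph.funUnique (Fin 1) (Vel d))
  have h2 := isTest_waveMul (0 : Fin 1 → Λ) (φ := fun v => ψ (v 0))
    (hψ.smooth.comp (contDiff_apply ℝ (Vel d) (0 : Fin 1))) h1
  have e : waveMul (0 : Fin 1 → Λ) (fun v => ψ (v 0)) = fun z : Fin 1 → Phase d => ψ (z 0).2 := by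
    funext z; simp [waveMul, wave, mFourier_zero]
  rwa [e] at h2

lemma norm_le_of_forall_apply_le {X : ℝ} (hX : 0 ≤ X) (v : EuclideanSpace ℂ (Fin d))
    (h : ∀ a, ‖v a‖ ≤ X) : ‖v‖ ≤ √d * X := by
  rw [EuclideanSpace.norm_eq, ← Real.sqrt_sq hX, ← Real.sqrt_mul (by positivity)]
  refine Real.sqrt_le_sqrt ?_
  calc ∑ a, ‖v a‖ ^ 2 ≤ ∑ _a : Fin d, X ^ 2 := by gcongr with a; exact h a
    _ = _ := by simp

lemma integral_waveMul_resolvent (hβ : 0 < β) (hF : GradField F K Vh)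
    {k : Fin (m + 1) → Λ} {h u : 𝕍 (m + 1) → ℂ} {ω : ℂ}
    (hh : MemLp h 2 (Φ (m + 1))) (hu : MemLp u 2 (Φ (m + 1)))
    (e : ∀ v, modeOp β Vh N m k h v = u v + I * ω * h v) {ψ : Obs (m + 1)} (hψ : IsTest ψ) :
    ∫ z, waveMul k h z * vlasovAdj β F N m ψ z ∂Ψ (m + 1) = ∫ z, waveMul k u z * ψ z ∂Ψ (m + 1)
        + I * ω * ∫ z, waveMul k h z * ψ z ∂Ψ (m + 1) := by
  have i1 : Integrable (fun z => waveMul k u z * ψ z) (Ψ (m + 1)) :=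
    (memLp_waveMul hβ k hu).integrable_mul (hψ.memLp hβ)
  have i2 : Integrable (fun z => I * ω * (waveMul k h z * ψ z)) (Ψ (m + 1)) :=
    ((memLp_waveMul hβ k hh).integrable_mul (hψ.memLp hβ)).const_mul _
  have a1 := integral_add i1 i2
  rw [integral_waveMul_mul_vlasovAdj hβ hF k hh hψ, ← integral_const_mul, ← a1]
  refine integral_congr_ae (ae_of_all _ fun z => ?_)
  simp only [waveMul, e]; ring

lemma integral_pair_mul {X : Type*} [MeasurableSpace X] {μ : Measure X} {A B χ : X → ℂ}
    (hA : MemLp A 2 μ) (hB : MemLp B 2 μ) (hχ : MemLp χ 2 μ) (c e : ℂ) :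
    ∫ x, c * (A x + e * B x) * χ x ∂μ = c * (∫ x, A x * χ x ∂μ + e * ∫ x, B x * χ x ∂μ) := by
  have i1 : Integrable (fun x => A x * χ x) μ := hA.integrable_mul hχ
  have i2 : Integrable (fun x => e * (B x * χ x)) μ := (hB.integrable_mul hχ).const_mul e
  have a1 := integral_add i1 i2
  rw [← integral_const_mul e, ← a1, ← integral_const_mul]
  exact integral_congr_ae (ae_of_all _ fun x => by simp only []; ring)

/-- The constant in the pointwise bound on the flux. -/
def fluxConst (d : ℕ) (β C ρ K : ℝ) : ℝ := √d * (β * ρ * C * K * (K + √(β⁻¹ * (d * K ^ 2))))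

/-- The modes are weighted by the coefficients of `R` and summed. The `L²` bounds on `H₃`, `K₂`,
`H₂` may depend on `ω`, since they serve only existence. The flux bound is uniform because it
involves nothing but the densities `Y`. -/
theorem exists_correlation (hβ : 0 < β) (hF : GradField F K Vh) (hN : 1 ≤ N) {ω : ℂ}
    (hω : 0 < ω.im) {C : ℝ} (hC : 0 ≤ C)
    (hS : ∀ k : Λ, k ≠ 0 → Nonempty (KineticSolution β C Vh N ω k))
    {g : Vel d → ℝ} {D : Vel d → Vel d} (mg : Measurable g) (hg : MemLp g 2 ϖ)
    (mD : Measurable D) (hD : MemLp D 2 ϖ)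
    (hgD : HasAdaptedGrad β (fun v => (g v : ℂ)) fun a v => (D v a : ℂ))
    {R : Torus d → ℂ} (hR : Measurable R) {b : ℝ} (hb : ∀ x, ‖R x‖ ≤ b) (h0 : ∫ x, R x = 0)
    {ρ : ℝ} (hρ : ∀ k, ‖∫ x, R x * mFourier (-k) x‖ ≤ ρ) :
    ∃ H₃ K₂ H₂, IsResolvent β F N 2 ω (fun z => g (z 0).2 * R ((z 1).1 - (z 2).1)) H₃ ∧
      IsMApplied β F N 1 H₃ K₂ ∧ IsResolvent β F N 1 ω K₂ H₂ ∧
      ∃ G : Vel d → EuclideanSpace ℂ (Fin d), Measurable G ∧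
        (∀ v, ‖G v‖ ≤ fluxConst d β C ρ K * min 1 ‖ω‖ * ‖D v‖) ∧
        ∀ ψ : Vel d → ℂ, IsVelTest ψ → spaceAverage β F N ω H₂ ψ = divPairing β G ψ := by
  have := prob_vel (d := d) hβ
  have := prob_phase (d := d) hβ 3
  have hω0 : ω ≠ 0 := fun h => by simp [h] at hω
  have S := fun k : Λ₀ => (hS k.1 k.2).some
  set r : Λ₀ → ℂ := fun k => ∫ x, R x * mFourier (-k.1) x with hr
  set c : Λ₀ → ℂ := fun k => r k * collFactor Vh N k.1 with hc
  have hρ0 : 0 ≤ ρ := (norm_nonneg _).trans (hρ 0)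
  have hK := hF.nonneg_bound
  have sr : Summable fun k => ‖r k‖ ^ 2 :=
    (summable_sq_fourier (MemLp.of_bound hR.aestronglyMeasurable b (ae_of_all _ hb))).subtype _
  have sV : Summable fun k : Λ₀ => Vh k.1 := hF.summable.subtype _
  have cle : ∀ k, ‖c k‖ ≤ ‖r k‖ * Vh k.1 := fun k => by
    rw [hc, norm_mul]
    gcongr
    exact norm_collFactor_le hF hN _
  -- The extra power of `modeFreq` is affordable: `‖c k‖ modeFreq` is at most the product of two
  -- square summable sequences, the coefficients of `R` and `modeFreq · V̂`.
  have sc : Summable fun k => ‖c k‖ * (1 + modeFreq β k.1) := by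
    refine Summable.of_nonneg_of_le (fun k => mul_nonneg (norm_nonneg _)
      (by linarith [modeFreq_pos hβ k.2])) (fun k => ?_) ((sV.mul_left ρ).add
      (sr.add ((hF.summable_sq_modeFreq_mul hβ).subtype _)))
    have h1 := mul_le_mul_of_nonneg_right (cle k)
      (show 0 ≤ 1 + modeFreq β k.1 by linarith [modeFreq_pos hβ k.2])
    have h2 := mul_le_mul_of_nonneg_right (hρ k.1) (hF.nonneg k.1)
    simp only [Function.comp_apply]
    nlinarith [sq_nonneg (‖r k‖ - modeFreq β k.1 * Vh k.1), sq_nonneg ‖r k‖,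
      sq_nonneg (modeFreq β k.1 * Vh k.1)]
  -- the three-particle series
  have vM3 : MemLp (fun v : Fin 3 → Vel d => |g (v 0)| *
      (linWeight β (v 1) * linWeight β (v 2))) 2 (Φ 3) := by
    have l1 : MemLp (linWeight (d := d) β) 2 ϖ := by
      simpa using memLp_linWeight hβ 1
    exact memLp_coord_mul hβ 0 hg.norm (memLp_coord_mul hβ 1 l1 (memLp_coord_real hβ 2 l1)
      fun v y => by simp) fun v y => by simp
  have mM3 : MemLp (fun z : Fin 3 → Phase d => |g (z 0).2| *
      (linWeight β (z 1).2 * linWeight β (z 2).2)) 2 (Ψ 3) :=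
    vM3.comp_measurePreserving (preserves_vel hβ)
  have meas3 := fun k => (S k).measurable_three mg
  have meas2 := fun k => (S k).measurable_two mD
  have measS := fun k => (S k).measurable_source mD
  have measD := fun k => (S k).measurable_drift mg
  -- No factor `V̂` is available yet, so convergence rests on the orthogonality of distinct plane
  -- waves. For `K₂` and `H₂` the factor produced by `M_3^2` gives absolute convergence.
  obtain ⟨H₃, hH₃⟩ := exists_l2Series_of_orthogonal (μ := Ψ 3)
    (f := fun k z => r k * waveMul ![0, k.1, -k.1] ((S k).three g) z)
    (b := fun k => ‖r k‖ * (C / ω.im)) mM3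
    (fun k => ((measurable_waveMul _ (meas3 k)).const_mul _).aestronglyMeasurable)
    (fun k => by positivity)
    (fun k z => by
      rw [norm_mul, norm_waveMul, mul_assoc]
      gcongr
      exact (S k).norm_three_le hβ k.2 hω _)
    (by simp_rw [mul_pow]; exact sr.mul_right _)
    (fun i j hij => by
      have e : ∀ z, r j * waveMul ![0, j.1, -j.1] ((S j).three g) z *
          conj (r i * waveMul ![0, i.1, -i.1] ((S i).three g) z) = r j * conj (r i) *
          waveMul (![0, j.1, -j.1] - ![0, i.1, -i.1])
            (fun v => (S j).three g v * conj ((S i).three g v)) z := by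
        intro z
        rw [← waveMul_mul_conj, map_mul]; ring
      simp_rw [e]
      rw [integral_const_mul, integral_waveMul_eq_zero hβ, mul_zero]
      intro h
      have := congrFun h 1
      simp only [Pi.sub_apply, Matrix.cons_val_one, Matrix.cons_val_zero, Pi.zero_apply,
        sub_eq_zero] at this
      exact hij (Subtype.ext this).symm)
  -- the two-particle series
  have mP : MemLp (fun z : Fin 2 → Phase d => pairWeight β g D fun j => (z j).2) 2
      (Ψ 2) :=
    (memLp_pairWeight hβ hg hD).comp_measurePreserving (preserves_vel hβ)
  have P0 : ∀ v, 0 ≤ pairWeight β g D v := fun v => by unfold pairWeight; positivity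
  have hσ := fun k : Λ₀ => (modeFreq_pos hβ k.2).le
  obtain ⟨K₂, hK₂⟩ := exists_l2Series (μ := Ψ 2)
    (f := fun k z => c k * (S k).pairSource g D z)
    (b := fun k => ‖c k‖ * (1 + modeFreq β k.1) * (√β * C + β * C * (2 + ω.im⁻¹))) mP
    (fun k => (((measurable_waveMul _ (measS k)).add
      (measurable_waveMul _ (measD k))).const_mul _).aestronglyMeasurable)
    (fun k => by have := hσ k; positivity)
    (fun k z => by
      rw [norm_mul, mul_assoc, mul_assoc]
      gcongr
      refine (norm_add_le _ _).trans ?_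
      rw [norm_waveMul, norm_waveMul]
      have h1 := (S k).norm_source_le (g := g) (D := D) hβ k.2 fun j => (z j).2
      have h2 := (S k).norm_drift_le (g := g) (D := D) hβ k.2 hω fun j => (z j).2
      have h3 : 0 ≤ √β * C * pairWeight β g D (fun j => (z j).2) * modeFreq β k.1 :=
        mul_nonneg (mul_nonneg (by positivity) (P0 _)) (hσ k)
      nlinarith)
    (sc.mul_right _)
  obtain ⟨H₂, hH₂⟩ := exists_l2Series (μ := Ψ 2)
    (f := fun k z => c k * (S k).pairSolution g D z)
    (b := fun k => ‖c k‖ * (1 + modeFreq β k.1) *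
      (√β * (C / ω.im) + ‖I / ω‖ * (β * C * (2 + ω.im⁻¹)))) mP
    (fun k => (((measurable_waveMul _ (meas2 k)).add
      ((measurable_waveMul _ (measD k)).const_mul _)).const_mul _).aestronglyMeasurable)
    (fun k => by have := hσ k; positivity)
    (fun k z => by
      rw [norm_mul, mul_assoc, mul_assoc]
      gcongr
      refine (norm_add_le _ _).trans ?_
      rw [norm_mul, norm_waveMul, norm_waveMul]
      have h1 := (S k).norm_two_le (g := g) (D := D) hβ k.2 hω fun j => (z j).2
      have h2 := mul_le_mul_of_nonneg_left
        ((S k).norm_drift_le (g := g) (D := D) hβ k.2 hω fun j => (z j).2) (norm_nonneg (I / ω))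
      have h3 : 0 ≤ √β * (C / ω.im) * pairWeight β g D (fun j => (z j).2) * modeFreq β k.1 :=
        mul_nonneg (mul_nonneg (by positivity) (P0 _)) (hσ k)
      nlinarith)
    (sc.mul_right _)
  have v3 : ∀ k, MemLp ((S k).three g) 2 (Φ 3) := fun k =>
    memLp_of_le_weight vM3 (meas3 k).aestronglyMeasurable fun v => (S k).norm_three_le hβ k.2 hω v
  have vP : ∀ {u : (Fin 2 → Vel d) → ℂ} {b : ℝ}, Measurable u →
      (∀ v, ‖u v‖ ≤ b * pairWeight β g D v) → MemLp u 2 (Φ 2) := fun hu hb =>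
    memLp_of_le_weight (memLp_pairWeight hβ hg hD) hu.aestronglyMeasurable hb
  have v2 := fun k => vP (meas2 k) fun v => (S k).norm_two_le (g := g) hβ k.2 hω v
  have vS := fun k => vP (measS k) fun v => (S k).norm_source_le (g := g) hβ k.2 v
  have vD := fun k => vP (measD k) fun v => (S k).norm_drift_le (D := D) hβ k.2 hω v
  refine ⟨H₃, K₂, H₂, ?_, ⟨hK₂.memLp, fun ψ hψ => ?_⟩, ?_, ?_⟩
  · refine isResolvent_of_series hβ hF (memLp_mul_bounded
      (memLp_phase_coord hβ (f := fun v => (g v : ℂ)) hg.ofReal 0)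
      (Measurable.aestronglyMeasurable (by fun_prop)) fun z => hb _) hH₃
      (fun ψ hψ => hasSum_source hβ mg hg hR hb h0 hψ) fun k ψ hψ => ?_
    simp_rw [mul_assoc, integral_const_mul]
    rw [integral_waveMul_resolvent hβ hF (v3 k) (memLp_velPi_coord hβ hg.ofReal 0)
      ((S k).modeOp_three hβ k.2 (hF.neg _)) hψ]
    simp only [hr]
    ring!
  · have h1 := hH₃.hasSum _ (memLp_collisionAdj (N := N) (m := 1) hβ hF hψ)
    rw [← mPairing_eq hβ hF hH₃.memLp hψ] at h1
    refine (hK₂.hasSum ψ (hψ.memLp hβ)).unique ?_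
    convert h1 using 2 with k
    simp_rw [mul_assoc, integral_const_mul]
    rw [← mPairing_eq hβ hF (memLp_waveMul hβ _ (v3 k)) hψ,
      (S k).mPairing_three hβ hF k.2 hg hD hgD hψ, hc]
    simp_rw [mul_assoc, integral_const_mul]
  · refine isResolvent_of_series hβ hF hK₂.memLp hH₂ (fun ψ hψ => hK₂.hasSum ψ (hψ.memLp hβ))
      fun k ψ hψ => ?_
    have w0 := memLp_waveMul hβ 0 (vD k)
    have e1 : ∀ z, (S k).pairSource g D z = waveMul ![-k.1, k.1] ((S k).source D) z
        + 1 * waveMul 0 ((S k).drift g) z := fun z => by rw [one_mul]; rfl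
    simp_rw [e1, KineticSolution.pairSolution]
    rw [integral_pair_mul (memLp_waveMul hβ _ (v2 k)) w0 (memLp_vlasovAdj hβ hF hψ),
      integral_pair_mul (memLp_waveMul hβ _ (v2 k)) w0 (hψ.memLp hβ),
      integral_pair_mul (memLp_waveMul hβ _ (vS k)) w0 (hψ.memLp hβ),
      integral_waveMul_resolvent hβ hF (v2 k) (vS k) ((S k).modeOp_two hβ k.2 hN) hψ,
      integral_waveMul_mul_vlasovAdj hβ hF 0 (vD k) hψ]
    have e2 : ∀ z, waveMul 0 (modeOp β Vh N 1 0 ((S k).drift g)) z = 0 := fun z => by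
      simp [waveMul, modeOp_zero]
    -- The Vlasov operator vanishes on homogeneous functions, so the coefficient `i/ω` of the drift
    -- is forced by `iω · (i/ω) = -1`.
    simp only [e2, zero_mul, integral_zero]
    field_simp
    ring_nf
    simp only [I_sq]
    ring
  -- The contribution of one mode to the flux, apart from the direction `n`. The minus sign is `i ·
  -- i`, one factor from `iω` and one from the force coefficient.
  · set t : Λ₀ → Vel d → ℂ := fun k v => -(ω * c k * Vh k.1) *
      ((mdot k.1 (D v) : ℝ) * (S k).Y (mdot k.1 v)) with ht
    set B : ℝ := ρ * √β * C * (K + √(β⁻¹ * (d * K ^ 2))) * min 1 ‖ω‖ with hB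
    have tle : ∀ k a v, ‖t k v * modeDir β k.1 a‖ ≤ √β * (B * Vh k.1 * ‖D v‖) := by
      intro k a v
      have hV := hF.nonneg k.1
      have hσ' := modeFreq_pos hβ k.2
      set y := ‖(S k).Y (mdot k.1 v)‖ with hy
      set s := √(β⁻¹ * (d * K ^ 2)) with hs
      have hs0 : 0 ≤ s := Real.sqrt_nonneg _
      have y1 : y ≤ C := (S k).norm_Y_le _
      have y2 : ‖ω‖ * y ≤ modeFreq β k.1 * C := by
        have := (S k).norm_mul_Y_le (mdot k.1 v)
        rw [norm_div, norm_real, norm_of_nonneg hσ'.le, div_mul_eq_mul_div, div_le_iff₀ hσ'] at this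
        linarith
      -- The two alternatives use the two bounds on `Y`. The bound on `|w| |Y|` costs a factor
      -- `modeFreq`, compensated by `V̂`; the bound on `|Y|` alone keeps the factor `|ω|`.
      have y3 : ‖ω‖ * y * Vh k.1 ≤ C * (K + s) * min 1 ‖ω‖ := by
        rcases min_choice 1 ‖ω‖ with h | h <;> rw [h]
        · calc ‖ω‖ * y * Vh k.1 ≤ modeFreq β k.1 * C * Vh k.1 := by gcongr
            _ = C * (modeFreq β k.1 * Vh k.1) := by ring
            _ ≤ C * s := by gcongr; exact hF.modeFreq_mul_le hβ k.1
            _ ≤ _ := by rw [mul_one]; gcongr; linarith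
        · calc ‖ω‖ * y * Vh k.1 ≤ ‖ω‖ * C * K := by gcongr; exact hF.le_bound k.1
            _ = C * K * ‖ω‖ := by ring
            _ ≤ _ := by gcongr; linarith
      have y4 : ‖(modeDir β k.1 a : ℂ)‖ ≤ √β := by
        rw [norm_real, ← norm_modeDir hβ k.2]; exact PiLp.norm_apply_le _ a
      have y5 : ‖c k‖ ≤ ρ * Vh k.1 := (cle k).trans (mul_le_mul_of_nonneg_right (hρ k.1) hV)
      have y6 := KineticSolution.norm_inner_dir_le hβ k.2 (D v)
      rw [ht]
      simp only [norm_mul, norm_neg]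
      rw [← hy, norm_real (Vh k.1), norm_of_nonneg hV, mul_comm]
      calc _ ≤ √β * (‖ω‖ * (ρ * Vh k.1) * Vh k.1 * (√β * ‖D v‖ * y)) := by gcongr
        _ = √β * (ρ * √β * (‖ω‖ * y * Vh k.1) * Vh k.1 * ‖D v‖) := by ring
        _ ≤ √β * (ρ * √β * (C * (K + s) * min 1 ‖ω‖) * Vh k.1 * ‖D v‖) := by gcongr
        _ = _ := by rw [hB]; ring
    have tm : ∀ k, Measurable (t k) := fun k => by
      have := (S k).measurable_Y
      fun_prop
    have hB0 : 0 ≤ B := by positivity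
    have tb : ∀ v, Summable fun k : Λ₀ => √β * (B * Vh k.1 * ‖D v‖) :=
      fun v => ((sV.mul_left B).mul_right _).mul_left _
    have ts : ∀ a v, Summable fun k => t k v * modeDir β k.1 a := fun a v =>
      Summable.of_norm_bounded (tb v) fun k => tle k a v
    set G : Vel d → EuclideanSpace ℂ (Fin d) := fun v =>
      WithLp.toLp 2 fun a => ∑' k, t k v * modeDir β k.1 a with hG
    have Gle : ∀ a v, ‖G v a‖ ≤ √β * (B * K * ‖D v‖) := by
      intro a v
      refine (tsum_of_norm_bounded (tb v).hasSum fun k => tle k a v).trans ?_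
      rw [tsum_mul_left, tsum_mul_right, tsum_mul_left]
      gcongr
      exact (Summable.tsum_subtype_le Vh _ hF.nonneg hF.summable).trans
        (hF.summable.tsum_le_of_sum_le hF.sum_le)
    have Gm : Measurable G := by
      refine (WithLp.measurable_toLp 2 _).comp (measurable_pi_iff.2 fun a => ?_)
      exact Measurable.tsum fun k => (tm k).mul_const _
    refine ⟨G, Gm, fun v => ?_, fun ψ hψ => ?_⟩
    · refine (norm_le_of_forall_apply_le (by positivity) _ fun a => Gle a v).trans (le_of_eq ?_)
      rw [hB, fluxConst]
      have := Real.mul_self_sqrt hβ.le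
      linear_combination √d * (ρ * C * (K + √(β⁻¹ * (d * K ^ 2))) * min 1 ‖ω‖ * K * ‖D v‖) * this
    · have iD : ∀ a, Integrable (fun v => ‖D v‖ * ‖velDeriv a ψ v‖) ϖ := fun a =>
        hD.norm.integrable_mul (hψ.memLp_velDeriv hβ a (p := 2)).norm
      have dm := fun a => (hψ.continuous_velDeriv a).measurable
      have tψ : ∀ k a v, ‖t k v * modeDir β k.1 a * velDeriv a ψ v‖
          ≤ √β * B * Vh k.1 * (‖D v‖ * ‖velDeriv a ψ v‖) := fun k a v => by
        rw [norm_mul]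
        calc _ ≤ √β * (B * Vh k.1 * ‖D v‖) * ‖velDeriv a ψ v‖ := by gcongr; exact tle k a v
          _ = _ := by ring
      have it : ∀ k a, Integrable (fun v => t k v * modeDir β k.1 a * velDeriv a ψ v)
          ϖ := fun k a => ((iD a).const_mul _).mono'
        (((tm k).mul_const _).mul (dm a)).aestronglyMeasurable (ae_of_all _ (tψ k a))
      have hs : ∀ a, HasSum (fun k => ∫ v, t k v * modeDir β k.1 a * velDeriv a ψ v
          ∂ϖ) (∫ v, G v a * velDeriv a ψ v ∂ϖ) := by
        intro a
        have h1 := hasSum_integral_of_summable_integral_norm (fun k => it k a)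
          (Summable.of_nonneg_of_le (fun k => by positivity) (fun k =>
            integral_mono_of_nonneg (ae_of_all _ fun v => norm_nonneg _)
              ((iD a).const_mul _) (ae_of_all _ (tψ k a)))
            (by simp_rw [integral_const_mul]; exact (sV.mul_left _).mul_right _))
        simp_rw [tsum_mul_right] at h1
        exact h1
      have iG : ∀ a, Integrable (fun v => G v a * velDeriv a ψ v) ϖ := fun a =>
        ((iD a).const_mul (√β * (B * K))).mono' (by fun_prop)
          (ae_of_all _ fun v => by
            rw [norm_mul]
            calc _ ≤ √β * (B * K * ‖D v‖) * ‖velDeriv a ψ v‖ := by gcongr; exact Gle a v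
              _ = _ := by ring)
      have h1 := (hH₂.hasSum _ (memLp_collisionAdj (N := N) (m := 0) hβ hF hψ.isTest)).mul_left
        (I * ω)
      rw [← mPairing_eq hβ hF hH₂.memLp hψ.isTest] at h1
      have h2 := (hasSum_sum (s := Finset.univ) fun a (_ : a ∈ Finset.univ) => hs a).neg
      rw [spaceAverage, divPairing, integral_finsetSum _ fun a _ => iG a]
      refine h1.unique (h2.congr_fun fun k => ?_)
      simp_rw [KineticSolution.pairSolution]
      rw [integral_pair_mul (memLp_waveMul hβ _ (v2 k)) (memLp_waveMul hβ 0 (vD k))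
        (memLp_collisionAdj hβ hF hψ.isTest), ← mPairing_eq hβ hF (memLp_waveMul hβ _ (v2 k))
        hψ.isTest, ← mPairing_eq hβ hF (memLp_waveMul hβ 0 (vD k)) hψ.isTest,
        mPairing_waveMul_zero hβ hF, (S k).mPairing_two hβ hF hN k.2 mD hψ, mul_zero, add_zero,
        mul_neg, mul_neg, ← neg_inj, neg_neg, neg_neg, mul_sum, mul_sum]
      refine sum_congr rfl fun a _ => ?_
      rw [← integral_const_mul, ← integral_const_mul]
      refine integral_congr_ae (ae_of_all _ fun v => ?_)
      beta_reduce
      linear_combination (ω * c k * modeDir β k.1 a * Vh k.1 * (mdot k.1 (D v) : ℝ) *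
        (S k).Y (mdot k.1 v) * velDeriv a ψ v) * I_mul_I

/-! ### The interaction potential -/

/-- The Fourier coefficients of an even potential. -/
def potCoeff (V : Torus d → ℝ) (k : Λ) : ℝ := (mFourierCoeff (fun x => (V x : ℂ)) k).re

/-- The field `F`, with the values of norm larger than `K` replaced by zero. -/
def truncField (F : Torus d → Vel d) (K : ℝ) (x : Torus d) : Vel d := {x | ‖F x‖ ≤ K}.indicator F x

variable {V : Torus d → ℝ}

/-- Evenness makes the coefficients real and insensitive to the sign of the wave number. -/
lemma integral_potential_mul (hV : ∀ x, V (-x) = V x) (k : Λ) :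
    ∫ x, (V x : ℂ) * mFourier k x = potCoeff V k := by
  have e1 : ∀ k, ∫ x, (V x : ℂ) * mFourier (-k) x = ∫ x, (V x : ℂ) * mFourier k x := by
    intro k
    rw [← integral_neg_eq_self]
    simp_rw [hV, mFourier_neg_arg, neg_neg]
  have e2 : conj (∫ x, (V x : ℂ) * mFourier k x) = ∫ x, (V x : ℂ) * mFourier k x := by
    rw [← integral_conj, ← e1 k]
    simp [mFourier_neg]
  rw [potCoeff, mFourierCoeff_eq, e1, conj_eq_iff_re.1 e2]

lemma potCoeff_neg (hV : ∀ x, V (-x) = V x) (k : Λ) : potCoeff V (-k) = potCoeff V k := by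
  have h1 := integral_potential_mul hV (-k)
  have h2 := integral_potential_mul hV k
  rw [← integral_neg_eq_self] at h1
  simp_rw [hV, mFourier_neg_arg, neg_neg, h2] at h1
  exact_mod_cast h1.symm

lemma hasDerivAt_mFourier (k : Λ) (a : Fin d) (x : Torus d) :
    HasDerivAt (fun t : ℝ => mFourier k (x + Pi.single a (t : UnitAddCircle)))
      (2 * π * I * k a * mFourier k x) 0 := by
  simp_rw [mFourier_add_arg, mFourier_single_coe]
  simpa [mul_comm] using (hasDerivAt_cexp_mul_zero (2 * π * I * k a)).const_mul (mFourier k x)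

lemma smoothOnTorus_mFourier (k : Λ) (L : ℂ →L[ℝ] ℝ) : SmoothOnTorus fun x => L (mFourier k x) := by
  unfold SmoothOnTorus
  simp_rw [mFourier_coe]
  have h : ContDiff ℝ (⊤ : ℕ∞) fun y : Fin d → ℝ => ∑ a, (k a : ℝ) * y a :=
    ContDiff.sum fun a _ => contDiff_const.mul (contDiff_apply ℝ ℝ a)
  exact L.contDiff.comp (ContDiff.cexp (contDiff_const.mul (ofRealCLM.contDiff.comp h)))

/-- The weak gradient is tested with the real and imaginary parts of a plane wave, since admissible
test functions are real. -/
lemma integral_gradient_mul (hV : ∀ x, V (-x) = V x) {G : Torus d → Vel d} (hG : Measurable G)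
    (bG : ∀ x, ‖G x‖ ≤ K) (mV : Measurable V) (bV : ∀ᵐ x, |V x| ≤ K)
    (h : HasTorusWeakGrad V G) (a : Fin d) (k : Λ) :
    ∫ x, (G x a : ℂ) * mFourier (-k) x = 2 * π * I * k a * potCoeff V k := by
  have ce : Continuous fun x : Torus d => mFourier (-k) x := map_continuous _
  have i1 : Integrable fun x => (V x : ℂ) * (2 * π * I * (-k) a * mFourier (-k) x) := by
    have h1 : MemLp (fun x => (V x : ℂ)) 2 := MemLp.of_bound (by fun_prop) K (by simpa using bV)
    exact (memLp_mul_bounded h1 (by fun_prop)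
      (B := ‖2 * π * I * (-k) a‖) fun x => by
        rw [norm_mul, norm_mFourier_apply, mul_one]).integrable (by norm_num)
  have i2 : Integrable fun x => (G x a : ℂ) * mFourier (-k) x := by
    refine .mono' (integrable_const K)
      (by fun_prop) (ae_of_all _ fun x => ?_)
    rw [norm_mul, norm_mFourier_apply, mul_one, norm_real]
    exact (PiLp.norm_apply_le _ a).trans (bG x)
  have key : ∀ L : ℂ →L[ℝ] ℝ, L (∫ x, (G x a : ℂ) * mFourier (-k) x)
      = L (2 * π * I * k a * potCoeff V k) := by
    intro L
    have h1 := h _ (smoothOnTorus_mFourier (-k) L) a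
    have e1 : ∀ x, torusDeriv a (fun x => L (mFourier (-k) x)) x
        = L (2 * π * I * (-k) a * mFourier (-k) x) := fun x =>
      (L.hasFDerivAt.comp_hasDerivAt (0 : ℝ) (hasDerivAt_mFourier (-k) a x)).deriv
    have e2 : ∀ (c : ℝ) (z : ℂ), c * L z = L (c * z) := fun c z => by
      rw [← real_smul, map_smul, smul_eq_mul]
    simp_rw [e1, e2] at h1
    rw [L.integral_comp_comm i1, L.integral_comp_comm i2, eq_neg_iff_add_eq_zero, ← map_add] at h1
    have e3 : ∫ x, (V x : ℂ) * (2 * π * I * (-k) a * mFourier (-k) x)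
        = -(2 * π * I * k a * potCoeff V k) := by
      rw [← potCoeff_neg hV, ← integral_potential_mul hV, ← integral_const_mul, ← integral_neg]
      refine integral_congr_ae (ae_of_all _ fun x => ?_)
      push_cast [Pi.neg_apply]; ring
    rw [e3, map_add, map_neg] at h1
    linarith
  exact Complex.ext (key reCLM) (key imCLM)

/-- With `S` the sum of the waves in `B`, the left side is `∫ V |S|²`. As `V ≤ K` almost everywhere,
it is at most `K ∫ |S|² = K #B`. -/
lemma sum_potCoeff_sub_le (hV : ∀ x, V (-x) = V x) (mV : Measurable V) (bV : ∀ᵐ x, |V x| ≤ K)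
    (B : Finset Λ) : ∑ j ∈ B, ∑ l ∈ B, potCoeff V (j - l) ≤ K * B.card := by
  set S : Torus d → ℂ := fun x => ∑ j ∈ B, mFourier j x with hS
  have iV : Integrable fun x => (V x : ℂ) := .mono' (integrable_const K)
      (by fun_prop) (by simpa using bV)
  have ie : ∀ k : Λ, Integrable fun x : Torus d => mFourier k x := fun k =>
    .mono' (integrable_const 1) (map_continuous _).aestronglyMeasurable
      (ae_of_all _ fun x => (norm_mFourier_apply k x).le)
  have iVe : ∀ k, Integrable fun x => (V x : ℂ) * mFourier k x := fun k =>
    iV.mul_bdd (c := 1) (map_continuous _).aestronglyMeasurable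
      (ae_of_all _ fun x => (norm_mFourier_apply k x).le)
  have e1 : ∀ x, (((K - V x) * ‖S x‖ ^ 2 : ℝ) : ℂ)
      = ∑ j ∈ B, ∑ l ∈ B, (K * mFourier (j - l) x - V x * mFourier (j - l) x) := by
    intro x
    have h1 : ((‖S x‖ ^ 2 : ℝ) : ℂ) = ∑ j ∈ B, ∑ l ∈ B, mFourier (j - l) x := by
      push_cast
      rw [← mul_conj', hS, map_sum, Finset.sum_mul_sum]
      simp_rw [sub_eq_add_neg, mFourier_add, mFourier_neg]
    rw [ofReal_mul, h1, mul_sum]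
    simp_rw [mul_sum, ofReal_sub, sub_mul]
  have h0 : 0 ≤ ∫ x, (K - V x) * ‖S x‖ ^ 2 := by
    refine integral_nonneg_of_ae ?_
    filter_upwards [bV] with x hx
    exact mul_nonneg (by linarith [le_abs_self (V x)]) (by positivity)
  have e2 : ((∫ x, (K - V x) * ‖S x‖ ^ 2 : ℝ) : ℂ)
      = ∑ j ∈ B, ∑ l ∈ B, (K * (if j = l then 1 else 0) - potCoeff V (j - l) : ℂ) := by
    rw [← integral_complex_ofReal]
    simp_rw [e1]
    have is : ∀ j l : Λ, Integrable fun x : Torus d =>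
        (K * mFourier (j - l) x - V x * mFourier (j - l) x : ℂ) := fun j l =>
      ((ie _).const_mul _).sub (iVe _)
    rw [integral_finsetSum _ fun j _ => integrable_finsetSum _ fun l _ => is j l]
    refine sum_congr rfl fun j _ => ?_
    rw [integral_finsetSum _ fun l _ => is j l]
    refine sum_congr rfl fun l _ => ?_
    have a1 := integral_sub ((ie (j - l)).const_mul (K : ℂ)) (iVe (j - l))
    rw [a1, integral_const_mul, integral_mFourier, integral_potential_mul hV]
    simp only [sub_eq_zero]
  have e3 : ∫ x, (K - V x) * ‖S x‖ ^ 2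
      = ∑ j ∈ B, ∑ l ∈ B, (K * (if j = l then 1 else 0) - potCoeff V (j - l)) := by
    have : (((∫ x, (K - V x) * ‖S x‖ ^ 2 : ℝ)) : ℂ) = ((∑ j ∈ B, ∑ l ∈ B,
      (K * (if j = l then 1 else 0) - potCoeff V (j - l)) : ℝ) : ℂ) := by
      rw [e2]; push_cast [apply_ite ((↑) : ℝ → ℂ)]; rfl
    exact_mod_cast this
  rw [e3] at h0
  simp only [sum_sub_distrib, mul_ite, mul_one, mul_zero, Finset.sum_ite_eq] at h0
  rw [Finset.sum_ite_mem, Finset.inter_self, sum_const, nsmul_eq_mul] at h0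
  linarith

/-- A Fejér-type argument. In a large box almost every point admits all the translations by elements
of `s`, so each coefficient is counted about as many times as the box has points. The ratio of the
sizes of the enlarged and the original box tends to one, so no constant is lost. -/
lemma sum_potCoeff_le (hV : ∀ x, V (-x) = V x) (mV : Measurable V) (bV : ∀ᵐ x, |V x| ≤ K)
    (pV : ∀ k, 0 ≤ potCoeff V k) (s : Finset Λ) : ∑ k ∈ s, potCoeff V k ≤ K := by
  set M : ℕ := ∑ k ∈ s, ∑ a, (k a).natAbs with hM
  have hk : ∀ k ∈ s, ∀ a, |k a| ≤ M := by
    intro k hk a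
    have h1 : (k a).natAbs ≤ ∑ a, (k a).natAbs :=
      Finset.single_le_sum (f := fun a => (k a).natAbs) (fun _ _ => Nat.zero_le _)
        (mem_univ a)
    have h2 : ∑ a, (k a).natAbs ≤ M := Finset.single_le_sum (f := fun k : Λ => ∑ a, (k a).natAbs)
        (fun _ _ => Nat.zero_le _) hk
    rw [Int.abs_eq_natAbs]
    exact_mod_cast h1.trans h2
  have main : ∀ j : ℕ, ∑ k ∈ s, potCoeff V k ≤ K * (1 + 2 * M / ((j : ℝ) + 1)) ^ d := by
    intro j
    set J : Finset Λ := Fintype.piFinset fun _ => Finset.Ico 0 ((j : ℤ) + 1) with hJ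
    set B : Finset Λ := Fintype.piFinset fun _ =>
      Finset.Ico (-M : ℤ) ((j : ℤ) + 1 + M) with hB
    have cJ : (J.card : ℝ) = ((j : ℝ) + 1) ^ d := by
      have : ((j : ℤ) + 1).toNat = j + 1 := by omega
      rw [hJ, Fintype.card_piFinset]; simp [this]
    have cB : (B.card : ℝ) = ((j : ℝ) + 1 + 2 * M) ^ d := by
      have : ((j : ℤ) + 1 + M + M).toNat = j + 1 + 2 * M := by omega
      rw [hB, Fintype.card_piFinset]; simp [this]
    -- The injection `(k, j) ↦ (k + j, j)` lands in the enlarged box because the entries of `k` are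
    -- at most `M`. The unused pairs contribute nonnegative terms.
    have h1 : ∑ p ∈ s ×ˢ J, potCoeff V p.1 ≤ ∑ q ∈ B ×ˢ B, potCoeff V (q.1 - q.2) := by
      have h2 : ∑ q ∈ (s ×ˢ J).image (fun p => (p.1 + p.2, p.2)), potCoeff V (q.1 - q.2)
          = ∑ p ∈ s ×ˢ J, potCoeff V p.1 := by
        rw [Finset.sum_image fun p _ q _ h => ?_]
        · simp
        · simp only [Prod.mk.injEq] at h
          exact Prod.ext (add_right_cancel (h.2 ▸ h.1)) h.2
      rw [← h2]
      refine Finset.sum_le_sum_of_subset_of_nonneg (fun q hq => ?_) fun _ _ _ => pV _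
      obtain ⟨p, hp, rfl⟩ := Finset.mem_image.1 hq
      obtain ⟨hp1, hp2⟩ := Finset.mem_product.1 hp
      simp only [hB, hJ, Finset.mem_product, Fintype.mem_piFinset, Finset.mem_Ico,
        Pi.add_apply] at hp2 ⊢
      refine ⟨fun a => ?_, fun a => ?_⟩ <;>
      · have h3 := abs_le.1 (hk _ hp1 a)
        have h4 := hp2 a
        omega
    rw [Finset.sum_product, Finset.sum_product] at h1
    simp only [sum_const, nsmul_eq_mul] at h1
    rw [← mul_sum, cJ] at h1
    have h5 := h1.trans (sum_potCoeff_sub_le hV mV bV B)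
    rw [cB] at h5
    have hj : (0 : ℝ) < (j : ℝ) + 1 := by positivity
    rw [show (1 : ℝ) + 2 * M / ((j : ℝ) + 1) = ((j : ℝ) + 1 + 2 * M) / ((j : ℝ) + 1) by field_simp,
      div_pow, mul_div_assoc', le_div_iff₀ (by positivity)]
    linarith
  refine ge_of_tendsto' (x := atTop) ?_ main
  have h1 : Tendsto (fun j : ℕ => 2 * (M : ℝ) / ((j : ℝ) + 1)) atTop (𝓝 0) :=
    tendsto_const_nhds.div_atTop (tendsto_atTop_add_const_right _ _ tendsto_natCast_atTop_atTop)
  simpa using ((h1.const_add 1).pow d).const_mul K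

/-- The gradient is bounded only almost everywhere. Truncating its large values makes the bound
pointwise and does not change any of the operators. -/
theorem MemW2Infty.gradientField (h : MemW2Infty V F K) (hV : ∀ x, V (-x) = V x)
    (hp : PosDefPotential V) :
    truncField F K =ᵐ[volume] F ∧ GradField (truncField F K) K (potCoeff V) := by
  have h1 : truncField F K =ᵐ[volume] F := 
    h.bound_grad.mono fun x hx => Set.indicator_of_mem (show x ∈ {x | ‖F x‖ ≤ K} from hx) F
  have hK : 0 ≤ K := by
    obtain ⟨x, hx⟩ := h.bound.exists
    exact (abs_nonneg _).trans hx
  have mF : Measurable (truncField F K) :=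
    h.measurable_grad.indicator (measurableSet_le h.measurable_grad.norm measurable_const)
  have bF : ∀ x, ‖truncField F K x‖ ≤ K := fun x => by
    by_cases hx : ‖F x‖ ≤ K
    · rw [truncField, Set.indicator_of_mem (show x ∈ {x | ‖F x‖ ≤ K} from hx)]; exact hx
    · rw [truncField, Set.indicator_of_notMem (show x ∉ {x | ‖F x‖ ≤ K} from hx), norm_zero]; exact hK
  have wF : HasTorusWeakGrad V (truncField F K) := fun φ hφ a =>
    (h.weakGrad φ hφ a).trans (congrArg Neg.neg
      (integral_congr_ae (h1.mono fun x hx => by simp only [hx])))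
  exact ⟨h1, mF, bF, fun a k => integral_gradient_mul hV mF bF h.measurable h.bound wF a k, hp,
    potCoeff_neg hV, sum_potCoeff_le hV h.measurable h.bound hp⟩

/-- The potential as the sum of its Fourier series. -/
def fourPot (Vh : Λ → ℝ) (x : Torus d) : ℝ := (∑' k, (Vh k : ℂ) * mFourier k x).re

namespace GradField

lemma summable_mul_mFourier (hF : GradField F K Vh) (x : Torus d) :
    Summable fun k => (Vh k : ℂ) * mFourier k x :=
  Summable.of_norm_bounded hF.summable fun k => by
    rw [norm_mul, norm_mFourier_apply, mul_one, norm_real, norm_of_nonneg (hF.nonneg k)]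

lemma hasSum_fourPot (hF : GradField F K Vh) (x : Torus d) :
    HasSum (fun k => Vh k * (mFourier k x).re) (fourPot Vh x) := by
  simpa [fourPot] using reCLM.hasSum (hF.summable_mul_mFourier x).hasSum

lemma ofReal_fourPot (hF : GradField F K Vh) (x : Torus d) :
    (fourPot Vh x : ℂ) = ∑' k, (Vh k : ℂ) * mFourier k x := by
  refine conj_eq_iff_re.1 ?_
  rw [conj_tsum, ← (Equiv.neg Λ).tsum_eq fun k => (Vh k : ℂ) * mFourier k x]
  simp [hF.neg, mFourier_neg]

lemma continuous_fourPot (hF : GradField F K Vh) : Continuous (fourPot Vh) :=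
  continuous_re.comp (continuous_tsum (fun k => by fun_prop) hF.summable fun k x => by
    rw [norm_mul, norm_mFourier_apply, mul_one, norm_real, norm_of_nonneg (hF.nonneg k)])

lemma abs_fourPot_le (hF : GradField F K Vh) (x : Torus d) : |fourPot Vh x| ≤ K := by
  refine (abs_re_le_norm _).trans ((tsum_of_norm_bounded hF.summable.hasSum fun k => ?_).trans
    (hF.summable.tsum_le_of_sum_le hF.sum_le))
  rw [norm_mul, norm_mFourier_apply, mul_one, norm_real, norm_of_nonneg (hF.nonneg k)]

lemma fourPot_neg (hF : GradField F K Vh) (x : Torus d) : fourPot Vh (-x) = fourPot Vh x := by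
  rw [fourPot, fourPot, ← (Equiv.neg Λ).tsum_eq fun k => (Vh k : ℂ) * mFourier k x]
  simp [hF.neg, mFourier_neg_arg]

lemma integral_fourPot_mul (hF : GradField F K Vh) (k : Λ) :
    ∫ x, (fourPot Vh x : ℂ) * mFourier k x = Vh k := by
  have ib : ∀ l, Integrable fun x : Torus d => (Vh l : ℂ) * mFourier l x * mFourier k x :=
    fun l => .mono' (integrable_const (Vh l))
      (by fun_prop) (ae_of_all _ fun x => by
        rw [norm_mul, norm_mul, norm_mFourier_apply, norm_mFourier_apply, norm_real,
          norm_of_nonneg (hF.nonneg l), mul_one, mul_one])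
  have h1 := hasSum_integral_of_summable_integral_norm ib (by
    simp only [norm_mul, norm_mFourier_apply, norm_real, norm_of_nonneg (hF.nonneg _)]
    simpa using hF.summable)
  simp_rw [tsum_mul_right, ← hF.ofReal_fourPot] at h1
  refine h1.unique ?_
  have e : ∀ l, ∫ x : Torus d, (Vh l : ℂ) * mFourier l x * mFourier k x
      = (Vh l : ℂ) * (if l + k = 0 then 1 else 0) := fun l => by
    rw [← integral_mFourier, ← integral_const_mul]
    simp_rw [mFourier_add, mul_assoc]
  simp_rw [e]
  have h2 := hasSum_single (f := fun l => (Vh l : ℂ) * (if l + k = 0 then 1 else 0)) (-k)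
    fun l hl => by rw [if_neg fun h => hl (eq_neg_of_add_eq_zero_left h), mul_zero]
  simpa [hF.neg] using h2

lemma _root_.TaggedParticle.ofReal_norm_sum_mFourier_sq (k : Λ) (x : Fin n → Torus d) :
    ((‖∑ j, mFourier k (x j)‖ ^ 2 : ℝ) : ℂ) = ∑ j, ∑ l, mFourier k (x j - x l) := by
  push_cast
  rw [← mul_conj', map_sum, Finset.sum_mul_sum]
  simp_rw [mFourier_sub_arg, mFourier_neg]

/-- The double sum equals `∑ V̂(k) |∑ e_k(x_j)|²`. All terms are nonnegative, and only the mode `k =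
0` is kept. -/
lemma le_sum_fourPot (hF : GradField F K Vh) (x : Fin n → Torus d) :
    (n : ℝ) ^ 2 * Vh 0 ≤ ∑ j, ∑ l, fourPot Vh (x j - x l) := by
  have h1 := hasSum_sum (s := Finset.univ) fun j (_ : j ∈ Finset.univ) =>
    hasSum_sum (s := Finset.univ) fun l (_ : l ∈ Finset.univ) => hF.hasSum_fourPot (x j - x l)
  have e : ∀ k, ∑ j, ∑ l, Vh k * (mFourier k (x j - x l)).re
      = Vh k * ‖∑ j, mFourier k (x j)‖ ^ 2 := by
    intro k
    rw [← ofReal_re (‖_‖ ^ 2), ofReal_norm_sum_mFourier_sq]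
    simp [mul_sum]
  simp_rw [e] at h1
  have h2 := le_hasSum h1 0 fun k _ => mul_nonneg (hF.nonneg k) (by positivity)
  simp [mFourier_zero] at h2
  linarith

end GradField

/-- The potential has a continuous representative, its absolutely convergent Fourier series. The
Gibbs estimates are proved for that representative, whose value at the origin is meaningful. -/
lemma fourPot_ae_eq (h : MemW2Infty V F K) (hV : ∀ x, V (-x) = V x)
    (hp : PosDefPotential V) : ∀ᵐ x, V x = fourPot (potCoeff V) x := by
  have hF := (h.gradientField hV hp).2
  have m1 : MemLp (fun x => (V x : ℂ)) 2 := MemLp.of_bound (by have := h.measurable; fun_prop)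
      K (by simpa using h.bound)
  have m2 : MemLp (fun x => (fourPot (potCoeff V) x : ℂ)) 2 :=
    MemLp.of_bound (by have := hF.continuous_fourPot
                       fun_prop)
      K (ae_of_all _ fun x => by simpa using hF.abs_fourPot_le x)
  have h0 := ae_eq_zero_of_fourier (m1.sub m2) fun k => by
    have me : MemLp (fun x : Torus d => mFourier k x) 2 :=
      MemLp.of_bound (map_continuous _).aestronglyMeasurable 1
        (ae_of_all _ fun x => (norm_mFourier_apply k x).le)
    have a1 := integral_sub (m1.integrable_mul me) (m2.integrable_mul me)
    simp only [Pi.mul_apply] at a1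
    simp only [Pi.sub_apply, sub_mul]
    rw [a1, integral_potential_mul hV, hF.integral_fourPot_mul, sub_self]
  filter_upwards [h0] with x hx
  exact_mod_cast (sub_eq_zero.1 hx : (V x : ℂ) = fourPot (potCoeff V) x)

/-! ### The Gibbs measure in position space -/

instance : BorelSpace (Fin n → Torus d) := Pi.borelSpace

instance : (volume : Measure (Fin n → Torus d)).IsAddHaarMeasure :=
  Measure.pi.isAddHaarMeasure fun _ => (volume : Measure (Torus d))

instance : IsProbabilityMeasure (volume : Measure (Fin n → Torus d)) :=
  Measure.pi.instIsProbabilityMeasure fun _ => (volume : Measure (Torus d))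

lemma preserves_sub {j l : Fin n} (h : j ≠ l) :
    MeasurePreserving fun x : Fin n → Torus d => x j - x l := by
  refine AddMonoidHom.measurePreserving
    (f := Pi.evalAddMonoidHom (fun _ : Fin n => Torus d) j - Pi.evalAddMonoidHom _ l)
    ((continuous_apply j).sub (continuous_apply l)) (fun u => ⟨Pi.single j u, ?_⟩)
    ((measure_univ (μ := volume)).trans (measure_univ (μ := volume)).symm)
  change (Pi.single j u : Fin n → Torus d) j - (Pi.single j u : Fin n → Torus d) l = u
  rw [Pi.single_eq_same, Pi.single_eq_of_ne h.symm, sub_zero]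

lemma integral_comp_sub {E : Type*} [NormedAddCommGroup E] [NormedSpace ℝ E] {j l : Fin n}
    (h : j ≠ l) {φ : Torus d → E} (hφ : AEStronglyMeasurable φ) :
    ∫ x : Fin n → Torus d, φ (x j - x l) = ∫ u, φ u := by
  have := preserves_sub (d := d) h
  rw [← this.map_eq] at hφ
  rw [← this.map_eq, integral_map this.aemeasurable hφ]

/-- The weight `exp (-β/2N ∑_{j ≠ l} U(x_j - x_l))`. -/
def posWeight (β : ℝ) (U : Torus d → ℝ) (N : ℕ) (x : Fin N → Torus d) : ℝ :=
  rexp (-(β / (2 * N)) * ∑ j, ∑ l, if j = l then 0 else U (x j - x l))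

/-- The configuration of `N` points whose first `m` points are `w`, the others being `y`. -/
def glue {α : Type*} (h : m ≤ N) (w : Fin m → α) (y : Fin (N - m) → α) (i : Fin N) : α :=
  Sum.elim w y ((finSumFinEquiv.trans (finCongr (Nat.add_sub_of_le h))).symm i)

lemma glue_comp {α γ : Type*} (h : m ≤ N) (w : Fin m → α) (y : Fin (N - m) → α) (φ : α → γ) :
    (fun i => φ (glue h w y i)) = glue h (fun i => φ (w i)) fun i => φ (y i) := by
  funext i
  simp only [glue]
  cases (finSumFinEquiv.trans (finCongr (Nat.add_sub_of_le h))).symm i <;> rfl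

lemma prod_glue {α : Type*} (h : m ≤ N) (w : Fin m → α) (y : Fin (N - m) → α) (φ : α → ℝ) :
    ∏ i, φ (glue h w y i) = (∏ i, φ (w i)) * ∏ i, φ (y i) := by
  unfold glue
  rw [Equiv.prod_comp (finSumFinEquiv.trans (finCongr (Nat.add_sub_of_le h))).symm
    fun s => φ (Sum.elim w y s), Fintype.prod_sum_type]
  rfl

lemma glue_castLE {α : Type*} (h : m ≤ N) (w : Fin m → α) (y : Fin (N - m) → α) (i : Fin m) :
    glue h w y (i.castLE h) = w i := by
  have : i.castLE h = (finSumFinEquiv.trans (finCongr (Nat.add_sub_of_le h))) (Sum.inl i) := by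
    ext; simp
  rw [glue, this, Equiv.symm_apply_apply, Sum.elim_inl]

lemma glue_cases (h : m ≤ N) (i : Fin N) :
    (∃ a : Fin m, i = a.castLE h) ∨ ∃ a, ∀ (α : Type) (w : Fin m → α) y, glue h w y i = y a := by
  obtain ⟨s, rfl⟩ := (finSumFinEquiv.trans (finCongr (Nat.add_sub_of_le h))).surjective i
  rcases s with a | a
  · exact Or.inl ⟨a, by ext; simp⟩
  · exact Or.inr ⟨a, fun α w y => by rw [glue, Equiv.symm_apply_apply, Sum.elim_inr]⟩

/-- Label `0` is the tagged particle, so a background index of the joint configuration is shifted by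
one relative to its index in `z`. -/
lemma dite_eq_glue {α : Type*} (h : m ≤ N) (z : Fin (m + 1) → α) (y : Fin (N - m) → α) (i : Fin N) :
    (if h : i.succ.val < m + 1 then z ⟨i.succ.val, h⟩ else y ⟨i.succ.val - (m + 1), by
      have := i.2; simp only [Fin.val_succ] at h ⊢; omega⟩) = glue h (fun i => z i.succ) y i := by
  obtain ⟨s, rfl⟩ := (finSumFinEquiv.trans (finCongr (Nat.add_sub_of_le h))).surjective i
  rw [glue, Equiv.symm_apply_apply]
  rcases s with a | a
  · rw [dif_pos (by simp)]; rfl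
  · rw [dif_neg (by simp)]
    simp only [Sum.elim_inr]
    congr 1
    ext
    simp

lemma preserves_glue (h : m ≤ N) : MeasurePreserving
    fun p : (Fin m → Torus d) × (Fin (N - m) → Torus d) => glue h p.1 p.2 := by
  have h1 := (volume_measurePreserving_piCongrLeft (fun _ => Torus d)
    (finSumFinEquiv.trans (finCongr (Nat.add_sub_of_le h)))).comp
    (volume_measurePreserving_sumPiEquivProdPi_symm fun _ : Fin m ⊕ Fin (N - m) => Torus d)
  refine (congrArg (fun f => MeasurePreserving f volume volume) ?_).mp h1
  funext p i
  obtain ⟨s, rfl⟩ := (finSumFinEquiv.trans (finCongr (Nat.add_sub_of_le h))).surjective i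
  rw [glue, Equiv.symm_apply_apply, Function.comp_apply, MeasurableEquiv.coe_piCongrLeft,
    Equiv.piCongrLeft_apply_apply]
  cases s <;> rfl

lemma integral_glue (h : m ≤ N) {G : (Fin N → Torus d) → ℂ} (hG : Integrable G) :
    ∫ w, ∫ y, G (glue h w y) = ∫ x, G x := by
  have hm := preserves_glue (d := d) h
  have i1 := hm.integrable_comp_of_integrable hG
  have h2 := hG.aestronglyMeasurable
  rw [← hm.map_eq] at h2
  rw [← hm.map_eq, integral_map hm.aemeasurable h2]
  exact (integral_prod _ i1).symm

variable {U : Torus d → ℝ}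

lemma posWeight_pos (x : Fin N → Torus d) : 0 < posWeight β U N x := Real.exp_pos _

lemma posWeight_add (x : Fin N → Torus d) (t : Torus d) :
    posWeight β U N (fun i => x i + t) = posWeight β U N x := by
  unfold posWeight; simp_rw [add_sub_add_right_eq_sub]

lemma posWeight_perm (x : Fin N → Torus d) (σ : Equiv.Perm (Fin N)) :
    posWeight β U N (fun i => x (σ i)) = posWeight β U N x := by
  unfold posWeight
  have h := fun j => Equiv.sum_comp σ fun l => if j = l then 0 else U (x j - x l)
  simp_rw [← Equiv.sum_comp σ fun j => ∑ l, if j = l then 0 else U (x j - x l), ← h,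
    σ.injective.eq_iff]

/-- The weight integrated over all the points but the first `m`. -/
def posMarginal (β : ℝ) (U : Torus d → ℝ) (h : m ≤ N) (w : Fin m → Torus d) : ℝ :=
  ∫ y, posWeight β U N (glue h w y)

lemma posMarginal_add (h : m ≤ N) (w : Fin m → Torus d) (t : Torus d) :
    posMarginal β U h (fun i => w i + t) = posMarginal β U h w := by
  unfold posMarginal
  rw [← integral_add_right_eq_self _ fun _ => t]
  refine integral_congr_ae (ae_of_all _ fun y => ?_)
  change posWeight β U N (glue h (fun i => w i + t) fun i => y i + t) = _
  rw [← glue_comp h w y fun x => x + t]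
  exact posWeight_add _ t

lemma integral_prod_mul_pos (E : Vel d → ℝ) (B : (Fin n → Torus d) → ℝ) :
    ∫ y : Fin n → Phase d, (∏ i, E (y i).2) * B (fun i => (y i).1) = (∫ v, E v) ^ n * ∫ x, B x := by
  have h1 := (volume_measurePreserving_arrowProdEquivProdArrow (Torus d) (Vel d)
    (Fin n)).integral_comp' fun p => (∏ i, E (p.2 i)) * B p.1
  refine Eq.trans h1 ?_
  have h2 := integral_prod_mul (μ := (volume : Measure (Fin n → Torus d)))
    (ν := (volume : Measure (𝕍 n))) B fun v => ∏ i, E (v i)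
  rw [integral_fintype_prod_volume_eq_pow, mul_comm, Fintype.card_fin] at h2
  rw [← h2]
  exact integral_congr_ae (ae_of_all _ fun p => mul_comm _ _)

lemma gibbsWeight_eq (V : Torus d → ℝ) (z : Fin N → Phase d) :
    gibbsWeight β V N z = (∏ j, rexp (-(β / 2) * ‖(z j).2‖ ^ 2)) *
      posWeight β V N fun j => (z j).1 := by
  rw [gibbsWeight, posWeight, ← Real.exp_sum, ← Real.exp_add, mul_sum, sub_eq_add_neg,
    neg_mul (β / (2 * N))]

/-- The Maxwellian has mass one, so the proportionality constant is identified without evaluating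
the Gaussian integral. -/
lemma exp_eq_maxwellian (hβ : 0 < β) (v : Vel d) : rexp (-(β / 2) * ‖v‖ ^ 2)
    = (∫ v : Vel d, rexp (-(β / 2) * ‖v‖ ^ 2)) * maxwellian d β v := by
  have := prob_vel (d := d) hβ
  have h1 := integral_velMeasure (d := d) hβ fun _ => (1 : ℝ)
  simp only [integral_const, probReal_univ, smul_eq_mul, mul_one, maxwellian] at h1
  rw [integral_const_mul] at h1
  rw [maxwellian, ← mul_assoc, mul_comm (∫ _, _), ← h1, one_mul]

/-- The Gibbs density factorizes into velocities and positions. The velocity integrals contribute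
powers of one constant that cancel against the partition function, and the remaining velocity
factors are the Maxwellians divided out on the left. -/
theorem marginal_div (hβ : 0 < β) {V : Torus d → ℝ} (f : Vel d → ℝ) (h : m ≤ N)
    (z : Fin (m + 1) → Phase d) :
    marginal N m (initialDensity β V f N) z / ∏ i, maxwellian d β (z i).2
      = f (z 0).2 / maxwellian d β (z 0).2 * ((∫ x, posWeight β V N x)⁻¹ *
        posMarginal β V h fun i => (z i.succ).1) := by
  set s : ℝ := ∫ v : Vel d, rexp (-(β / 2) * ‖v‖ ^ 2) with hs
  have s0 : s ≠ 0 := fun h0 => by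
    have := exp_eq_maxwellian (d := d) hβ 0
    rw [← hs, h0, zero_mul] at this
    exact (Real.exp_pos _).ne' this
  have e1 : marginal N m (initialDensity β V f N) z = f (z 0).2 * ((s ^ N * ∫ x, posWeight β V N x)⁻¹ *
      (s ^ m * ∏ i : Fin m, maxwellian d β (z i.succ).2) * (s ^ (N - m) *
        posMarginal β V h fun i => (z i.succ).1)) := by
    rw [posMarginal, ← integral_prod_mul_pos, ← integral_prod_mul_pos, marginal,
      ← integral_const_mul, ← integral_const_mul]
    refine integral_congr_ae (ae_of_all _ fun y => ?_)
    simp only [initialDensity, gibbsDensity, dite_eq_glue h z y, ← gibbsWeight_eq]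
    rw [gibbsWeight_eq, glue_comp h _ y Prod.fst,
      prod_glue h _ y fun z => rexp (-(β / 2) * ‖z.2‖ ^ 2)]
    have : ∏ i : Fin m, rexp (-(β / 2) * ‖(z i.succ).2‖ ^ 2)
        = s ^ m * ∏ i : Fin m, maxwellian d β (z i.succ).2 := by
      rw [prod_congr rfl fun i _ => exp_eq_maxwellian hβ (z i.succ).2,
        prod_mul_distrib, Finset.prod_const, card_univ, Fintype.card_fin]
    rw [this]
    rw [dif_pos (show ((0 : Fin (N + 1)) : ℕ) < m + 1 from Nat.succ_pos m)]
    change f (z 0).2 * _ = _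
    ring
  rw [e1, Fin.prod_univ_succ]
  have h1 : ∏ i : Fin m, maxwellian d β (z i.succ).2 ≠ 0 :=
    Finset.prod_ne_zero_iff.2 fun i _ => (maxwellian_pos hβ _).ne'
  have h2 := (maxwellian_pos hβ (z 0).2).ne'
  rw [← pow_mul_pow_sub s h]
  field_simp

/-! ### Two-point correlations of the Gibbs measure -/

lemma mFourier_zero_arg (k : Λ) : mFourier k (0 : Torus d) = 1 := by
  simp [mFourier]

lemma sum_sum_offDiag {E : Type*} [AddCommGroup E] (a : Fin n → Fin n → E) :
    (∑ j, ∑ l, if j = l then 0 else a j l) = ∑ j, ∑ l, a j l - ∑ j, a j j := by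
  have h : ∀ j l, (if j = l then 0 else a j l) = a j l - if j = l then a j l else 0 := fun j l => by
    split_ifs <;> simp
  simp [h, sum_sub_distrib]

lemma continuous_posWeight (hU : Continuous U) : Continuous (posWeight β U N) := by
  refine Real.continuous_exp.comp (continuous_const.mul (continuous_finsetSum _ fun j _ =>
    continuous_finsetSum _ fun l _ => ?_))
  split_ifs
  · exact continuous_const
  · exact hU.comp ((continuous_apply j).sub (continuous_apply l))

lemma integrable_of_continuous {E : Type*} [NormedAddCommGroup E] {φ : (Fin n → Torus d) → E}
    (h : Continuous φ) : Integrable φ :=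
  h.integrable_of_hasCompactSupport (HasCompactSupport.of_compactSpace _)

/-- The full double sum is bounded below by positive definiteness; removing its diagonal costs `N
U(0) ≤ N K`. After multiplication by `β/2N` this is a constant independent of `N`. -/
lemma GradField.posWeight_le (hF : GradField F K Vh) (hβ : 0 < β) (hN : 1 ≤ N)
    (x : Fin N → Torus d) : posWeight β (fourPot Vh) N x
      ≤ rexp (-(β * N * Vh 0 / 2)) * rexp (β * K / 2) := by
  have hN' : (0 : ℝ) < N := by exact_mod_cast hN
  have h1 := hF.le_sum_fourPot x
  have h2 := (abs_le.1 (hF.abs_fourPot_le 0)).2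
  rw [posWeight, ← Real.exp_add, Real.exp_le_exp, sum_sum_offDiag]
  simp only [sub_self, sum_const, card_univ, Fintype.card_fin, nsmul_eq_mul]
  have h3 : (N : ℝ) ^ 2 * Vh 0 - N * K
      ≤ ∑ j, ∑ l, fourPot Vh (x j - x l) - N * fourPot Vh 0 := by nlinarith
  have h4 := mul_le_mul_of_nonneg_left h3 (show 0 ≤ β / (2 * N) by positivity)
  have h5 : β / (2 * N) * ((N : ℝ) ^ 2 * Vh 0 - N * K) = β * N * Vh 0 / 2 - β * K / 2 := by
    field_simp
  linarith

/-- Jensen's inequality: under the uniform measure the exponent has mean `-β(N - 1)V̂(0)/2`. With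
the preceding pointwise bound, the normalized weight is at most `exp (βK/2)`, uniformly in `N`. -/
lemma GradField.le_integral_posWeight (hF : GradField F K Vh) (hβ : 0 < β) (hN : 1 ≤ N) :
    rexp (-(β * N * Vh 0 / 2)) ≤ ∫ x, posWeight β (fourPot Vh) N x := by
  have hN' : (0 : ℝ) < N := by exact_mod_cast hN
  have hU := hF.continuous_fourPot
  set t : (Fin N → Torus d) → ℝ := fun x => -(β / (2 * N)) *
    ∑ j, ∑ l, if j = l then 0 else fourPot Vh (x j - x l) with ht
  have ci : ∀ j l, Continuous fun x : Fin N → Torus d =>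
      if j = l then 0 else fourPot Vh (x j - x l) := fun j l => by
    split_ifs
    · exact continuous_const
    · exact hU.comp ((continuous_apply j).sub (continuous_apply l))
  have ct : Continuous t := continuous_const.mul (continuous_finsetSum _ fun j _ =>
    continuous_finsetSum _ fun l _ => ci j l)
  have hV : ∫ u, fourPot Vh u = Vh 0 := by
    have := hF.integral_fourPot_mul 0
    simp only [mFourier_zero, ContinuousMap.one_apply, mul_one, integral_complex_ofReal] at this
    exact_mod_cast this
  have et : ∫ x, t x = -(β * (N - 1) * Vh 0 / 2) := by
    have : ∀ j l, ∫ x : Fin N → Torus d, (if j = l then 0 else fourPot Vh (x j - x l))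
        = if j = l then 0 else Vh 0 := fun j l => by
      split_ifs with h
      · simp
      · rw [integral_comp_sub h hU.aestronglyMeasurable, hV]
    rw [ht, integral_const_mul, integral_finsetSum _ fun j _ => integrable_finsetSum _ fun l _ =>
      integrable_of_continuous (ci j l)]
    simp_rw [integral_finsetSum _ fun l _ => integrable_of_continuous (ci _ l), this]
    rw [sum_sum_offDiag]
    simp
    field_simp
  set c : ℝ := -(β * (N - 1) * Vh 0 / 2) with hc
  calc rexp (-(β * N * Vh 0 / 2)) ≤ rexp c := by
        rw [Real.exp_le_exp, hc]; nlinarith [mul_nonneg hβ.le (hF.nonneg 0)]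
    -- The tangent line of the exponential at the mean `c` of the exponent.
    _ = ∫ x, rexp c * (t x - c + 1) := by
        have a1 := integral_sub (integrable_of_continuous ct) (integrable_const c)
        have a2 := integral_add ((integrable_of_continuous ct).sub (integrable_const c))
          (integrable_const (1 : ℝ))
        simp only [Pi.sub_apply] at a2
        rw [integral_const_mul, a2, a1, et]
        simp
    _ ≤ ∫ x, posWeight β (fourPot Vh) N x := by
        refine integral_mono (integrable_of_continuous (by fun_prop))
          (integrable_of_continuous (continuous_posWeight hU)) fun x => ?_
        change rexp c * (t x - c + 1) ≤ rexp (t x)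
        rw [show t x = c + (t x - c) by ring, Real.exp_add, add_sub_cancel_left]
        exact mul_le_mul_of_nonneg_left (Real.add_one_le_exp _) (Real.exp_pos _).le

/-- Exchangeability of the particles. Two transpositions suffice to carry one pair of distinct
labels to another. -/
lemma integral_posWeight_mul_eq {j l j' l' : Fin N} (h : j ≠ l) (h' : j' ≠ l') (φ : Torus d → ℂ) :
    ∫ x, (posWeight β U N x : ℂ) * φ (x j - x l)
      = ∫ x, (posWeight β U N x : ℂ) * φ (x j' - x l') := by
  set p := Equiv.swap j' j l' with hp
  have hpj : j ≠ p := fun e => h' (by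
    have := congrArg (Equiv.swap j' j) e
    rw [hp, Equiv.swap_apply_right, Equiv.swap_apply_self] at this
    exact this)
  set σ : Equiv.Perm (Fin N) := Equiv.swap p l * Equiv.swap j' j with hσ
  have s1 : σ j' = j := by
    rw [hσ, Equiv.Perm.mul_apply, Equiv.swap_apply_left, Equiv.swap_apply_of_ne_of_ne hpj h]
  have s2 : σ l' = l := by rw [hσ, Equiv.Perm.mul_apply, ← hp, Equiv.swap_apply_left]
  rw [← (volume_measurePreserving_piCongrLeft (fun _ : Fin N => Torus d) σ.symm).integral_comp'
    fun x => (posWeight β U N x : ℂ) * φ (x j' - x l')]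
  refine integral_congr_ae (ae_of_all _ fun x => ?_)
  have e : MeasurableEquiv.piCongrLeft (fun _ : Fin N => Torus d) σ.symm x = fun i => x (σ i) := by
    funext i
    obtain ⟨a, rfl⟩ := σ.symm.surjective i
    rw [MeasurableEquiv.coe_piCongrLeft, Equiv.piCongrLeft_apply_apply, Equiv.apply_symm_apply]
  simp only [e, posWeight_perm, s1, s2]

/-- The pair correlation is read off from the second moment of `∑ e_k(x_j)`. Under the uniform
measure this moment is `N` for `k ≠ 0`, and the Gibbs density relative to it is at most `exp
(βK/2)`. -/
theorem GradField.norm_integral_posWeight_mul_le (hF : GradField F K Vh) (hβ : 0 < β)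
    (hN : 2 ≤ N) {j l : Fin N} (hjl : j ≠ l) {k : Λ} (hk : k ≠ 0) :
    N * ‖∫ x, (posWeight β (fourPot Vh) N x : ℂ) * mFourier k (x j - x l)‖
      ≤ 2 * rexp (β * K / 2) * ∫ x, posWeight β (fourPot Vh) N x := by
  have hN' : (2 : ℝ) ≤ N := by exact_mod_cast hN
  have hU := hF.continuous_fourPot
  have cW := continuous_posWeight (β := β) (N := N) hU
  set W := posWeight β (fourPot Vh) N
  set a := ∫ x, (W x : ℂ) * mFourier k (x j - x l)
  set Z := ∫ x, W x
  set B := rexp (β * K / 2)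
  have cS : Continuous fun x : Fin N → Torus d => ‖∑ j, mFourier k (x j)‖ ^ 2 := by fun_prop
  have ce : ∀ j l : Fin N, Continuous fun x : Fin N → Torus d => mFourier k (x j - x l) := fun j l =>
    (map_continuous _).comp ((continuous_apply j).sub (continuous_apply l))
  have eS : ∀ φ : (Fin N → Torus d) → ℝ, Continuous φ →
      ((∫ x, φ x * ‖∑ j, mFourier k (x j)‖ ^ 2 : ℝ) : ℂ)
        = ∑ j, ∑ l, ∫ x, (φ x : ℂ) * mFourier k (x j - x l) := fun φ hφ => by
    have i1 : ∀ j l : Fin N, Integrable fun x : Fin N → Torus d =>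
      (φ x : ℂ) * mFourier k (x j - x l) := fun j l =>
        integrable_of_continuous ((continuous_ofReal.comp hφ).mul (ce j l))
    rw [← integral_complex_ofReal]
    simp_rw [ofReal_mul, ofReal_norm_sum_mFourier_sq, mul_sum]
    rw [integral_finsetSum _ fun j _ => integrable_finsetSum _ fun l _ => i1 j l]
    exact sum_congr rfl fun j _ => integral_finsetSum _ fun l _ => i1 j l
  have e1 : ∫ x : Fin N → Torus d, ‖∑ j, mFourier k (x j)‖ ^ 2 = N := by
    have h1 := eS (fun _ => 1) continuous_const
    have h2 : ∀ j l : Fin N, ∫ x : Fin N → Torus d, mFourier k (x j - x l)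
        = if j = l then 1 else 0 := fun j l => by
      split_ifs with h
      · simp [h, mFourier_zero_arg]
      · rw [integral_comp_sub h (map_continuous _).aestronglyMeasurable, integral_mFourier, if_neg hk]
    simp only [ofReal_one, one_mul, h2] at h1
    simp at h1
    exact_mod_cast h1
  set Q := ∫ x, W x * ‖∑ j, mFourier k (x j)‖ ^ 2
  -- By exchangeability all off-diagonal pairs contribute equally, and the diagonal contributes the
  -- partition function `N` times.
  have hQ : (Q : ℂ) = N * (N - 1) * a + N * Z := by
    have h1 := sum_sum_offDiag fun j l : Fin N => ∫ x, (W x : ℂ) * mFourier k (x j - x l)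
    have h2 : ∀ i i' : Fin N, (if i = i' then 0 else ∫ x, (W x : ℂ) * mFourier k (x i - x i'))
        = if i = i' then 0 else a := fun i i' => by
      split_ifs with h
      · rfl
      · exact integral_posWeight_mul_eq h hjl _
    simp_rw [h2, ← eS W cW, sub_self, mFourier_zero_arg, mul_one] at h1
    rw [sum_sum_offDiag, integral_complex_ofReal] at h1
    simp at h1
    linear_combination -h1
  have hZ : rexp (-(β * N * Vh 0 / 2)) ≤ Z := hF.le_integral_posWeight hβ (by omega)
  have hB : 1 ≤ B := Real.one_le_exp (by
    have := (norm_nonneg _).trans (hF.bound 0); positivity)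
  have Q0 : 0 ≤ Q := integral_nonneg fun x => mul_nonneg (Real.exp_pos _).le (by positivity)
  have Q1 : Q ≤ Z * B * N := by
    calc Q ≤ ∫ x : Fin N → Torus d, Z * B * ‖∑ j, mFourier k (x j)‖ ^ 2 := by
          refine integral_mono (integrable_of_continuous (cW.mul cS))
            (integrable_of_continuous (continuous_const.mul cS)) fun x => ?_
          refine mul_le_mul_of_nonneg_right ((hF.posWeight_le hβ (by omega) x).trans ?_)
            (by positivity)
          exact mul_le_mul_of_nonneg_right hZ (Real.exp_pos _).le
      _ = Z * B * N := by rw [integral_const_mul, e1]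
  have hZ0 : 0 < Z := (Real.exp_pos _).trans_le hZ
  have h3 : (N : ℝ) * ((N - 1) * ‖a‖) = |Q - N * Z| := by
    have : ((Q - N * Z : ℝ) : ℂ) = ((N * (N - 1) : ℝ) : ℂ) * a := by
      push_cast; rw [hQ]; ring
    rw [← norm_eq_abs, ← norm_real, this, norm_mul, norm_real, norm_of_nonneg (by nlinarith)]
    ring
  have h4 : |Q - N * Z| ≤ N * (B * Z) := by
    rw [abs_le]
    constructor <;> nlinarith [mul_le_mul_of_nonneg_left hB (mul_nonneg (by positivity : (0:ℝ) ≤ N) hZ0.le)]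
  have h5 : (N - 1) * ‖a‖ ≤ B * Z := le_of_mul_le_mul_left (h3 ▸ h4) (by linarith)
  -- The factor `2` pays for `N ≤ 2(N - 1)`, valid since `N ≥ 2`.
  nlinarith [norm_nonneg a]

/-- `N` times the two-point correlation of the Gibbs measure, as a function of the difference of the
positions. -/
def gibbsCorr (β : ℝ) (U : Torus d → ℝ) (N : ℕ) (u : Torus d) : ℝ :=
  if h : 2 ≤ N then N * ((∫ x, posWeight β U N x)⁻¹ * posMarginal β U h ![u, 0] - 1) else 0

lemma posMarginal_pair (h : 2 ≤ N) (w : Fin 2 → Torus d) :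
    posMarginal β U h ![w 0 - w 1, 0] = posMarginal β U h w := by
  rw [← posMarginal_add h _ (w 1)]
  congr 1
  funext i
  fin_cases i
  · exact sub_add_cancel (w 0) (w 1)
  · exact zero_add (w 1)

lemma continuous_glue (h : m ≤ N) : Continuous
    fun p : (Fin m → Torus d) × (Fin (N - m) → Torus d) => glue h p.1 p.2 := by
  refine continuous_pi fun i => ?_
  unfold glue
  cases (finSumFinEquiv.trans (finCongr (Nat.add_sub_of_le h))).symm i with
  | inl a => exact (continuous_apply a).comp continuous_fst
  | inr a => exact (continuous_apply a).comp continuous_snd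

lemma continuous_posMarginal (h : m ≤ N) (hU : Continuous U) :
    Continuous fun w => posMarginal β U h w :=
  (continuous_parametric_integral_of_continuous (μ := volume) (s := Set.univ)
    (f := fun w y => posWeight β U N (glue h w y))
    ((continuous_posWeight hU).comp (continuous_glue h)) isCompact_univ).congr fun w => by
      rw [Measure.restrict_univ]; rfl

lemma continuous_posMarginal_pair (h : 2 ≤ N) (hU : Continuous U) :
    Continuous fun u => posMarginal β U h ![u, 0] :=
  (continuous_posMarginal h hU).comp (continuous_pi fun i => by
    fin_cases i
    · exact continuous_id
    · exact continuous_const)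

lemma continuous_gibbsCorr (hU : Continuous U) : Continuous (gibbsCorr β U N) := by
  by_cases h : 2 ≤ N
  · rw [show gibbsCorr β U N = _ from funext fun u => dif_pos h]
    exact continuous_const.mul ((continuous_const.mul (continuous_posMarginal_pair h hU)).sub continuous_const)
  · rw [show gibbsCorr β U N = _ from funext fun u => dif_neg h]
    exact continuous_const

/-- Translation invariance makes a marginal in at most one point constant, hence equal to its
average over the torus. -/
lemma posMarginal_of_le_one (h : m ≤ N) (hm : m ≤ 1) (hU : Continuous U) (w : Fin m → Torus d) :
    posMarginal β U h w = ∫ x, posWeight β U N x := by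
  have h1 : ∀ w', posMarginal β U h w' = posMarginal β U h w := fun w' => by
    rcases Nat.le_one_iff_eq_zero_or_eq_one.1 hm with rfl | rfl
    · rw [Subsingleton.elim w' w]
    · rw [← posMarginal_add h w (w' 0 - w 0)]
      congr 1
      funext i
      rw [Subsingleton.elim i 0, add_sub_cancel]
  have h2 := integral_glue h (integrable_of_continuous
    (continuous_ofReal.comp (continuous_posWeight (β := β) (N := N) hU)))
  simp only [Function.comp_apply, integral_complex_ofReal] at h2
  have h3 : ∫ w', posMarginal β U h w' = ∫ x, posWeight β U N x := by exact_mod_cast h2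
  simpa [h1] using h3

/-- The pair marginal depends only on the difference of the two points, so the integral over the
difference can be replaced by one over the full configuration. -/
lemma integral_posMarginal_mul (h : 2 ≤ N) (hU : Continuous U) {φ : Torus d → ℂ}
    (hφ : Continuous φ) : ∫ u, (posMarginal β U h ![u, 0] : ℂ) * φ u
      = ∫ x, (posWeight β U N x : ℂ) * φ (x ((0 : Fin 2).castLE h) - x ((1 : Fin 2).castLE h)) := by
  rw [← integral_comp_sub (zero_ne_one : (0 : Fin 2) ≠ 1)
    (φ := fun u => (posMarginal β U h ![u, 0] : ℂ) * φ u)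
    ((continuous_ofReal.comp (continuous_posMarginal_pair h hU)).mul hφ).aestronglyMeasurable, ← integral_glue h
    (G := fun x => (posWeight β U N x : ℂ) * φ (x ((0 : Fin 2).castLE h) - x ((1 : Fin 2).castLE h)))
    (integrable_of_continuous ((continuous_ofReal.comp (continuous_posWeight hU)).mul
      (hφ.comp ((continuous_apply _).sub (continuous_apply _)))))]
  refine integral_congr_ae (ae_of_all _ fun w => ?_)
  simp only [posMarginal_pair, glue_castLE]
  rw [integral_mul_const, integral_complex_ofReal]
  rfl

lemma GradField.integral_gibbsCorr_mul (hF : GradField F K Vh) (h : 2 ≤ N)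
    {φ : Torus d → ℂ} (hφ : Continuous φ) : ∫ u, (gibbsCorr β (fourPot Vh) N u : ℂ) * φ u
      = N * ((∫ x, posWeight β (fourPot Vh) N x : ℝ)⁻¹ * (∫ x, (posWeight β (fourPot Vh) N x : ℂ) *
          φ (x ((0 : Fin 2).castLE h) - x ((1 : Fin 2).castLE h))) - ∫ u, φ u) := by
  have hU := hF.continuous_fourPot
  have i1 : Integrable fun u : Torus d => (posMarginal β (fourPot Vh) h ![u, 0] : ℂ) * φ u :=
    ((continuous_ofReal.comp (continuous_posMarginal_pair h hU)).mul hφ).integrable_of_hasCompactSupport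
      (HasCompactSupport.of_compactSpace _)
  have i2 : Integrable φ := hφ.integrable_of_hasCompactSupport (HasCompactSupport.of_compactSpace _)
  rw [← integral_posMarginal_mul h hU hφ, ← integral_const_mul]
  have a1 := integral_sub (i1.const_mul (((∫ x, posWeight β (fourPot Vh) N x)⁻¹ : ℝ) : ℂ)) i2
  rw [← a1, ← integral_const_mul]
  refine integral_congr_ae (ae_of_all _ fun u => ?_)
  simp only [gibbsCorr, h, dite_true]
  push_cast
  ring

lemma GradField.integral_gibbsCorr (hF : GradField F K Vh) (hβ : 0 < β) (hN : 1 ≤ N) :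
    ∫ u, (gibbsCorr β (fourPot Vh) N u : ℂ) = 0 := by
  by_cases h : 2 ≤ N
  · have h1 := hF.integral_gibbsCorr_mul (β := β) h (φ := fun _ => 1) continuous_const
    have h2 := (Real.exp_pos _).trans_le (hF.le_integral_posWeight hβ hN)
    simp only [mul_one, integral_complex_ofReal, integral_const, probReal_univ, one_smul] at h1 ⊢
    rw [h1, ← ofReal_mul, inv_mul_cancel₀ h2.ne']
    simp
  · simp [gibbsCorr, h]

lemma GradField.norm_integral_gibbsCorr_le (hF : GradField F K Vh) (hβ : 0 < β) (hN : 1 ≤ N)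
    (k : Λ) : ‖∫ u, (gibbsCorr β (fourPot Vh) N u : ℂ) * mFourier (-k) u‖
      ≤ 2 * rexp (β * K / 2) := by
  by_cases h : 2 ≤ N
  -- The second-moment estimate fails at the zero mode, which is covered by the vanishing mean.
  · by_cases hk : k = 0
    · subst hk
      simp only [neg_zero, mFourier_zero, ContinuousMap.one_apply, mul_one,
        hF.integral_gibbsCorr hβ hN, norm_zero]
      positivity
    · have h2 := (Real.exp_pos _).trans_le (hF.le_integral_posWeight hβ hN)
      have h3 := hF.norm_integral_posWeight_mul_le hβ h (j := (0 : Fin 2).castLE h)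
        (l := (1 : Fin 2).castLE h) (by simp [Fin.ext_iff]) (neg_ne_zero.2 hk)
      rw [hF.integral_gibbsCorr_mul h (map_continuous _), integral_mFourier,
        if_neg (neg_ne_zero.2 hk), sub_zero, norm_mul, norm_mul, norm_real, norm_inv,
        norm_of_nonneg h2.le, norm_natCast, mul_left_comm, inv_mul_le_iff₀ h2]
      linarith
  · simp only [gibbsCorr, h, dite_false, ofReal_zero, zero_mul, integral_zero, norm_zero]
    positivity

/-! ### The initial cumulant -/

lemma integral_posWeight_congr {Y : Type*} [MeasurableSpace Y] {μ : Measure Y}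
    {c : Y → Fin N → Torus d} (h : ∀ j l, j ≠ l → ∀ᵐ y ∂μ, V (c y j - c y l) = U (c y j - c y l)) :
    ∫ y, posWeight β V N (c y) ∂μ = ∫ y, posWeight β U N (c y) ∂μ := by
  have h1 : ∀ᵐ y ∂μ, ∀ j l, j ≠ l → V (c y j - c y l) = U (c y j - c y l) := by
    simp_rw [ae_all_iff]; exact h
  refine integral_congr_ae (h1.mono fun y hy => ?_)
  simp only [posWeight]
  congr 2
  refine sum_congr rfl fun j _ => sum_congr rfl fun l _ => ?_
  split_ifs with hjl
  · rfl
  · exact hy j l hjl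

/-- Two potentials equal almost everywhere need not agree at the differences of the fixed points,
which is the content of `hw`. For every other pair the difference is a measure preserving function
of the integrated points. -/
lemma posMarginal_congr (hVU : ∀ᵐ u, V u = U u) (h : m ≤ N) {w : Fin m → Torus d}
    (hw : ∀ i i', i ≠ i' → V (w i - w i') = U (w i - w i')) :
    posMarginal β V h w = posMarginal β U h w := by
  refine integral_posWeight_congr fun j l hjl => ?_
  have hev : ∀ a, MeasurePreserving fun y : Fin (N - m) → Torus d => y a := fun a =>
    measurePreserving_eval (fun _ => (volume : Measure (Torus d))) a
  rcases glue_cases h j with ⟨a, rfl⟩ | ⟨a, ha⟩ <;> rcases glue_cases h l with ⟨b, rfl⟩ | ⟨b, hb⟩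
  · simp only [glue_castLE]
    exact ae_of_all _ fun _ => hw a b fun e => hjl (e ▸ rfl)
  · simp only [glue_castLE, hb]
    exact ((Measure.measurePreserving_sub_left volume (w a)).comp (hev b)).quasiMeasurePreserving.ae hVU
  · simp only [glue_castLE, ha]
    exact ((measurePreserving_sub_right volume (w b)).comp (hev a)).quasiMeasurePreserving.ae hVU
  · simp only [ha, hb]
    refine (preserves_sub fun e => hjl ?_).quasiMeasurePreserving.ae hVU
    have e2 := (ha _ Sum.inl Sum.inr).trans ((congrArg Sum.inr e).trans (hb _ Sum.inl Sum.inr).symm)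
    have e3 : ∀ i, glue h (Sum.inl : Fin m → Fin m ⊕ Fin (N - m)) Sum.inr i
        = (finSumFinEquiv.trans (finCongr (Nat.add_sub_of_le h))).symm i := fun i => by
      unfold glue
      cases (finSumFinEquiv.trans (finCongr (Nat.add_sub_of_le h))).symm i <;> rfl
    rw [e3, e3] at e2
    exact Equiv.injective _ e2

lemma posMarginal_two (hm : m = 2) (h : m ≤ N) (w : Fin m → Torus d) : posMarginal β U h w
    = posMarginal β U (hm ▸ h) ![w ⟨0, by omega⟩ - w ⟨1, by omega⟩, 0] := by
  subst hm
  exact (posMarginal_pair h w).symm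

/-- After division by the Maxwellians, every marginal with at most one background particle equals
`g(v₀)`. The alternating sum therefore collapses to `g(v₀)` times the normalized pair marginal minus
one. The identity is only almost everywhere, since `V` and its continuous representative must agree
at `x₁ - x₂`. -/
theorem cumulant_eq (hβ : 0 < β) (hU : Continuous U) (hVU : ∀ᵐ u, V u = U u)
    (sV : ∀ u, V (-u) = V u) (sU : ∀ u, U (-u) = U u) (f : Vel d → ℝ) :
    ∀ᵐ z ∂Ψ 3, N * cumulant β N 2 (initialDensity β V f N) z
      = f (z 0).2 / maxwellian d β (z 0).2 * gibbsCorr β U N ((z 1).1 - (z 2).1) := by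
  have := prob_vel (d := d) hβ
  have := prob_one (d := d) hβ
  have m1 : MeasurePreserving (fun (z : Fin 3 → Phase d) i => (z i).1) (Ψ 3) volume :=
    measurePreserving_pi _ _ fun _ => measurePreserving_fst
  have m2 := (preserves_sub (d := d) (show (1 : Fin 3) ≠ 2 by decide)).comp m1
  filter_upwards [m2.quasiMeasurePreserving.ae hVU] with z hz
  simp only [Function.comp_apply] at hz
  by_cases h : 2 ≤ N
  · have eZ : ∫ x, posWeight β V N x = ∫ x, posWeight β U N x :=
      integral_posWeight_congr fun j l hjl =>
        (preserves_sub hjl).quasiMeasurePreserving.ae hVU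
    have hZ : ∫ x, posWeight β U N x ≠ 0 := by
      refine (integral_pos_of_integrable_nonneg_nonzero (continuous_posWeight hU)
        (integrable_of_continuous (continuous_posWeight hU)) (fun x => (posWeight_pos x).le)
        (posWeight_pos (x := fun _ => 0)).ne').ne'
    have hz' : ∀ a b : Fin 2, a ≠ b → V ((z a.succ).1 - (z b.succ).1)
        = U ((z a.succ).1 - (z b.succ).1) := fun a b hab => by
      fin_cases a <;> fin_cases b
      · exact absurd rfl hab
      · exact hz
      · rw [← neg_sub, sV, sU]; exact hz
      · exact absurd rfl hab
    have key : ∀ σ : Finset (Fin 2), marginal N σ.card (initialDensity β V f N)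
        (selectParticles z σ) / ∏ i, maxwellian d β (selectParticles z σ i).2
        = f (z 0).2 / maxwellian d β (z 0).2 * if σ.card ≤ 1 then 1 else
          (∫ x, posWeight β U N x)⁻¹ * posMarginal β U h ![(z 1).1 - (z 2).1, 0] := fun σ => by
      have hσ : σ.card ≤ 2 := σ.card_le_univ
      rw [marginal_div hβ f (hσ.trans h), eZ]
      simp only [selectParticles, Fin.cons_zero, Fin.cons_succ]
      congr 1
      split_ifs with h1
      · rw [posMarginal_congr hVU _ fun i i' hi => absurd (Fin.ext (by omega)) hi,
          posMarginal_of_le_one _ h1 hU, inv_mul_cancel₀ hZ]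
      · have h2 : σ.card = 2 := by omega
        have hu : σ = Finset.univ := Finset.card_eq_iff_eq_univ σ |>.1 h2
        subst hu
        have o0 : ∀ h0, (Finset.univ : Finset (Fin 2)).orderEmbOfFin rfl ⟨0, h0⟩ = 0 := fun h0 => by
          rw [Finset.orderEmbOfFin_zero rfl h0]; rfl
        have o1 : ∀ h0, (Finset.univ : Finset (Fin 2)).orderEmbOfFin rfl ⟨1, h0⟩ = 1 := fun h0 =>
          (Finset.orderEmbOfFin_last (s := (Finset.univ : Finset (Fin 2))) rfl (by simp)).trans rfl
        rw [posMarginal_congr hVU, posMarginal_two h2]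
        · simp only [o0, o1]; rfl
        · exact fun i i' hi => hz' _ _ fun e => hi ((Finset.orderEmbOfFin _ _).injective e)
    rw [cumulant, if_pos h, gibbsCorr, dif_pos h]
    simp_rw [key]
    have hun : (Finset.univ : Finset (Finset (Fin 2))) = {∅, {0}, {1}, {0, 1}} := by decide
    rw [hun, Finset.sum_insert (by decide), Finset.sum_insert (by decide),
      Finset.sum_insert (by decide), Finset.sum_singleton]
    simp only [Finset.card_empty, Finset.card_singleton,
      Finset.card_pair (zero_ne_one : (0 : Fin 2) ≠ 1)]
    norm_num
    ring
  · simp [cumulant, gibbsCorr, h]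

/-! ### Dependence on representatives -/

lemma integral_field_congr (hβ : 0 < β) {F' : Torus d → Vel d} (h : F =ᵐ[volume] F') (x : Torus d)
    (a : Fin d) (φ : Phase d → ℂ) : ∫ y, (F (x - y.1) a : ℂ) * φ y ∂oneMeasure d β
      = ∫ y, (F' (x - y.1) a : ℂ) * φ y ∂oneMeasure d β := by
  have := prob_vel (d := d) hβ
  have h1 : ∀ᵐ y ∂oneMeasure d β, F (x - y.1) = F' (x - y.1) :=
    ((Measure.measurePreserving_sub_left volume x).comp
      (measurePreserving_fst (ν := ϖ))).quasiMeasurePreserving.ae h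
  exact integral_congr_ae (h1.mono fun y hy => by simp only [hy])

lemma mPairing_field_congr (hβ : 0 < β) {F' : Torus d → Vel d} (h : F =ᵐ[volume] F') :
    mPairing β F N m = mPairing β F' N m := by
  funext H ψ
  simp only [mPairing, forceMoment, integral_field_congr hβ h]

lemma IsResolvent.field_congr (hβ : 0 < β) {F' : Torus d → Vel d} (h : F =ᵐ[volume] F') {ω : ℂ}
    {G H : Obs (m + 1)} (hr : IsResolvent β F N m ω G H) : IsResolvent β F' N m ω G H :=
  ⟨hr.1, hr.2, fun ψ hψ => by
    rw [← hr.3 ψ hψ]; simp only [meanFieldTerm, integral_field_congr hβ h]⟩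

lemma IsInitCorrelation.field_congr (hβ : 0 < β) {F' : Torus d → Vel d} (h : F =ᵐ[volume] F')
    {f : Vel d → ℝ} {ω : ℂ} {H₃ : Obs 3} {K₂ H₂ : Obs 2}
    (hc : IsInitCorrelation β V F f N ω H₃ K₂ H₂) : IsInitCorrelation β V F' f N ω H₃ K₂ H₂ :=
  ⟨hc.1.field_congr hβ h, ⟨hc.2.1, by rw [← mPairing_field_congr hβ h]; exact hc.2.2⟩,
    hc.3.field_congr hβ h⟩

lemma IsResolvent.source_congr {ω : ℂ} {G G' H : Obs (m + 1)}
    (h : G =ᵐ[Ψ (m + 1)] G') (hr : IsResolvent β F N m ω G H) : IsResolvent β F N m ω G' H := by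
  have e : (fun z => G z + I * ω * H z) =ᵐ[Ψ (m + 1)]
    fun z => G' z + I * ω * H z := h.mono fun z hz => by simp only [hz]
  exact ⟨hr.1, hr.2.ae_eq e, fun ψ hψ => (hr.3 ψ hψ).trans
    (integral_congr_ae (e.mono fun z hz => by simp only [hz]))⟩

lemma spaceAverage_congr (hβ : 0 < β) {ω : ℂ} {H H' : Obs 2} (h : H =ᵐ[Ψ 2] H') (ψ : Vel d → ℂ) :
    spaceAverage β F N ω H ψ = spaceAverage β F N ω H' ψ := by
  have := prob_one (d := d) hβ
  have h1 := Measure.ae_ae_of_ae_prod ((preserves_snoc (n := 1)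
    (oneMeasure d β)).quasiMeasurePreserving.ae h)
  unfold spaceAverage mPairing
  congr 2
  refine sum_congr rfl fun j _ => sum_congr rfl fun a _ =>
    integral_congr_ae (h1.mono fun z hz => ?_)
  simp only [forceMoment]
  congr 2
  exact integral_congr_ae (hz.mono fun y hy => congrArg (_ * ·) hy)

/-! ### The main result -/

/-- The data of the proposition are brought into the form of `exists_correlation`: the source is the
Gibbs correlation, and both couplings lie in `[0, β|K|]`, where one constant `C` serves all modes
and all `N`. -/
theorem exists_initCorrelation (hβ : 0 < β) (hW : MemW2Infty V F K) (sV : ∀ x, V (-x) = V x)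
    (pV : PosDefPotential V) (hN : 1 ≤ N) {ω : ℂ} (hω : 0 < ω.im) {C : ℝ} (hC : 0 ≤ C)
    (hS : ∀ L ∈ Icc 0 (β * |K|), ∀ L' ∈ Icc 0 (β * |K|), ∀ w : ℂ, 0 < w.im →
      Nonempty (ModeSolution C L L' w)) {f g : Vel d → ℝ} {D : Vel d → Vel d} (mf : Measurable f)
    (hg : ∀ v, g v = f v / maxwellian d β v) (mg : MemLp g 2 ϖ)
    (hD : HasVelWeakGrad g D) (mD : MemLp (fun v => D v - (β * g v) • v) 2 ϖ) :
    ∃ H₃ K₂ H₂, IsInitCorrelation β V (truncField F K) f N ω H₃ K₂ H₂ ∧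
      ∃ G : Vel d → EuclideanSpace ℂ (Fin d), Measurable G ∧
        (∀ᵐ v, ‖G v‖ ≤ fluxConst d β C (2 * rexp (β * K / 2)) K * min 1 ‖ω‖ *
          ‖D v - (β * g v) • v‖) ∧
        ∀ ψ, IsVelTest ψ → spaceAverage β (truncField F K) N ω H₂ ψ = divPairing β G ψ := by
  obtain ⟨-, hF⟩ := hW.gradientField sV pV
  have hU := hF.continuous_fourPot
  have hK := hF.nonneg_bound
  have mg' : Measurable g := by
    rw [show g = _ from funext hg]; exact mf.div continuous_maxwellian.measurable
  -- A measurable representative of `(∇ - βv)g` is needed because the flux is built pointwise from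
  -- it; the gradient is corrected accordingly.
  set E := mD.1.mk with hE
  have mE : Measurable E := mD.1.stronglyMeasurable_mk.measurable
  have eE : ∀ᵐ v ∂ϖ, D v - (β * g v) • v = E v := mD.1.ae_eq_mk
  have eE' := (ae_velMeasure_iff hβ).1 eE
  have hE2 : MemLp E 2 ϖ := mD.ae_eq eE
  have hD' : HasVelWeakGrad g fun v => E v + (β * g v) • v := fun ψ hψ a =>
    (hD ψ hψ a).trans (congrArg Neg.neg (integral_congr_ae (eE'.mono fun v hv => by
      simp only [← hv, sub_add_cancel])))
  have hgE := hD'.hasAdaptedGrad hβ mg (by simpa only [add_sub_cancel_right] using hE2)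
  simp only [add_sub_cancel_right] at hgE
  set R : Torus d → ℂ := fun u => (gibbsCorr β (fourPot (potCoeff V)) N u : ℂ)
  have cR : Continuous R := continuous_ofReal.comp (continuous_gibbsCorr hU)
  obtain ⟨b, hb⟩ := (isCompact_range cR).isBounded.exists_norm_le
  have hk : ∀ k, potCoeff V k ∈ Icc 0 |K| := fun k =>
    ⟨hF.nonneg k, (hF.le_bound k).trans (le_abs_self K)⟩
  have hN' : (1 : ℝ) ≤ N := by exact_mod_cast hN
  obtain ⟨H₃, K₂, H₂, h3, hM, h2, G, mG, bG, eG⟩ := exists_correlation hβ hF hN hω hC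
    (fun k h0 => hS _ (by
      have h1 : ((N : ℝ) - 1) / N ≤ 1 := by rw [div_le_one (by linarith)]; linarith
      have h2 : 0 ≤ ((N : ℝ) - 1) / N := div_nonneg (by linarith) (by linarith)
      refine ⟨mul_nonneg (mul_nonneg h2 hβ.le) (hk k).1, ?_⟩
      rw [mul_assoc]
      exact (mul_le_of_le_one_left (mul_nonneg hβ.le (hk k).1) h1).trans
        (mul_le_mul_of_nonneg_left (hk k).2 hβ.le)) _
      ⟨mul_nonneg hβ.le (hk k).1, mul_le_mul_of_nonneg_left (hk k).2 hβ.le⟩ _ (by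
        rw [div_ofReal_im]; exact div_pos hω (modeFreq_pos hβ h0)))
    mg' mg mE hE2 hgE cR.measurable (fun x => hb _ ⟨x, rfl⟩) (hF.integral_gibbsCorr hβ hN)
    (hF.norm_integral_gibbsCorr_le hβ hN)
  refine ⟨H₃, K₂, H₂, ⟨h3.source_congr ?_, hM, h2⟩, G, mG, ?_, eG⟩
  · filter_upwards [cumulant_eq (N := N) hβ hU (fourPot_ae_eq hW sV pV) sV hF.fourPot_neg f]
      with z hz
    rw [hz, hg]
    push_cast
    rfl
  · filter_upwards [eE'] with v hv
    rw [hv]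
    exact bG v

/-- The crude inequality `ab ≤ a² + b²` replaces the Cauchy–Schwarz inequality. What matters is that
the bound is linear in `A`, which will be of order `|ω|`. -/
lemma hNegOneNorm_le (hβ : 0 < β) {G : Vel d → EuclideanSpace ℂ (Fin d)} {E : Vel d → Vel d}
    (hE : MemLp E 2 ϖ) {A : ℝ} (hA : 0 ≤ A) (hG : ∀ᵐ v, ‖G v‖ ≤ A * ‖E v‖)
    {T : (Vel d → ℂ) → ℂ} (hT : ∀ ψ, IsVelTest ψ → T ψ = divPairing β G ψ) :
    hNegOneNorm β T ≤ ENNReal.ofReal (A * (d * ∫ v, ‖E v‖ ^ 2 ∂ϖ + 1)) := by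
  refine iSup_le fun ψ => iSup_le fun hψ => iSup_le fun h1 => ?_
  rw [← ofReal_norm, hT ψ hψ]
  refine ENNReal.ofReal_le_ofReal ?_
  have iE := hE.integrable_norm_pow (p := 2) (by norm_num)
  have iD : ∀ a, Integrable (fun v => ‖velDeriv a ψ v‖ ^ 2) ϖ := fun a =>
    (hψ.memLp_velDeriv hβ a (p := 2)).integrable_norm_pow (p := 2) (by norm_num)
  have iψ : Integrable (fun v => ‖ψ v‖ ^ 2) ϖ :=
    (hψ.memLp hβ (p := 2)).integrable_norm_pow (p := 2) (by norm_num)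
  have iS : Integrable (fun v => ‖ψ v‖ ^ 2 + ∑ a, ‖velDeriv a ψ v‖ ^ 2) ϖ :=
    iψ.add (integrable_finsetSum _ fun a _ => iD a)
  have iB : Integrable (fun v => A * (d * ‖E v‖ ^ 2 + (‖ψ v‖ ^ 2 + ∑ a, ‖velDeriv a ψ v‖ ^ 2))) ϖ :=
    ((iE.const_mul (d : ℝ)).add iS).const_mul A
  rw [divPairing, norm_neg]
  refine (norm_integral_le_of_norm_le iB ?_).trans ?_
  · filter_upwards [(ae_velMeasure_iff hβ).2 hG] with v hv
    refine (norm_sum_le _ _).trans ?_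
    calc ∑ a, ‖G v a * velDeriv a ψ v‖ ≤ ∑ a : Fin d, A * (‖E v‖ ^ 2 + ‖velDeriv a ψ v‖ ^ 2) := by
          refine sum_le_sum fun a _ => ?_
          rw [norm_mul]
          have h2 := (PiLp.norm_apply_le (G v) a).trans hv
          calc ‖G v a‖ * ‖velDeriv a ψ v‖ ≤ A * ‖E v‖ * ‖velDeriv a ψ v‖ := by gcongr
            _ ≤ _ := by
              rw [mul_assoc]
              refine mul_le_mul_of_nonneg_left ?_ hA
              nlinarith [sq_nonneg (‖E v‖ - ‖velDeriv a ψ v‖), sq_nonneg ‖E v‖,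
                sq_nonneg ‖velDeriv a ψ v‖]
      _ ≤ _ := by
          rw [← mul_sum, sum_add_distrib]
          simp only [sum_const, card_univ, Fintype.card_fin, nsmul_eq_mul]
          refine mul_le_mul_of_nonneg_left ?_ hA
          linarith [sq_nonneg ‖ψ v‖]
  · have a1 := integral_add (iE.const_mul (d : ℝ)) iS
    rw [integral_const_mul, a1, integral_const_mul]
    exact mul_le_mul_of_nonneg_left (by gcongr; exact h1) hA

end TaggedParticle

/-- All three claims come from one flux, bounded by `c min(1, |ω|) |(∇ - βv)g|`. It belongs to a
constructed solution, and uniqueness transfers it to any solution. -/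
theorem proposition5p7 (d : ℕ) (hd : 1 ≤ d) (β : ℝ) (hβ : 0 < β) (K : ℝ) :
    ∃ C : ℝ, ∀ (V : TaggedParticle.Torus d → ℝ)
      (gradV : TaggedParticle.Torus d → TaggedParticle.Vel d),
      TaggedParticle.MemW2Infty V gradV K → (∀ x, V (-x) = V x) → TaggedParticle.PosDefPotential V →
      ∀ (f g : TaggedParticle.Vel d → ℝ) (gradg : TaggedParticle.Vel d → TaggedParticle.Vel d),
      Measurable f → (∀ v, g v = f v / TaggedParticle.maxwellian d β v) →
      MemLp g 2 (TaggedParticle.velMeasure d β) → TaggedParticle.HasVelWeakGrad g gradg →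
      MemLp (fun v => gradg v - (β * g v) • v) 2 (TaggedParticle.velMeasure d β) →
      -- the objects exist and are unique
      (∀ N : ℕ, 1 ≤ N → ∀ ω : ℂ, 0 < ω.im → ∃ H₃ K₂ H₂,
        TaggedParticle.IsInitCorrelation β V gradV f N ω H₃ K₂ H₂ ∧
        ∀ H₃' K₂' H₂', TaggedParticle.IsInitCorrelation β V gradV f N ω H₃' K₂' H₂' →
          H₃' =ᵐ[TaggedParticle.phaseMeasure d β 3] H₃ ∧
          K₂' =ᵐ[TaggedParticle.phaseMeasure d β 2] K₂ ∧
          H₂' =ᵐ[TaggedParticle.phaseMeasure d β 2] H₂) ∧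
      -- divergence form with a pointwise bound, uniform in N and ω
      (∀ N : ℕ, 1 ≤ N → ∀ ω : ℂ, 0 < ω.im → ∀ H₃ K₂ H₂,
        TaggedParticle.IsInitCorrelation β V gradV f N ω H₃ K₂ H₂ →
        ∃ G : TaggedParticle.Vel d → EuclideanSpace ℂ (Fin d), Measurable G ∧
          (∀ᵐ v, ‖G v‖ ≤ C * ‖gradg v - (β * g v) • v‖) ∧
          ∀ ψ : TaggedParticle.Vel d → ℂ, TaggedParticle.IsVelTest ψ →
            TaggedParticle.spaceAverage β gradV N ω H₂ ψ = TaggedParticle.divPairing β G ψ) ∧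
      -- convergence to zero in the negative Sobolev space, uniform in N
      (∀ ε : ℝ, 0 < ε → ∃ δ : ℝ, 0 < δ ∧ ∀ N : ℕ, 1 ≤ N → ∀ ω : ℂ, 0 < ω.im → ‖ω‖ < δ →
        ∀ H₃ K₂ H₂, TaggedParticle.IsInitCorrelation β V gradV f N ω H₃ K₂ H₂ →
          TaggedParticle.hNegOneNorm β (TaggedParticle.spaceAverage β gradV N ω H₂)
            ≤ ENNReal.ofReal ε) := by
  -- The constant has to be fixed before `V` is given, when the sign of `K` is still unknown; hence
  -- the absolute value.
  obtain ⟨C₀, hC₀, hS⟩ := TaggedParticle.exists_modeSolution (β * |K|)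
  refine ⟨TaggedParticle.fluxConst d β C₀ (2 * Real.exp (β * K / 2)) K, ?_⟩
  intro V F hW sV pV f g D mf hg mg hD mD
  obtain ⟨eF, hF⟩ := hW.gradientField sV pV
  have hK := hF.nonneg_bound
  set c := TaggedParticle.fluxConst d β C₀ (2 * Real.exp (β * K / 2)) K with hc
  have c0 : 0 ≤ c := by rw [hc]; unfold TaggedParticle.fluxConst; positivity
  have key : ∀ N : ℕ, 1 ≤ N → ∀ ω : ℂ, 0 < ω.im → ∃ H₃ K₂ H₂,
      TaggedParticle.IsInitCorrelation β V F f N ω H₃ K₂ H₂ ∧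
      (∀ H₃' K₂' H₂', TaggedParticle.IsInitCorrelation β V F f N ω H₃' K₂' H₂' →
        H₃' =ᵐ[TaggedParticle.phaseMeasure d β 3] H₃ ∧
        K₂' =ᵐ[TaggedParticle.phaseMeasure d β 2] K₂ ∧
        H₂' =ᵐ[TaggedParticle.phaseMeasure d β 2] H₂) ∧
      ∃ G : TaggedParticle.Vel d → EuclideanSpace ℂ (Fin d), Measurable G ∧
        (∀ᵐ v, ‖G v‖ ≤ c * min 1 ‖ω‖ * ‖D v - (β * g v) • v‖) ∧
        ∀ H₂', H₂' =ᵐ[TaggedParticle.phaseMeasure d β 2] H₂ →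
        ∀ ψ : TaggedParticle.Vel d → ℂ, TaggedParticle.IsVelTest ψ →
          TaggedParticle.spaceAverage β F N ω H₂' ψ = TaggedParticle.divPairing β G ψ := by
    intro N hN ω hω
    obtain ⟨H₃, K₂, H₂, h, G, mG, bG, eG⟩ :=
      TaggedParticle.exists_initCorrelation hβ hW sV pV hN hω hC₀ hS mf hg mg hD mD
    refine ⟨H₃, K₂, H₂, h.field_congr hβ eF, fun H₃' K₂' H₂' h' =>
      (h'.field_congr hβ eF.symm).unique hβ hF hN hω h, G, mG, bG, fun H₂' e ψ hψ => ?_⟩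
    rw [← eG ψ hψ, ← TaggedParticle.spaceAverage_congr hβ e ψ, TaggedParticle.spaceAverage,
      TaggedParticle.spaceAverage, TaggedParticle.mPairing_field_congr hβ eF]
  refine ⟨fun N hN ω hω => ?_, fun N hN ω hω H₃ K₂ H₂ h => ?_, fun ε hε => ?_⟩
  · obtain ⟨H₃, K₂, H₂, h, hu, -⟩ := key N hN ω hω
    exact ⟨H₃, K₂, H₂, h, hu⟩
  · obtain ⟨_, _, _, -, hu, G, mG, bG, eG⟩ := key N hN ω hω
    refine ⟨G, mG, bG.mono fun v hv => hv.trans ?_, eG _ (hu _ _ _ h).2.2⟩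
    exact mul_le_mul_of_nonneg_right (mul_le_of_le_one_right c0 (min_le_left _ _)) (norm_nonneg _)
  · set S : ℝ := d * ∫ v, ‖D v - (β * g v) • v‖ ^ 2 ∂TaggedParticle.velMeasure d β + 1
    have hS0 : 0 ≤ c * S := by positivity
    -- The norm is at most `c |ω| S`. The summand `1` avoids a division by zero when `c` vanishes.
    refine ⟨ε / (c * S + 1), by positivity, fun N hN ω hω hδ H₃ K₂ H₂ h => ?_⟩
    obtain ⟨_, _, _, -, hu, G, mG, bG, eG⟩ := key N hN ω hω
    refine (TaggedParticle.hNegOneNorm_le hβ mD (mul_nonneg c0 (norm_nonneg ω))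
      (bG.mono fun v hv => hv.trans ?_) (eG _ (hu _ _ _ h).2.2)).trans
      (ENNReal.ofReal_le_ofReal ?_)
    · gcongr
      exact min_le_right _ _
    · rw [lt_div_iff₀ (by positivity)] at hδ
      change c * ‖ω‖ * S ≤ ε
      nlinarith [norm_nonneg ω]

end
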